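/- **Theorem.** Let $X$ be a smooth split complete toric variety over $\mathbb Q$ of positive dimension, with open torus $T$ and fan $\Sigma$, and let $\Sigma_{\max}$ be the set of maximal cones. Let $\mathfrak D_1,\dots,\mathfrak D_s\in\mathrm{Pic}(X)$ be the pairwise distinct classes of the torus-invariant prime divisors, let $D_{i,1},\dots,D_{i,n_i}$ be the torus-invariant prime divisors of class $\mathfrak D_i$, and let $\rho_{i,j}$ be the ray of $D_{i,j}$ and $x_{i,j}$ the corresponding variable of the Cox ring $\mathbb Q[x_{i,j}]$ of $X$. Let $t_1,\dots,t_s\ge 0$ be integers and let $V\subseteq X$ be a complete intersection of hypersurfaces $H_{i,l}$, $1\le i\le s$, $1\le l\le t_i$, where $H_{i,l}$ is defined by a linear form $g_{i,l}=\sum_{j=1}^{n_i}c_{i,l,j}x_{i,j}$ with rational coefficients in the variables of degree $\mathfrak D_i$. Assume that $V\cap T\ne\emptyset$, that $t_i\le n_i-2$ for all $i\in\{1,\dots,s\}$, and that $L$ is an ample torus-invariant divisor of class $-(K_X+\sum_{i,l}[H_{i,l}])$. For $\sigma\in\Sigma_{\max}$ let $L(\sigma)=\sum_{i,j}\alpha_{i,j,\sigma}D_{i,j}$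 be the unique divisor of the form $L+\operatorname{div}(\chi)$, with $\chi$ a character of $T$, such that $\alpha_{i,j,\sigma}=0$ whenever $\rho_{i,j}\subseteq\sigma$, and put $\alpha_{i,\sigma}=\sum_j\alpha_{i,j,\sigma}$. For $P\in T(\mathbb Q)$ with Cox coordinates $\mathbf x\in(\mathbb Q^\times)^{\sum n_i}$ let $H_L(P)=\prod_v\max_{\sigma\in\Sigma_{\max}}|\mathbf x^{L(\sigma)}|_v$, where $v$ runs over all places of $\mathbb Q$. Let $N_V(B)$ be the number of rational points on $V\cap T$ with $H_L\le B$. Then $N_V(B)$ is finite for every $B$, and for $B\to\infty$ $$N_V(B)=cB(\log B)^{b-1}+O\bigl(B(\log B)^{b-2}(\log\log B)^s\bigr),\qquad b=\operatorname{rk}\operatorname{Pic}(V),$$ where $c>0$ is the following constant. Put $\varpi_i=n_i-t_i$, $k=b-1$, $r=\operatorname{rk}\operatorname{Pic}(X)$. Let $\mathcal P\subseteq\mathbb R^s$ be the polytope given by $u_i\ge 0$ for all $i$ and $\sum_i\alpha_{i,\sigma}u_i\le 1$ for all $\sigma\in\Sigma_{\max}$, and let $a$ be the maximum of $\sum_i\varpi_iu_i$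 on $\mathcal P$. Let $$c_{\mathcal P}=\lim_{\delta\to 0^+}\delta^{k+1-s}\operatorname{meas}_{s-1}\Bigl(\mathcal P\cap\Bigl\{\sum_i\varpi_iu_i=a-\delta\Bigr\}\Bigr),$$ where $\operatorname{meas}_{s-1}$ is given by $\prod_{i\ne i_0}\varpi_i\,du_i$ for any choice of $i_0$; this limit exists and does not depend on $i_0$. Let $I_\sigma$ be the set of all $i$ such that some $\rho_{i,j}$ is not contained in $\sigma$, and let $\mu:\mathbb Z_{>0}^s\to\mathbb Z$ be the function such that $\sum_{e_1\mid d_1,\dots,e_s\mid d_s}\mu(e_1,\dots,e_s)$ is $1$ if $\gcd_{\sigma\in\Sigma_{\max}}\prod_{i\in I_\sigma}d_i=1$ and $0$ otherwise. Let $W_i\subseteq\mathbb R^{n_i}$ be the space defined by $g_{i,1}=\dots=g_{i,t_i}=0$, let $\Lambda_i=W_i\cap\mathbb Z^{n_i}$, and $c_i=\operatorname{meas}_{n_i-t_i}([-1,1]^{n_i}\cap W_i)/\det\Lambda_i$. Then $$c=(s-1-k)!\;c_{\mathcal P}\;2^{-r}\sum_{\mathbf d\in\mathbb Z_{>0}^s}\mu(\mathbf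 d)\prod_{i=1}^s\frac{c_i}{d_i^{\,n_i-t_i}},$$ and this series converges absolutely. -/

import Mathlib

open MeasureTheory Filter Topology Asymptotics TopologicalSpace
open scoped Nat

noncomputable section

/-! ### Čech cohomology in degree one -/

/-- Let `Z` be a topological space and `S` a sheaf of abelian groups on `Z`, given by the subgroups
`S U` of functions `q ↦ g q` whose restriction to `U` is a section (only the values on `U` matter).
The Čech `1`-cocycles for some open cover `(U p)` with `p ∈ U p`; every open cover has a refinement
of this shape. -/
def cechCocycles {Z : Type} [TopologicalSpace Z] {G : Z → Type} [∀ q, CommGroup (G q)]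
    (S : Opens Z → Subgroup (∀ q, G q)) (hS : Antitone S) :
    Subgroup (∀ (_ _ q : Z), G q) where
  carrier := {g | ∃ U : Z → Opens Z, (∀ p, p ∈ U p) ∧ (∀ p p', g p p' ∈ S (U p ⊓ U p')) ∧
    ∀ p p' p'' q, q ∈ U p → q ∈ U p' → q ∈ U p'' → g p p' q * g p' p'' q = g p p'' q}
  one_mem' := ⟨fun _ => ⊤, fun _ => trivial, fun _ _ => one_mem _, fun _ _ _ _ _ _ _ => by simp⟩
  mul_mem' := by
    rintro g g' ⟨U, hU, hg, hc⟩ ⟨U', hU', hg', hc'⟩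
    refine ⟨fun p => U p ⊓ U' p, fun p => ⟨hU p, hU' p⟩, fun p p' => ?_, ?_⟩
    · exact mul_mem (hS (inf_le_inf inf_le_left inf_le_left) (hg p p'))
        (hS (inf_le_inf inf_le_right inf_le_right) (hg' p p'))
    · intro p p' p'' q h h' h''
      have e := hc p p' p'' q h.1 h'.1 h''.1
      have e' := hc' p p' p'' q h.2 h'.2 h''.2
      simp only [Pi.mul_apply]
      rw [← e, ← e', mul_mul_mul_comm]
  inv_mem' := by
    rintro g ⟨U, hU, hg, hc⟩
    refine ⟨U, hU, fun p p' => inv_mem (hg p p'), ?_⟩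
    intro p p' p'' q h h' h''
    have e := hc p p' p'' q h h' h''
    simp only [Pi.inv_apply]
    rw [← e, mul_inv]

/-- The Čech `1`-coboundaries. -/
def cechCoboundaries {Z : Type} [TopologicalSpace Z] {G : Z → Type} [∀ q, CommGroup (G q)]
    (S : Opens Z → Subgroup (∀ q, G q)) (hS : Antitone S) :
    Subgroup (∀ (_ _ q : Z), G q) where
  carrier := {g | ∃ (U : Z → Opens Z) (h : ∀ (_ q : Z), G q), (∀ p, p ∈ U p) ∧
    (∀ p, h p ∈ S (U p)) ∧ ∀ p p' q, q ∈ U p → q ∈ U p' → g p p' q = h p q * (h p' q)⁻¹}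
  one_mem' := ⟨fun _ => ⊤, 1, fun _ => trivial, fun _ => one_mem _, fun _ _ _ _ _ => by simp⟩
  mul_mem' := by
    rintro g g' ⟨U, h, hU, hh, hc⟩ ⟨U', h', hU', hh', hc'⟩
    refine ⟨fun p => U p ⊓ U' p, h * h', fun p => ⟨hU p, hU' p⟩, fun p => ?_, ?_⟩
    · exact mul_mem (hS inf_le_left (hh p)) (hS inf_le_right (hh' p))
    · intro p p' q k k'
      simp only [Pi.mul_apply]
      rw [hc p p' q k.1 k'.1, hc' p p' q k.2 k'.2, mul_inv, mul_mul_mul_comm]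
  inv_mem' := by
    rintro g ⟨U, h, hU, hh, hc⟩
    refine ⟨U, h⁻¹, hU, fun p => inv_mem (hh p), ?_⟩
    intro p p' q k k'
    simp only [Pi.inv_apply]
    rw [hc p p' q k k', mul_inv]

/-- First Čech cohomology group (direct limit over all open covers). -/
def CechH1 {Z : Type} [TopologicalSpace Z] {G : Z → Type} [∀ q, CommGroup (G q)]
    (S : Opens Z → Subgroup (∀ q, G q)) (hS : Antitone S) : Type :=
  cechCocycles S hS ⧸ (cechCoboundaries S hS).subgroupOf (cechCocycles S hS)

instance {Z : Type} [TopologicalSpace Z] {G : Z → Type} [∀ q, CommGroup (G q)]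
    (S : Opens Z → Subgroup (∀ q, G q)) (hS : Antitone S) : CommGroup (CechH1 S hS) :=
  inferInstanceAs
    (CommGroup (cechCocycles S hS ⧸ (cechCoboundaries S hS).subgroupOf (cechCocycles S hS)))

/-! ### Smooth complete fans and their toric varieties over `ℚ` -/

/-- The cone in `ℝ^d` generated by the vectors `gen ρ`, `ρ ∈ σ`. -/
def coneOf {d : ℕ} {ι : Type} (gen : ι → Fin d → ℤ) (σ : Finset ι) : Set (Fin d → ℝ) :=
  {v | ∃ a : ι → ℝ, (∀ ρ, 0 ≤ a ρ) ∧ v = ∑ ρ ∈ σ, a ρ • fun k => (gen ρ k : ℝ)}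

/-- A smooth complete fan in the lattice `N = ℤ^d`, with rays indexed by `ι`, given by the primitive
generators of its rays and its maximal cones (as sets of rays). The cones of the fan are the faces
of the maximal cones, i.e. the cones generated by subsets of the sets in `maxCones`. -/
structure SmoothCompleteFan (d : ℕ) (ι : Type) [Fintype ι] [DecidableEq ι] where
  /-- the primitive generator of each ray -/
  gen : ι → Fin d → ℤ
  /-- the maximal cones -/
  maxCones : Finset (Finset ι)
  /-- smoothness: the generators of a maximal cone form a basis of `N` -/
  linearIndependent : ∀ σ ∈ maxCones, LinearIndependent ℤ fun ρ : σ => gen ρ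
  span_eq_top : ∀ σ ∈ maxCones, ⊤ ≤ Submodule.span ℤ (Set.range fun ρ : σ => gen ρ)
  /-- two maximal cones meet in a common face -/
  inter_subset : ∀ σ ∈ maxCones, ∀ σ' ∈ maxCones,
    coneOf gen σ ∩ coneOf gen σ' ⊆ coneOf gen (σ ∩ σ')
  /-- completeness -/
  exists_mem_cone : ∀ v : Fin d → ℝ, ∃ σ ∈ maxCones, v ∈ coneOf gen σ
  /-- every ray belongs to the fan -/
  exists_ray_mem : ∀ ρ, ∃ σ ∈ maxCones, ρ ∈ σ

namespace SmoothCompleteFan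

variable {d : ℕ} {ι : Type} [Fintype ι] [DecidableEq ι] (X : SmoothCompleteFan d ι)

/-- The divisor of the character `χ^m`, namely `∑ ⟨m, u_ρ⟩ D_ρ`, where a torus-invariant divisor
`∑ a_ρ D_ρ` is written as the function `a : ι → ℤ`. -/
def divChar : (Fin d → ℤ) →ₗ[ℤ] (ι → ℤ) where
  toFun m ρ := ∑ k, m k * X.gen ρ k
  map_add' m m' := by ext ρ; simp [add_mul, Finset.sum_add_distrib]
  map_smul' c m := by ext ρ; simp [Finset.mul_sum, mul_assoc]

/-- The Picard group of the toric variety: torus-invariant divisors modulo divisors of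
characters. -/
abbrev PicX : Type := (ι → ℤ) ⧸ LinearMap.range X.divChar

/-- The class of a torus-invariant divisor. -/
def cls (D : ι → ℤ) : X.PicX := Submodule.Quotient.mk D

/-- The class of the torus-invariant prime divisor `D_ρ`. -/
def primeClass (ρ : ι) : X.PicX := X.cls (Pi.single ρ 1)

/-- The canonical class `K_X = -∑ [D_ρ]`. -/
def canonicalClass : X.PicX := -∑ ρ, X.primeClass ρ

/-- `f` is an element of degree `γ` of the Cox ring `ℚ[x_ρ]`, graded by `Pic X` with
`deg x_ρ = [D_ρ]`; the elements of degree `γ` are the global sections of the line bundle `γ`. -/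
def IsHomog (f : MvPolynomial ι ℚ) (γ : X.PicX) : Prop :=
  MvPolynomial.IsWeightedHomogeneous X.primeClass f γ

/-- The closed subscheme `V` of the toric variety `X` defined by an ideal `J` generated by
homogeneous elements of the Cox ring (`J = ⊥` gives `X` itself), as a topological space.
`X` is the quotient of the open set `Y` of `Spec ℚ[x_ρ]`, where not all the monomials
`∏_{ρ ∉ σ} x_ρ` (`σ` a maximal cone) vanish, by the torus with character group `Pic X`,
and `Y → X` is a torsor. As in the construction of `Proj`, the points of the scheme `V` are the
homogeneous primes in `Y` that contain `J`, with the Zariski topology. -/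
def points (J : Ideal (MvPolynomial ι ℚ)) : Set (PrimeSpectrum (MvPolynomial ι ℚ)) :=
  {p | (∀ f ∈ p.asIdeal, ∀ γ, MvPolynomial.weightedHomogeneousComponent X.primeClass γ f
        ∈ p.asIdeal) ∧
    J ≤ p.asIdeal ∧ ∃ σ ∈ X.maxCones, (∏ ρ ∈ σᶜ, MvPolynomial.X ρ) ∉ p.asIdeal}

/-- A class `γ` on `X` is ample: the open sets `X_f`, `f` a global section of `k γ` with
`k ≥ 1`, form a basis of the topology of `X`. -/
def IsAmple (γ : X.PicX) : Prop :=
  ∀ U : Opens (X.points ⊥), ∀ p ∈ U, ∃ k : ℕ, 1 ≤ k ∧ ∃ f, X.IsHomog f (k • γ) ∧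
    f ∉ p.1.asIdeal ∧ ∀ q : X.points ⊥, f ∉ q.1.asIdeal → q ∈ U

/-- The ring `(ℚ[x_ρ] / J)_q`; the local ring of `V` at `q` is its subring of fractions `a / b`
with `a`, `b` homogeneous of the same degree and `b ∉ q`. -/
def Stalk (J : Ideal (MvPolynomial ι ℚ)) (q : X.points J) : Type :=
  Localization (q.1.asIdeal.primeCompl.map (Ideal.Quotient.mk J))

instance (J : Ideal (MvPolynomial ι ℚ)) (q : X.points J) : CommRing (X.Stalk J q) :=
  inferInstanceAs (CommRing (Localization (q.1.asIdeal.primeCompl.map (Ideal.Quotient.mk J))))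

/-- The image of a polynomial in `(ℚ[x_ρ] / J)_q`. -/
def toStalk (J : Ideal (MvPolynomial ι ℚ)) (q : X.points J) :
    MvPolynomial ι ℚ →+* X.Stalk J q :=
  (algebraMap (MvPolynomial ι ℚ ⧸ J)
    (Localization (q.1.asIdeal.primeCompl.map (Ideal.Quotient.mk J)))).comp (Ideal.Quotient.mk J)

/-- The sections over `U` of the sheaf `𝒪_V^×`: the families of units that are locally of the form
`a / b`, where `a`, `b` are homogeneous of the same degree and vanish nowhere. -/
def unitSections (J : Ideal (MvPolynomial ι ℚ)) (U : Opens (X.points J)) :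
    Subgroup (∀ q : X.points J, (X.Stalk J q)ˣ) where
  carrier := {g | ∀ p ∈ U, ∃ W : Opens (X.points J), p ∈ W ∧ ∃ γ a b,
    X.IsHomog a γ ∧ X.IsHomog b γ ∧ ∀ q ∈ W, a ∉ q.1.asIdeal ∧ b ∉ q.1.asIdeal ∧
      (g q : X.Stalk J q) * X.toStalk J q b = X.toStalk J q a}
  one_mem' := fun p _ => ⟨⊤, trivial, 0, 1, 1, MvPolynomial.isWeightedHomogeneous_one _ _,
    MvPolynomial.isWeightedHomogeneous_one _ _, fun q _ =>
      ⟨(Ideal.ne_top_iff_one _).1 q.1.2.ne_top, (Ideal.ne_top_iff_one _).1 q.1.2.ne_top, by simp⟩⟩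
  mul_mem' := by
    intro g g' hg hg' p hp
    obtain ⟨W, hW, γ, a, b, ha, hb, h⟩ := hg p hp
    obtain ⟨W', hW', γ', a', b', ha', hb', h'⟩ := hg' p hp
    refine ⟨W ⊓ W', ⟨hW, hW'⟩, γ + γ', a * a', b * b', ha.mul ha', hb.mul hb', fun q hq => ?_⟩
    obtain ⟨h1, h2, h3⟩ := h q hq.1
    obtain ⟨h1', h2', h3'⟩ := h' q hq.2
    refine ⟨fun k => (q.1.2.mem_or_mem k).elim h1 h1', fun k => (q.1.2.mem_or_mem k).elim h2 h2',
      ?_⟩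
    simp only [Pi.mul_apply, Units.val_mul, map_mul]
    rw [mul_mul_mul_comm, h3, h3']
  inv_mem' := by
    intro g hg p hp
    obtain ⟨W, hW, γ, a, b, ha, hb, h⟩ := hg p hp
    refine ⟨W, hW, γ, b, a, hb, ha, fun q hq => ?_⟩
    obtain ⟨h1, h2, h3⟩ := h q hq
    refine ⟨h2, h1, ?_⟩
    rw [← h3, Pi.inv_apply, Units.inv_mul_cancel_left]

theorem unitSections_antitone (J : Ideal (MvPolynomial ι ℚ)) : Antitone (X.unitSections J) :=
  fun _ _ h _ hg p hp => hg p (h hp)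

/-- The Picard group of the subscheme `V` of `X` defined by `J`, as `H¹(V, 𝒪_V^×)`. -/
abbrev Pic (J : Ideal (MvPolynomial ι ℚ)) : Type :=
  CechH1 (X.unitSections J) (X.unitSections_antitone J)

/-- The rank of `Pic V`. -/
def rkPic (J : Ideal (MvPolynomial ι ℚ)) : ℕ := Module.finrank ℤ (Additive (X.Pic J))

/-! ### Heights and rational points -/

/-- The generators of a maximal cone, as a basis of `N`. -/
def coneBasis (σ : X.maxCones) : Module.Basis σ.1 ℤ (Fin d → ℤ) :=
  Module.Basis.mk (X.linearIndependent σ.1 σ.2) (X.span_eq_top σ.1 σ.2)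

/-- The character `u_{σ,D}` with `u_{σ,D}(u_ρ) = a_ρ` for the rays `ρ` of `σ`,
where `D = ∑ a_ρ D_ρ`. -/
def coneChar (D : ι → ℤ) (σ : X.maxCones) : (Fin d → ℤ) →ₗ[ℤ] ℤ :=
  (X.coneBasis σ).constr ℤ fun ρ => D ρ

/-- The divisor `D(σ) = D - ∑ u_{σ,D}(u_ρ) D_ρ`. -/
def atCone (D : ι → ℤ) (σ : X.maxCones) (ρ : ι) : ℤ := D ρ - X.coneChar D σ (X.gen ρ)

/-- The height `∏_v max_σ |x^{D(σ)}|_v` (product over all places of `ℚ`) of the point of `X` with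
Cox coordinates `x ∈ (ℚˣ)^ι`. -/
def height (D : ι → ℤ) (x : ι → ℚˣ) : ℝ :=
  Height.mulHeight fun σ : X.maxCones => ((∏ ρ, x ρ ^ X.atCone D σ ρ : ℚˣ) : ℚ)

/-- The rational point of the torus `T ⊆ X`, `T(ℚ) = Hom(M, ℚˣ) = (ℚˣ)^d`, with Cox
coordinates `x ∈ (ℚˣ)^ι`. Every point of `T(ℚ)` has Cox coordinates, unique up to the action of
`Hom(Pic X, ℚˣ)`. -/
def torusPoint (x : ι → ℚˣ) : Fin d → ℚˣ := fun k => ∏ ρ, x ρ ^ X.gen ρ k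

/-- The rational points of `V ∩ T` of height at most `B` with respect to the divisor `D`, where `V`
is defined by `J`. -/
def pointsOfHeightLE (J : Ideal (MvPolynomial ι ℚ)) (D : ι → ℤ) (B : ℝ) : Set (Fin d → ℚˣ) :=
  {P | ∃ x : ι → ℚˣ, X.torusPoint x = P ∧
    (∀ f ∈ J, MvPolynomial.eval (fun ρ => (x ρ : ℚ)) f = 0) ∧ X.height D x ≤ B}

end SmoothCompleteFan

/-! ### Linear complete intersections: the leading constant

From now on the rays are indexed by pairs `(i, j)`, `1 ≤ i ≤ s`, `1 ≤ j ≤ n_i`, such that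
`(i, j)` and `(i', j')` give divisors of the same class if and only if `i = i'`. -/

namespace SmoothCompleteFan

variable {d s : ℕ} {n : Fin s → ℕ} (X : SmoothCompleteFan d ((i : Fin s) × Fin (n i)))

/-- The index set `I_σ` of all `i` such that some ray `(i, j)` is not in `σ`. -/
def coneIndex (σ : Finset ((i : Fin s) × Fin (n i))) : Finset (Fin s) :=
  {i | ∃ j, (⟨i, j⟩ : (i : Fin s) × Fin (n i)) ∉ σ}

open Classical in
/-- The characteristic function of the tuples with `∑_σ ∏_{i ∈ I_σ} b_i ℤ = ℤ`. -/
def coprimeInd (b : Fin s → ℕ) : ℤ :=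
  if (X.maxCones.gcd fun σ => ∏ i ∈ coneIndex σ, b i) = 1 then 1 else 0

/-- The function `μ` on `s`-tuples of positive integers with `∑_{e ∣ b} μ(e) = χ(b)`, where `χ` is
the characteristic function above and divisibility is componentwise. -/
def mobius {d s : ℕ} {n : Fin s → ℕ} (X : SmoothCompleteFan d ((i : Fin s) × Fin (n i)))
    (b : Fin s → ℕ) : ℤ :=
  X.coprimeInd b -
    ∑ e ∈ ((Fintype.piFinset fun i => (b i).divisors).erase b).attach, X.mobius e.1
termination_by ∑ i, b i
decreasing_by
  have he := e.2
  rw [Finset.mem_erase, Fintype.mem_piFinset] at he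
  obtain ⟨hne, hdvd⟩ := he
  have hle : ∀ i, e.1 i ≤ b i := fun i => Nat.divisor_le (hdvd i)
  obtain ⟨i, hi⟩ := Function.ne_iff.1 hne
  exact Finset.sum_lt_sum (fun i _ => hle i) ⟨i, Finset.mem_univ i, lt_of_le_of_ne (hle i) hi⟩

/-- `α_{i,σ} = ∑_j α_{i,j,σ}`, where `D(σ) = ∑ α_{i,j,σ} D_{i,j}`. -/
def alpha (D : (i : Fin s) × Fin (n i) → ℤ) (σ : X.maxCones) (i : Fin s) : ℤ :=
  ∑ j, X.atCone D σ ⟨i, j⟩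

/-- The polytope `𝒫` of all `u ∈ ℝ^s` with `u ≥ 0` and `∑ α_{i,σ} u_i ≤ 1` for all `σ`. -/
def polytope (D : (i : Fin s) × Fin (n i) → ℤ) : Set (Fin s → ℝ) :=
  {u | (∀ σ : X.maxCones, ∑ i, (X.alpha D σ i : ℝ) * u i ≤ 1) ∧ ∀ i, 0 ≤ u i}

end SmoothCompleteFan

/-- The `(s-1)`-dimensional measure, given by `∏_{i ≠ i₀} ϖ_i du_i`, of the intersection of `P` with
the hyperplane `∑ ϖ_i u_i = h`. -/
def sliceMeasure {s : ℕ} (ϖ : Fin s → ℕ) (P : Set (Fin s → ℝ)) (i₀ : Fin s) (h : ℝ) : ℝ :=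
  (∏ i : {i // i ≠ i₀}, (ϖ i : ℝ)) *
    (volume : Measure ({i // i ≠ i₀} → ℝ)).real
      {v | ∃ u ∈ P, ∑ i, (ϖ i : ℝ) * u i = h ∧ ∀ i : {i // i ≠ i₀}, u i = v i}

/-- The subspace `W ⊆ ℝ^m` defined by the linear forms with coefficient vectors `c l`. -/
def solSpace {m t : ℕ} (c : Fin t → Fin m → ℚ) : Submodule ℝ (EuclideanSpace ℝ (Fin m)) where
  carrier := {w | ∀ l, ∑ j, (c l j : ℝ) * w j = 0}
  zero_mem' := by simp
  add_mem' := by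
    intro v w hv hw l
    have := hv l
    have := hw l
    simp_all [mul_add, Finset.sum_add_distrib]
  smul_mem' := by
    intro r w hw l
    have := hw l
    simp only [PiLp.smul_apply, smul_eq_mul, mul_left_comm _ r, ← Finset.mul_sum, this, mul_zero]

/-- The lattice `Λ = ℤ^m ∩ W`. -/
def solLattice {m t : ℕ} (c : Fin t → Fin m → ℚ) : Submodule ℤ (solSpace c) where
  carrier := {w | ∀ j, ∃ z : ℤ, (w : EuclideanSpace ℝ (Fin m)) j = z}
  zero_mem' := fun _ => ⟨0, by simp⟩
  add_mem' := by
    intro v w hv hw j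
    obtain ⟨a, ha⟩ := hv j
    obtain ⟨b, hb⟩ := hw j
    exact ⟨a + b, by simp [ha, hb]⟩
  smul_mem' := by
    intro r w hw j
    obtain ⟨b, hb⟩ := hw j
    exact ⟨r * b, by simp [hb]⟩

/-- The Lebesgue measure on `W` (an orthonormal unit cube has measure `1`). -/
def solMeasure {m t : ℕ} (c : Fin t → Fin m → ℚ) : Measure (solSpace c) :=
  (stdOrthonormalBasis ℝ (solSpace c)).toBasis.addHaar

/-- The density `meas([-1,1]^m ∩ W) / det Λ`. -/
def boxDensity {m t : ℕ} (c : Fin t → Fin m → ℚ) : ℝ :=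
  (solMeasure c).real {w | ∀ j, |(w : EuclideanSpace ℝ (Fin m)) j| ≤ 1} /
    ZLattice.covolume (solLattice c) (solMeasure c)

/-- The linear form `∑_j c_j x_{i,j}`. -/
def linForm {s : ℕ} {n : Fin s → ℕ} (i : Fin s) (c : Fin (n i) → ℚ) :
    MvPolynomial ((i : Fin s) × Fin (n i)) ℚ :=
  ∑ j, MvPolynomial.C (c j) * MvPolynomial.X ⟨i, j⟩

/-- The ideal generated by the linear forms `g_{i,l} = ∑_j c_{i,l,j} x_{i,j}`. -/
def linIdeal {s : ℕ} {n t : Fin s → ℕ} (c : ∀ i, Fin (t i) → Fin (n i) → ℚ) :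
    Ideal (MvPolynomial ((i : Fin s) × Fin (n i)) ℚ) :=
  Ideal.span {g | ∃ i l, g = linForm i (c i l)}

end

/-! The proof is a universal torsor count. A point of `T(ℚ)` has integral Cox coordinates such that,
for each prime `p`, the coordinates divisible by `p` belong to rays of one maximal cone. They are
unique up to `Hom(Pic X, {±1})`, a group of order `2 ^ r`, and on them the finite places contribute
nothing to the height. Rays of equal class can be exchanged in a maximal cone, so both the
coprimality condition and the height bound depend only on the gcd and the maximum norm of each block
`(x_{i,1}, …, x_{i,n_i})`. Hence `2 ^ r * N_V(B)` is the number of tuples of integral points without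
zero coordinates in the spaces `W_i`, subject to a condition on their gcds, whose logarithmic norms
`u_i` lie in the polytope dilated by `T = log B` (`ncard_coprimeTuples_eq`).

The function `μ` removes the gcd condition, provided that tuples scaled by `d` are counted with an
error summable against `|μ(d)|`. In one space `W_i` the points of norm at most `e^U / d` number `c_i
d^{-ϖ_i} e^{ϖ_i U}` up to a factor `1 + O(√(d / e^U))`. So the counting measure in the variable
`u_i` is close to a multiple of the measure with density `ϖ_i e^{ϖ_i u_i}`. The factors of the
product measure are replaced one at a time. Each replacement costs a sum of `exp(ϖ · m - m_i / 2)`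
over lattice points `m` of the polytope; it is concentrated near `u_i = 0` and smaller than the main
term by a factor `T` (`exists_lattice_bound`, `exists_pi_region_bound`).

The main term is the mass of the dilated polytope for the density `∏ ϖ_i e^{ϖ_i u_i}`. Linear
relations between the ray generators are dual to `Pic X` and constant on the rays of a class;
because `L` has class `-(K_X + ∑ [H_{i,l}])`, all the forms `α_σ` agree with `ϖ` on them. Conversely
`α_σ ≤ ϖ` for all `σ` forces a relation, so these relations span the face where `ϖ · u` is maximal,
and that face has dimension `r - 1` (`exists_regionData`). Close to this face a slice is nearly a
product of the face with a small dilated polytope, which gives mass `c_P (s - r)! e^T T^{r-1} (1 +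
O(1/T))` (`exists_slice_mass`). The factor `(log log B)^s` in the error term is not used up.

It remains to see that `b = r`. The Cox ring modulo the linear forms is a polynomial ring, and the
codimension hypothesis forces it to have exactly `n_i - t_i ≥ 2` variables of degree `𝔇_i`.
Therefore every homogeneous prime element defines a point of `V`. A cocycle of units is a divisor,
principal in this factorial ring and given by a homogeneous fraction; its degree identifies `Pic V`
with `Pic X` (`rkPic_linIdeal`). The same inequality `n_i - t_i ≥ 2` makes the series over `d`
converge. -/

open scoped Pointwise

open scoped Nat

/-! ### Regions cut out by linear inequalities -/

/-- The data of a polytope `{u ≥ 0, α σ · u ≤ 1}` whose intersection with the hyperplane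
`ϖ · u = 1` consists of the `u` with `α σ · u = 1` for all `σ`, together with a positive point of
that face. -/
structure RegionData (s : ℕ) (S : Type) where
  α : S → Fin s → ℝ
  ϖ : Fin s → ℕ
  center : Fin s → ℝ
  α_nonneg : ∀ σ i, 0 ≤ α σ i
  ϖ_pos : ∀ i, 0 < ϖ i
  -- Vectors of arbitrary sign are allowed: transversally to the span of the face some `α σ` always
  -- exceeds `ϖ`.
  rigid : ∀ u : Fin s → ℝ, (∀ σ, α σ ⬝ᵥ u ≤ (fun i => (ϖ i : ℝ)) ⬝ᵥ u) →
    ∀ σ, α σ ⬝ᵥ u = (fun i => (ϖ i : ℝ)) ⬝ᵥ u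
  center_pos : ∀ i, 0 < center i
  α_center : ∀ σ, α σ ⬝ᵥ center = 1
  ϖ_center : (fun i => (ϖ i : ℝ)) ⬝ᵥ center = 1

namespace RegionData

variable {s : ℕ} {S : Type} (A : RegionData s S)

/-- The vector `ϖ` with real entries. -/
def w : Fin s → ℝ := fun i => A.ϖ i

/-- The dilated polytope. -/
def region (T : ℝ) : Set (Fin s → ℝ) := {u | (∀ σ, A.α σ ⬝ᵥ u ≤ T) ∧ ∀ i, 0 ≤ u i}

/-- The linear span of the maximal face. -/
def faceSpan : Submodule ℝ (Fin s → ℝ) where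
  carrier := {u | ∀ σ, A.α σ ⬝ᵥ u = A.w ⬝ᵥ u}
  zero_mem' := by simp
  add_mem' := by
    intro u v hu hv σ
    rw [dotProduct_add, dotProduct_add, hu σ, hv σ]
  smul_mem' := by
    intro c u hu σ
    rw [dotProduct_smul, dotProduct_smul, hu σ]

/-- The dimension of the span of the maximal face. -/
noncomputable def rk : ℕ := Module.finrank ℝ A.faceSpan

theorem center_mem : A.center ∈ A.faceSpan := fun σ => by
  rw [A.α_center σ]; exact A.ϖ_center.symm

theorem w_center : A.w ⬝ᵥ A.center = 1 := A.ϖ_center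

theorem w_pos (i : Fin s) : 0 < A.w i := by
  have := A.ϖ_pos i
  simpa [w] using this

/-- Some linear form `α σ` is at least `ϖ`. -/
theorem exists_le_alpha [Nonempty S] (u : Fin s → ℝ) : ∃ σ, A.w ⬝ᵥ u ≤ A.α σ ⬝ᵥ u := by
  by_contra h
  push Not at h
  obtain ⟨σ⟩ := ‹Nonempty S›
  exact (h σ).ne (A.rigid u (fun σ => (h σ).le) σ)

theorem w_le_of_mem [Nonempty S] {T : ℝ} {u : Fin s → ℝ} (hu : u ∈ A.region T) : A.w ⬝ᵥ u ≤ T := by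
  obtain ⟨σ, hσ⟩ := A.exists_le_alpha u
  exact hσ.trans (hu.1 σ)

/-- The center has positive coordinates, so a multiple of it absorbs any bounded perturbation of the
conditions `u i ≥ 0`. -/
theorem exists_smul_center_le (C : ℝ) : ∃ C' : ℝ, 0 ≤ C' ∧ ∀ i, C ≤ C' * A.center i := by
  rcases isEmpty_or_nonempty (Fin s) with h | h
  · exact ⟨0, le_rfl, fun i => isEmptyElim i⟩
  refine ⟨∑ i, |C| / A.center i, Finset.sum_nonneg fun i _ =>
    div_nonneg (abs_nonneg _) (A.center_pos i).le, fun i => ?_⟩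
  have h1 : |C| / A.center i ≤ ∑ i, |C| / A.center i :=
    Finset.single_le_sum (f := fun i => |C| / A.center i)
      (fun j _ => div_nonneg (abs_nonneg _) (A.center_pos j).le) (Finset.mem_univ i)
  calc C ≤ |C| := le_abs_self _
    _ = |C| / A.center i * A.center i := by rw [div_mul_cancel₀ _ (A.center_pos i).ne']
    _ ≤ _ := mul_le_mul_of_nonneg_right h1 (A.center_pos i).le

/-- Linear coordinates adapted to the maximal face. -/
theorem exists_coords : 1 ≤ A.rk ∧ A.rk ≤ s ∧
    ∃ (e₁ : (Fin (s - A.rk) → ℝ) →ₗ[ℝ] (Fin s → ℝ)) (e₀ : (Fin (A.rk - 1) → ℝ) →ₗ[ℝ] (Fin s → ℝ)),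
      (∀ x, A.w ⬝ᵥ e₁ x = 0) ∧ (∀ y, A.w ⬝ᵥ e₀ y = 0) ∧ (∀ y, e₀ y ∈ A.faceSpan) ∧
      (∀ x, e₁ x ∈ A.faceSpan → x = 0) ∧ (∀ y, e₀ y = 0 → y = 0) := by
  have hc0 : (⟨A.center, A.center_mem⟩ : A.faceSpan) ≠ 0 := by
    intro h
    have h' : A.center = 0 := congrArg Subtype.val h
    have := A.w_center
    rw [h', dotProduct_zero] at this
    exact zero_ne_one this
  have hr1 : 1 ≤ A.rk := Module.finrank_pos_iff_exists_ne_zero.2 ⟨_, hc0⟩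
  have hrs : A.rk ≤ s := by
    have := A.faceSpan.finrank_le
    rwa [Module.finrank_fin_fun] at this
  obtain ⟨K', hK'⟩ := A.faceSpan.exists_isCompl
  have hdim : Module.finrank ℝ K' = s - A.rk := by
    have := Submodule.finrank_add_eq_of_isCompl hK'
    rw [Module.finrank_fin_fun] at this
    change A.rk + _ = s at this
    omega
  let ℓ : (Fin s → ℝ) →ₗ[ℝ] ℝ := dotProductBilin ℝ ℝ A.w
  have hℓ : ∀ u, ℓ u = A.w ⬝ᵥ u := fun u => rfl
  have hfree : ∀ K₀ : Submodule ℝ A.faceSpan, Module.Free ℝ K₀ := fun K₀ =>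
    Module.Free.of_divisionRing ℝ K₀
  obtain ⟨K₀, hK₀⟩ : ∃ K₀ : Submodule ℝ A.faceSpan,
      K₀ = LinearMap.ker (ℓ.comp A.faceSpan.subtype) := ⟨_, rfl⟩
  have hdim0 : Module.finrank ℝ K₀ = A.rk - 1 := by
    have h1 := LinearMap.finrank_range_add_finrank_ker (ℓ.comp A.faceSpan.subtype)
    have h2 : LinearMap.range (ℓ.comp A.faceSpan.subtype) = ⊤ := by
      rw [LinearMap.range_eq_top]
      intro c
      refine ⟨c • ⟨A.center, A.center_mem⟩, ?_⟩
      rw [map_smul]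
      simp [hℓ, A.w_center]
    rw [h2, finrank_top, Module.finrank_self] at h1
    rw [← hK₀] at h1
    change 1 + Module.finrank ℝ K₀ = A.rk at h1
    omega
  let f₁ : (Fin (s - A.rk) → ℝ) ≃ₗ[ℝ] K' := (LinearEquiv.ofFinrankEq _ _ (by simp [hdim]))
  let f₀ : (Fin (A.rk - 1) → ℝ) ≃ₗ[ℝ] K₀ := (LinearEquiv.ofFinrankEq _ _ (by simp [hdim0]))
  -- The projection to `w = 0` along the center changes a vector only by an element of `faceSpan`,
  -- so a complement of `faceSpan` stays transverse to it.
  let pr : (Fin s → ℝ) →ₗ[ℝ] (Fin s → ℝ) := LinearMap.id - ℓ.smulRight A.center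
  have hpr : ∀ u, pr u = u - (A.w ⬝ᵥ u) • A.center := fun u => rfl
  refine ⟨hr1, hrs, pr ∘ₗ K'.subtype ∘ₗ f₁.toLinearMap,
    A.faceSpan.subtype ∘ₗ K₀.subtype ∘ₗ f₀.toLinearMap, ?_, ?_, ?_, ?_, ?_⟩
  · intro x
    simp [hpr, dotProduct_sub, A.w_center]
  · intro y
    have h := hK₀.le (f₀ y).2
    exact h
  · intro y
    exact (f₀ y).1.2
  · intro x hx
    have h1 : ((f₁ x : K') : Fin s → ℝ) ∈ A.faceSpan := by
      have := A.faceSpan.add_mem hx (A.faceSpan.smul_mem (A.w ⬝ᵥ (f₁ x : Fin s → ℝ)) A.center_mem)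
      simpa [hpr] using this
    have h2 := (Submodule.disjoint_def.1 hK'.disjoint) _ h1 (f₁ x).2
    have h3 : f₁ x = 0 := Subtype.ext h2
    simpa using h3
  · intro y hy
    have h3 : f₀ y = 0 := Subtype.ext (Subtype.ext hy)
    simpa using h3

theorem isClosed_alpha_le {m : ℕ} (e : (Fin m → ℝ) →ₗ[ℝ] (Fin s → ℝ)) (T : ℝ) :
    IsClosed {x | ∀ σ, A.α σ ⬝ᵥ e x ≤ T} := by
  have : Continuous e := e.continuous_of_finiteDimensional
  simp only [Set.ofPred_forall]
  refine isClosed_iInter fun σ => isClosed_le ?_ continuous_const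
  exact Continuous.dotProduct continuous_const this

theorem isClosed_region (T : ℝ) : IsClosed (A.region T) := by
  have h1 := A.isClosed_alpha_le LinearMap.id T
  have : {u : Fin s → ℝ | ∀ i, 0 ≤ u i} = ⋂ i, {u | 0 ≤ u i} := by ext; simp
  have h2 : IsClosed {u : Fin s → ℝ | ∀ i, 0 ≤ u i} := by
    rw [this]
    exact isClosed_iInter fun i => isClosed_le continuous_const (continuous_apply i)
  exact h1.inter h2

/-- A linear image transverse to the face meets the polytope in a bounded set. -/
theorem exists_bound_transversal [Fintype S] [Nonempty S] {m : ℕ} (e : (Fin m → ℝ) →ₗ[ℝ] (Fin s → ℝ))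
    (he : ∀ x, A.w ⬝ᵥ e x = 0) (hi : ∀ x, e x ∈ A.faceSpan → x = 0) :
    ∃ C : ℝ, 0 ≤ C ∧ ∀ x, (∀ σ, A.α σ ⬝ᵥ e x ≤ 1) → ‖x‖ ≤ C := by
  have hec : Continuous e := e.continuous_of_finiteDimensional
  -- This maximum is positively homogeneous and, by `rigid` and `w ⬝ᵥ e x = 0`, positive away from
  -- the origin. Its minimum on the unit sphere bounds `‖x‖`.
  let q : (Fin m → ℝ) → ℝ := fun x => Finset.univ.sup' Finset.univ_nonempty fun σ => A.α σ ⬝ᵥ e x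
  have hq : Continuous q := Continuous.finset_sup'_apply _ fun σ _ =>
    Continuous.dotProduct continuous_const hec
  have hqpos : ∀ x ≠ 0, 0 < q x := by
    intro x hx
    by_contra h
    push Not at h
    apply hx
    apply hi
    apply A.rigid
    intro σ
    change _ ≤ A.w ⬝ᵥ e x
    rw [he]
    exact (Finset.le_sup' (fun σ => A.α σ ⬝ᵥ e x) (Finset.mem_univ σ)).trans h
  rcases isEmpty_or_nonempty (Fin m) with hm | hm
  · exact ⟨0, le_rfl, fun x _ => by simp [Subsingleton.elim x 0]⟩
  have hne : (Metric.sphere (0 : Fin m → ℝ) 1).Nonempty := NormedSpace.sphere_nonempty.2 zero_le_one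
  obtain ⟨x₀, hx₀, hmin⟩ := (isCompact_sphere (0 : Fin m → ℝ) 1).exists_isMinOn hne hq.continuousOn
  have hx₀' : x₀ ≠ 0 := by
    rintro rfl
    simp at hx₀
  have h0 := hqpos x₀ hx₀'
  refine ⟨(q x₀)⁻¹, by positivity, fun x hx => ?_⟩
  by_cases hx0 : x = 0
  · simp [hx0, h0.le]
  have hnx : 0 < ‖x‖ := norm_pos_iff.2 hx0
  have h1 : q x₀ ≤ q (‖x‖⁻¹ • x) := hmin (by simp [norm_smul, hnx.ne'])
  have h2 : q (‖x‖⁻¹ • x) ≤ ‖x‖⁻¹ := by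
    refine Finset.sup'_le _ _ fun σ _ => ?_
    rw [map_smul, dotProduct_smul, smul_eq_mul]
    exact mul_le_of_le_one_right (by positivity) (hx σ)
  rw [le_inv_comm₀ hnx h0]
  exact h1.trans h2

/-- The nonnegative vector `center + e x` satisfies `w · u = 1`, so its coordinates are at most `1 /
w i`; an injective linear map is antilipschitz, which carries the bound back to `x`. -/
theorem exists_bound_face {m : ℕ} (e : (Fin m → ℝ) →ₗ[ℝ] (Fin s → ℝ))
    (he : ∀ x, A.w ⬝ᵥ e x = 0) (hi : ∀ x, e x = 0 → x = 0) :
    ∃ C : ℝ, ∀ x, (∀ i, 0 ≤ A.center i + e x i) → ‖x‖ ≤ C := by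
  have hinj : Function.Injective e := by
    rw [injective_iff_map_eq_zero]; exact hi
  obtain ⟨κ, hκ, hanti⟩ := e.exists_antilipschitzWith (LinearMap.ker_eq_bot.2 hinj)
  refine ⟨κ * ∑ i, (1 + 1 / A.w i) * A.center i + κ * ∑ i, 1 / A.w i , fun x hx => ?_⟩
  have h1 : ‖x‖ ≤ κ * ‖e x‖ := by
    have := hanti.le_mul_dist x 0
    simpa using this
  have hsum : ∑ i, A.w i * (A.center i + e x i) = 1 := by
    have h2 : ∑ i, A.w i * (A.center i + e x i) = A.w ⬝ᵥ (A.center + e x) := rfl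
    rw [h2, dotProduct_add, he, A.w_center, add_zero]
  have hup : ∀ i, A.center i + e x i ≤ 1 / A.w i := by
    intro i
    rw [le_div_iff₀ (A.w_pos i), mul_comm, ← hsum]
    exact Finset.single_le_sum (f := fun i => A.w i * (A.center i + e x i))
      (fun j _ => mul_nonneg (A.w_pos j).le (hx j)) (Finset.mem_univ i)
  have hn : ‖e x‖ ≤ ∑ i, (1 + 1 / A.w i) * A.center i + ∑ i, 1 / A.w i := by
    rw [← Finset.sum_add_distrib, pi_norm_le_iff_of_nonneg]
    · intro i
      have hci := A.center_pos i
      have hwi := A.w_pos i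
      have hb : |e x i| ≤ (1 + 1 / A.w i) * A.center i + 1 / A.w i := by
        have h3 := hup i
        have h4 := hx i
        have h5 : 0 < 1 / A.w i * A.center i := by positivity
        have h6 : 0 < 1 / A.w i := by positivity
        rw [abs_le]
        constructor <;> nlinarith
      exact hb.trans (Finset.single_le_sum
        (f := fun i => (1 + 1 / A.w i) * A.center i + 1 / A.w i)
        (fun j _ => by have := A.center_pos j; have := A.w_pos j; positivity) (Finset.mem_univ i))
    · exact Finset.sum_nonneg fun j _ => by
        have := A.center_pos j; have := A.w_pos j; positivity
  calc ‖x‖ ≤ κ * ‖e x‖ := h1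
    _ ≤ _ := by rw [← mul_add]; exact mul_le_mul_of_nonneg_left hn κ.2

end RegionData

/-! ### Volumes of the slices near the maximal face -/

theorem exists_one_add_mul_pow_le (C : ℝ) (hC : 0 ≤ C) (n : ℕ) :
    ∃ C₂ : ℝ, 0 ≤ C₂ ∧ ∀ ξ : ℝ, 0 ≤ ξ → ξ ≤ 1 → (1 + C * ξ) ^ n ≤ 1 + C₂ * ξ := by
  induction n with
  | zero => exact ⟨0, le_rfl, fun ξ _ _ => by simp⟩
  | succ n ih =>
    obtain ⟨C₂, h0, h⟩ := ih
    refine ⟨C₂ + C + C₂ * C, by positivity, fun ξ h1 h2 => ?_⟩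
    rw [pow_succ]
    calc (1 + C * ξ) ^ n * (1 + C * ξ) ≤ (1 + C₂ * ξ) * (1 + C * ξ) :=
          mul_le_mul_of_nonneg_right (h ξ h1 h2) (by positivity)
      _ ≤ _ := by nlinarith [mul_nonneg (mul_nonneg h0 hC) (mul_nonneg h1 (sub_nonneg.2 h2))]

/-- A linear isomorphism multiplies volumes by a positive constant. -/
theorem exists_volume_image_linearEquiv {ι : Type} [Fintype ι] {m k : ℕ}
    (Φ : ((Fin m → ℝ) × (Fin k → ℝ)) ≃ₗ[ℝ] (ι → ℝ)) :
    ∃ κ : ℝ, 0 < κ ∧ ∀ X : Set ((Fin m → ℝ) × (Fin k → ℝ)),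
      (volume : Measure (ι → ℝ)).real (Φ '' X) = κ * volume.real X := by
  have hv : (volume : Measure ((Fin m → ℝ) × (Fin k → ℝ))).IsAddHaarMeasure :=
    Measure.prod.instIsAddHaarMeasure _ _
  have : (volume.map Φ).IsAddHaarMeasure :=
    Φ.toContinuousLinearEquiv.isAddHaarMeasure_map
      (volume : Measure ((Fin m → ℝ) × (Fin k → ℝ)))
  have h := Measure.isAddLeftInvariant_eq_smul (volume : Measure (ι → ℝ)) (volume.map Φ)
  have hne := Measure.addHaarScalarFactor_pos_of_isAddHaarMeasure (volume : Measure (ι → ℝ))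
    (volume.map Φ)
  generalize Measure.addHaarScalarFactor (volume : Measure (ι → ℝ)) (volume.map Φ) = κ at h hne
  refine ⟨κ, NNReal.coe_pos.2 hne, fun X => ?_⟩
  rw [h]
  have hm : (volume.map Φ) (Φ '' X) = volume X := by
    have hc : (Φ : _ → _) = (Φ.toContinuousLinearEquiv.toHomeomorph.toMeasurableEquiv : _ → _) := rfl
    rw [hc, MeasurableEquiv.map_apply, Set.preimage_image_eq _ (MeasurableEquiv.injective _)]
  rw [measureReal_def, Measure.smul_apply, hm]
  simp [measureReal_def, ENNReal.smul_def]

namespace RegionData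

variable {s : ℕ} {S : Type} [Fintype S] [Nonempty S] (A : RegionData s S)

/-- The volumes of the slices of the dilated polytope near the maximal face. -/
theorem exists_slice_bound (i₀ : Fin s) : ∃ c : ℝ, 0 < c ∧ ∃ C : ℝ, 0 ≤ C ∧ ∀ T x : ℝ, 0 < x → x ≤ T →
    |sliceMeasure A.ϖ (A.region T) i₀ (T - x) - c * x ^ (s - A.rk) * T ^ (A.rk - 1)| ≤
      C * x ^ (s - A.rk) * T ^ (A.rk - 1) * (x / T) := by
  obtain ⟨hr1, hrs, e₁, e₀, h1, h0, h0K, h1i, h0i⟩ := A.exists_coords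
  -- the coordinates of the hyperplane
  let ι := {i // i ≠ i₀}
  let Φ' : ((Fin (s - A.rk) → ℝ) × (Fin (A.rk - 1) → ℝ)) →ₗ[ℝ] (ι → ℝ) :=
    (LinearMap.funLeft ℝ ℝ (Subtype.val : ι → Fin s)) ∘ₗ (e₁.coprod e₀)
  have hΦ' : ∀ p i, Φ' p i = e₁ p.1 i.1 + e₀ p.2 i.1 := fun p i => rfl
  have hzero : ∀ u v : Fin s → ℝ, A.w ⬝ᵥ u = A.w ⬝ᵥ v → (∀ i : ι, u i.1 = v i.1) → u = v := by
    intro u v huv h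
    have h2 : ∀ i, i ≠ i₀ → u i = v i := fun i hi => h ⟨i, hi⟩
    ext i
    by_cases hi : i = i₀
    · subst hi
      have e1 : A.w ⬝ᵥ (u - v) = A.w i * (u i - v i) := by
        refine (Finset.sum_eq_single i (fun j _ hj => ?_) (by simp)).trans rfl
        simp [h2 j hj]
      rw [dotProduct_sub, huv, sub_self, eq_comm, mul_eq_zero] at e1
      rcases e1 with e1 | e1
      · exact absurd e1 (A.w_pos i).ne'
      · exact sub_eq_zero.1 e1
    · exact h2 i hi
  have hinj : Function.Injective Φ' := by
    rw [injective_iff_map_eq_zero]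
    rintro ⟨x, y⟩ hxy
    have h2 : e₁ x + e₀ y = 0 := hzero _ _ (by simp [dotProduct_add, h1, h0]) fun i => by
      have := congrFun hxy i
      simpa [hΦ'] using this
    have hx : x = 0 := by
      apply h1i
      rw [eq_neg_of_add_eq_zero_left h2]
      exact A.faceSpan.neg_mem (h0K y)
    subst hx
    have hy : y = 0 := h0i y (by simpa using h2)
    simp [hy]
  have hfr : Module.finrank ℝ ((Fin (s - A.rk) → ℝ) × (Fin (A.rk - 1) → ℝ)) =
      Module.finrank ℝ (ι → ℝ) := by
    rw [Module.finrank_prod, Module.finrank_fin_fun, Module.finrank_fin_fun, Module.finrank_pi]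
    have : Fintype.card ι = s - 1 := by
      simp [ι]
    rw [this]
    omega
  let Φ := LinearEquiv.ofInjectiveOfFinrankEq Φ' hinj hfr
  have hΦ : ∀ p, Φ p = Φ' p := fun p => rfl
  obtain ⟨κ, hκ, hvol⟩ := exists_volume_image_linearEquiv Φ
  -- the two model sets
  let Q : Set (Fin (s - A.rk) → ℝ) := {x | ∀ σ, A.α σ ⬝ᵥ e₁ x ≤ 1}
  let F : Set (Fin (A.rk - 1) → ℝ) := {y | ∀ i, 0 ≤ A.center i + e₀ y i}
  have he₁ : Continuous e₁ := e₁.continuous_of_finiteDimensional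
  have he₀ : Continuous e₀ := e₀.continuous_of_finiteDimensional
  obtain ⟨CQ, hCQ0, hCQ⟩ := A.exists_bound_transversal e₁ h1 h1i
  obtain ⟨CF, hCF⟩ := A.exists_bound_face e₀ h0 h0i
  have hQfin : volume Q ≠ ⊤ := by
    have : Q ⊆ Metric.closedBall 0 CQ := fun x hx => by simpa using hCQ x hx
    exact (measure_mono this |>.trans_lt Metric.isBounded_closedBall.measure_lt_top).ne
  have hFfin : volume F ≠ ⊤ := by
    have : F ⊆ Metric.closedBall 0 CF := fun x hx => by simpa using hCF x hx
    exact (measure_mono this |>.trans_lt Metric.isBounded_closedBall.measure_lt_top).ne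
  have hQpos : 0 < volume.real Q := by
    refine ENNReal.toReal_pos (ne_of_gt ?_) hQfin
    let Q' : Set (Fin (s - A.rk) → ℝ) := ⋂ σ, {x | A.α σ ⬝ᵥ e₁ x < 1}
    have ho : IsOpen Q' := isOpen_iInter_of_finite fun σ =>
      isOpen_lt (Continuous.dotProduct continuous_const he₁) continuous_const
    exact (ho.measure_pos volume ⟨0, by simp [Q']⟩).trans_le (measure_mono fun x hx σ =>
      le_of_lt (Set.mem_iInter.1 hx σ))
  have hFpos : 0 < volume.real F := by
    refine ENNReal.toReal_pos (ne_of_gt ?_) hFfin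
    let F' : Set (Fin (A.rk - 1) → ℝ) := ⋂ i, {x | 0 < A.center i + e₀ x i}
    have ho : IsOpen F' := isOpen_iInter_of_finite fun i =>
      isOpen_lt continuous_const (continuous_const.add ((continuous_apply i).comp he₀))
    exact (ho.measure_pos volume ⟨0, by simp [F', A.center_pos]⟩).trans_le (measure_mono fun x hx i =>
      le_of_lt (Set.mem_iInter.1 hx i))
  have hmemQ : ∀ x : ℝ, 0 < x → ∀ z, z ∈ x • Q ↔ ∀ σ, A.α σ ⬝ᵥ e₁ z ≤ x := by
    intro x hx z
    rw [Set.mem_smul_set_iff_inv_smul_mem₀ hx.ne']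
    refine forall_congr' fun σ => ?_
    rw [map_smul, dotProduct_smul, smul_eq_mul, inv_mul_le_iff₀ hx, mul_one]
  have hmemF : ∀ x : ℝ, 0 < x → ∀ z, z ∈ x • F ↔ ∀ i, 0 ≤ x * A.center i + e₀ z i := by
    intro x hx z
    rw [Set.mem_smul_set_iff_inv_smul_mem₀ hx.ne']
    refine forall_congr' fun i => ?_
    rw [map_smul, Pi.smul_apply, smul_eq_mul]
    have : x * A.center i + e₀ z i = x * (A.center i + x⁻¹ * e₀ z i) := by
      field_simp
    rw [this, mul_nonneg_iff_of_pos_left hx]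
  obtain ⟨κ₁, hκ₁⟩ := (LinearMap.toContinuousLinearMap e₁).bound
  have hκ₁' : ∀ x, ‖e₁ x‖ ≤ κ₁ * ‖x‖ := hκ₁.2
  obtain ⟨C₁, hC₁0, hC₁⟩ := A.exists_smul_center_le (κ₁ * CQ)
  have hQb : ∀ x : ℝ, 0 < x → ∀ z ∈ x • Q, ∀ i, |e₁ z i| ≤ C₁ * x * A.center i := by
    rintro x hx _ ⟨z, hz, rfl⟩ i
    simp only [map_smul, Pi.smul_apply, smul_eq_mul, abs_mul, abs_of_pos hx]
    have h2 : |e₁ z i| ≤ C₁ * A.center i :=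
      ((norm_le_pi_norm (e₁ z) i).trans (hκ₁' z)).trans
        ((mul_le_mul_of_nonneg_left (hCQ z hz) hκ₁.1.le).trans (hC₁ i))
    calc x * |e₁ z i| ≤ x * (C₁ * A.center i) := mul_le_mul_of_nonneg_left h2 hx.le
      _ = _ := by ring
  -- the slice in coordinates
  let inner : ℝ → ℝ → Set ((Fin (s - A.rk) → ℝ) × (Fin (A.rk - 1) → ℝ)) := fun T x =>
    {p | (∀ σ, A.α σ ⬝ᵥ e₁ p.1 ≤ x) ∧ ∀ i, 0 ≤ (T - x) * A.center i + e₁ p.1 i + e₀ p.2 i}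
  have hslice : ∀ T x, sliceMeasure A.ϖ (A.region T) i₀ (T - x) =
      (∏ i : ι, A.w i) * κ * volume.real (inner T x) := by
    intro T x
    have hset : {v : ι → ℝ | ∃ u ∈ A.region T, ∑ i, (A.ϖ i : ℝ) * u i = T - x ∧
        ∀ i : ι, u i = v i} =
        (fun v => (fun i : ι => -((T - x) * A.center i)) + v) ⁻¹' (Φ '' inner T x) := by
      ext v
      simp only [Set.mem_preimage, Set.mem_image]
      constructor
      · rintro ⟨u, hu, hus, huv⟩
        obtain ⟨p, hp⟩ := Φ.surjective ((fun i : ι => -((T - x) * A.center i)) + v)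
        refine ⟨p, ?_, hp⟩
        have hu' : u = (T - x) • A.center + (e₁ p.1 + e₀ p.2) := by
          apply hzero
          · rw [dotProduct_add, dotProduct_smul, A.w_center, dotProduct_add, h1, h0]
            simpa using (show A.w ⬝ᵥ u = T - x from hus)
          · intro i
            have := congrFun hp i
            rw [hΦ, hΦ'] at this
            simp only [Pi.add_apply, Pi.smul_apply, smul_eq_mul, this, huv i]
            ring
        constructor
        · intro σ
          have := hu.1 σ
          rw [hu', dotProduct_add, dotProduct_smul, A.α_center, dotProduct_add, h0K p.2 σ, h0] at this
          simp only [smul_eq_mul] at this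
          linarith
        · intro i
          have := hu.2 i
          rw [hu'] at this
          simpa [add_assoc] using this
      · rintro ⟨p, hp, hpv⟩
        refine ⟨(T - x) • A.center + (e₁ p.1 + e₀ p.2), ⟨?_, ?_⟩, ?_, ?_⟩
        · intro σ
          rw [dotProduct_add, dotProduct_smul, A.α_center, dotProduct_add, h0K p.2 σ, h0]
          have := hp.1 σ
          simp only [smul_eq_mul]
          linarith
        · intro i
          simpa [add_assoc] using hp.2 i
        · change A.w ⬝ᵥ _ = _
          rw [dotProduct_add, dotProduct_smul, A.w_center, dotProduct_add, h1, h0]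
          simp
        · intro i
          have := congrFun hpv i
          rw [hΦ, hΦ'] at this
          simp only [Pi.add_apply] at this
          simp only [Pi.add_apply, Pi.smul_apply, smul_eq_mul, this]
          ring
    unfold sliceMeasure
    rw [hset, measureReal_def, measure_preimage_add, ← measureReal_def, hvol, mul_assoc]
    rfl
  have hprod : ∀ a b : ℝ, 0 ≤ a → 0 ≤ b → volume.real ((a • Q) ×ˢ (b • F)) =
      a ^ (s - A.rk) * b ^ (A.rk - 1) * (volume.real Q * volume.real F) := by
    intro a b ha hb
    rw [measureReal_def, Measure.volume_eq_prod, Measure.prod_prod, Measure.addHaar_smul,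
      Measure.addHaar_smul, Module.finrank_fin_fun, Module.finrank_fin_fun]
    rw [ENNReal.toReal_mul, ENNReal.toReal_mul, ENNReal.toReal_mul,
      ENNReal.toReal_ofReal (abs_nonneg _), ENNReal.toReal_ofReal (abs_nonneg _),
      abs_of_nonneg (pow_nonneg ha _), abs_of_nonneg (pow_nonneg hb _), measureReal_def,
      measureReal_def]
    ring
  have hfin : ∀ a b : ℝ, volume ((a • Q) ×ˢ (b • F)) ≠ ⊤ := by
    intro a b
    rw [Measure.volume_eq_prod, Measure.prod_prod, Measure.addHaar_smul, Measure.addHaar_smul]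
    exact ENNReal.mul_ne_top (ENNReal.mul_ne_top ENNReal.ofReal_ne_top hQfin)
      (ENNReal.mul_ne_top ENNReal.ofReal_ne_top hFfin)
  -- The margin `(C₁ + 1) * x` covers the displacement `C₁ * x` caused by `e₁` and the passage from
  -- `T - x` to `T`; it serves for both inclusions.
  have hupper : ∀ T x, 0 < x → x ≤ T → inner T x ⊆ (x • Q) ×ˢ ((T + (C₁ + 1) * x) • F) := by
    rintro T x hx hxT p ⟨hp1, hp2⟩
    have hpQ := (hmemQ x hx p.1).2 hp1
    refine ⟨hpQ, (hmemF _ (by nlinarith) _).2 fun i => ?_⟩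
    have h2 := (abs_le.1 (hQb x hx p.1 hpQ i)).2
    have h3 := hp2 i
    have h4 := mul_pos hx (A.center_pos i)
    nlinarith
  have hlower : ∀ T x, 0 < x → 0 < T - (C₁ + 1) * x →
      (x • Q) ×ˢ ((T - (C₁ + 1) * x) • F) ⊆ inner T x := by
    rintro T x hx hxT p ⟨hpQ, hpF⟩
    refine ⟨(hmemQ x hx p.1).1 hpQ, fun i => ?_⟩
    have h2 := (abs_le.1 (hQb x hx p.1 hpQ i)).1
    have h3 := (hmemF _ hxT _).1 hpF i
    have h4 := mul_pos hx (A.center_pos i)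
    nlinarith
  obtain ⟨C₂, hC₂0, hC₂⟩ := exists_one_add_mul_pow_le (C₁ + 1) (by positivity) (A.rk - 1)
  have hwpos : 0 < ∏ i : ι, A.w i := Finset.prod_pos fun i _ => A.w_pos i
  set D := (∏ i : ι, A.w i) * κ with hD
  have hDpos : 0 < D := mul_pos hwpos hκ
  set q := volume.real Q * volume.real F with hq
  have hqpos : 0 < q := mul_pos hQpos hFpos
  refine ⟨D * q, by positivity, D * q * (C₂ + ((A.rk - 1 : ℕ) + 1) * (C₁ + 1)), by positivity,
    fun T x hx hxT => ?_⟩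
  have hT : 0 < T := hx.trans_le hxT
  rw [hslice]
  have hξ1 : x / T ≤ 1 := (div_le_one hT).2 hxT
  have hξ0 : 0 < x / T := div_pos hx hT
  set ξ := x / T with hξ
  have hxξ : x = T * ξ := by rw [hξ]; field_simp
  have hP : 0 ≤ D * q * x ^ (s - A.rk) * T ^ (A.rk - 1) := by positivity
  have hup : D * volume.real (inner T x) ≤
      D * q * x ^ (s - A.rk) * T ^ (A.rk - 1) * (1 + C₂ * ξ) := by
    have h2 : volume.real (inner T x) ≤
        x ^ (s - A.rk) * (T + (C₁ + 1) * x) ^ (A.rk - 1) * q := by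
      rw [← hprod x _ hx.le (by positivity)]
      exact measureReal_mono (hupper T x hx hxT) (hfin _ _)
    have h3 : (T + (C₁ + 1) * x) ^ (A.rk - 1) ≤ T ^ (A.rk - 1) * (1 + C₂ * ξ) := by
      have : T + (C₁ + 1) * x = T * (1 + (C₁ + 1) * ξ) := by rw [hxξ]; ring
      rw [this, mul_pow]
      exact mul_le_mul_of_nonneg_left (hC₂ ξ hξ0.le hξ1) (by positivity)
    calc D * volume.real (inner T x) ≤ D * (x ^ (s - A.rk) * (T ^ (A.rk - 1) * (1 + C₂ * ξ)) * q) := by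
          gcongr
          exact h2.trans (by gcongr)
      _ = _ := by ring
  have hlow : D * q * x ^ (s - A.rk) * T ^ (A.rk - 1) * (1 - ((A.rk - 1 : ℕ) + 1) * (C₁ + 1) * ξ) ≤
      D * volume.real (inner T x) := by
    by_cases hpos : 0 < T - (C₁ + 1) * x
    · have h2 : x ^ (s - A.rk) * (T - (C₁ + 1) * x) ^ (A.rk - 1) * q ≤ volume.real (inner T x) := by
        rw [← hprod x _ hx.le hpos.le]
        exact measureReal_mono (hlower T x hx hpos)
          ((measure_mono (hupper T x hx hxT)).trans_lt (hfin _ _).lt_top).ne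
      have h4 : T - (C₁ + 1) * x = T * (1 + -((C₁ + 1) * ξ)) := by rw [hxξ]; ring
      have h5 : (C₁ + 1) * ξ < 1 := by
        rw [h4] at hpos
        have := (mul_pos_iff_of_pos_left hT).1 hpos
        linarith
      have h3 : T ^ (A.rk - 1) * (1 - ((A.rk - 1 : ℕ) + 1) * (C₁ + 1) * ξ) ≤
          (T - (C₁ + 1) * x) ^ (A.rk - 1) := by
        rw [h4, mul_pow]
        have := one_add_mul_le_pow (a := -((C₁ + 1) * ξ)) (by linarith) (A.rk - 1)
        refine mul_le_mul_of_nonneg_left (le_trans ?_ this) (by positivity)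
        have : 0 ≤ (C₁ + 1) * ξ := by positivity
        nlinarith
      calc _ = D * (x ^ (s - A.rk) * (T ^ (A.rk - 1) *
            (1 - ((A.rk - 1 : ℕ) + 1) * (C₁ + 1) * ξ)) * q) := by ring
        _ ≤ D * volume.real (inner T x) := by
          gcongr
          exact le_trans (by gcongr) h2
    -- Here `x` is comparable to `T` and the lower bound to be shown is not positive.
    · have h5 : 1 ≤ (C₁ + 1) * ξ := by
        have h4 : T - (C₁ + 1) * x = T * (1 - (C₁ + 1) * ξ) := by rw [hxξ]; ring
        rw [h4, mul_pos_iff_of_pos_left hT] at hpos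
        linarith
      have h6 : 1 - ((A.rk - 1 : ℕ) + 1) * (C₁ + 1) * ξ ≤ 0 := by
        have : (0 : ℝ) ≤ (A.rk - 1 : ℕ) := Nat.cast_nonneg _
        nlinarith
      exact (mul_nonpos_of_nonneg_of_nonpos hP h6).trans (mul_nonneg hDpos.le measureReal_nonneg)
  have e0 : 0 ≤ D * q * x ^ (s - A.rk) * T ^ (A.rk - 1) * (C₂ * ξ) := mul_nonneg hP (by positivity)
  have e1 : 0 ≤ D * q * x ^ (s - A.rk) * T ^ (A.rk - 1) * (((A.rk - 1 : ℕ) + 1) * (C₁ + 1) * ξ) :=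
    mul_nonneg hP (by positivity)
  have e2 : D * q * (C₂ + ((A.rk - 1 : ℕ) + 1) * (C₁ + 1)) * x ^ (s - A.rk) * T ^ (A.rk - 1) * ξ =
    D * q * x ^ (s - A.rk) * T ^ (A.rk - 1) * (C₂ * ξ) +
    D * q * x ^ (s - A.rk) * T ^ (A.rk - 1) * (((A.rk - 1 : ℕ) + 1) * (C₁ + 1) * ξ) := by ring
  rw [e2, abs_le]
  constructor <;> linarith

end RegionData

/-! ### Product measures with densities -/

theorem lintegral_fin_prod_eq_prod {n : ℕ} (μ : Fin n → Measure ℝ) [∀ i, SigmaFinite (μ i)]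
    (f : Fin n → ℝ → ENNReal) (hf : ∀ i, Measurable (f i)) :
    ∫⁻ u, ∏ i, f i (u i) ∂(Measure.pi μ) = ∏ i, ∫⁻ t, f i t ∂(μ i) := by
  induction n with
  | zero => simp
  | succ n ih =>
    have h := measurePreserving_piFinSuccAbove μ 0
    have hm : Measurable fun p : ℝ × (Fin n → ℝ) => f 0 p.1 * ∏ j : Fin n, f j.succ (p.2 j) := by
      refine ((hf 0).comp measurable_fst).mul (Finset.measurable_prod _ fun j _ => ?_)
      exact (hf j.succ).comp ((measurable_pi_apply j).comp measurable_snd)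
    have h2 := h.lintegral_comp hm
    have h3 : ∀ u : Fin (n + 1) → ℝ, f 0 ((MeasurableEquiv.piFinSuccAbove (fun _ => ℝ) 0) u).1 *
        ∏ j : Fin n, f j.succ (((MeasurableEquiv.piFinSuccAbove (fun _ => ℝ) 0) u).2 j) =
        ∏ i, f i (u i) := by
      intro u
      rw [Fin.prod_univ_succ]
      rfl
    simp only [h3] at h2
    have h4 : Measurable fun v : Fin n → ℝ => ∏ j : Fin n, f j.succ (v j) :=
      Finset.measurable_prod _ fun j _ => (hf j.succ).comp (measurable_pi_apply j)
    rw [h2, Fin.prod_univ_succ, lintegral_prod_mul (f := f 0)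
      (g := fun v : Fin n → ℝ => ∏ j : Fin n, f j.succ (v j)) (hf 0).aemeasurable h4.aemeasurable]
    congr 1
    exact ih _ _ fun i => hf i.succ

/-- The measure on the line with density `k e^{k u}`. -/
noncomputable def expMeasure (k : ℝ) : Measure ℝ :=
  volume.withDensity fun u => ENNReal.ofReal (k * Real.exp (k * u))

theorem measurable_expDensity (k : ℝ) :
    Measurable fun u : ℝ => ENNReal.ofReal (k * Real.exp (k * u)) := by fun_prop

instance (k : ℝ) : SigmaFinite (expMeasure k) :=
  SigmaFinite.withDensity_ofReal _

theorem pi_expMeasure {n : ℕ} (k : Fin n → ℝ) : Measure.pi (fun i => expMeasure (k i)) =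
    (volume : Measure (Fin n → ℝ)).withDensity
      fun u => ∏ i, ENNReal.ofReal (k i * Real.exp (k i * u i)) := by
  refine (Measure.pi_eq fun X hX => ?_)
  rw [withDensity_apply _ (MeasurableSet.univ_pi hX), volume_pi, Measure.restrict_pi_pi,
    lintegral_fin_prod_eq_prod _ _ fun i => measurable_expDensity (k i)]
  exact Finset.prod_congr rfl fun i _ => (withDensity_apply _ (hX i)).symm

theorem expMeasure_Icc {k : ℝ} (hk : 0 < k) {a b : ℝ} (hab : a ≤ b) :
    expMeasure k (Set.Icc a b) = ENNReal.ofReal (Real.exp (k * b) - Real.exp (k * a)) := by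
  unfold expMeasure
  have hc : Continuous fun u : ℝ => k * Real.exp (k * u) := by fun_prop
  rw [withDensity_apply _ measurableSet_Icc, ← ofReal_integral_eq_lintegral_ofReal
    hc.integrableOn_Icc (Eventually.of_forall fun u => by positivity),
    integral_Icc_eq_integral_Ioc, ← intervalIntegral.integral_of_le hab]
  congr 1
  apply intervalIntegral.integral_eq_sub_of_hasDerivAt (f := fun u => Real.exp (k * u))
  · intro x _
    have := ((hasDerivAt_id x).const_mul k).exp
    simpa [mul_comm] using this
  · exact hc.intervalIntegrable _ _

theorem lintegral_comp_add_mul {w : ℝ} (hw : 0 < w) (a : ℝ) {F : ℝ → ENNReal} (hF : Measurable F) :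
    ENNReal.ofReal w * ∫⁻ t, F (a + w * t) = ∫⁻ h, F h := by
  have h1 := Real.smul_map_volume_mul_left hw.ne'
  have h2 : ∫⁻ h, F h = ∫⁻ h, F (a + h) := (lintegral_add_left_eq_self F a).symm
  rw [h2]
  conv_rhs => rw [← h1]
  rw [lintegral_smul_measure, lintegral_map (by fun_prop) (by fun_prop), abs_of_pos hw]
  rfl

/-- Integration over the slices by the hyperplanes `w · u = h`. -/
theorem lintegral_slices {s : ℕ} {w : Fin s → ℝ} (hw : ∀ i, 0 < w i) (i₀ : Fin s)
    {R : Set (Fin s → ℝ)} (hR : MeasurableSet R) {g : ℝ → ENNReal} (hg : Measurable g) :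
    ∫⁻ u in R, g (w ⬝ᵥ u) * ∏ i, ENNReal.ofReal (w i) =
      ∫⁻ h, g h * ((∏ i : {i // i ≠ i₀}, ENNReal.ofReal (w i)) *
        (volume : Measure ({i // i ≠ i₀} → ℝ))
          {v | ∃ u ∈ R, ∑ i, w i * u i = h ∧ ∀ i : {i // i ≠ i₀}, u i = v i}) := by
  classical
  let ι := {i // i ≠ i₀}
  let glue : (ι → ℝ) × ℝ → Fin s → ℝ := fun p i => if h : i ≠ i₀ then p.1 ⟨i, h⟩ else p.2
  have hglue_i₀ : ∀ p, glue p i₀ = p.2 := fun p => by simp [glue]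
  have hglue_ne : ∀ p (i : ι), glue p i = p.1 i := fun p i => by simp [glue, i.2]
  have hgm : Measurable glue := by
    refine measurable_pi_lambda _ fun i => ?_
    by_cases h : i ≠ i₀
    · simp only [glue, h, not_false_iff, dif_pos, ne_eq]
      exact (measurable_pi_apply _).comp measurable_fst
    · simp only [glue, h, dif_neg, not_false_iff]
      exact measurable_snd
  have hpres : MeasurePreserving glue (volume.prod volume) volume := by
    let U : Unique {i // ¬ i ≠ i₀} := ⟨⟨⟨i₀, by simp⟩⟩, fun i => Subtype.ext (not_not.1 i.2)⟩
    have h1 := (volume_preserving_piEquivPiSubtypeProd (fun _ : Fin s => ℝ) (· ≠ i₀)).symm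
    have h2 := (volume_preserving_piUnique (fun _ : {i // ¬ i ≠ i₀} => ℝ)).symm
    have h3 := (MeasurePreserving.id (volume : Measure (ι → ℝ))).prod h2
    have h4 := h1.comp h3
    exact h4
  have hw0 := hw i₀
  have hdot : ∀ u : Fin s → ℝ, w ⬝ᵥ u = ∑ i : ι, w i * u i + w i₀ * u i₀ := by
    intro u
    have := Fintype.sum_subtype_add_sum_subtype (· ≠ i₀) fun i => w i * u i
    change ∑ i, w i * u i = _
    rw [← this]
    congr 1
    have U : Unique {i // ¬ i ≠ i₀} := ⟨⟨⟨i₀, by simp⟩⟩, fun i => Subtype.ext (not_not.1 i.2)⟩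
    rw [Fintype.sum_unique]
    have : (default : {i // ¬ i ≠ i₀}).1 = i₀ := not_not.1 (default : {i // ¬ i ≠ i₀}).2
    rw [this]
  have hprod : ∏ i, ENNReal.ofReal (w i) =
      (∏ i : ι, ENNReal.ofReal (w i)) * ENNReal.ofReal (w i₀) := by
    have := Fintype.prod_subtype_mul_prod_subtype (· ≠ i₀) fun i => ENNReal.ofReal (w i)
    rw [← this]
    congr 1
    have U : Unique {i // ¬ i ≠ i₀} := ⟨⟨⟨i₀, by simp⟩⟩, fun i => Subtype.ext (not_not.1 i.2)⟩
    rw [Fintype.prod_unique]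
    have : (default : {i // ¬ i ≠ i₀}).1 = i₀ := not_not.1 (default : {i // ¬ i ≠ i₀}).2
    rw [this]
  let a : (ι → ℝ) → ℝ := fun v => ∑ i : ι, w i * v i
  have ham : Measurable a := Finset.measurable_sum _ fun i _ => (measurable_pi_apply i).const_mul _
  -- The coordinate `u i₀` is replaced by the height `h = w · u`. The Jacobian is `w i₀`, which is
  -- why this factor is absent from the measure on the slices.
  let pt : (ι → ℝ) × ℝ → Fin s → ℝ := fun p => glue (p.1, (p.2 - a p.1) / w i₀)
  have hpt : Measurable pt := by
    refine hgm.comp (measurable_fst.prodMk ?_)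
    exact (measurable_snd.sub (ham.comp measurable_fst)).div_const _
  have hset : ∀ h, {v : ι → ℝ | ∃ u ∈ R, ∑ i, w i * u i = h ∧ ∀ i : ι, u i = v i} =
      {v | pt (v, h) ∈ R} := by
    intro h
    ext v
    constructor
    · rintro ⟨u, hu, hus, huv⟩
      have : pt (v, h) = u := by
        ext i
        by_cases hi : i = i₀
        · subst hi
          simp only [pt, hglue_i₀]
          rw [div_eq_iff hw0.ne', sub_eq_iff_eq_add, ← hus, mul_comm, add_comm]
          refine (hdot u).trans ?_
          simp [a, huv]
        · exact (hglue_ne _ ⟨i, hi⟩).trans (huv ⟨i, hi⟩).symm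
      change pt (v, h) ∈ R
      rwa [this]
    · intro hv
      refine ⟨pt (v, h), hv, ?_, fun i => hglue_ne _ i⟩
      refine (hdot _).trans ?_
      simp only [pt, hglue_ne, hglue_i₀]
      rw [mul_div_cancel₀ _ hw0.ne']
      simp [a]
  let F : (ι → ℝ) × ℝ → ENNReal := fun p => R.indicator (fun _ => g p.2) (pt p)
  have hF : Measurable F := by
    have : F = (pt ⁻¹' R).indicator fun p => g p.2 := by
      ext p; simp [F, Set.indicator]
    rw [this]
    exact (hg.comp measurable_snd).indicator (hpt hR)
  have h1 : ∫⁻ u in R, g (w ⬝ᵥ u) =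
      ∫⁻ v : ι → ℝ, ∫⁻ t : ℝ, F (v, a v + w i₀ * t) := by
    have hwm : Measurable fun u : Fin s → ℝ => w ⬝ᵥ u := by
      unfold dotProduct; fun_prop
    have hgw : Measurable fun u : Fin s → ℝ => g (w ⬝ᵥ u) := hg.comp hwm
    rw [← lintegral_indicator hR, ← hpres.lintegral_comp (hgw.indicator hR)]
    refine (lintegral_prod _ ((hgw.indicator hR).comp hgm).aemeasurable).trans ?_
    refine lintegral_congr fun v => lintegral_congr fun t => ?_
    have e1 : pt (v, a v + w i₀ * t) = glue (v, t) := by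
      simp only [pt]; congr 2; field_simp; ring
    have e2 : w ⬝ᵥ glue (v, t) = a v + w i₀ * t := by
      rw [hdot]; simp only [hglue_ne, hglue_i₀, a]
    simp only [F, Set.indicator, e1, e2, Function.comp]
  have h2 : ENNReal.ofReal (w i₀) * ∫⁻ u in R, g (w ⬝ᵥ u) = ∫⁻ h, ∫⁻ v : ι → ℝ, F (v, h) := by
    rw [h1, ← lintegral_const_mul']
    · have : ∀ v, ENNReal.ofReal (w i₀) * ∫⁻ t : ℝ, F (v, a v + w i₀ * t) = ∫⁻ h, F (v, h) :=
        fun v => lintegral_comp_add_mul hw0 (a v) (hF.comp measurable_prodMk_left)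
      simp only [this]
      exact lintegral_lintegral_swap hF.aemeasurable
    · exact ENNReal.ofReal_ne_top
  have hmeas : ∀ h, MeasurableSet {v : ι → ℝ | pt (v, h) ∈ R} := fun h =>
    (hpt.comp measurable_prodMk_right) hR
  have h3 : ∀ h, ∫⁻ v : ι → ℝ, F (v, h) = g h * volume {v : ι → ℝ | pt (v, h) ∈ R} := by
    intro h
    have : ∀ v, F (v, h) = {v : ι → ℝ | pt (v, h) ∈ R}.indicator (fun _ => g h) v := fun v => by
      simp [F, Set.indicator]
    simp only [this]
    rw [lintegral_indicator_const (hmeas h)]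
  rw [lintegral_mul_const' _ _ (ENNReal.prod_lt_top fun i _ => ENNReal.ofReal_lt_top).ne, hprod]
  have hset' : ∀ h, volume {v : {i // i ≠ i₀} → ℝ | ∃ u ∈ R, ∑ i, w i * u i = h ∧
      ∀ i : {i // i ≠ i₀}, u i = v i} = volume {v : ι → ℝ | pt (v, h) ∈ R} := fun h => by
    rw [← hset]
  simp only [hset']
  have h4 : ∀ h, g h * ((∏ i : ι, ENNReal.ofReal (w i)) * volume {v : ι → ℝ | pt (v, h) ∈ R}) =
      (∏ i : ι, ENNReal.ofReal (w i)) * ∫⁻ v : ι → ℝ, F (v, h) := fun h => by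
    rw [h3]; ring
  simp only [ι] at h4 ⊢
  simp only [h4]
  rw [lintegral_const_mul' _ _ (ENNReal.prod_lt_top fun i _ => ENNReal.ofReal_lt_top).ne, ← h2]
  ring

theorem lintegral_exp_neg_mul_pow (a : ℕ) :
    ∫⁻ x in Set.Ioi (0 : ℝ), ENNReal.ofReal (Real.exp (-x) * x ^ a) = ENNReal.ofReal (a ! : ℝ) := by
  have h1 := Real.GammaIntegral_convergent (s := (a : ℝ) + 1) (by positivity)
  have h2 := Real.Gamma_eq_integral (s := (a : ℝ) + 1) (by positivity)
  rw [Real.Gamma_nat_eq_factorial] at h2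
  have h3 : ∀ x : ℝ, Real.exp (-x) * x ^ ((a : ℝ) + 1 - 1) = Real.exp (-x) * x ^ a := fun x => by
    rw [add_sub_cancel_right, Real.rpow_natCast]
  simp only [h3] at h1 h2
  rw [h2, ofReal_integral_eq_lintegral_ofReal h1]
  exact (ae_restrict_iff' measurableSet_Ioi).2 (Eventually.of_forall fun x hx => by
    have : (0 : ℝ) < x := hx
    positivity)

/-! ### The mass of the dilated polytope for the exponential density -/

namespace RegionData

variable {s : ℕ} {S : Type} (A : RegionData s S)

/-- The measure with density `∏ ϖ_i e^{ϖ_i u_i}`. -/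
noncomputable def expPi : Measure (Fin s → ℝ) := Measure.pi fun i => expMeasure (A.w i)

theorem expPi_eq : A.expPi = (volume : Measure (Fin s → ℝ)).withDensity
    fun u => ENNReal.ofReal (Real.exp (A.w ⬝ᵥ u)) * ∏ i, ENNReal.ofReal (A.w i) := by
  rw [expPi, pi_expMeasure]
  congr 1
  ext u
  have h : ∀ i, ENNReal.ofReal (A.w i * Real.exp (A.w i * u i)) =
      ENNReal.ofReal (Real.exp (A.w i * u i)) * ENNReal.ofReal (A.w i) := fun i => by
    rw [mul_comm, ENNReal.ofReal_mul (Real.exp_nonneg _)]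
  simp only [h]
  rw [Finset.prod_mul_distrib, ← ENNReal.ofReal_prod_of_nonneg fun i _ => Real.exp_nonneg _,
    ← Real.exp_sum]
  rfl

theorem region_subset_Icc [Nonempty S] (T : ℝ) :
    A.region T ⊆ Set.Icc 0 fun i => T / A.w i := by
  intro u hu
  refine ⟨fun i => hu.2 i, fun i => ?_⟩
  rw [le_div_iff₀ (A.w_pos i), mul_comm]
  exact (Finset.single_le_sum (f := fun i => A.w i * u i)
    (fun j _ => mul_nonneg (A.w_pos j).le (hu.2 j)) (Finset.mem_univ i)).trans (A.w_le_of_mem hu)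

theorem expPi_region_ne_top [Nonempty S] (T : ℝ) : A.expPi (A.region T) ≠ ⊤ := by
  refine ((measure_mono (A.region_subset_Icc T)).trans_lt ?_).ne
  rw [expPi, ← Set.pi_univ_Icc, Measure.pi_pi]
  refine ENNReal.prod_lt_top fun i _ => ?_
  rcases le_total ((0 : Fin s → ℝ) i) (T / A.w i) with h | h
  · rw [expMeasure_Icc (A.w_pos i) h]
    exact ENNReal.ofReal_lt_top
  · refine lt_of_le_of_lt (measure_mono (Set.Icc_subset_Icc_right h)) ?_
    rw [expMeasure_Icc (A.w_pos i) le_rfl]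
    exact ENNReal.ofReal_lt_top

/-- The mass of the dilated polytope. -/
noncomputable def mass (T : ℝ) : ℝ := A.expPi.real (A.region T)

/-- The slice measure as an extended real. -/
theorem ofReal_sliceMeasure [Nonempty S] (T : ℝ) (i₀ : Fin s) (h : ℝ) :
    (∏ i : {i // i ≠ i₀}, ENNReal.ofReal (A.w i)) * (volume : Measure ({i // i ≠ i₀} → ℝ))
        {v | ∃ u ∈ A.region T, ∑ i, A.w i * u i = h ∧ ∀ i : {i // i ≠ i₀}, u i = v i} =
      ENNReal.ofReal (sliceMeasure A.ϖ (A.region T) i₀ h) := by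
  have hfin : (volume : Measure ({i // i ≠ i₀} → ℝ))
      {v | ∃ u ∈ A.region T, ∑ i, A.w i * u i = h ∧ ∀ i : {i // i ≠ i₀}, u i = v i} ≠ ⊤ := by
    refine ((measure_mono (t := Set.Icc 0 fun i : {i // i ≠ i₀} => T / A.w i) ?_).trans_lt
      isCompact_Icc.measure_lt_top).ne
    rintro v ⟨u, hu, -, huv⟩
    have := A.region_subset_Icc T hu
    exact ⟨fun i => (huv i) ▸ this.1 i, fun i => (huv i) ▸ this.2 i⟩
  unfold sliceMeasure
  rw [ENNReal.ofReal_mul (Finset.prod_nonneg fun i _ => Nat.cast_nonneg _),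
    ENNReal.ofReal_prod_of_nonneg fun i _ => Nat.cast_nonneg _, measureReal_def]
  congr 1
  exact (ENNReal.ofReal_toReal hfin).symm

/-- On the slice `w · u = T - x` the exponential `e^{w · u}` is constant; for `x` outside `[0, T]`
the slice is empty, since `0 ≤ w · u ≤ T` on the polytope. -/
theorem expPi_region_eq [Nonempty S] (T : ℝ) (i₀ : Fin s) : A.expPi (A.region T) =
    ∫⁻ x in Set.Ioc 0 T,
      ENNReal.ofReal (Real.exp (T - x) * sliceMeasure A.ϖ (A.region T) i₀ (T - x)) := by
  rw [expPi_eq, withDensity_apply _ (A.isClosed_region T).measurableSet,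
    lintegral_slices A.w_pos i₀ (A.isClosed_region T).measurableSet
      (g := fun h => ENNReal.ofReal (Real.exp h)) (by fun_prop)]
  simp only [A.ofReal_sliceMeasure]
  have h1 : ∀ h, ENNReal.ofReal (Real.exp h) * ENNReal.ofReal (sliceMeasure A.ϖ (A.region T) i₀ h) =
      ENNReal.ofReal (Real.exp h * sliceMeasure A.ϖ (A.region T) i₀ h) := fun h => by
    rw [ENNReal.ofReal_mul (Real.exp_nonneg _)]
  simp only [h1]
  rw [← lintegral_sub_left_eq_self _ T]
  have hsupp : ∀ x, x ∉ Set.Icc 0 T → sliceMeasure A.ϖ (A.region T) i₀ (T - x) = 0 := by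
    intro x hx
    have : {v : {i // i ≠ i₀} → ℝ | ∃ u ∈ A.region T, ∑ i, (A.ϖ i : ℝ) * u i = T - x ∧
        ∀ i : {i // i ≠ i₀}, u i = v i} = ∅ := by
      refine Set.eq_empty_of_forall_notMem ?_
      rintro v ⟨u, hu, hus, -⟩
      have h1 : A.w ⬝ᵥ u = T - x := hus
      have h2 := A.w_le_of_mem hu
      have h3 : 0 ≤ A.w ⬝ᵥ u := Finset.sum_nonneg fun i _ => mul_nonneg (A.w_pos i).le (hu.2 i)
      exact hx ⟨by linarith, by linarith⟩
    unfold sliceMeasure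
    rw [this]; simp
  rw [restrict_Ioc_eq_restrict_Icc, ← lintegral_indicator measurableSet_Icc]
  refine lintegral_congr fun x => ?_
  by_cases hx : x ∈ Set.Icc 0 T
  · simp [hx]
  · simp [hx, hsupp x hx]

/-- The mass of the dilated polytope. -/
theorem exists_mass_bound [Fintype S] [Nonempty S] (i₀ : Fin s) {c C : ℝ} (hc : 0 < c) (hC : 0 ≤ C)
    (h : ∀ T x : ℝ, 0 < x → x ≤ T →
      |sliceMeasure A.ϖ (A.region T) i₀ (T - x) - c * x ^ (s - A.rk) * T ^ (A.rk - 1)| ≤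
        C * x ^ (s - A.rk) * T ^ (A.rk - 1) * (x / T)) (T : ℝ) (hT : 0 < T) :
    |A.mass T - c * (s - A.rk)! * (Real.exp T * T ^ (A.rk - 1))| ≤
      (C + c) * (s - A.rk + 1)! * (Real.exp T * T ^ (A.rk - 1) / T) := by
  set a := s - A.rk
  set b := A.rk - 1
  have hmass : A.expPi (A.region T) = ENNReal.ofReal (A.mass T) :=
    (ENNReal.ofReal_toReal (A.expPi_region_ne_top T)).symm
  have hE := A.expPi_region_eq T i₀
  -- Over the whole half line the integrals are factorials. The main term of the slices gives `a!`,
  -- and the error, having one more factor `x / T`, gives `(a + 1)! / T`.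
  have key : ∀ (D : ℝ) (k : ℕ), 0 ≤ D → ∫⁻ x in Set.Ioi (0 : ℝ),
      ENNReal.ofReal (D * (Real.exp T * T ^ b) * (Real.exp (-x) * x ^ k)) =
        ENNReal.ofReal (D * (Real.exp T * T ^ b) * k !) := by
    intro D k hD
    have h0 : 0 ≤ D * (Real.exp T * T ^ b) := by positivity
    simp only [ENNReal.ofReal_mul h0]
    rw [lintegral_const_mul' _ _ ENNReal.ofReal_ne_top, lintegral_exp_neg_mul_pow]
  have hmeas : ∀ (D : ℝ) (k : ℕ), Measurable fun x : ℝ =>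
      ENNReal.ofReal (D * (Real.exp T * T ^ b) * (Real.exp (-x) * x ^ k)) := by
    intro D k; fun_prop
  have hupper : A.expPi (A.region T) ≤ ENNReal.ofReal (c * (Real.exp T * T ^ b) * a !) +
      ENNReal.ofReal (C / T * (Real.exp T * T ^ b) * (a + 1)!) := by
    rw [hE, ← key c a hc.le, ← key (C / T) (a + 1) (by positivity), ← lintegral_add_left (hmeas _ _)]
    refine (setLIntegral_mono ((hmeas _ _).add (hmeas _ _)) fun x hx => ?_).trans
      (lintegral_mono_set Set.Ioc_subset_Ioi_self)
    have hx0 : 0 < x := hx.1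
    rw [Pi.add_apply, ← ENNReal.ofReal_add (by positivity) (by positivity)]
    refine ENNReal.ofReal_le_ofReal ?_
    have h2 := (abs_le.1 (h T x hx.1 hx.2)).2
    have h3 : sliceMeasure A.ϖ (A.region T) i₀ (T - x) ≤
        c * x ^ a * T ^ b + C * x ^ a * T ^ b * (x / T) := by linarith
    calc Real.exp (T - x) * sliceMeasure A.ϖ (A.region T) i₀ (T - x)
        ≤ Real.exp (T - x) * (c * x ^ a * T ^ b + C * x ^ a * T ^ b * (x / T)) := by gcongr
      _ = _ := by rw [sub_eq_add_neg, Real.exp_add, pow_succ]; ring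
  have hlower : ENNReal.ofReal (c * (Real.exp T * T ^ b) * a !) ≤ A.expPi (A.region T) +
      ENNReal.ofReal ((C + c) / T * (Real.exp T * T ^ b) * (a + 1)!) := by
    rw [hE, ← key c a hc.le, ← key ((C + c) / T) (a + 1) (by positivity)]
    rw [← lintegral_indicator measurableSet_Ioc, ← lintegral_indicator measurableSet_Ioi,
      ← lintegral_indicator measurableSet_Ioi, ← lintegral_add_right _
        ((hmeas _ _).indicator measurableSet_Ioi)]
    refine lintegral_mono fun x => ?_
    by_cases hx : x ∈ Set.Ioi (0 : ℝ)
    · have hx0 : 0 < x := hx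
      simp only [Set.indicator_of_mem hx]
      by_cases hxT : x ≤ T
      · rw [Set.indicator_of_mem (show x ∈ Set.Ioc 0 T from ⟨hx0, hxT⟩)]
        have hs0 : 0 ≤ sliceMeasure A.ϖ (A.region T) i₀ (T - x) :=
          mul_nonneg (Finset.prod_nonneg fun i _ => Nat.cast_nonneg _) measureReal_nonneg
        rw [← ENNReal.ofReal_add (by positivity) (by positivity)]
        refine ENNReal.ofReal_le_ofReal ?_
        have h2 := (abs_le.1 (h T x hx0 hxT)).1
        have h4 : 0 ≤ c * x ^ a * T ^ b * (x / T) := by positivity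
        have h3 : c * x ^ a * T ^ b ≤ sliceMeasure A.ϖ (A.region T) i₀ (T - x) +
            (C + c) * x ^ a * T ^ b * (x / T) := by linarith
        calc c * (Real.exp T * T ^ b) * (Real.exp (-x) * x ^ a)
            = Real.exp (T - x) * (c * x ^ a * T ^ b) := by
              rw [sub_eq_add_neg, Real.exp_add]; ring
          _ ≤ Real.exp (T - x) * (sliceMeasure A.ϖ (A.region T) i₀ (T - x) +
            (C + c) * x ^ a * T ^ b * (x / T)) := by gcongr
          _ = _ := by rw [sub_eq_add_neg, Real.exp_add, pow_succ]; ring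
      -- The tail `x > T` does not occur in the mass. There `x / T ≥ 1`, so the main term is
      -- absorbed by an error term with constant `C + c`.
      · push Not at hxT
        refine le_add_left (ENNReal.ofReal_le_ofReal ?_)
        have h2 : 1 ≤ x / T := (one_le_div hT).2 hxT.le
        have h3 : c ≤ (C + c) * (x / T) := by nlinarith
        have h4 : 0 ≤ Real.exp T * T ^ b * (Real.exp (-x) * x ^ a) := by positivity
        calc c * (Real.exp T * T ^ b) * (Real.exp (-x) * x ^ a)
            = c * (Real.exp T * T ^ b * (Real.exp (-x) * x ^ a)) := by ring
          _ ≤ (C + c) * (x / T) * (Real.exp T * T ^ b * (Real.exp (-x) * x ^ a)) := by gcongr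
          _ = _ := by rw [pow_succ]; ring
    · simp [hx]
  have hm0 : 0 ≤ A.mass T := measureReal_nonneg
  rw [hmass, ← ENNReal.ofReal_add (by positivity) (by positivity),
    ENNReal.ofReal_le_ofReal_iff (by positivity)] at hupper
  rw [hmass, ← ENNReal.ofReal_add (by positivity) (by positivity),
    ENNReal.ofReal_le_ofReal_iff (by positivity)] at hlower
  have h5 : 0 ≤ c / T * (Real.exp T * T ^ b) * (a + 1)! := by positivity
  have e1 : (C + c) * (a + 1)! * (Real.exp T * T ^ b / T) =
    C / T * (Real.exp T * T ^ b) * (a + 1)! + c / T * (Real.exp T * T ^ b) * (a + 1)! := by ring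
  have e2 : (C + c) / T * (Real.exp T * T ^ b) * (a + 1)! =
    C / T * (Real.exp T * T ^ b) * (a + 1)! + c / T * (Real.exp T * T ^ b) * (a + 1)! := by ring
  rw [e2] at hlower
  rw [e1, abs_le]
  constructor <;> linarith

/-- The leading constants of the slices do not depend on the choice of the coordinate. -/
theorem exists_slice_mass [Fintype S] [Nonempty S] (i₁ : Fin s) : ∃ c : ℝ, 0 < c ∧
    (∀ i₀, Tendsto (fun δ : ℝ => δ ^ ((A.rk : ℤ) - s) * sliceMeasure A.ϖ (A.region 1) i₀ (1 - δ))
      (𝓝[>] 0) (𝓝 c)) ∧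
    ∃ C : ℝ, 0 ≤ C ∧ ∀ T : ℝ, 0 < T → |A.mass T - c * (s - A.rk)! * (Real.exp T * T ^ (A.rk - 1))| ≤
      C * (Real.exp T * T ^ (A.rk - 1) / T) := by
  obtain ⟨hr1, hrs, -⟩ := A.exists_coords
  have hall : ∀ i₀, ∃ c : ℝ, 0 < c ∧
      Tendsto (fun δ : ℝ => δ ^ ((A.rk : ℤ) - s) * sliceMeasure A.ϖ (A.region 1) i₀ (1 - δ))
        (𝓝[>] 0) (𝓝 c) ∧ ∃ C : ℝ, 0 ≤ C ∧
        ∀ T : ℝ, 0 < T → |A.mass T - c * (s - A.rk)! * (Real.exp T * T ^ (A.rk - 1))| ≤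
          C * (Real.exp T * T ^ (A.rk - 1) / T) := by
    intro i₀
    obtain ⟨c, hc, C, hC, h⟩ := A.exists_slice_bound i₀
    refine ⟨c, hc, ?_, (C + c) * (s - A.rk + 1)!, by positivity, fun T hT =>
      A.exists_mass_bound i₀ hc hC h T hT⟩
    rw [tendsto_iff_norm_sub_tendsto_zero]
    have hlim : Tendsto (fun δ : ℝ => C * δ) (𝓝[>] 0) (𝓝 0) := by
      have : Tendsto (fun δ : ℝ => C * δ) (𝓝 0) (𝓝 (C * 0)) := tendsto_id.const_mul C
      rw [mul_zero] at this
      exact this.mono_left nhdsWithin_le_nhds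
    refine squeeze_zero' (Eventually.of_forall fun _ => norm_nonneg _) ?_ hlim
    filter_upwards [Ioo_mem_nhdsGT (zero_lt_one' ℝ)] with δ hδ
    have h1 := h 1 δ hδ.1 hδ.2.le
    have hδ0 := hδ.1
    simp only [one_pow, mul_one, div_one] at h1
    have hz : δ ^ ((A.rk : ℤ) - s) * δ ^ (s - A.rk) = 1 := by
      rw [← zpow_natCast, ← zpow_add₀ hδ0.ne']
      rw [Nat.cast_sub hrs]
      simp
    have hz0 : 0 < δ ^ ((A.rk : ℤ) - s) := zpow_pos hδ0 _
    rw [Real.norm_eq_abs]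
    have e : δ ^ ((A.rk : ℤ) - s) * sliceMeasure A.ϖ (A.region 1) i₀ (1 - δ) - c =
        δ ^ ((A.rk : ℤ) - s) *
          (sliceMeasure A.ϖ (A.region 1) i₀ (1 - δ) - c * δ ^ (s - A.rk)) := by
      rw [mul_sub, mul_left_comm, hz, mul_one]
    rw [e, abs_mul, abs_of_pos hz0]
    calc _ ≤ δ ^ ((A.rk : ℤ) - s) * (C * δ ^ (s - A.rk) * δ) := by gcongr
      _ = (δ ^ ((A.rk : ℤ) - s) * δ ^ (s - A.rk)) * (C * δ) := by ring
      _ = C * δ := by rw [hz, one_mul]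
  -- The mass does not involve `i₀`, so its asymptotic behaviour forces the constants obtained from
  -- different `i₀` to coincide.
  have hlim : ∀ c C : ℝ, (∀ T : ℝ, 0 < T →
      |A.mass T - c * (s - A.rk)! * (Real.exp T * T ^ (A.rk - 1))| ≤
          C * (Real.exp T * T ^ (A.rk - 1) / T)) →
      Tendsto (fun T => A.mass T / (Real.exp T * T ^ (A.rk - 1))) atTop (𝓝 (c * (s - A.rk)!)) := by
    intro c C h
    rw [tendsto_iff_norm_sub_tendsto_zero]
    refine squeeze_zero' (Eventually.of_forall fun _ => norm_nonneg _) ?_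
      (tendsto_const_nhds.div_atTop tendsto_id : Tendsto (fun T : ℝ => C / T) atTop (𝓝 0))
    filter_upwards [eventually_gt_atTop 0] with T hT
    have hp : 0 < Real.exp T * T ^ (A.rk - 1) := by positivity
    rw [Real.norm_eq_abs, div_sub' hp.ne', abs_div, abs_of_pos hp, div_le_iff₀ hp, mul_comm _ (c * _)]
    exact (h T hT).trans (le_of_eq (by ring))
  obtain ⟨c, hc, -, C, hC, hm⟩ := hall i₁
  refine ⟨c, hc, fun i₀ => ?_, C, hC, hm⟩
  obtain ⟨c', -, ht, C', -, hm'⟩ := hall i₀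
  have := tendsto_nhds_unique (hlim c C hm) (hlim c' C' hm')
  rw [mul_right_cancel₀ (by positivity) this]
  exact ht

end RegionData

/-! ### Boundary layers of the polytope and weighted lattice sums -/

namespace RegionData

variable {s : ℕ} {S : Type} (A : RegionData s S)

/-- A translation by `k • center` raises `w · u` by `k`, hence multiplies the density by `e^k`. -/
theorem expPi_add_region (T : ℝ) (k : ℝ) :
    A.expPi ((fun u => (-(k • A.center)) + u) ⁻¹' A.region T) =
      ENNReal.ofReal (Real.exp k) * A.expPi (A.region T) := by
  have hm := (A.isClosed_region T).measurableSet
  have hm' : MeasurableSet ((fun u => (-(k • A.center)) + u) ⁻¹' A.region T) :=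
    measurable_const_add _ hm
  rw [expPi_eq, withDensity_apply _ hm, withDensity_apply _ hm', ← lintegral_indicator hm,
    ← lintegral_indicator hm', ← lintegral_const_mul' _ _ ENNReal.ofReal_ne_top,
    ← lintegral_add_left_eq_self _ (k • A.center)]
  refine lintegral_congr fun u => ?_
  by_cases hu : u ∈ A.region T
  · rw [Set.indicator_of_mem hu, Set.indicator_of_mem (by simpa using hu), dotProduct_add,
      dotProduct_smul, A.w_center, Real.exp_add, ENNReal.ofReal_mul (Real.exp_nonneg _), mul_assoc]
    simp
  · rw [Set.indicator_of_notMem hu, Set.indicator_of_notMem (by simpa using hu), mul_zero]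

/-- The part of the dilated polytope near a coordinate hyperplane has small mass. -/
theorem exists_layer_bound [Fintype S] [Nonempty S] (i₁ : Fin s) : ∃ C : ℝ, 0 ≤ C ∧
    ∀ T : ℝ, 1 ≤ T → ∀ t : ℝ, 0 ≤ t → ∀ i, A.expPi.real (A.region T ∩ {u | u i ≤ t}) ≤
      C * (1 + t) * (Real.exp T * T ^ (A.rk - 1) / T) := by
  obtain ⟨c, hc, -, C, hC, h⟩ := A.exists_slice_mass i₁
  set K := c * (s - A.rk)! with hK
  have hK0 : 0 < K := by positivity
  set b := A.rk - 1 with hb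
  obtain ⟨D, hD0, hD⟩ := A.exists_smul_center_le 1
  refine ⟨(2 * (K + C) + K * b + 3 * C) * (1 + D), by positivity, fun T hT t ht i => ?_⟩
  have hT0 : 0 < T := by linarith
  have hci := A.center_pos i
  -- the number of shifts
  obtain ⟨n, hn1, hn2, hn3⟩ : ∃ n : ℕ, t < n * A.center i ∧ (n : ℝ) ≤ (1 + D) * (1 + t) ∧
      1 ≤ (n : ℝ) := by
    refine ⟨⌊t / A.center i⌋₊ + 1, ?_, ?_, by simp⟩
    · rw [← div_lt_iff₀ hci]
      exact_mod_cast Nat.lt_floor_add_one (t / A.center i)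
    · push_cast
      have h1 := Nat.floor_le (div_nonneg ht hci.le)
      have h2 : t / A.center i ≤ D * t := by
        rw [div_le_iff₀ hci]
        have := mul_le_mul_of_nonneg_left (hD i) ht
        linarith
      nlinarith
  have hE : 0 < Real.exp T * T ^ b / T := by positivity
  set E := Real.exp T * T ^ b / T with hEdef
  have hET : Real.exp T * T ^ b = T * E := by rw [hEdef]; field_simp
  suffices hmain : A.expPi.real (A.region T ∩ {u | u i ≤ t}) ≤
      (2 * (K + C) + K * b + 3 * C) * n * E by
    refine hmain.trans ?_
    have : 0 ≤ 2 * (K + C) + K * b + 3 * C := by positivity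
    calc _ ≤ (2 * (K + C) + K * b + 3 * C) * ((1 + D) * (1 + t)) * E := by gcongr
      _ = _ := by ring
  have hMT := abs_le.1 (h T hT0)
  rw [hET, mul_div_cancel_left₀ _ hT0.ne'] at hMT
  -- If `n` is at least of the order of `T`, the mass of the whole polytope is already `O(n * E)`.
  by_cases hnT : T < 2 * n
  · have h1 : A.expPi.real (A.region T ∩ {u | u i ≤ t}) ≤ A.mass T :=
      measureReal_mono Set.inter_subset_left (A.expPi_region_ne_top T)
    have h2 : A.mass T ≤ K * (T * E) + C * E := by linarith [hMT.2]
    have h3 : K * (T * E) ≤ K * (2 * n * E) := by gcongr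
    have h4 : C * E ≤ C * (2 * n * E) := by
      gcongr
      nlinarith
    have h5 : 0 ≤ (K * b + 3 * C) * n * E := by positivity
    calc _ ≤ K * (2 * n * E) + C * (2 * n * E) := by linarith
      _ = 2 * (K + C) * n * E := by ring
      _ ≤ _ := by linarith
  · push Not at hnT
    have hTn : 0 < T - n := by linarith
    -- The translate of `region (T - n)` by `n • center` lies in `region T` and avoids the layer,
    -- because `n * center i > t`. So the layer has mass at most `mass T - e^n * mass (T - n)`; the
    -- leading terms of this difference cancel up to `O(n * E)`.
    set Y : Set (Fin s → ℝ) := (fun u => (-((n : ℝ) • A.center)) + u) ⁻¹' A.region (T - n)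
    have hYT : Y ⊆ A.region T := by
      intro u hu
      have hu' : (-((n : ℝ) • A.center)) + u ∈ A.region (T - n) := hu
      constructor
      · intro σ
        have := hu'.1 σ
        rw [dotProduct_add, dotProduct_neg, dotProduct_smul, A.α_center] at this
        simp only [smul_eq_mul, mul_one] at this
        linarith
      · intro j
        have := hu'.2 j
        simp only [Pi.add_apply, Pi.neg_apply, Pi.smul_apply, smul_eq_mul] at this
        have := mul_nonneg (zero_le_one.trans hn3) (A.center_pos j).le
        linarith
    have hdisj : Disjoint (A.region T ∩ {u | u i ≤ t}) Y := by
      rw [Set.disjoint_left]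
      rintro u ⟨-, hu⟩ hu'
      have := (show (-((n : ℝ) • A.center)) + u ∈ A.region (T - n) from hu').2 i
      simp only [Pi.add_apply, Pi.neg_apply, Pi.smul_apply, smul_eq_mul] at this
      have hut : u i ≤ t := hu
      linarith
    have hYm : MeasurableSet Y := measurable_const_add _ (A.isClosed_region _).measurableSet
    have hY : A.expPi.real Y = Real.exp n * A.mass (T - n) := by
      rw [measureReal_def, A.expPi_add_region, ENNReal.toReal_mul,
        ENNReal.toReal_ofReal (Real.exp_nonneg _)]
      rfl
    have h1 : A.expPi.real (A.region T ∩ {u | u i ≤ t}) + A.expPi.real Y ≤ A.mass T := by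
      rw [← measureReal_union hdisj hYm
        (measure_mono Set.inter_subset_left |>.trans_lt (A.expPi_region_ne_top T).lt_top).ne
        (measure_mono hYT |>.trans_lt (A.expPi_region_ne_top T).lt_top).ne]
      exact measureReal_mono (Set.union_subset Set.inter_subset_left hYT) (A.expPi_region_ne_top T)
    have hMn := (abs_le.1 (h (T - n) hTn)).1
    have hexp : Real.exp n * Real.exp (T - n) = Real.exp T := by
      rw [← Real.exp_add]; congr 1; ring
    have h2 : K * (Real.exp T * (T - n) ^ b) - C * (Real.exp T * (T - n) ^ b / (T - n)) ≤
        A.expPi.real Y := by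
      rw [hY]
      have := mul_le_mul_of_nonneg_left hMn (Real.exp_nonneg n)
      rw [← hexp]
      calc _ = Real.exp n * (-(C * (Real.exp (T - n) * (T - n) ^ b / (T - n)))) +
            K * (Real.exp n * Real.exp (T - n) * (T - n) ^ b) := by ring
        _ ≤ Real.exp n * (A.mass (T - n) - K * (Real.exp (T - n) * (T - n) ^ b)) +
            K * (Real.exp n * Real.exp (T - n) * (T - n) ^ b) := by linarith
        _ = _ := by ring
    have h3 : Real.exp T * (T - n) ^ b / (T - n) ≤ 2 * E := by
      have h4 : (T - n) ^ b ≤ T ^ b := pow_le_pow_left₀ hTn.le (by linarith) b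
      have h5 : T / 2 ≤ T - n := by linarith
      calc Real.exp T * (T - n) ^ b / (T - n) ≤ Real.exp T * T ^ b / (T / 2) := by gcongr
        _ = 2 * E := by rw [hEdef]; field_simp
    have h4 : T * E - b * n * E ≤ Real.exp T * (T - n) ^ b := by
      have h5 : T - n = T * (1 + -(n / T)) := by field_simp; ring
      have h6 : (n : ℝ) / T ≤ 1 := by rw [div_le_one hT0]; linarith
      have h7 := one_add_mul_le_pow (a := -((n : ℝ) / T)) (by linarith) b
      rw [h5, mul_pow]
      calc T * E - b * n * E = Real.exp T * T ^ b * (1 + b * -(n / T)) := by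
            rw [hEdef]; field_simp; ring
        _ ≤ Real.exp T * T ^ b * (1 + -(n / T)) ^ b := by gcongr
        _ = _ := by ring
    have h5 : K * (T * E - b * n * E) ≤ K * (Real.exp T * (T - n) ^ b) := by gcongr
    have h6 : C * (Real.exp T * (T - n) ^ b / (T - n)) ≤ C * (2 * E) := by gcongr
    have h7 : C * E ≤ C * (n * E) := by
      gcongr; nlinarith
    have h8 : 0 ≤ 2 * (K + C) * n * E := by positivity
    calc A.expPi.real (A.region T ∩ {u | u i ≤ t})
        ≤ (K * (T * E) + C * E) - (K * (T * E - b * n * E) - C * (2 * E)) := by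
          linarith [hMT.2]
      _ = K * b * n * E + 3 * (C * E) := by ring
      _ ≤ K * b * n * E + 3 * (C * (n * E)) := by linarith
      _ ≤ _ := by linarith

/-- Weighted number of lattice points near a coordinate hyperplane. -/
theorem exists_lattice_bound [Fintype S] [Nonempty S] (i₁ : Fin s) : ∃ C : ℝ, 0 ≤ C ∧
    ∀ T : ℝ, 1 ≤ T → ∀ i, (∑' m : Fin s → ℕ, Set.indicator {m : Fin s → ℕ | (fun j => (m j : ℝ)) ∈ A.region T}
      (fun m => ENNReal.ofReal (Real.exp ((A.w ⬝ᵥ fun j => (m j : ℝ)) - m i / 2))) m) ≤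
      ENNReal.ofReal (C * (Real.exp T * T ^ (A.rk - 1) / T)) := by
  classical
  obtain ⟨C, hC, h⟩ := A.exists_layer_bound i₁
  set b := A.rk - 1
  let c₀ : ℝ := ∑ σ, ∑ i, A.α σ i
  have hc₀ : 0 ≤ c₀ := Finset.sum_nonneg fun σ _ => Finset.sum_nonneg fun i _ => A.α_nonneg σ i
  have hc₀' : ∀ σ, ∑ i, A.α σ i ≤ c₀ := fun σ =>
    Finset.single_le_sum (f := fun σ => ∑ i, A.α σ i)
      (fun σ _ => Finset.sum_nonneg fun i _ => A.α_nonneg σ i) (Finset.mem_univ σ)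
  let cube : (Fin s → ℕ) → Set (Fin s → ℝ) := fun m => Set.univ.pi fun j => Set.Ico (m j : ℝ) (m j + 1)
  have hcube_m : ∀ m, MeasurableSet (cube m) := fun m =>
    MeasurableSet.univ_pi fun j => measurableSet_Ico
  have hcube_d : Pairwise (Function.onFun Disjoint cube) := by
    intro m m' hmm
    obtain ⟨j, hj⟩ := Function.ne_iff.1 hmm
    refine Set.disjoint_left.2 fun u hu hu' => hj ?_
    have h1 := hu j (Set.mem_univ j)
    have h2 := hu' j (Set.mem_univ j)
    have h3 : (m j : ℝ) < m' j + 1 := h1.1.trans_lt h2.2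
    have h4 : (m' j : ℝ) < m j + 1 := h2.1.trans_lt h1.2
    have h5 : m j < m' j + 1 := by exact_mod_cast h3
    have h6 : m' j < m j + 1 := by exact_mod_cast h4
    omega
  -- Since `w j ≥ 1`, one has `e^{w j} - 1 ≥ 1`, so the unit cube at `m` has at least the mass `e^{w
  -- · m}`.
  have hcube_v : ∀ m : Fin s → ℕ,
      ENNReal.ofReal (Real.exp (A.w ⬝ᵥ fun j => (m j : ℝ))) ≤ A.expPi (cube m) := by
    intro m
    have h1 : A.expPi (cube m) = ∏ j, expMeasure (A.w j) (Set.Ico (m j : ℝ) (m j + 1)) :=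
      Measure.pi_pi _ _
    rw [h1]
    have h2 : ENNReal.ofReal (Real.exp (A.w ⬝ᵥ fun j => (m j : ℝ))) =
        ∏ j, ENNReal.ofReal (Real.exp (A.w j * m j)) := by
      rw [← ENNReal.ofReal_prod_of_nonneg fun i _ => Real.exp_nonneg _, ← Real.exp_sum]
      rfl
    rw [h2]
    refine Finset.prod_le_prod' fun j _ => ?_
    have h3 : expMeasure (A.w j) (Set.Ico (m j : ℝ) (m j + 1)) =
        expMeasure (A.w j) (Set.Icc (m j : ℝ) (m j + 1)) :=
      measure_congr ((withDensity_absolutelyContinuous _ _).ae_le Ico_ae_eq_Icc)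
    rw [h3, expMeasure_Icc (A.w_pos j) (by linarith)]
    refine ENNReal.ofReal_le_ofReal ?_
    have h4 : (1 : ℝ) ≤ A.w j := by
      have := A.ϖ_pos j
      simp only [w]
      exact_mod_cast this
    have h5 : 2 ≤ Real.exp (A.w j) := by
      have := Real.add_one_le_exp (A.w j)
      linarith
    rw [mul_add, mul_one, Real.exp_add]
    nlinarith [Real.exp_pos (A.w j * m j)]
  have hcube_r : ∀ T, ∀ m : Fin s → ℕ, (fun j => (m j : ℝ)) ∈ A.region T → ∀ i,
      cube m ⊆ A.region (T + c₀) ∩ {u | u i ≤ m i + 1} := by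
    intro T m hm i u hu
    refine ⟨⟨fun σ => ?_, fun j => ?_⟩, (hu i (Set.mem_univ i)).2.le⟩
    · calc A.α σ ⬝ᵥ u ≤ A.α σ ⬝ᵥ fun j => ((m j : ℝ) + 1) :=
            Finset.sum_le_sum fun j _ =>
              mul_le_mul_of_nonneg_left (hu j (Set.mem_univ j)).2.le (A.α_nonneg σ j)
        _ = A.α σ ⬝ᵥ (fun j => (m j : ℝ)) + ∑ j, A.α σ j := by
            simp [dotProduct, mul_add, Finset.sum_add_distrib]
        _ ≤ T + c₀ := add_le_add (hm.1 σ) (hc₀' σ)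
    · exact (Nat.cast_nonneg _).trans (hu j (Set.mem_univ j)).1
  have hsum : Summable fun k : ℕ => Real.exp (-(k / 2)) * (2 + k) := by
    have hr : ‖Real.exp (-(1 / 2 : ℝ))‖ < 1 := by
      rw [Real.norm_eq_abs, abs_of_pos (Real.exp_pos _), Real.exp_lt_one_iff]; norm_num
    have h1 := summable_geometric_of_norm_lt_one hr
    have h2 := summable_pow_mul_geometric_of_norm_lt_one 1 hr
    refine ((h1.mul_left 2).add h2).congr fun k => ?_
    have : Real.exp (-((k : ℝ) / 2)) = Real.exp (-(1 / 2 : ℝ)) ^ k := by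
      rw [← Real.exp_nat_mul]; congr 1; ring
    rw [this]; ring
  set Z := ∑' k : ℕ, Real.exp (-((k : ℝ) / 2)) * (2 + k) with hZ
  have hZ0 : 0 ≤ Z := tsum_nonneg fun k => by positivity
  refine ⟨Z * (C * (Real.exp c₀ * (1 + c₀) ^ b)), by positivity, fun T hT i => ?_⟩
  have hT0 : 0 < T := by linarith
  set E := Real.exp T * T ^ b / T
  have hE : Real.exp (T + c₀) * (T + c₀) ^ b / (T + c₀) ≤ Real.exp c₀ * (1 + c₀) ^ b * E := by
    have h1 : T + c₀ ≤ (1 + c₀) * T := by nlinarith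
    calc Real.exp (T + c₀) * (T + c₀) ^ b / (T + c₀)
        ≤ Real.exp (T + c₀) * ((1 + c₀) * T) ^ b / T := by gcongr; linarith
      _ = _ := by rw [Real.exp_add, mul_pow]; ring
  -- The points with `m i = k` are grouped. Their cubes lie in the layer `u i ≤ k + 1` of `region (T
  -- + c₀)`, whose mass is `O((2 + k) * E)`, and the weight `e^{-k/2}` makes the sum over `k`
  -- converge.
  have hterm : ∀ m : Fin s → ℕ, Set.indicator {m : Fin s → ℕ | (fun j => (m j : ℝ)) ∈ A.region T}
      (fun m => ENNReal.ofReal (Real.exp ((A.w ⬝ᵥ fun j => (m j : ℝ)) - m i / 2))) m =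
      ∑' k : ℕ, if m i = k then Set.indicator {m : Fin s → ℕ | (fun j => (m j : ℝ)) ∈ A.region T}
      (fun m => ENNReal.ofReal (Real.exp ((A.w ⬝ᵥ fun j => (m j : ℝ)) - m i / 2))) m else 0 := by
    intro m
    rw [tsum_eq_single (m i) (fun k hk => if_neg hk.symm), if_pos rfl]
  rw [tsum_congr hterm, ENNReal.tsum_comm]
  have hk : ∀ k : ℕ, (∑' m : Fin s → ℕ, if m i = k then
      Set.indicator {m : Fin s → ℕ | (fun j => (m j : ℝ)) ∈ A.region T}
      (fun m => ENNReal.ofReal (Real.exp ((A.w ⬝ᵥ fun j => (m j : ℝ)) - m i / 2))) m else 0) ≤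
      ENNReal.ofReal (Real.exp (-((k : ℝ) / 2)) * (2 + k)) *
        ENNReal.ofReal (C * (Real.exp c₀ * (1 + c₀) ^ b) * E) := by
    intro k
    let I : Set (Fin s → ℕ) := {m | m i = k ∧ (fun j => (m j : ℝ)) ∈ A.region T}
    have h1 : ∀ m : Fin s → ℕ, (if m i = k then
        Set.indicator {m : Fin s → ℕ | (fun j => (m j : ℝ)) ∈ A.region T}
        (fun m => ENNReal.ofReal (Real.exp ((A.w ⬝ᵥ fun j => (m j : ℝ)) - m i / 2))) m else 0) ≤
        ENNReal.ofReal (Real.exp (-((k : ℝ) / 2))) * I.indicator (fun m => A.expPi (cube m)) m := by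
      intro m
      by_cases hm1 : m i = k
      · by_cases hm2 : (fun j => (m j : ℝ)) ∈ A.region T
        · rw [if_pos hm1, Set.indicator_of_mem (show m ∈ _ from hm2),
            Set.indicator_of_mem (show m ∈ I from ⟨hm1, hm2⟩), sub_eq_add_neg, add_comm, Real.exp_add,
            ENNReal.ofReal_mul (Real.exp_nonneg _), hm1]
          exact mul_le_mul_right (hcube_v m) _
        · rw [if_pos hm1, Set.indicator_of_notMem (show m ∉ _ from hm2)]
          exact zero_le
      · rw [if_neg hm1]; exact zero_le
    refine (ENNReal.tsum_le_tsum h1).trans ?_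
    rw [ENNReal.tsum_mul_left, ENNReal.ofReal_mul (Real.exp_nonneg _), mul_assoc]
    refine mul_le_mul_right ?_ _
    have h2 : ∑' m, I.indicator (fun m => A.expPi (cube m)) m ≤
        A.expPi (A.region (T + c₀) ∩ {u | u i ≤ k + 1}) := by
      rw [← tsum_subtype I fun m => A.expPi (cube m), ← measure_iUnion (f := fun m : I => cube m)
        (fun m m' hmm => hcube_d (fun e => hmm (Subtype.ext e))) fun m => hcube_m m]
      refine measure_mono (Set.iUnion_subset fun m => ?_)
      have := hcube_r T m.1 m.2.2 i
      rwa [m.2.1] at this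
    refine h2.trans ?_
    have h3 := h (T + c₀) (by linarith) (k + 1) (by positivity) i
    have hfin : A.expPi (A.region (T + c₀) ∩ {u | u i ≤ k + 1}) ≠ ⊤ :=
      (measure_mono Set.inter_subset_left |>.trans_lt (A.expPi_region_ne_top _).lt_top).ne
    rw [← ENNReal.ofReal_toReal hfin, ← ENNReal.ofReal_mul (by positivity)]
    refine ENNReal.ofReal_le_ofReal (h3.trans ?_)
    calc C * (1 + (k + 1)) * (Real.exp (T + c₀) * (T + c₀) ^ b / (T + c₀))
        ≤ C * (1 + (k + 1)) * (Real.exp c₀ * (1 + c₀) ^ b * E) := by gcongr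
      _ = _ := by ring
  refine (ENNReal.tsum_le_tsum hk).trans ?_
  rw [ENNReal.tsum_mul_right, ← ENNReal.ofReal_tsum_of_nonneg (fun k => by positivity) hsum,
    ← ENNReal.ofReal_mul hZ0]
  exact ENNReal.ofReal_le_ofReal (le_of_eq (by ring))

end RegionData

/-! ### Replacing the factors of a product measure one at a time -/

/-- Insert a value at the coordinate `i₀`. -/
def glueAt {s : ℕ} {X : Type} (i₀ : Fin s) (v : {i // i ≠ i₀} → X) (t : X) : Fin s → X :=
  fun i => if h : i ≠ i₀ then v ⟨i, h⟩ else t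

theorem glueAt_same {s : ℕ} {X : Type} (i₀ : Fin s) (v : {i // i ≠ i₀} → X) (t : X) :
    glueAt i₀ v t i₀ = t := by simp [glueAt]

theorem glueAt_ne {s : ℕ} {X : Type} (i₀ : Fin s) (v : {i // i ≠ i₀} → X) (t : X)
    (i : {i // i ≠ i₀}) : glueAt i₀ v t i = v i := by simp [glueAt, i.2]

theorem forall_iff_subtype_ne {s : ℕ} (i₀ : Fin s) {p : Fin s → Prop} :
    (∀ i, p i) ↔ (∀ i : {i // i ≠ i₀}, p i) ∧ p i₀ := by
  constructor
  · exact fun h => ⟨fun i => h i, h i₀⟩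
  · rintro ⟨h1, h2⟩ i
    by_cases h : i = i₀
    · exact h ▸ h2
    · exact h1 ⟨i, h⟩

theorem prod_eq_prod_subtype_ne_mul {s : ℕ} {M : Type} [CommMonoid M] (i₀ : Fin s) (f : Fin s → M) :
    ∏ i, f i = (∏ i : {i // i ≠ i₀}, f i) * f i₀ := by
  have h := Fintype.prod_subtype_mul_prod_subtype (· ≠ i₀) f
  rw [← h]
  congr 1
  have U : Unique {i // ¬ i ≠ i₀} := ⟨⟨⟨i₀, by simp⟩⟩, fun i => Subtype.ext (not_not.1 i.2)⟩
  rw [Fintype.prod_unique, not_not.1 (default : {i // ¬ i ≠ i₀}).2]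

theorem sum_eq_sum_subtype_ne_add {s : ℕ} (i₀ : Fin s) (f : Fin s → ℝ) :
    ∑ i, f i = (∑ i : {i // i ≠ i₀}, f i) + f i₀ := by
  have h := Fintype.sum_subtype_add_sum_subtype (· ≠ i₀) f
  rw [← h]
  congr 1
  have U : Unique {i // ¬ i ≠ i₀} := ⟨⟨⟨i₀, by simp⟩⟩, fun i => Subtype.ext (not_not.1 i.2)⟩
  rw [Fintype.sum_unique, not_not.1 (default : {i // ¬ i ≠ i₀}).2]

theorem pi_apply_eq_lintegral_glueAt {s : ℕ} (μ : Fin s → Measure ℝ) [∀ i, SigmaFinite (μ i)]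
    (i₀ : Fin s) {R : Set (Fin s → ℝ)} (hR : MeasurableSet R) :
    Measure.pi μ R = ∫⁻ v, μ i₀ {t | glueAt i₀ v t ∈ R}
      ∂(Measure.pi fun i : {i // i ≠ i₀} => μ i) := by
  classical
  have hgm : Measurable fun p : ({i // i ≠ i₀} → ℝ) × ℝ => glueAt i₀ p.1 p.2 := by
    refine measurable_pi_lambda _ fun i => ?_
    by_cases h : i ≠ i₀
    · simp only [glueAt, h, not_false_iff, dif_pos, ne_eq]
      exact (measurable_pi_apply _).comp measurable_fst
    · simp only [glueAt, h, dif_neg, not_false_iff]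
      exact measurable_snd
  have hpi : Measure.pi μ = ((Measure.pi fun i : {i // i ≠ i₀} => μ i).prod (μ i₀)).map
      fun p => glueAt i₀ p.1 p.2 := by
    refine (Measure.pi_eq fun X hX => ?_)
    rw [Measure.map_apply hgm (MeasurableSet.univ_pi hX)]
    have : (fun p : ({i // i ≠ i₀} → ℝ) × ℝ => glueAt i₀ p.1 p.2) ⁻¹' (Set.univ.pi X) =
        (Set.univ.pi fun i : {i // i ≠ i₀} => X i) ×ˢ X i₀ := by
      ext p
      simp only [Set.mem_preimage, Set.mem_univ_pi, Set.mem_prod]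
      rw [forall_iff_subtype_ne i₀]
      simp [glueAt_ne, glueAt_same]
    rw [this, Measure.prod_prod, Measure.pi_pi, prod_eq_prod_subtype_ne_mul i₀]
  rw [hpi, Measure.map_apply hgm hR, Measure.prod_apply (hgm hR)]
  rfl

namespace RegionData

variable {s : ℕ} {S : Type} (A : RegionData s S)

theorem region_mono_of_le {T : ℝ} {u v : Fin s → ℝ} (hu : u ∈ A.region T) (hv : ∀ i, 0 ≤ v i)
    (h : ∀ i, v i ≤ u i) : v ∈ A.region T :=
  ⟨fun σ => (Finset.sum_le_sum fun i _ =>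
    mul_le_mul_of_nonneg_left (h i) (A.α_nonneg σ i)).trans (hu.1 σ), hv⟩

/-- As `α` is nonnegative, the polytope is downward closed in the orthant. The sections are
therefore initial segments, the only sets on which the one-dimensional measures have to be compared.
-/
theorem section_eq [Nonempty S] (T : ℝ) (i₀ : Fin s) (v : {i // i ≠ i₀} → ℝ) :
    {t | glueAt i₀ v t ∈ A.region T} = ∅ ∨
      ∃ U : ℝ, 0 ≤ U ∧ {t | glueAt i₀ v t ∈ A.region T} = Set.Icc 0 U := by
  rcases Set.eq_empty_or_nonempty {t | glueAt i₀ v t ∈ A.region T} with h | h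
  · exact Or.inl h
  refine Or.inr ⟨sSup {t | glueAt i₀ v t ∈ A.region T}, ?_⟩
  have hcont : Continuous fun t : ℝ => glueAt i₀ v t := by
    refine continuous_pi fun i => ?_
    by_cases hi : i ≠ i₀
    · simp only [glueAt, hi, not_false_iff, dif_pos, ne_eq]; exact continuous_const
    · simp only [glueAt, hi, dif_neg, not_false_iff]; exact continuous_id
  have hclosed : IsClosed {t | glueAt i₀ v t ∈ A.region T} := (A.isClosed_region T).preimage hcont
  have hbdd : BddAbove {t | glueAt i₀ v t ∈ A.region T} := by
    refine ⟨T / A.w i₀, fun t ht => ?_⟩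
    have := (A.region_subset_Icc T ht).2 i₀
    simpa [glueAt_same] using this
  have hpos : ∀ t ∈ {t | glueAt i₀ v t ∈ A.region T}, 0 ≤ t := fun t ht => by
    have := (show glueAt i₀ v t ∈ A.region T from ht).2 i₀
    rwa [glueAt_same] at this
  have hmem := hclosed.csSup_mem h hbdd
  refine ⟨hpos _ hmem, Set.Subset.antisymm (fun t ht => ⟨hpos t ht, le_csSup hbdd ht⟩) ?_⟩
  rintro t ⟨ht0, ht1⟩
  have hmem' : glueAt i₀ v _ ∈ A.region T := hmem
  refine A.region_mono_of_le hmem' ((forall_iff_subtype_ne i₀).2 ⟨fun i => ?_, ?_⟩)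
    ((forall_iff_subtype_ne i₀).2 ⟨fun i => ?_, ?_⟩)
  · have := hmem'.2 i
    rwa [glueAt_ne] at this ⊢
  · rwa [glueAt_same]
  · rw [glueAt_ne, glueAt_ne]
  · rwa [glueAt_same, glueAt_same]

/-- Change one factor of a product measure. -/
theorem pi_region_le [Fintype S] [Nonempty S] (T : ℝ) (i₀ : Fin s) (μ ν : Fin s → Measure ℝ)
    [∀ i, SigmaFinite (μ i)] [∀ i, SigmaFinite (ν i)] (hμν : ∀ j, j ≠ i₀ → μ j = ν j)
    (K : Fin s → ℝ) (hK0 : ∀ j, 0 ≤ K j)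
    (hK : ∀ j, j ≠ i₀ → ∀ m : ℕ, μ j (Set.Ico m (m + 1)) ≤ ENNReal.ofReal (K j * Real.exp (A.w j * m)))
    (E : ℝ) (hE0 : 0 ≤ E) (hE : ∀ U, 0 ≤ U →
      μ i₀ (Set.Icc 0 U) ≤ ν i₀ (Set.Icc 0 U) + ENNReal.ofReal (E * Real.exp ((A.w i₀ - 1 / 2) * U))) :
    Measure.pi μ (A.region T) ≤ Measure.pi ν (A.region T) +
      ENNReal.ofReal (E * Real.exp (A.w i₀) * ∏ j : {j // j ≠ i₀}, K j) *
      ∑' m : Fin s → ℕ, Set.indicator {m : Fin s → ℕ | (fun j => (m j : ℝ)) ∈ A.region T}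
        (fun m => ENNReal.ofReal (Real.exp ((A.w ⬝ᵥ fun j => (m j : ℝ)) - m i₀ / 2))) m := by
  classical
  let ι := {j // j ≠ i₀}
  have hR := (A.isClosed_region T).measurableSet
  rw [pi_apply_eq_lintegral_glueAt μ i₀ hR, pi_apply_eq_lintegral_glueAt ν i₀ hR]
  have hpi : (Measure.pi fun i : ι => ν i) = Measure.pi fun i : ι => μ i := by
    congr 1; ext1 i; exact (hμν i i.2).symm
  rw [hpi]
  let cube : (ι → ℕ) → Set (ι → ℝ) := fun m => Set.univ.pi fun j => Set.Ico (m j : ℝ) (m j + 1)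
  have hcube : ∀ m, MeasurableSet (cube m) := fun m =>
    MeasurableSet.univ_pi fun j => measurableSet_Ico
  let G : (ι → ℕ) × ℕ → ENNReal := fun p =>
    if (glueAt i₀ (fun j => (p.1 j : ℝ)) (p.2 : ℝ)) ∈ A.region T then
      ENNReal.ofReal (E * Real.exp (A.w i₀) * Real.exp ((A.w i₀ - 1 / 2) * p.2)) else 0
  have hw : 1 ≤ A.w i₀ := by
    have := A.ϖ_pos i₀
    simp only [w]; exact_mod_cast this
  have hpt : ∀ v : ι → ℝ, μ i₀ {t | glueAt i₀ v t ∈ A.region T} ≤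
      ν i₀ {t | glueAt i₀ v t ∈ A.region T} +
        ∑' p : (ι → ℕ) × ℕ, (cube p.1).indicator (fun _ => G p) v := by
    intro v
    rcases A.section_eq T i₀ v with h | ⟨U, hU0, hU⟩
    · rw [h]; simp
    rw [hU]
    refine (hE U hU0).trans (add_le_add_right ?_ _)
    have hUmem : glueAt i₀ v U ∈ A.region T := by
      have : U ∈ {t | glueAt i₀ v t ∈ A.region T} := by rw [hU]; exact ⟨hU0, le_rfl⟩
      exact this
    have hv0 : ∀ j : ι, 0 ≤ v j := fun j => by
      have := hUmem.2 j
      rwa [glueAt_ne] at this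
    -- The error on the section is charged to the lattice point below its upper end, which still
    -- lies in the polytope because the polytope is downward closed.
    let p : (ι → ℕ) × ℕ := (fun j => ⌊v j⌋₊, ⌊U⌋₊)
    refine le_trans ?_ (ENNReal.le_tsum p)
    have hvc : v ∈ cube p.1 := fun j _ => ⟨Nat.floor_le (hv0 j), Nat.lt_floor_add_one _⟩
    rw [Set.indicator_of_mem hvc]
    have hp : (glueAt i₀ (fun j => (p.1 j : ℝ)) (p.2 : ℝ)) ∈ A.region T := by
      refine A.region_mono_of_le hUmem ((forall_iff_subtype_ne i₀).2 ⟨fun i => ?_, ?_⟩)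
        ((forall_iff_subtype_ne i₀).2 ⟨fun i => ?_, ?_⟩)
      · rw [glueAt_ne]; exact Nat.cast_nonneg _
      · rw [glueAt_same]; exact Nat.cast_nonneg _
      · rw [glueAt_ne, glueAt_ne]; exact Nat.floor_le (hv0 i)
      · rw [glueAt_same, glueAt_same]; exact Nat.floor_le hU0
    simp only [G, if_pos hp]
    refine ENNReal.ofReal_le_ofReal ?_
    rw [mul_assoc, ← Real.exp_add]
    gcongr
    have : U < ⌊U⌋₊ + 1 := Nat.lt_floor_add_one U
    have h2 : (p.2 : ℝ) = ⌊U⌋₊ := rfl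
    rw [h2]
    nlinarith
  refine (lintegral_mono hpt).trans ?_
  have hGm : ∀ p : (ι → ℕ) × ℕ, Measurable fun v => (cube p.1).indicator (fun _ => G p) v :=
    fun p => measurable_const.indicator (hcube p.1)
  rw [lintegral_add_right _ (Measurable.tsum hGm), lintegral_tsum fun p => (hGm p).aemeasurable]
  refine add_le_add_right ?_ _
  have hinj : Function.Injective fun p : (ι → ℕ) × ℕ => glueAt i₀ p.1 p.2 := by
    rintro ⟨m, k⟩ ⟨m', k'⟩ h
    have h1 := congrFun h i₀
    simp only [glueAt_same] at h1
    have h2 : m = m' := by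
      ext j
      have := congrFun h j
      simpa only [glueAt_ne] using this
    rw [h1, h2]
  rw [← ENNReal.tsum_mul_left]
  refine le_trans (ENNReal.tsum_le_tsum fun p => ?_) (ENNReal.tsum_comp_le_tsum_of_injective hinj _)
  rw [lintegral_indicator_const (hcube p.1)]
  have hcast : (fun j => ((glueAt i₀ p.1 p.2 j : ℕ) : ℝ)) =
      glueAt i₀ (fun j => (p.1 j : ℝ)) (p.2 : ℝ) := by
    ext j; unfold glueAt; split_ifs <;> rfl
  by_cases hp : (glueAt i₀ (fun j => (p.1 j : ℝ)) (p.2 : ℝ)) ∈ A.region T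
  · rw [Set.indicator_of_mem (show glueAt i₀ p.1 p.2 ∈ {m : Fin s → ℕ | _} by
      change (fun j => ((glueAt i₀ p.1 p.2 j : ℕ) : ℝ)) ∈ A.region T
      rw [hcast]; exact hp)]
    simp only [G, if_pos hp, hcast]
    have h1 : (Measure.pi fun i : ι => μ i) (cube p.1) ≤
        ENNReal.ofReal (∏ j : ι, (K j * Real.exp (A.w j * p.1 j))) := by
      rw [Measure.pi_pi, ENNReal.ofReal_prod_of_nonneg
        fun (j : ι) _ => mul_nonneg (hK0 j.1) (Real.exp_nonneg _)]
      exact Finset.prod_le_prod' fun j _ => hK j j.2 (p.1 j)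
    refine (mul_le_mul_right h1 _).trans ?_
    have hk0 : 0 ≤ ∏ j : ι, K j := Finset.prod_nonneg fun j _ => hK0 j
    rw [← ENNReal.ofReal_mul (by positivity), ← ENNReal.ofReal_mul (by positivity)]
    refine ENNReal.ofReal_le_ofReal (le_of_eq ?_)
    have h2 : A.w ⬝ᵥ glueAt i₀ (fun j => (p.1 j : ℝ)) (p.2 : ℝ) =
        ∑ j : ι, A.w j * p.1 j + A.w i₀ * p.2 := by
      refine (sum_eq_sum_subtype_ne_add i₀ _).trans ?_
      simp only [glueAt_ne, glueAt_same]
      rfl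
    have h3 : ((glueAt i₀ p.1 p.2 i₀ : ℕ) : ℝ) = p.2 := by rw [glueAt_same]
    rw [h2, h3, Finset.prod_mul_distrib, ← Real.exp_sum]
    have h4 : ∑ j : ι, A.w j * p.1 j + A.w i₀ * p.2 - p.2 / 2 =
        (A.w i₀ - 1 / 2) * p.2 + ∑ j : ι, A.w j * p.1 j := by ring
    rw [h4, Real.exp_add]
    ring
  · simp only [G, if_neg hp, zero_mul]
    exact zero_le

/-- Counting in the dilated polytope with respect to a product of measures that are close to
multiples of the exponential measures. -/
theorem exists_pi_region_bound [Fintype S] [Nonempty S] (i₁ : Fin s) : ∃ C : ℝ, 0 ≤ C ∧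
    ∀ (ν : Fin s → Measure ℝ) [∀ i, SigmaFinite (ν i)] (c E : Fin s → ℝ), (∀ i, 0 ≤ c i) →
      (∀ i, 0 ≤ E i) → (∀ i U, 0 ≤ U → ν i (Set.Icc 0 U) ≠ ⊤ ∧
        |(ν i).real (Set.Icc 0 U) - c i * (Real.exp (A.w i * U) - 1)| ≤
          E i * Real.exp ((A.w i - 1 / 2) * U)) →
      ∀ T : ℝ, 1 ≤ T → |(Measure.pi ν).real (A.region T) - (∏ i, c i) * A.mass T| ≤
        C * (∏ i, (c i + E i)) * (Real.exp T * T ^ (A.rk - 1) / T) := by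
  obtain ⟨C, hC, hlat⟩ := A.exists_lattice_bound i₁
  refine ⟨s * ((∏ i, Real.exp (A.w i)) * C), by positivity, fun ν _ c E hc hE h T hT => ?_⟩
  set H := Real.exp T * T ^ (A.rk - 1) / T with hH
  have hH0 : 0 ≤ H := by positivity
  let lam : Fin s → Measure ℝ := fun i => (c i).toNNReal • expMeasure (A.w i)
  have hlam : ∀ i U, 0 ≤ U → lam i (Set.Icc 0 U) =
      ENNReal.ofReal (c i * (Real.exp (A.w i * U) - 1)) := by
    intro i U hU
    simp only [lam]
    rw [Measure.smul_apply, expMeasure_Icc (A.w_pos i) hU, mul_zero, Real.exp_zero,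
      ENNReal.ofReal_mul (hc i)]
    rfl
  have hle : ∀ i U, 0 ≤ U → 0 ≤ c i * (Real.exp (A.w i * U) - 1) := fun i U hU =>
    mul_nonneg (hc i) (sub_nonneg.2 (Real.one_le_exp (mul_nonneg (A.w_pos i).le hU)))
  have hνeq : ∀ i U, 0 ≤ U → ν i (Set.Icc 0 U) = ENNReal.ofReal ((ν i).real (Set.Icc 0 U)) :=
    fun i U hU => (ENNReal.ofReal_toReal (h i U hU).1).symm
  have h1 : ∀ i U, 0 ≤ U → ν i (Set.Icc 0 U) ≤ lam i (Set.Icc 0 U) +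
      ENNReal.ofReal (E i * Real.exp ((A.w i - 1 / 2) * U)) := by
    intro i U hU
    rw [hνeq i U hU, hlam i U hU, ← ENNReal.ofReal_add (hle i U hU)
      (mul_nonneg (hE i) (Real.exp_nonneg _))]
    exact ENNReal.ofReal_le_ofReal (by linarith [(abs_le.1 (h i U hU).2).2])
  have h2 : ∀ i U, 0 ≤ U → lam i (Set.Icc 0 U) ≤ ν i (Set.Icc 0 U) +
      ENNReal.ofReal (E i * Real.exp ((A.w i - 1 / 2) * U)) := by
    intro i U hU
    rw [hνeq i U hU, hlam i U hU, ← ENNReal.ofReal_add measureReal_nonneg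
      (mul_nonneg (hE i) (Real.exp_nonneg _))]
    exact ENNReal.ofReal_le_ofReal (by linarith [(abs_le.1 (h i U hU).2).1])
  let K : Fin s → ℝ := fun i => (c i + E i) * Real.exp (A.w i)
  have hK0 : ∀ i, 0 ≤ K i := fun i => mul_nonneg (add_nonneg (hc i) (hE i)) (Real.exp_nonneg _)
  have hKlam : ∀ i (m : ℕ), lam i (Set.Ico m (m + 1)) ≤
      ENNReal.ofReal (K i * Real.exp (A.w i * m)) := by
    intro i m
    refine (measure_mono (t := Set.Icc 0 ((m : ℝ) + 1)) fun x hx =>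
      ⟨(Nat.cast_nonneg m).trans hx.1, hx.2.le⟩).trans ?_
    rw [hlam i _ (by positivity)]
    refine ENNReal.ofReal_le_ofReal ?_
    have h3 : Real.exp (A.w i * (m + 1)) = Real.exp (A.w i) * Real.exp (A.w i * m) := by
      rw [← Real.exp_add]; congr 1; ring
    have h4 : 0 ≤ E i * (Real.exp (A.w i) * Real.exp (A.w i * m)) :=
      mul_nonneg (hE i) (by positivity)
    have h5 := hc i
    simp only [K]
    rw [h3]
    nlinarith
  have hKν : ∀ i (m : ℕ), ν i (Set.Ico m (m + 1)) ≤
      ENNReal.ofReal (K i * Real.exp (A.w i * m)) := by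
    intro i m
    refine (measure_mono (t := Set.Icc 0 ((m : ℝ) + 1)) fun x hx =>
      ⟨(Nat.cast_nonneg m).trans hx.1, hx.2.le⟩).trans ?_
    rw [hνeq i _ (by positivity)]
    refine ENNReal.ofReal_le_ofReal ?_
    have h3 : Real.exp (A.w i * (m + 1)) = Real.exp (A.w i) * Real.exp (A.w i * m) := by
      rw [← Real.exp_add]; congr 1; ring
    have h4 : Real.exp ((A.w i - 1 / 2) * (m + 1)) ≤ Real.exp (A.w i * (m + 1)) := by
      refine Real.exp_le_exp.2 ?_
      have : (0 : ℝ) ≤ m := Nat.cast_nonneg m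
      nlinarith
    have h5 := (abs_le.1 (h i (m + 1) (by positivity)).2).2
    have h6 : E i * Real.exp ((A.w i - 1 / 2) * (m + 1)) ≤ E i * Real.exp (A.w i * (m + 1)) :=
      mul_le_mul_of_nonneg_left h4 (hE i)
    have h7 := hc i
    simp only [K]
    calc (ν i).real (Set.Icc 0 ((m : ℝ) + 1)) ≤ (c i + E i) * Real.exp (A.w i * (m + 1)) := by
          nlinarith
      _ = _ := by rw [h3]; ring
  -- the hybrid measures
  let hyb : ℕ → Fin s → Measure ℝ := fun k i => if i.val < k then lam i else ν i
  have hsig : ∀ k i, SigmaFinite (hyb k i) := by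
    intro k i
    simp only [hyb]
    split_ifs
    · simp only [lam]; infer_instance
    · infer_instance
  have hfin : ∀ k, Measure.pi (hyb k) (A.region T) ≠ ⊤ := by
    intro k
    refine ((measure_mono (A.region_subset_Icc T)).trans_lt ?_).ne
    rw [← Set.pi_univ_Icc, Measure.pi_pi]
    refine ENNReal.prod_lt_top fun i _ => ?_
    have hU : 0 ≤ T / A.w i := div_nonneg (by linarith) (A.w_pos i).le
    simp only [hyb]
    split_ifs
    · exact (hlam i _ hU).trans_lt ENNReal.ofReal_lt_top
    · exact (h i _ hU).1.lt_top
  have hprodK : ∀ i₀ : Fin s, E i₀ * Real.exp (A.w i₀) * ∏ j : {j // j ≠ i₀}, K j ≤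
      (∏ i, Real.exp (A.w i)) * ∏ i, (c i + E i) := by
    intro i₀
    rw [← Finset.prod_mul_distrib, prod_eq_prod_subtype_ne_mul i₀, mul_comm]
    have e : ∀ j : {j // j ≠ i₀}, K j = Real.exp (A.w j) * (c j + E j) := fun j => mul_comm _ _
    simp only [e]
    refine mul_le_mul_of_nonneg_left ?_ (Finset.prod_nonneg fun j _ =>
      mul_nonneg (Real.exp_nonneg _) (add_nonneg (hc _) (hE _)))
    have := mul_nonneg (hc i₀) (Real.exp_nonneg (A.w i₀))
    nlinarith
  have hP0 : 0 ≤ ∏ i, (c i + E i) := Finset.prod_nonneg fun i _ => add_nonneg (hc i) (hE i)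
  set D := (∏ i, Real.exp (A.w i)) * (∏ i, (c i + E i)) * (C * H) with hD
  have hD0 : 0 ≤ D := by positivity
  -- Consecutive hybrid measures differ in the factor `k` only; `pi_region_le` is applied in both
  -- directions, and `exists_lattice_bound` bounds the cost.
  have hstep : ∀ k, k < s → |(Measure.pi (hyb k)).real (A.region T) -
      (Measure.pi (hyb (k + 1))).real (A.region T)| ≤ D := by
    intro k hk
    let i₀ : Fin s := ⟨k, hk⟩
    have hne : ∀ j, j ≠ i₀ → hyb k j = hyb (k + 1) j := by
      intro j hj
      have hj' : j.val ≠ k := fun e => hj (Fin.ext e)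
      have : j.val < k ↔ j.val < k + 1 := by omega
      simp only [hyb, this]
    have hk1 : hyb k i₀ = ν i₀ := by simp [hyb, i₀]
    have hk2 : hyb (k + 1) i₀ = lam i₀ := by simp [hyb, i₀]
    have hKh : ∀ k' j, ∀ m : ℕ, hyb k' j (Set.Ico m (m + 1)) ≤
        ENNReal.ofReal (K j * Real.exp (A.w j * m)) := by
      intro k' j m
      simp only [hyb]
      split_ifs
      · exact hKlam j m
      · exact hKν j m
    have hbound : ∀ k₁ k₂, (∀ j, j ≠ i₀ → hyb k₁ j = hyb k₂ j) →
        (∀ U, 0 ≤ U → hyb k₁ i₀ (Set.Icc 0 U) ≤ hyb k₂ i₀ (Set.Icc 0 U) +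
          ENNReal.ofReal (E i₀ * Real.exp ((A.w i₀ - 1 / 2) * U))) →
        (Measure.pi (hyb k₁)).real (A.region T) ≤ (Measure.pi (hyb k₂)).real (A.region T) + D := by
      intro k₁ k₂ hj hi
      have h3 := A.pi_region_le T i₀ (hyb k₁) (hyb k₂) hj K hK0 (fun j _ m => hKh k₁ j m) (E i₀)
        (hE i₀) hi
      have h4 := h3.trans (add_le_add_right (mul_le_mul_right (hlat T hT i₀) _) _)
      rw [← ENNReal.ofReal_mul (mul_nonneg (mul_nonneg (hE _) (Real.exp_nonneg _))
        (Finset.prod_nonneg fun (j : {j // j ≠ i₀}) _ => hK0 j.1))] at h4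
      have h5 := h4.trans (add_le_add_right (ENNReal.ofReal_le_ofReal
        (mul_le_mul_of_nonneg_right (hprodK i₀) (mul_nonneg hC hH0))) _)
      have h6 := ENNReal.toReal_mono (by finiteness [hfin k₂]) h5
      rwa [ENNReal.toReal_add (hfin k₂) ENNReal.ofReal_ne_top, ENNReal.toReal_ofReal hD0] at h6
    rw [abs_le]
    constructor
    · have := hbound (k + 1) k (fun j hj => (hne j hj).symm) (by rw [hk1, hk2]; exact h2 i₀)
      linarith
    · have := hbound k (k + 1) hne (by rw [hk1, hk2]; exact h1 i₀)
      linarith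
  have htel : |(Measure.pi (hyb 0)).real (A.region T) - (Measure.pi (hyb s)).real (A.region T)| ≤
      s * D := by
    have := dist_le_range_sum_of_dist_le (f := fun k => (Measure.pi (hyb k)).real (A.region T))
      (d := fun _ => D) s (fun {k} hk => by rw [Real.dist_eq]; exact hstep k hk)
    rw [Real.dist_eq] at this
    simpa using this
  have hh0 : hyb 0 = ν := by ext1 i; simp [hyb]
  have hhs : hyb s = lam := by ext1 i; simp [hyb]
  have hmass : (Measure.pi lam).real (A.region T) = (∏ i, c i) * A.mass T := by
    have : Measure.pi lam = (∏ i, (c i).toNNReal) • A.expPi := by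
      have := fun i => (hhs ▸ hsig s i : SigmaFinite (lam i))
      refine Measure.pi_eq fun X hX => ?_
      rw [Measure.smul_apply, expPi, Measure.pi_pi]
      simp only [lam, Measure.smul_apply, ENNReal.smul_def, smul_eq_mul, ENNReal.ofNNReal_finsetProd]
      rw [Finset.prod_mul_distrib]
    rw [this, measureReal_def, Measure.smul_apply, ENNReal.smul_def, smul_eq_mul, ENNReal.toReal_mul,
      mass, measureReal_def]
    congr 1
    simp [hc]
  rw [hh0, hhs, hmass] at htel
  refine htel.trans (le_of_eq ?_)
  rw [hD]; ring

end RegionData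

/-! ### Counting integral points in rational subspaces -/

section SolLattice

variable {m t : ℕ} (c : Fin t → Fin m → ℚ)

instance : (solMeasure c).IsAddHaarMeasure := by
  unfold solMeasure; infer_instance

/-- The integral solutions of the linear equations. -/
def intSol : Set (Fin m → ℤ) := {x | ∀ l, ∑ j, c l j * (x j : ℚ) = 0}

/-- An integral solution as a lattice vector. -/
noncomputable def intSol.toLattice (x : intSol c) : solLattice c :=
  ⟨⟨WithLp.toLp 2 fun j => (x.1 j : ℝ), fun l => by
    have := x.2 l
    have h2 : ((∑ j, c l j * (x.1 j : ℚ) : ℚ) : ℝ) = 0 := by rw [this]; simp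
    push_cast at h2
    simpa using h2⟩, fun j => ⟨x.1 j, rfl⟩⟩

theorem intSol.toLattice_apply (x : intSol c) (j : Fin m) :
    ((intSol.toLattice c x : solSpace c) : EuclideanSpace ℝ (Fin m)) j = x.1 j := rfl

theorem intSol.toLattice_bijective : Function.Bijective (intSol.toLattice c) := by
  constructor
  · intro x y h
    refine Subtype.ext (funext fun j => ?_)
    have := congrArg (fun w : solLattice c => ((w : solSpace c) : EuclideanSpace ℝ (Fin m)) j) h
    simp only [intSol.toLattice_apply] at this
    exact_mod_cast this
  · intro w
    choose z hz using w.2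
    refine ⟨⟨z, fun l => ?_⟩, ?_⟩
    · have := w.1.2 l
      simp only [hz] at this
      exact_mod_cast this
    · refine Subtype.ext (Subtype.ext ?_)
      ext j
      exact (hz j).symm

instance : DiscreteTopology (solLattice c) := by
  refine DiscreteTopology.of_forall_le_dist zero_lt_one fun v w hvw => ?_
  obtain ⟨x, rfl⟩ := (intSol.toLattice_bijective c).2 v
  obtain ⟨y, rfl⟩ := (intSol.toLattice_bijective c).2 w
  have hxy : x.1 ≠ y.1 := fun h => hvw (congrArg _ (Subtype.ext h))
  obtain ⟨j, hj⟩ := Function.ne_iff.1 hxy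
  have h1 : (1 : ℝ) ≤ |(x.1 j : ℝ) - y.1 j| := by
    have : (1 : ℤ) ≤ |x.1 j - y.1 j| := Int.one_le_abs (sub_ne_zero.2 hj)
    exact_mod_cast this
  refine h1.trans ?_
  have h2 := PiLp.norm_apply_le ((intSol.toLattice c x : solSpace c) -
    (intSol.toLattice c y : solSpace c) : EuclideanSpace ℝ (Fin m)) j
  rw [dist_eq_norm]
  exact h2

/-- The coordinates of a real solution span a finite-dimensional `ℚ`-space. Expanding them in a
`ℚ`-basis `β` of it writes the solution as a real combination of rational ones, since the
coefficients of the equations are rational. Clearing denominators makes those integral. -/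
theorem span_solLattice : Submodule.span ℝ (solLattice c : Set (solSpace c)) = ⊤ := by
  rw [eq_top_iff]
  rintro w -
  let V : Submodule ℚ ℝ := Submodule.span ℚ (Set.range fun j => (w : EuclideanSpace ℝ (Fin m)) j)
  have : FiniteDimensional ℚ V := FiniteDimensional.span_of_finite ℚ (Set.finite_range _)
  let β := Module.finBasis ℚ V
  let wV : Fin m → V := fun j => ⟨(w : EuclideanSpace ℝ (Fin m)) j, Submodule.subset_span ⟨j, rfl⟩⟩
  let q : Fin (Module.finrank ℚ V) → Fin m → ℚ := fun k j => β.repr (wV j) k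
  have hw : ∀ j, (w : EuclideanSpace ℝ (Fin m)) j = ∑ k, (β k : ℝ) * q k j := by
    intro j
    have h := congrArg (Subtype.val) (β.sum_repr (wV j))
    simp only [Submodule.coe_sum, Submodule.coe_smul] at h
    refine h.symm.trans (Finset.sum_congr rfl fun k _ => ?_)
    rw [Rat.smul_def, mul_comm]
  have hq : ∀ k l, ∑ j, c l j * q k j = 0 := by
    intro k l
    have h1 : ∑ j, c l j • wV j = 0 := by
      refine Subtype.ext ?_
      have := w.2 l
      simpa [Rat.smul_def, wV] using this
    have h2 := congrArg (fun v => β.repr v k) h1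
    simpa [q] using h2
  -- multiples of rational solutions are lattice vectors
  let vq : Fin (Module.finrank ℚ V) → solSpace c := fun k =>
    ⟨WithLp.toLp 2 fun j => (q k j : ℝ), fun l => by
      have h2 : ((∑ j, c l j * q k j : ℚ) : ℝ) = 0 := by rw [hq k l]; simp
      push_cast at h2
      simpa using h2⟩
  have hvq : ∀ k, vq k ∈ Submodule.span ℝ (solLattice c : Set (solSpace c)) := by
    intro k
    let N : ℕ := ∏ j, (q k j).den
    have hN : (N : ℝ) ≠ 0 := by
      have : N ≠ 0 := Finset.prod_ne_zero_iff.2 fun j _ => (q k j).den_nz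
      exact_mod_cast this
    have hmem : (N : ℝ) • vq k ∈ solLattice c := by
      intro j
      obtain ⟨M, hM⟩ : (q k j).den ∣ N := Finset.dvd_prod_of_mem _ (Finset.mem_univ j)
      refine ⟨M * (q k j).num, ?_⟩
      have h1 : ((N : ℝ) • vq k : EuclideanSpace ℝ (Fin m)) j = (N : ℝ) * (q k j : ℝ) := rfl
      change ((N : ℝ) • vq k : EuclideanSpace ℝ (Fin m)) j = _
      rw [h1, hM]
      have h3 := Rat.den_mul_eq_num (q k j)
      have h2 : ((q k j).den : ℝ) * (q k j : ℝ) = (q k j).num := by exact_mod_cast h3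
      push_cast
      rw [← h2]; ring
    have h3 : vq k = (N : ℝ)⁻¹ • ((N : ℝ) • vq k) := by rw [smul_smul, inv_mul_cancel₀ hN, one_smul]
    rw [h3]
    exact Submodule.smul_mem _ _ (Submodule.subset_span hmem)
  have hsum : w = ∑ k, (β k : ℝ) • vq k := by
    refine Subtype.ext ?_
    ext j
    rw [hw j]
    simp [vq]
  rw [hsum]
  exact Submodule.sum_mem _ fun k _ => Submodule.smul_mem _ _ (hvq k)

instance : IsZLattice ℝ (solLattice c) := ⟨span_solLattice c⟩

/-- The box of size `Y` in the solution space. -/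
def solBox (Y : ℝ) : Set (solSpace c) := {w | ∀ j, |(w : EuclideanSpace ℝ (Fin m)) j| ≤ Y}

theorem solBox_eq_smul {Y : ℝ} (hY : 0 < Y) : solBox c Y = Y • solBox c 1 := by
  ext w
  rw [Set.mem_smul_set_iff_inv_smul_mem₀ hY.ne']
  refine forall_congr' fun j => ?_
  have : ((Y⁻¹ • w : solSpace c) : EuclideanSpace ℝ (Fin m)) j =
    Y⁻¹ * (w : EuclideanSpace ℝ (Fin m)) j := rfl
  rw [this, abs_mul, abs_of_pos (inv_pos.2 hY), inv_mul_le_iff₀ hY, mul_one]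

theorem isBounded_solBox (Y : ℝ) : Bornology.IsBounded (solBox c Y) := by
  rw [isBounded_iff_forall_norm_le]
  refine ⟨∑ _j : Fin m, |Y|, fun w hw => ?_⟩
  rw [Submodule.coe_norm, EuclideanSpace.norm_eq]
  refine Real.sqrt_le_iff.2 ⟨by positivity, ?_⟩
  refine (Finset.sum_le_sum fun j _ => ?_).trans
    (Finset.sum_sq_le_sq_sum_of_nonneg fun j _ => abs_nonneg Y)
  rw [Real.norm_eq_abs]
  exact pow_le_pow_left₀ (abs_nonneg _) ((hw j).trans (le_abs_self _)) 2

theorem solMeasure_solBox_ne_top (Y : ℝ) : solMeasure c (solBox c Y) ≠ ⊤ :=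
  (isBounded_solBox c Y).measure_lt_top.ne

theorem solMeasure_real_solBox {Y : ℝ} (hY : 0 < Y) : (solMeasure c).real (solBox c Y) =
    Y ^ Module.finrank ℝ (solSpace c) * (solMeasure c).real (solBox c 1) := by
  rw [solBox_eq_smul c hY, measureReal_def, Measure.addHaar_smul, ENNReal.toReal_mul,
    ENNReal.toReal_ofReal (abs_nonneg _), abs_of_pos (pow_pos hY _), measureReal_def]

theorem boxDensity_pos : 0 < boxDensity c := by
  refine div_pos (ENNReal.toReal_pos (ne_of_gt ?_) (solMeasure_solBox_ne_top c 1))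
    (ZLattice.covolume_pos (solLattice c) (solMeasure c))
  let O : Set (solSpace c) := ⋂ j, {w | |(w : EuclideanSpace ℝ (Fin m)) j| < 1}
  have hO : IsOpen O := isOpen_iInter_of_finite fun j => isOpen_lt
    (continuous_abs.comp ((PiLp.continuous_apply 2 _ j).comp continuous_subtype_val))
    continuous_const
  exact (hO.measure_pos _ ⟨0, by simp [O]⟩).trans_le (measure_mono fun w hw j =>
    le_of_lt (Set.mem_iInter.1 hw j))

/-- The integral solutions in the box of size `Y`. -/
def intBox (Y : ℝ) : Set (intSol c) := {x | ∀ j, |(x.1 j : ℝ)| ≤ Y}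

theorem finite_intBox (Y : ℝ) : (intBox c Y).Finite := by
  refine Set.Finite.of_injOn (f := fun x : intSol c => x.1)
    (t := Set.Icc (fun _ : Fin m => -⌈|Y|⌉) (fun _ => ⌈|Y|⌉)) ?_ (Subtype.val_injective.injOn)
    (Set.finite_Icc _ _)
  intro x hx
  have h : ∀ j, |x.1 j| ≤ ⌈|Y|⌉ := fun j => by
    have h1 : |(x.1 j : ℝ)| ≤ (⌈|Y|⌉ : ℝ) := (hx j).trans ((le_abs_self Y).trans (Int.le_ceil _))
    exact_mod_cast h1
  exact ⟨fun j => (abs_le.1 (h j)).1, fun j => (abs_le.1 (h j)).2⟩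

/-- Comparison of the number of lattice points in a box with volumes of boxes. -/
theorem exists_covolume_bound : ∃ C : ℝ, 0 < C ∧ ∀ Y : ℝ,
    (intBox c Y).ncard * ZLattice.covolume (solLattice c) (solMeasure c) ≤
      (solMeasure c).real (solBox c (Y + C)) ∧
    (solMeasure c).real (solBox c (Y - C)) ≤
      (intBox c Y).ncard * ZLattice.covolume (solLattice c) (solMeasure c) := by
  let b := Module.Free.chooseBasis ℤ (solLattice c)
  have hF := ZLattice.isAddFundamentalDomain b (solMeasure c)
  set F := ZSpan.fundamentalDomain (b.ofZLatticeBasis ℝ) with hFdef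
  have hbd : Bornology.IsBounded F := ZSpan.fundamentalDomain_isBounded _
  obtain ⟨C₀, hC₀⟩ := isBounded_iff_forall_norm_le.1 hbd
  have hC : ∀ w ∈ F, ∀ j, |(w : EuclideanSpace ℝ (Fin m)) j| ≤ |C₀| + 1 := fun w hw j => by
    have h1 := PiLp.norm_apply_le (w : EuclideanSpace ℝ (Fin m)) j
    have h2 : ‖(w : EuclideanSpace ℝ (Fin m))‖ ≤ C₀ := hC₀ w hw
    rw [Real.norm_eq_abs] at h1
    linarith [le_abs_self C₀]
  have hcov : ZLattice.covolume (solLattice c) (solMeasure c) = (solMeasure c).real F :=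
    ZLattice.covolume_eq_measure_fundamentalDomain _ _ hF
  have hFfin : solMeasure c F ≠ ⊤ := hbd.measure_lt_top.ne
  refine ⟨|C₀| + 1, by positivity, fun Y => ?_⟩
  let Λ := (finite_intBox c Y).toFinset
  have hcard : Λ.card = (intBox c Y).ncard := (Set.ncard_eq_toFinset_card _ (finite_intBox c Y)).symm
  -- The translates of the fundamental domain are disjoint up to null sets, and the coordinates on
  -- it are bounded; so their union lies between the boxes of sizes `Y - C` and `Y + C`.
  let U : Set (solSpace c) := ⋃ x ∈ Λ, intSol.toLattice c x +ᵥ F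
  have hU : solMeasure c U = Λ.card * solMeasure c F := by
    have : VAddInvariantMeasure (solLattice c) (solSpace c) (solMeasure c) :=
      ⟨fun g s _ => measure_preimage_add _ (g : solSpace c) s⟩
    have hvadd : ∀ x, solMeasure c (intSol.toLattice c x +ᵥ F) = solMeasure c F := fun x =>
      measure_vadd _ _ _
    rw [measure_biUnion_finset₀]
    · simp [hvadd]
    · intro x _ y _ hxy
      exact hF.aedisjoint fun e => hxy ((intSol.toLattice_bijective c).1 e)
    · intro x _
      exact (hF.nullMeasurableSet).vadd _
  have hUreal : (solMeasure c).real U = (intBox c Y).ncard * (solMeasure c).real F := by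
    rw [measureReal_def, hU, ENNReal.toReal_mul, ← hcard]; simp [measureReal_def]
  have hsub : U ⊆ solBox c (Y + (|C₀| + 1)) := by
    intro w hw
    simp only [U, Set.mem_iUnion] at hw
    obtain ⟨x, hx, f, hf, rfl⟩ := hw
    intro j
    have h1 : |(x.1 j : ℝ)| ≤ Y := (Set.Finite.mem_toFinset _).1 hx j
    have h2 := hC f hf j
    have h3 : ((intSol.toLattice c x +ᵥ f : solSpace c) : EuclideanSpace ℝ (Fin m)) j =
      x.1 j + (f : EuclideanSpace ℝ (Fin m)) j := rfl
    change |((intSol.toLattice c x +ᵥ f : solSpace c) : EuclideanSpace ℝ (Fin m)) j| ≤ _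
    rw [h3]
    exact (abs_add_le _ _).trans (add_le_add h1 h2)
  have hsup : solBox c (Y - (|C₀| + 1)) ⊆ U := by
    intro w hw
    obtain ⟨v, hv, -⟩ := ZSpan.exist_unique_vadd_mem_fundamentalDomain (b.ofZLatticeBasis ℝ) w
    have hvmem : -(v : solSpace c) ∈ solLattice c := by
      exact neg_mem ((b.ofZLatticeBasis_span ℝ).le v.2)
    obtain ⟨x, hx⟩ := (intSol.toLattice_bijective c).2 ⟨_, hvmem⟩
    have hvF : (v : solSpace c) + w ∈ F := hv
    have hxv : (intSol.toLattice c x : solSpace c) = -(v : solSpace c) := by rw [hx]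
    simp only [U, Set.mem_iUnion]
    refine ⟨x, ?_, (v : solSpace c) + w, hvF, ?_⟩
    · refine (Set.Finite.mem_toFinset _).2 fun j => ?_
      have h1 := hC _ hvF j
      have h2 := hw j
      have h3 : (x.1 j : ℝ) = -((v : solSpace c) : EuclideanSpace ℝ (Fin m)) j := by
        rw [← intSol.toLattice_apply c x j, hxv]; rfl
      have h4 : (((v : solSpace c) + w : solSpace c) : EuclideanSpace ℝ (Fin m)) j =
        ((v : solSpace c) : EuclideanSpace ℝ (Fin m)) j + (w : EuclideanSpace ℝ (Fin m)) j := rfl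
      rw [h4] at h1
      rw [h3, abs_neg]
      rw [abs_le] at h1 h2 ⊢
      constructor <;> linarith
    · change (intSol.toLattice c x : solSpace c) + ((v : solSpace c) + w) = w
      rw [hxv]; simp
  rw [hcov, ← hUreal]
  exact ⟨measureReal_mono hsub (solMeasure_solBox_ne_top c _),
    measureReal_mono hsup (measure_mono hsub |>.trans_lt (solMeasure_solBox_ne_top c _).lt_top).ne⟩

/-- The number of integral solutions in a box. -/
theorem exists_ncard_intBox_bound : ∃ C : ℝ, 0 ≤ C ∧ ∀ Y : ℝ, 1 ≤ Y →
    |(intBox c Y).ncard - boxDensity c * Y ^ Module.finrank ℝ (solSpace c)| ≤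
      C * Y ^ Module.finrank ℝ (solSpace c) / Y := by
  obtain ⟨C₀, hC₀, h⟩ := exists_covolume_bound c
  set D := Module.finrank ℝ (solSpace c)
  set κ := ZLattice.covolume (solLattice c) (solMeasure c) with hκ
  have hκ0 : 0 < κ := ZLattice.covolume_pos _ _
  have hbd : (solMeasure c).real (solBox c 1) = boxDensity c * κ := by
    have : boxDensity c = (solMeasure c).real (solBox c 1) / κ := rfl
    rw [this, div_mul_cancel₀ _ hκ0.ne']
  have hb0 := boxDensity_pos c
  obtain ⟨C₂, hC₂0, hC₂⟩ := exists_one_add_mul_pow_le C₀ hC₀.le D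
  refine ⟨boxDensity c * (C₂ + (D + 1) * C₀), by positivity, fun Y hY => ?_⟩
  have hY0 : 0 < Y := by linarith
  obtain ⟨h1, h2⟩ := h Y
  rw [solMeasure_real_solBox c (by linarith : 0 < Y + C₀), hbd, ← mul_assoc] at h1
  have h1' := le_of_mul_le_mul_right h1 hκ0
  have hξ0 : 0 < 1 / Y := by positivity
  have hξ1 : 1 / Y ≤ 1 := by rw [div_le_one hY0]; exact hY
  have hup : ((intBox c Y).ncard : ℝ) ≤ boxDensity c * Y ^ D * (1 + C₂ * (1 / Y)) := by
    have e : Y + C₀ = Y * (1 + C₀ * (1 / Y)) := by field_simp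
    rw [e, mul_pow] at h1'
    refine h1'.trans ?_
    have := hC₂ _ hξ0.le hξ1
    calc Y ^ D * (1 + C₀ * (1 / Y)) ^ D * boxDensity c
        ≤ Y ^ D * (1 + C₂ * (1 / Y)) * boxDensity c := by gcongr
      _ = _ := by ring
  have hlow : boxDensity c * Y ^ D * (1 - (D + 1) * C₀ * (1 / Y)) ≤ (intBox c Y).ncard := by
    by_cases hpos : 0 < Y - C₀
    · rw [solMeasure_real_solBox c hpos, hbd, ← mul_assoc] at h2
      have h2' := le_of_mul_le_mul_right h2 hκ0
      have e : Y - C₀ = Y * (1 + -(C₀ * (1 / Y))) := by field_simp; ring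
      have hlt : C₀ * (1 / Y) < 1 := by
        rw [mul_one_div, div_lt_one hY0]; linarith
      rw [e, mul_pow] at h2'
      refine le_trans ?_ h2'
      have h3 := one_add_mul_le_pow (a := -(C₀ * (1 / Y))) (by linarith) D
      have h4 : 0 < C₀ * (1 / Y) := by positivity
      have h5 : 1 - (D + 1) * C₀ * (1 / Y) ≤ (1 + -(C₀ * (1 / Y))) ^ D := by nlinarith
      calc boxDensity c * Y ^ D * (1 - (D + 1) * C₀ * (1 / Y))
          ≤ boxDensity c * Y ^ D * (1 + -(C₀ * (1 / Y))) ^ D := by gcongr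
        _ = _ := by ring
    · refine le_trans ?_ (Nat.cast_nonneg _)
      refine mul_nonpos_of_nonneg_of_nonpos (by positivity) ?_
      have h3 : 1 ≤ C₀ * (1 / Y) := by
        rw [mul_one_div, one_le_div hY0]; linarith
      have : (0 : ℝ) ≤ D := Nat.cast_nonneg _
      nlinarith
  have e1 : boxDensity c * (C₂ + (D + 1) * C₀) * Y ^ D / Y =
    boxDensity c * Y ^ D * (C₂ * (1 / Y)) + boxDensity c * Y ^ D * ((D + 1) * C₀ * (1 / Y)) := by ring
  have p1 : 0 ≤ boxDensity c * Y ^ D * (C₂ * (1 / Y)) := by positivity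
  have p2 : 0 ≤ boxDensity c * Y ^ D * ((D + 1) * C₀ * (1 / Y)) := by positivity
  rw [e1, abs_le]
  constructor <;> nlinarith

end SolLattice

/-! ### Integral solutions without zero coordinates -/

section NzSol

variable {m t : ℕ} (c : Fin t → Fin m → ℚ)

/-- The integral solutions without zero coordinates. -/
def nzSol : Set (Fin m → ℤ) := {x | x ∈ intSol c ∧ ∀ j, x j ≠ 0}

/-- The maximum norm of an integral vector. -/
def supAbs (x : Fin m → ℤ) : ℕ := Finset.univ.sup fun j => (x j).natAbs

theorem supAbs_le_iff (x : Fin m → ℤ) {Y : ℝ} (hY : 0 ≤ Y) :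
    (supAbs x : ℝ) ≤ Y ↔ ∀ j, |(x j : ℝ)| ≤ Y := by
  have h1 : ∀ j, |(x j : ℝ)| = ((x j).natAbs : ℝ) := fun j => by
    rw [Nat.cast_natAbs, Int.cast_abs]
  simp only [h1]
  rw [← Nat.le_floor_iff hY]
  simp only [supAbs, Finset.sup_le_iff, Finset.mem_univ, true_imp_iff]
  exact forall_congr' fun j => Nat.le_floor_iff hY

/-- The integral solutions without zero coordinates in the box of size `Y`. -/
def nzBox (Y : ℝ) : Set (nzSol c) := {x | ∀ j, |(x.1 j : ℝ)| ≤ Y}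

theorem ncard_nzBox (Y : ℝ) : (nzBox c Y).ncard =
    (intBox c Y \ ⋃ j, {x | x.1 j = 0}).ncard := by
  refine Set.ncard_congr (fun x _ => ⟨x.1, x.2.1⟩) ?_ ?_ ?_
  · intro x hx
    refine ⟨fun j => hx j, ?_⟩
    simp only [Set.mem_iUnion, not_exists]
    exact fun j => x.2.2 j
  · intro x y _ _ h
    exact Subtype.ext (congrArg (fun z : intSol c => z.1) h)
  · rintro x ⟨hx, hx'⟩
    simp only [Set.mem_iUnion, not_exists] at hx'
    exact ⟨⟨x.1, x.2, hx'⟩, fun j => hx j, rfl⟩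

theorem finite_nzBox (Y : ℝ) : (nzBox c Y).Finite := by
  refine Set.Finite.of_injOn (f := fun x : nzSol c => (⟨x.1, x.2.1⟩ : intSol c)) (t := intBox c Y)
    (fun x hx j => hx j) ?_ (finite_intBox c Y)
  intro x _ y _ h
  exact Subtype.ext (congrArg (fun z : intSol c => z.1) h)

theorem finrank_solSpace_cons_lt (j : Fin m)
    (hj : ∃ w : solSpace c, (w : EuclideanSpace ℝ (Fin m)) j ≠ 0) :
    Module.finrank ℝ (solSpace (Fin.cons (Pi.single j 1) c : Fin (t + 1) → Fin m → ℚ)) <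
      Module.finrank ℝ (solSpace c) := by
  refine Submodule.finrank_lt_finrank_of_lt ⟨fun w hw l => ?_, fun h => ?_⟩
  · have := hw l.succ
    simpa using this
  · obtain ⟨w, hw⟩ := hj
    have := h w.2 0
    rw [Fintype.sum_eq_single j fun k hk => by simp [hk]] at this
    exact hw (by simpa using this)

/-- By `hj` each hyperplane `x j = 0` cuts the solution space in smaller dimension, so the solutions
with a zero coordinate number `O(Y ^ D / Y)` when `Y ≥ 1`. For `Y < 1` the box is empty, since
nonzero integers have absolute value at least `1`. The bound is applied with `Y = e^U / d`: validity
for all `Y > 0` makes it uniform in `d`, and a saving of only `√Y` costs `√d`, so that `√d / d ^ 2`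
remains summable when `D = 2`. A saving of `Y` would leave the divergent `1 / d`. -/
theorem exists_ncard_nzBox_bound {D : ℕ} (hD : Module.finrank ℝ (solSpace c) = D)
    (hm : 0 < m) (hj : ∀ j, ∃ w : solSpace c, (w : EuclideanSpace ℝ (Fin m)) j ≠ 0) :
    ∃ C : ℝ, 0 ≤ C ∧ ∀ Y : ℝ, 0 < Y →
      |(nzBox c Y).ncard - boxDensity c * Y ^ D| ≤ C * (Y ^ D / √Y) := by
  obtain ⟨C₁, hC₁, h₁⟩ := exists_ncard_intBox_bound c
  rw [hD] at h₁
  have hj' : ∀ j, ∃ C : ℝ, 0 ≤ C ∧ ∀ Y : ℝ, 1 ≤ Y →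
      ((intBox c Y ∩ {x | x.1 j = 0}).ncard : ℝ) ≤ C * Y ^ D / Y := by
    intro j
    let c' : Fin (t + 1) → Fin m → ℚ := Fin.cons (Pi.single j 1) c
    obtain ⟨C, hC, h⟩ := exists_ncard_intBox_bound c'
    refine ⟨boxDensity c' + C, add_nonneg (boxDensity_pos c').le hC, fun Y hY => ?_⟩
    have hY0 : 0 < Y := by linarith
    have hlt := finrank_solSpace_cons_lt c j (hj j)
    rw [hD] at hlt
    set D' := Module.finrank ℝ (solSpace c') with hD'
    have hle : (intBox c Y ∩ {x | x.1 j = 0}).ncard ≤ (intBox c' Y).ncard := by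
      have hmem : ∀ x ∈ intBox c Y ∩ {x | x.1 j = 0}, x.1 ∈ intSol c' := by
        rintro x ⟨-, hx⟩ l
        have hx' : x.1 j = 0 := hx
        refine Fin.cases ?_ (fun l => ?_) l
        · simp [c', Pi.single_apply, hx']
        · simpa [c'] using x.2 l
      have := Set.ncard_le_ncard_of_injOn (s := Subtype.val '' (intBox c Y ∩ {x | x.1 j = 0}))
        (t := Subtype.val '' intBox c' Y) id ?_ (Function.injective_id.injOn)
        ((finite_intBox c' Y).image _)
      · rwa [Set.ncard_image_of_injective _ Subtype.val_injective,
          Set.ncard_image_of_injective _ Subtype.val_injective] at this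
      · rintro _ ⟨x, hx, rfl⟩
        exact ⟨⟨x.1, hmem x hx⟩, fun j => hx.1 j, rfl⟩
    have h2 := (abs_le.1 (h Y hY)).2
    have h3 : Y ^ D' ≤ Y ^ D / Y := by
      rw [le_div_iff₀ hY0, ← pow_succ]
      exact pow_le_pow_right₀ hY hlt
    have h4 : C * Y ^ D' / Y ≤ C * (Y ^ D / Y) := by
      rw [mul_div_assoc]
      refine mul_le_mul_of_nonneg_left ?_ hC
      exact (div_le_self (by positivity) hY).trans h3
    calc ((intBox c Y ∩ {x | x.1 j = 0}).ncard : ℝ) ≤ (intBox c' Y).ncard := by exact_mod_cast hle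
      _ ≤ boxDensity c' * Y ^ D' + C * Y ^ D' / Y := by linarith
      _ ≤ boxDensity c' * (Y ^ D / Y) + C * (Y ^ D / Y) :=
          add_le_add (mul_le_mul_of_nonneg_left h3 (boxDensity_pos c').le) h4
      _ = _ := by ring
  choose C₂ hC₂ h₂ using hj'
  have hb0 := boxDensity_pos c
  have hC₂s : 0 ≤ ∑ j, C₂ j := Finset.sum_nonneg fun j _ => hC₂ j
  refine ⟨C₁ + ∑ j, C₂ j + boxDensity c, by positivity, fun Y hY => ?_⟩
  by_cases hY1 : 1 ≤ Y
  · have hsq : Y ^ D / Y ≤ Y ^ D / √Y := by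
      refine div_le_div_of_nonneg_left (by positivity) (Real.sqrt_pos.2 hY) ?_
      rw [Real.sqrt_le_left hY.le]
      nlinarith
    have hle : (nzBox c Y).ncard ≤ (intBox c Y).ncard := by
      rw [ncard_nzBox]
      exact Set.ncard_le_ncard Set.sdiff_subset (finite_intBox c Y)
    have hge : (intBox c Y).ncard ≤ (nzBox c Y).ncard +
        ∑ j, (intBox c Y ∩ {x | x.1 j = 0}).ncard := by
      rw [ncard_nzBox]
      have h1 : intBox c Y ⊆ (intBox c Y \ ⋃ j, {x | x.1 j = 0}) ∪
          ⋃ j, (intBox c Y ∩ {x | x.1 j = 0}) := by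
        intro x hx
        by_cases h : x ∈ ⋃ j, {x : intSol c | x.1 j = 0}
        · right
          rw [← Set.inter_iUnion]
          exact ⟨hx, h⟩
        · exact Or.inl ⟨hx, h⟩
      have hfin2 : (⋃ j, (intBox c Y ∩ {x | x.1 j = 0})).Finite :=
        (finite_intBox c Y).subset (Set.iUnion_subset fun j => Set.inter_subset_left)
      refine (Set.ncard_le_ncard h1 (((finite_intBox c Y).subset Set.sdiff_subset).union hfin2)).trans ?_
      refine (Set.ncard_union_le _ _).trans (Nat.add_le_add_left ?_ _)
      exact Set.ncard_iUnion_le_of_fintype _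
    have hge' : ((intBox c Y).ncard : ℝ) ≤ (nzBox c Y).ncard + (∑ j, C₂ j) * (Y ^ D / Y) := by
      have h1 : ((intBox c Y).ncard : ℝ) ≤ (nzBox c Y).ncard +
        ∑ j, ((intBox c Y ∩ {x | x.1 j = 0}).ncard : ℝ) := by exact_mod_cast hge
      refine h1.trans (add_le_add le_rfl ?_)
      rw [Finset.sum_mul]
      exact Finset.sum_le_sum fun j _ => (h₂ j Y hY1).trans (le_of_eq (mul_div_assoc _ _ _))
    have hle' : ((nzBox c Y).ncard : ℝ) ≤ (intBox c Y).ncard := by exact_mod_cast hle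
    have h3 := abs_le.1 (h₁ Y hY1)
    rw [mul_div_assoc] at h3
    have p1 : C₁ * (Y ^ D / Y) ≤ C₁ * (Y ^ D / √Y) := mul_le_mul_of_nonneg_left hsq hC₁
    have p2 : (∑ j, C₂ j) * (Y ^ D / Y) ≤ (∑ j, C₂ j) * (Y ^ D / √Y) :=
      mul_le_mul_of_nonneg_left hsq hC₂s
    have p3 : 0 ≤ boxDensity c * (Y ^ D / √Y) := by positivity
    have p4 : 0 ≤ (∑ j, C₂ j) * (Y ^ D / √Y) := by positivity
    rw [abs_le]
    constructor <;> nlinarith [h3.1, h3.2]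
  · push Not at hY1
    have h0 : nzBox c Y = ∅ := by
      refine Set.eq_empty_of_forall_notMem fun x hx => ?_
      have h1 := hx ⟨0, hm⟩
      have h2 : (1 : ℤ) ≤ |x.1 ⟨0, hm⟩| := Int.one_le_abs (x.2.2 _)
      have h3 : (1 : ℝ) ≤ |(x.1 ⟨0, hm⟩ : ℝ)| := by exact_mod_cast h2
      linarith
    rw [h0, Set.ncard_empty, Nat.cast_zero, zero_sub, abs_neg, abs_of_pos (by positivity)]
    have hsq : Y ^ D ≤ Y ^ D / √Y := by
      rw [le_div_iff₀ (Real.sqrt_pos.2 hY)]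
      exact mul_le_of_le_one_right (by positivity) (Real.sqrt_le_one.2 hY1.le)
    have p1 : 0 ≤ (C₁ + ∑ j, C₂ j) * (Y ^ D / √Y) := by positivity
    calc boxDensity c * Y ^ D ≤ boxDensity c * (Y ^ D / √Y) := by gcongr
      _ ≤ _ := by linarith

theorem supAbs_pos (hm : 0 < m) (x : nzSol c) : 0 < supAbs x.1 := by
  have h1 : (x.1 ⟨0, hm⟩).natAbs ≤ supAbs x.1 :=
    Finset.le_sup (f := fun j => (x.1 j).natAbs) (Finset.mem_univ _)
  have := Int.natAbs_pos.2 (x.2.2 ⟨0, hm⟩)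
  omega

/-- The image of the counting measure under the logarithm of the norm. -/
noncomputable def logCount (d : ℕ) : Measure ℝ :=
  (Measure.count : Measure (nzSol c)).map fun x => Real.log (d * supAbs x.1)

/-- All values `log (d * supAbs x)` are nonnegative, so the lower end `a ≤ 0` imposes nothing. -/
theorem logCount_Icc (hm : 0 < m) {d : ℕ} (hd : 0 < d) {a U : ℝ} (ha : a ≤ 0) :
    logCount c d (Set.Icc a U) = ((nzBox c (Real.exp U / d)).ncard : ENNReal) := by
  have hd' : (0 : ℝ) < d := by exact_mod_cast hd
  unfold logCount
  rw [Measure.map_apply (measurable_of_countable _) measurableSet_Icc,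
    Measure.count_apply (Set.to_countable _).measurableSet]
  have : (fun x : nzSol c => Real.log (d * supAbs x.1)) ⁻¹' Set.Icc a U =
      nzBox c (Real.exp U / d) := by
    ext x
    have hx : (1 : ℝ) ≤ supAbs x.1 := by exact_mod_cast supAbs_pos c hm x
    have hd1 : (1 : ℝ) ≤ d := by exact_mod_cast hd
    have h1 : (1 : ℝ) ≤ d * supAbs x.1 := one_le_mul_of_one_le_of_one_le hd1 hx
    have h2 : x ∈ nzBox c (Real.exp U / d) ↔ (supAbs x.1 : ℝ) ≤ Real.exp U / d :=
      (supAbs_le_iff x.1 (by positivity)).symm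
    rw [h2, le_div_iff₀ hd', Set.mem_preimage, Set.mem_Icc, Real.log_le_iff_le_exp (by linarith),
      mul_comm]
    exact ⟨fun h => h.2, fun h => ⟨ha.trans (Real.log_nonneg (by linarith)), h⟩⟩
  rw [this, Set.Finite.encard_eq_coe_toFinset_card (finite_nzBox c _),
    Set.ncard_eq_toFinset_card _ (finite_nzBox c _)]
  rfl

theorem sigmaFinite_logCount (hm : 0 < m) {d : ℕ} (hd : 0 < d) : SigmaFinite (logCount c d) := by
  have : IsFiniteMeasureOnCompacts (logCount c d) := ⟨fun K hK => by
    obtain ⟨r, hr⟩ := hK.isBounded.subset_closedBall 0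
    rw [Real.closedBall_eq_Icc] at hr
    have h1 : K ⊆ Set.Icc (-|r|) |r| := hr.trans
      (Set.Icc_subset_Icc (by simpa using neg_le_neg (le_abs_self r)) (by simpa using le_abs_self r))
    refine (measure_mono h1).trans_lt ?_
    rw [logCount_Icc c hm hd (by simp)]
    exact ENNReal.natCast_lt_top _⟩
  infer_instance

end NzSol

/-! ### Counting tuples of integral solutions -/

/-- Counting measures on countable types. -/
theorem pi_count_eq_count {ι : Type} [Fintype ι] {X : ι → Type} [∀ i, Countable (X i)]
    [∀ i, MeasurableSpace (X i)] [∀ i, MeasurableSingletonClass (X i)] :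
    Measure.pi (fun i => (Measure.count : Measure (X i))) = Measure.count := by
  refine Measure.ext_of_singleton fun x => ?_
  rw [Measure.pi_singleton]
  simp

namespace RegionData

variable {s : ℕ} {S : Type} (A : RegionData s S)

/-- Tuples of integral solutions whose norms, scaled by `d`, lie in the dilated polytope. -/
def tuples {n t : Fin s → ℕ} (c : ∀ i, Fin (t i) → Fin (n i) → ℚ) (d : Fin s → ℕ) (T : ℝ) :
    Set (∀ i, nzSol (c i)) :=
  {x | (fun i => Real.log (d i * supAbs (x i).1)) ∈ A.region T}

theorem finite_tuples [Nonempty S] {n t : Fin s → ℕ} (hn : ∀ i, 0 < n i)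
    (c : ∀ i, Fin (t i) → Fin (n i) → ℚ) {d : Fin s → ℕ} (hd : ∀ i, 0 < d i) (T : ℝ) :
    (A.tuples c d T).Finite := by
  refine Set.Finite.subset (s := Set.univ.pi fun i => nzBox (c i) (Real.exp (T / A.w i)))
    (Set.Finite.pi fun i => finite_nzBox (c i) _) ?_
  intro x hx i _
  have h1 := (A.region_subset_Icc T hx).2 i
  have h2 : (1 : ℝ) ≤ supAbs (x i).1 := by exact_mod_cast supAbs_pos (c i) (hn i) (x i)
  have h3 : (1 : ℝ) ≤ d i := by exact_mod_cast hd i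
  have h4 : (supAbs (x i).1 : ℝ) ≤ d i * supAbs (x i).1 := by nlinarith
  have h1' : Real.log (d i * supAbs (x i).1) ≤ T / A.w i := h1
  rw [Real.log_le_iff_le_exp (by nlinarith)] at h1'
  exact (supAbs_le_iff (x i).1 (by positivity)).1 (h4.trans h1')

/-- On countable sets the product of counting measures is the counting measure, and its image under
coordinatewise logarithms is the product of the measures `logCount`. -/
theorem ncard_tuples [Nonempty S] {n t : Fin s → ℕ} (hn : ∀ i, 0 < n i)
    (c : ∀ i, Fin (t i) → Fin (n i) → ℚ) {d : Fin s → ℕ} (hd : ∀ i, 0 < d i) (T : ℝ) :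
    ((A.tuples c d T).ncard : ℝ) =
      (Measure.pi fun i => logCount (c i) (d i)).real (A.region T) := by
  have hs := fun i => sigmaFinite_logCount (c i) (hn i) (hd i)
  unfold logCount at hs ⊢
  rw [← Measure.pi_map_pi (fun i => (measurable_of_countable _).aemeasurable), pi_count_eq_count,
    measureReal_def, Measure.map_apply (measurable_of_countable _)
      (A.isClosed_region T).measurableSet, Measure.count_apply (Set.to_countable _).measurableSet]
  have hf := A.finite_tuples hn c hd T
  change _ = (ENat.toENNReal (A.tuples c d T).encard).toReal
  rw [hf.encard_eq_coe_toFinset_card, Set.ncard_eq_toFinset_card _ hf]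
  simp

/-- The number of tuples. -/
theorem exists_ncard_tuples_bound [Fintype S] [Nonempty S] (i₁ : Fin s) {n t : Fin s → ℕ}
    (hn : ∀ i, 0 < n i) (c : ∀ i, Fin (t i) → Fin (n i) → ℚ)
    (hdim : ∀ i, Module.finrank ℝ (solSpace (c i)) = A.ϖ i) (hϖ : ∀ i, 2 ≤ A.ϖ i)
    (hj : ∀ i j, ∃ w : solSpace (c i), (w : EuclideanSpace ℝ (Fin (n i))) j ≠ 0) :
    ∃ C : ℝ, 0 ≤ C ∧ ∀ d : Fin s → ℕ, (∀ i, 0 < d i) → ∀ T : ℝ, 1 ≤ T →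
      |(A.tuples c d T).ncard - (∏ i, boxDensity (c i) / (d i : ℝ) ^ A.ϖ i) * A.mass T| ≤
        C * (∏ i, √(d i) / (d i : ℝ) ^ 2) * (Real.exp T * T ^ (A.rk - 1) / T) := by
  obtain ⟨C, hC, h⟩ := A.exists_pi_region_bound i₁
  choose C' hC' h' using fun i => exists_ncard_nzBox_bound (c i) (hdim i) (hn i) (hj i)
  have hb := fun i => boxDensity_pos (c i)
  refine ⟨C * ∏ i, (C' i + 2 * boxDensity (c i)), mul_nonneg hC (Finset.prod_nonneg fun i _ => by
    have := hC' i; have := hb i; positivity), fun d hd T hT => ?_⟩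
  have hs := fun i => sigmaFinite_logCount (c i) (hn i) (hd i)
  have hd' : ∀ i, (1 : ℝ) ≤ d i := fun i => by exact_mod_cast hd i
  have hd0 : ∀ i, (0 : ℝ) < d i := fun i => by exact_mod_cast hd i
  rw [A.ncard_tuples hn c hd T]
  -- In the error constant, `C' i` comes from `exists_ncard_nzBox_bound` at `Y = e^U / d i`, and the
  -- summand `boxDensity (c i)` absorbs the `-1` in `e^{w i * U} - 1`.
  refine (h (fun i => logCount (c i) (d i)) (fun i => boxDensity (c i) / (d i : ℝ) ^ A.ϖ i)
    (fun i => (C' i + boxDensity (c i)) * (√(d i) / (d i : ℝ) ^ A.ϖ i))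
    (fun i => by have := hb i; positivity)
    (fun i => by have := hb i; have := hC' i; positivity) (fun i U hU => ?_) T hT).trans ?_
  · rw [logCount_Icc (c i) (hn i) (hd i) le_rfl]
    refine ⟨ENNReal.natCast_ne_top _, ?_⟩
    rw [measureReal_def, logCount_Icc (c i) (hn i) (hd i) le_rfl, ENNReal.toReal_natCast]
    have h1 := h' i (Real.exp U / d i) (div_pos (Real.exp_pos U) (hd0 i))
    have e1 : (Real.exp U / d i) ^ A.ϖ i = Real.exp (A.w i * U) / (d i : ℝ) ^ A.ϖ i := by
      rw [div_pow, ← Real.exp_nat_mul]; rfl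
    have e2 : (Real.exp U / d i) ^ A.ϖ i / √(Real.exp U / d i) =
        √(d i) / (d i : ℝ) ^ A.ϖ i * Real.exp ((A.w i - 1 / 2) * U) := by
      rw [e1, Real.sqrt_div (Real.exp_nonneg U), ← Real.exp_half]
      have e3 : Real.exp (A.w i * U) = Real.exp ((A.w i - 1 / 2) * U) * Real.exp (U / 2) := by
        rw [← Real.exp_add]; congr 1; ring
      rw [e3]
      have := (Real.sqrt_pos.2 (hd0 i)).ne'
      have := (Real.exp_pos (U / 2)).ne'
      have := (hd0 i).ne'
      field_simp
    rw [e2, e1] at h1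
    have hexp : 1 ≤ Real.exp ((A.w i - 1 / 2) * U) := by
      refine Real.one_le_exp (mul_nonneg ?_ hU)
      have : (2 : ℝ) ≤ A.w i := by
        have := hϖ i
        simp only [w]; exact_mod_cast this
      linarith
    have hsq : 1 ≤ √(d i : ℝ) := Real.one_le_sqrt.2 (hd' i)
    have hbi := hb i
    have hpow : 0 < (d i : ℝ) ^ A.ϖ i := pow_pos (hd0 i) _
    have h3 : boxDensity (c i) / (d i : ℝ) ^ A.ϖ i ≤
        boxDensity (c i) * (√(d i) / (d i : ℝ) ^ A.ϖ i) * Real.exp ((A.w i - 1 / 2) * U) := by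
      rw [← mul_div_assoc, div_mul_eq_mul_div]
      gcongr
      nlinarith [mul_nonneg hbi.le (sub_nonneg.2 hsq), mul_nonneg (mul_pos hbi (by linarith : 0 < √(d i : ℝ))).le (sub_nonneg.2 hexp)]
    have e4 : boxDensity (c i) / (d i : ℝ) ^ A.ϖ i * (Real.exp (A.w i * U) - 1) =
      boxDensity (c i) * (Real.exp (A.w i * U) / (d i : ℝ) ^ A.ϖ i) -
        boxDensity (c i) / (d i : ℝ) ^ A.ϖ i := by ring
    have p0 : 0 < boxDensity (c i) / (d i : ℝ) ^ A.ϖ i := by positivity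
    rw [e4]
    have h1' := abs_le.1 h1
    have e5 : (C' i + boxDensity (c i)) * (√(d i) / (d i : ℝ) ^ A.ϖ i) *
        Real.exp ((A.w i - 1 / 2) * U) =
      C' i * (√(d i) / (d i : ℝ) ^ A.ϖ i * Real.exp ((A.w i - 1 / 2) * U)) +
        boxDensity (c i) * (√(d i) / (d i : ℝ) ^ A.ϖ i) * Real.exp ((A.w i - 1 / 2) * U) := by ring
    rw [e5, abs_le]
    constructor <;> linarith
  · have hE0 : 0 ≤ Real.exp T * T ^ (A.rk - 1) / T := by positivity
    refine mul_le_mul_of_nonneg_right ?_ hE0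
    rw [mul_assoc, ← Finset.prod_mul_distrib]
    refine mul_le_mul_of_nonneg_left ?_ hC
    refine Finset.prod_le_prod (fun i _ => ?_) fun i _ => ?_
    · have := hb i; have := hC' i; positivity
    · have hbi := hb i
      have hCi := hC' i
      have hsq : 1 ≤ √(d i : ℝ) := Real.one_le_sqrt.2 (hd' i)
      have hpow : (d i : ℝ) ^ 2 ≤ (d i : ℝ) ^ A.ϖ i := pow_le_pow_right₀ (hd' i) (hϖ i)
      have h2 : (0 : ℝ) < (d i : ℝ) ^ 2 := pow_pos (hd0 i) 2
      have h3 : √(d i) / (d i : ℝ) ^ A.ϖ i ≤ √(d i) / (d i : ℝ) ^ 2 := by gcongr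
      have h4 : 1 / (d i : ℝ) ^ A.ϖ i ≤ √(d i) / (d i : ℝ) ^ 2 := by gcongr
      calc boxDensity (c i) / (d i : ℝ) ^ A.ϖ i +
            (C' i + boxDensity (c i)) * (√(d i) / (d i : ℝ) ^ A.ϖ i)
          = boxDensity (c i) * (1 / (d i : ℝ) ^ A.ϖ i) +
            (C' i + boxDensity (c i)) * (√(d i) / (d i : ℝ) ^ A.ϖ i) := by ring
        _ ≤ boxDensity (c i) * (√(d i) / (d i : ℝ) ^ 2) +
            (C' i + boxDensity (c i)) * (√(d i) / (d i : ℝ) ^ 2) := by gcongr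
        _ = _ := by ring

end RegionData

/-! ### Absolutely convergent series and the function `μ` of the fan -/

section Tuples

variable {s : ℕ}

theorem summable_prod_of_summable {β : Type*} (a : Fin s → β → ℝ) (ha : ∀ i b, 0 ≤ a i b)
    (hs : ∀ i, Summable (a i)) : Summable fun e : Fin s → β => ∏ i, a i (e i) := by
  classical
  refine summable_of_sum_le (c := ∏ i, ∑' b, a i b)
    (fun e => Finset.prod_nonneg fun i _ => ha i _) fun F => ?_
  calc ∑ e ∈ F, ∏ i, a i (e i)
      ≤ ∑ e ∈ Fintype.piFinset fun i => F.image fun e => e i, ∏ i, a i (e i) := by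
        refine Finset.sum_le_sum_of_subset_of_nonneg (fun e he => ?_)
          fun e _ _ => Finset.prod_nonneg fun i _ => ha i _
        exact Fintype.mem_piFinset.2 fun i => Finset.mem_image_of_mem _ he
    _ = ∏ i, ∑ b ∈ F.image fun e => e i, a i b := (Finset.prod_univ_sum _ _).symm
    _ ≤ ∏ i, ∑' b, a i b := Finset.prod_le_prod
        (fun i _ => Finset.sum_nonneg fun b _ => ha i b)
        fun i _ => (hs i).sum_le_tsum _ fun b _ => ha i b

theorem summable_sqrt_div_sq : Summable fun e : ℕ+ => √(e : ℝ) / (e : ℝ) ^ 2 := by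
  have h : Summable fun e : ℕ => 1 / (e : ℝ) ^ (3 / 2 : ℝ) :=
    Real.summable_one_div_nat_rpow.2 (by norm_num)
  have h' := h.comp_injective PNat.coe_injective
  refine h'.congr fun e => ?_
  have he : (0 : ℝ) < e := by exact_mod_cast e.pos
  simp only [Function.comp]
  rw [Real.sqrt_eq_rpow, ← Real.rpow_natCast, ← Real.rpow_sub he, one_div, ← Real.rpow_neg he.le]
  norm_num

/-- The summand `√e / e ^ 2` is completely multiplicative. Grouping the square of its series by the
product `x * y = e` yields each value as often as `e` has divisors. -/
theorem summable_card_divisors_mul_sqrt_div_sq :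
    Summable fun e : ℕ+ => ((e : ℕ).divisors.card : ℝ) * (√(e : ℝ) / (e : ℝ) ^ 2) := by
  have h := summable_sqrt_div_sq.mul_of_nonneg summable_sqrt_div_sq (fun _ => by positivity)
    (fun _ => by positivity)
  rw [← sigmaAntidiagonalEquivProd.summable_iff] at h
  have h' := h.sigma
  refine h'.congr fun e => ?_
  have hc : ∀ x : ((e : ℕ).divisorsAntidiagonal),
      ((fun x : ℕ+ × ℕ+ => √(x.1 : ℝ) / (x.1 : ℝ) ^ 2 * (√(x.2 : ℝ) / (x.2 : ℝ) ^ 2)) ∘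
        sigmaAntidiagonalEquivProd) ⟨e, x⟩ = √(e : ℝ) / (e : ℝ) ^ 2 := by
    rintro ⟨⟨x, y⟩, hx⟩
    have hxy : (e : ℝ) = x * y := by
      rw [← Nat.cast_mul, (Nat.mem_divisorsAntidiagonal.1 hx).1]
    simp only [Function.comp, sigmaAntidiagonalEquivProd, divisorsAntidiagonalFactors,
      Equiv.coe_fn_mk, PNat.mk_coe]
    rw [hxy, Real.sqrt_mul (Nat.cast_nonneg _), mul_pow]
    ring
  rw [tsum_congr hc, tsum_fintype, Finset.sum_const, Finset.card_univ, Fintype.card_coe,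
    nsmul_eq_mul, ← Nat.map_div_right_divisors, Finset.card_map]

theorem sum_moebius_multiples {a b : ℕ} (hb : b ≠ 0) (hab : a ∣ b) :
    ∑ e ∈ b.divisors with a ∣ e, ArithmeticFunction.moebius (b / e) = if a = b then 1 else 0 := by
  obtain ⟨m, rfl⟩ := hab
  have ha : 0 < a := Nat.pos_of_ne_zero (left_ne_zero_of_mul hb)
  have hm : m ≠ 0 := right_ne_zero_of_mul hb
  have h1 : ∑ e ∈ (a * m).divisors with a ∣ e, ArithmeticFunction.moebius (a * m / e) =
      ∑ e ∈ m.divisors, ArithmeticFunction.moebius (m / e) := by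
    symm
    refine Finset.sum_bij (fun e _ => a * e) ?_ ?_ ?_ ?_
    · intro e he
      rw [Finset.mem_filter, Nat.mem_divisors]
      exact ⟨⟨Nat.mul_dvd_mul_left a (Nat.dvd_of_mem_divisors he), hb⟩, dvd_mul_right _ _⟩
    · intro e _ e' _ h
      exact Nat.eq_of_mul_eq_mul_left ha h
    · intro e he
      rw [Finset.mem_filter, Nat.mem_divisors] at he
      obtain ⟨f, rfl⟩ := he.2
      exact ⟨f, Nat.mem_divisors.2 ⟨Nat.dvd_of_mul_dvd_mul_left ha he.1.1, hm⟩, rfl⟩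
    · intro e _
      rw [Nat.mul_div_mul_left _ _ ha]
  rw [h1, Nat.sum_div_divisors, ← ArithmeticFunction.coe_mul_zeta_apply,
    ArithmeticFunction.moebius_mul_coe_zeta, ArithmeticFunction.one_apply]
  congr 1
  rw [eq_iff_iff]
  constructor
  · rintro rfl
    simp
  · intro h
    exact Nat.eq_of_mul_eq_mul_left ha (by omega)

end Tuples

namespace SmoothCompleteFan

variable {d s : ℕ} {n : Fin s → ℕ} (X : SmoothCompleteFan d ((i : Fin s) × Fin (n i)))

theorem sum_mobius {b : Fin s → ℕ} (hb : ∀ i, b i ≠ 0) :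
    ∑ e ∈ Fintype.piFinset fun i => (b i).divisors, X.mobius e = X.coprimeInd b := by
  have hmem : b ∈ Fintype.piFinset fun i => (b i).divisors :=
    Fintype.mem_piFinset.2 fun i => Nat.mem_divisors_self _ (hb i)
  rw [← Finset.add_sum_erase _ _ hmem]
  nth_rewrite 1 [mobius]
  rw [Finset.sum_attach _ X.mobius, sub_add_cancel]

/-- This is Möbius inversion in each variable: insert `sum_mobius`, exchange the sums, and use the
orthogonality relation `sum_moebius_multiples`. It serves to bound `μ` by the number of divisor
tuples. -/
theorem mobius_eq_sum {b : Fin s → ℕ} (hb : ∀ i, b i ≠ 0) :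
    X.mobius b = ∑ e ∈ Fintype.piFinset fun i => (b i).divisors,
      (∏ i, ArithmeticFunction.moebius (b i / e i)) * X.coprimeInd e := by
  have h1 : ∀ e ∈ Fintype.piFinset fun i => (b i).divisors,
      (∏ i, ArithmeticFunction.moebius (b i / e i)) * X.coprimeInd e =
      ∑ f ∈ Fintype.piFinset fun i => (b i).divisors,
        (if ∀ i, f i ∣ e i then (∏ i, ArithmeticFunction.moebius (b i / e i)) * X.mobius f
          else 0) := by
    intro e he
    have he' : ∀ i, e i ∣ b i := fun i => Nat.dvd_of_mem_divisors (Fintype.mem_piFinset.1 he i)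
    have he0 : ∀ i, e i ≠ 0 := fun i h => hb i (by simpa [h] using he' i)
    rw [← X.sum_mobius he0, Finset.mul_sum, ← Finset.sum_filter]
    refine Finset.sum_congr ?_ fun _ _ => rfl
    ext f
    simp only [Fintype.mem_piFinset, Finset.mem_filter, Nat.mem_divisors]
    exact ⟨fun h => ⟨fun i => ⟨(h i).1.trans (he' i), hb i⟩, fun i => (h i).1⟩,
      fun h i => ⟨h.2 i, he0 i⟩⟩
  rw [Finset.sum_congr rfl h1, Finset.sum_comm]
  have h2 : ∀ f ∈ Fintype.piFinset fun i => (b i).divisors,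
      (∑ e ∈ Fintype.piFinset fun i => (b i).divisors,
        (if ∀ i, f i ∣ e i then (∏ i, ArithmeticFunction.moebius (b i / e i)) * X.mobius f
          else 0)) = if f = b then X.mobius f else 0 := by
    intro f hf
    have hf' : ∀ i, f i ∣ b i := fun i => Nat.dvd_of_mem_divisors (Fintype.mem_piFinset.1 hf i)
    rw [← Finset.sum_filter, ← Finset.sum_mul]
    have h3 : (Fintype.piFinset fun i => (b i).divisors).filter (fun e => ∀ i, f i ∣ e i) =
        Fintype.piFinset fun i => (b i).divisors.filter (f i ∣ ·) := by
      ext e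
      simp only [Fintype.mem_piFinset, Finset.mem_filter]
      exact ⟨fun h i => ⟨h.1 i, h.2 i⟩, fun h => ⟨fun i => (h i).1, fun i => (h i).2⟩⟩
    rw [h3, ← Finset.prod_univ_sum (fun i => (b i).divisors.filter (f i ∣ ·))
      (fun i e => ArithmeticFunction.moebius (b i / e)),
      Finset.prod_congr rfl fun i _ => sum_moebius_multiples (hb i) (hf' i)]
    by_cases hfb : f = b
    · simp [hfb]
    · obtain ⟨i, hi⟩ := Function.ne_iff.1 hfb
      rw [Finset.prod_eq_zero (Finset.mem_univ i) (if_neg hi), if_neg hfb, zero_mul]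
  rw [Finset.sum_congr rfl h2, Finset.sum_ite_eq', if_pos]
  exact Fintype.mem_piFinset.2 fun i => Nat.mem_divisors_self _ (hb i)

theorem coprimeInd_nonneg (b : Fin s → ℕ) : 0 ≤ X.coprimeInd b := by
  unfold coprimeInd
  split_ifs <;> simp

theorem coprimeInd_le_one (b : Fin s → ℕ) : X.coprimeInd b ≤ 1 := by
  unfold coprimeInd
  split_ifs <;> simp

theorem abs_mobius_le {b : Fin s → ℕ} (hb : ∀ i, b i ≠ 0) :
    |(X.mobius b : ℝ)| ≤ ∏ i, ((b i).divisors.card : ℝ) := by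
  have h : |X.mobius b| ≤ ∏ i, ((b i).divisors.card : ℤ) := by
    rw [X.mobius_eq_sum hb]
    refine (Finset.abs_sum_le_sum_abs _ _).trans ?_
    have : ∀ e ∈ Fintype.piFinset fun i => (b i).divisors,
        |(∏ i, ArithmeticFunction.moebius (b i / e i)) * X.coprimeInd e| ≤ 1 := by
      intro e _
      rw [abs_mul, Finset.abs_prod, abs_of_nonneg (X.coprimeInd_nonneg e)]
      exact mul_le_one₀ (Finset.prod_le_one (fun i _ => abs_nonneg _)
        fun i _ => ArithmeticFunction.abs_moebius_le_one) (X.coprimeInd_nonneg e)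
        (X.coprimeInd_le_one e)
    refine (Finset.sum_le_sum this).trans ?_
    simp [Fintype.card_piFinset]
  exact_mod_cast h

theorem summable_abs_mobius :
    Summable fun e : Fin s → ℕ+ => |(X.mobius (fun i => e i) : ℝ)| *
      ∏ i, (√(e i : ℝ) / (e i : ℝ) ^ 2) := by
  have h := summable_prod_of_summable (s := s)
    (fun _ (e : ℕ+) => ((e : ℕ).divisors.card : ℝ) * (√(e : ℝ) / (e : ℝ) ^ 2))
    (fun _ _ => by positivity) fun _ => summable_card_divisors_mul_sqrt_div_sq
  refine Summable.of_nonneg_of_le (fun e => by positivity) (fun e => ?_) h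
  rw [Finset.prod_mul_distrib]
  exact mul_le_mul_of_nonneg_right (X.abs_mobius_le fun i => (e i).ne_zero) (by positivity)

theorem one_div_pow_le_sqrt_div_sq {k : ℕ} (hk : 2 ≤ k) (e : ℕ+) :
    1 / (e : ℝ) ^ k ≤ √(e : ℝ) / (e : ℝ) ^ 2 := by
  have he : (1 : ℝ) ≤ e := by exact_mod_cast e.pos
  exact div_le_div₀ (by positivity) (Real.one_le_sqrt.2 he) (by positivity)
    (pow_le_pow_right₀ he hk)

theorem summable_mobius {ϖ : Fin s → ℕ} (hϖ : ∀ i, 2 ≤ ϖ i) (κ : Fin s → ℝ) :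
    Summable fun e : Fin s → ℕ+ => (X.mobius (fun i => e i) : ℝ) *
      ∏ i, κ i / (e i : ℝ) ^ ϖ i := by
  refine Summable.of_norm_bounded (X.summable_abs_mobius.mul_left (∏ i, |κ i|)) fun e => ?_
  rw [norm_mul, Real.norm_eq_abs, Real.norm_eq_abs, Finset.abs_prod, mul_left_comm]
  refine mul_le_mul_of_nonneg_left ?_ (abs_nonneg _)
  rw [← Finset.prod_mul_distrib]
  refine Finset.prod_le_prod (fun i _ => abs_nonneg _) fun i _ => ?_
  rw [abs_div, abs_of_nonneg (a := (e i : ℝ) ^ ϖ i) (by positivity), div_eq_mul_one_div]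
  exact mul_le_mul_of_nonneg_left (one_div_pow_le_sqrt_div_sq (hϖ i) (e i)) (abs_nonneg _)

theorem coprimeInd_one (h : X.maxCones.Nonempty) : X.coprimeInd 1 = 1 := by
  unfold coprimeInd
  rw [if_pos]
  obtain ⟨σ, hσ⟩ := h
  refine Nat.dvd_one.1 ?_
  have := Finset.gcd_dvd (f := fun σ => ∏ i ∈ coneIndex σ, (1 : Fin s → ℕ) i) hσ
  simpa using this

/-- Multiply by the series of the completely multiplicative weights `Φ`. Convolution turns `μ` into
`coprimeInd`, so the product is a series of nonnegative terms whose term at `b = 1` is positive; the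
other factor is nonnegative. -/
theorem tsum_mobius_pos (hX : X.maxCones.Nonempty) {ϖ : Fin s → ℕ} (hϖ : ∀ i, 2 ≤ ϖ i) :
    0 < ∑' e : Fin s → ℕ+, (X.mobius (fun i => e i) : ℝ) * ∏ i, 1 / (e i : ℝ) ^ ϖ i := by
  set Φ : (Fin s → ℕ+) → ℝ := fun e => ∏ i, 1 / (e i : ℝ) ^ ϖ i with hΦ
  have hΦ0 : ∀ e, 0 < Φ e := fun e => Finset.prod_pos fun i _ => by
    have : (0 : ℝ) < e i := by exact_mod_cast (e i).pos
    positivity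
  have hΦm : ∀ e f, Φ (e * f) = Φ e * Φ f := fun e f => by
    simp only [hΦ, Pi.mul_apply, PNat.mul_coe, Nat.cast_mul, mul_pow, ← Finset.prod_mul_distrib]
    exact Finset.prod_congr rfl fun i _ => by rw [one_div_mul_one_div]
  have hΦs : Summable Φ := summable_prod_of_summable (fun i (e : ℕ+) => 1 / (e : ℝ) ^ ϖ i)
    (fun _ _ => by positivity) fun i => Summable.of_nonneg_of_le (fun _ => by positivity)
      (one_div_pow_le_sqrt_div_sq (hϖ i)) summable_sqrt_div_sq
  have hμs : Summable fun e : Fin s → ℕ+ => (X.mobius (fun i => e i) : ℝ) * Φ e :=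
    X.summable_mobius hϖ 1
  have hprod := summable_mul_of_summable_norm hμs.norm hΦs.norm
  have hmul := tsum_mul_tsum_of_summable_norm hμs.norm hΦs.norm
  let pr : (Fin s → ℕ+) × (Fin s → ℕ+) → (Fin s → ℕ+) := fun p => p.1 * p.2
  have hfib : ∀ b : Fin s → ℕ+, ∑' p : {p // pr p = b},
      ((X.mobius (fun i => p.1.1 i) : ℝ) * Φ p.1.1 * Φ p.1.2) =
      (X.coprimeInd fun i => b i) * Φ b := by
    intro b
    have h1 : ∀ p : {p // pr p = b}, (X.mobius (fun i => p.1.1 i) : ℝ) * Φ p.1.1 * Φ p.1.2 =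
        X.mobius (fun i => p.1.1 i) * Φ b := fun p => by
      rw [mul_assoc, ← hΦm, show p.1.1 * p.1.2 = b from p.2]
    rw [tsum_congr h1, tsum_mul_right]
    congr 1
    rw [← X.sum_mobius fun i => (b i).ne_zero, Int.cast_sum, ← Finset.tsum_subtype]
    let F : {p // pr p = b} → {e // e ∈ Fintype.piFinset fun i => (b i : ℕ).divisors} :=
      fun p => ⟨fun i => p.1.1 i, Fintype.mem_piFinset.2 fun i => Nat.mem_divisors.2
        ⟨⟨p.1.2 i, by
          have := congrFun p.2 i
          exact (congrArg PNat.val this).symm⟩, (b i).ne_zero⟩⟩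
    have hF : Function.Bijective F := by
      constructor
      · rintro ⟨⟨e, f⟩, hp⟩ ⟨⟨e', f'⟩, hp'⟩ h
        have h' : ∀ i, (e i : ℕ) = e' i := fun i => congrFun (congrArg Subtype.val h) i
        have he : e = e' := funext fun i => PNat.coe_injective (h' i)
        subst he
        have hf : f = f' := mul_left_cancel (a := e) (hp.trans hp'.symm)
        subst hf
        rfl
      · rintro ⟨e, he⟩
        have he' := fun i => Nat.dvd_of_mem_divisors (Fintype.mem_piFinset.1 he i)
        choose f hf using he'
        have he0 : ∀ i, 0 < e i := fun i => Nat.pos_of_ne_zero fun h => by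
          have := hf i
          rw [h, zero_mul] at this
          exact (b i).ne_zero this
        have hf0 : ∀ i, 0 < f i := fun i => Nat.pos_of_ne_zero fun h => by
          have := hf i
          rw [h, mul_zero] at this
          exact (b i).ne_zero this
        exact ⟨⟨(fun i => ⟨e i, he0 i⟩, fun i => ⟨f i, hf0 i⟩),
          funext fun i => PNat.coe_injective (hf i).symm⟩, rfl⟩
    exact (Equiv.ofBijective F hF).tsum_eq
      (fun e : {e // e ∈ Fintype.piFinset fun i => (b i : ℕ).divisors} => (X.mobius e.1 : ℝ))
  have hsig := (Equiv.sigmaFiberEquiv pr).summable_iff.2 hprod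
  have hsum : ∑' b : Fin s → ℕ+, ((X.coprimeInd fun i => b i : ℤ) : ℝ) * Φ b =
      ∑' p : (Fin s → ℕ+) × (Fin s → ℕ+),
        (X.mobius (fun i => p.1 i) : ℝ) * Φ p.1 * Φ p.2 := by
    rw [← (Equiv.sigmaFiberEquiv pr).tsum_eq]
    refine Eq.trans ?_ (Summable.tsum_sigma hsig).symm
    exact tsum_congr fun b => (hfib b).symm
  have hχs : Summable fun b : Fin s → ℕ+ => ((X.coprimeInd fun i => b i : ℤ) : ℝ) * Φ b := by
    refine Summable.of_nonneg_of_le (fun b => ?_) (fun b => ?_) hΦs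
    · exact mul_nonneg (by exact_mod_cast X.coprimeInd_nonneg _) (hΦ0 b).le
    · exact mul_le_of_le_one_left (hΦ0 b).le (by exact_mod_cast X.coprimeInd_le_one _)
  have hpos : 0 < ∑' b : Fin s → ℕ+, ((X.coprimeInd fun i => b i : ℤ) : ℝ) * Φ b := by
    refine hχs.tsum_pos (fun b => ?_) 1 ?_
    · exact mul_nonneg (by exact_mod_cast X.coprimeInd_nonneg _) (hΦ0 b).le
    · have : (X.coprimeInd fun i => ((1 : Fin s → ℕ+) i : ℕ)) = 1 := X.coprimeInd_one hX
      rw [this]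
      simpa using hΦ0 1
  rw [hsum, ← hmul] at hpos
  have hζ : 0 ≤ ∑' e, Φ e := tsum_nonneg fun e => (hΦ0 e).le
  by_contra hneg
  exact absurd hpos (not_lt.2 (mul_nonpos_of_nonpos_of_nonneg (not_lt.1 hneg) hζ))

end SmoothCompleteFan

/-! ### Removing the coprimality condition -/

section Coprime

variable {d s : ℕ} {n t : Fin s → ℕ} (X : SmoothCompleteFan d ((i : Fin s) × Fin (n i)))

/-- The greatest common divisor of the coordinates of an integral vector. -/
def gcdAbs {m : ℕ} (x : Fin m → ℤ) : ℕ := Finset.univ.gcd fun j => (x j).natAbs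

theorem dvd_gcdAbs_iff {m : ℕ} (x : Fin m → ℤ) (e : ℕ) : e ∣ gcdAbs x ↔ ∀ j, (e : ℤ) ∣ x j := by
  simp [gcdAbs, Finset.dvd_gcd_iff, Int.natCast_dvd]

theorem gcdAbs_ne_zero {m : ℕ} {t : ℕ} (c : Fin t → Fin m → ℚ) (hm : 0 < m) (x : nzSol c) :
    gcdAbs x.1 ≠ 0 := by
  intro h
  rw [gcdAbs, Finset.gcd_eq_zero_iff] at h
  exact x.2.2 ⟨0, hm⟩ (by simpa using h ⟨0, hm⟩ (Finset.mem_univ _))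

theorem supAbs_mul {m : ℕ} (e : ℕ) (x : Fin m → ℤ) :
    supAbs (fun j => (e : ℤ) * x j) = e * supAbs x := by
  unfold supAbs
  simp only [Int.natAbs_mul, Int.natAbs_natCast]
  exact (Finset.apply_sup_eq_sup_comp (fun a => e * a) (fun a b => Nat.mul_max_mul_left e a b |>.symm)
    (mul_zero e)).symm

theorem hasSum_ite_dvd (f : (Fin s → ℕ) → ℝ) {g : Fin s → ℕ} (hg : ∀ i, g i ≠ 0) :
    HasSum (fun e : Fin s → ℕ+ => if ∀ i, (e i : ℕ) ∣ g i then f (fun i => e i) else 0)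
      (∑ e ∈ Fintype.piFinset fun i => (g i).divisors, f e) := by
  have hinj : Function.Injective fun (e : Fin s → ℕ+) i => (e i : ℕ) := fun e e' h =>
    funext fun i => PNat.coe_injective (congrFun h i)
  have h1 : HasSum (fun e : Fin s → ℕ => if ∀ i, e i ∣ g i then f e else 0)
      (∑ e ∈ Fintype.piFinset fun i => (g i).divisors, f e) := by
    have h2 : ∀ e ∈ Fintype.piFinset fun i => (g i).divisors,
        f e = if ∀ i, e i ∣ g i then f e else 0 := fun e he => by
      rw [if_pos fun i => Nat.dvd_of_mem_divisors (Fintype.mem_piFinset.1 he i)]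
    rw [Finset.sum_congr rfl h2]
    refine hasSum_sum_of_ne_finset_zero fun e he => if_neg fun h => he ?_
    exact Fintype.mem_piFinset.2 fun i => Nat.mem_divisors.2 ⟨h i, hg i⟩
  have h3 : ∀ e ∉ Set.range fun (e : Fin s → ℕ+) i => (e i : ℕ),
      (if ∀ i, e i ∣ g i then f e else 0) = 0 := by
    intro e he
    rw [if_neg]
    intro h
    refine he ⟨fun i => ⟨e i, Nat.pos_of_dvd_of_pos (h i) (Nat.pos_of_ne_zero (hg i))⟩, ?_⟩
    funext i
    simp only [PNat.mk_coe]
  exact (hinj.hasSum_iff h3).2 h1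

theorem hasSum_mobius {g : Fin s → ℕ} (hg : ∀ i, g i ≠ 0) :
    HasSum (fun e : Fin s → ℕ+ => if ∀ i, (e i : ℕ) ∣ g i then (X.mobius (fun i => e i) : ℝ) else 0)
      (X.coprimeInd g) := by
  rw [← X.sum_mobius hg, Int.cast_sum]
  exact hasSum_ite_dvd (fun e => (X.mobius e : ℝ)) hg

namespace RegionData

variable {S : Type} (A : RegionData s S)

/-- The tuples of integral solutions that satisfy the coprimality conditions of the fan. -/
def coprimeTuples (c : ∀ i, Fin (t i) → Fin (n i) → ℚ) (T : ℝ) : Set (∀ i, nzSol (c i)) :=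
  {x | x ∈ A.tuples c 1 T ∧ X.coprimeInd (fun i => gcdAbs (x i).1) = 1}

/-- Multiplication of the `i`-th solution by `e i` multiplies its norm by `e i`, which is the
scaling built into `tuples`. -/
theorem ncard_tuples_dvd (c : ∀ i, Fin (t i) → Fin (n i) → ℚ) (e : Fin s → ℕ+) (T : ℝ) :
    {x ∈ A.tuples c 1 T | ∀ i, (e i : ℕ) ∣ gcdAbs (x i).1}.ncard =
      (A.tuples c (fun i => e i) T).ncard := by
  symm
  have he : ∀ i, ((e i : ℕ) : ℤ) ≠ 0 := fun i => by exact_mod_cast (e i).ne_zero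
  refine Set.ncard_congr (fun x _ i => ⟨fun j => (e i : ℕ) * (x i).1 j, fun l => ?_,
    fun j => mul_ne_zero (he i) ((x i).2.2 j)⟩) ?_ ?_ ?_
  · have := (x i).2.1 l
    simp only [Int.cast_mul, mul_left_comm _ (((e i : ℕ) : ℤ) : ℚ), ← Finset.mul_sum, this,
      mul_zero]
  · intro x hx
    refine ⟨?_, fun i => (dvd_gcdAbs_iff _ _).2 fun j => dvd_mul_right _ _⟩
    simpa [tuples, supAbs_mul] using hx
  · intro x y _ _ h
    funext i
    refine Subtype.ext (funext fun j => mul_left_cancel₀ (he i) ?_)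
    exact congrFun (congrArg Subtype.val (congrFun h i)) j
  · rintro y ⟨hy, hd⟩
    have hd' := fun i => (dvd_gcdAbs_iff _ _).1 (hd i)
    choose x hx using hd'
    have hmem : ∀ i, x i ∈ nzSol (c i) := fun i => by
      refine ⟨fun l => ?_, fun j h => (y i).2.2 j (by rw [hx, h, mul_zero])⟩
      have h1 := (y i).2.1 l
      simp only [hx, Int.cast_mul, mul_left_comm _ (((e i : ℕ) : ℤ) : ℚ), ← Finset.mul_sum,
        mul_eq_zero, Int.cast_eq_zero, he i, false_or] at h1
      exact h1
    have hyx : ∀ i, (y i).1 = fun j => ((e i : ℕ) : ℤ) * x i j := fun i => funext (hx i)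
    refine ⟨fun i => ⟨x i, hmem i⟩, ?_, funext fun i => Subtype.ext (hyx i).symm⟩
    simpa [tuples, hyx, supAbs_mul] using hy

theorem hasSum_coprimeTuples [Nonempty S] (hn : ∀ i, 0 < n i)
    (c : ∀ i, Fin (t i) → Fin (n i) → ℚ) (T : ℝ) :
    HasSum (fun e : Fin s → ℕ+ => (X.mobius (fun i => e i) : ℝ) *
      (A.tuples c (fun i => e i) T).ncard) (A.coprimeTuples X c T).ncard := by
  classical
  have hfin : (A.tuples c 1 T).Finite := A.finite_tuples hn c (fun _ => Nat.one_pos) T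
  have h1 := hasSum_sum (s := hfin.toFinset) fun x _ =>
    hasSum_mobius X (g := fun i => gcdAbs (x i).1) fun i => gcdAbs_ne_zero (c i) (hn i) (x i)
  convert h1 using 1
  · funext e
    rw [← A.ncard_tuples_dvd, ← Finset.sum_filter, Finset.sum_const, nsmul_eq_mul, mul_comm]
    congr 2
    rw [← Set.ncard_coe_finset]
    congr 1
    ext x
    simp
  · have h2 : ∀ x : ∀ i, nzSol (c i), ((X.coprimeInd fun i => gcdAbs (x i).1 : ℤ) : ℝ) =
        if X.coprimeInd (fun i => gcdAbs (x i).1) = 1 then 1 else 0 := fun x => by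
      unfold SmoothCompleteFan.coprimeInd
      split_ifs <;> simp_all
    rw [Finset.sum_congr rfl fun x _ => h2 x, ← Finset.sum_filter, Finset.sum_const, nsmul_eq_mul,
      mul_one]
    congr 1
    rw [← Set.ncard_coe_finset]
    congr 1
    ext x
    simp [coprimeTuples]

/-- The counts for the single `e` are inserted into the sum over `μ`. The error of
`exists_ncard_tuples_bound` depends on `e` through `∏ √(e i) / e i ^ 2`, summable against `|μ(e)|`
by `summable_abs_mobius`. -/
theorem exists_ncard_coprimeTuples_bound [Fintype S] [Nonempty S] (i₁ : Fin s)
    (hn : ∀ i, 0 < n i) (c : ∀ i, Fin (t i) → Fin (n i) → ℚ)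
    (hdim : ∀ i, Module.finrank ℝ (solSpace (c i)) = A.ϖ i) (hϖ : ∀ i, 2 ≤ A.ϖ i)
    (hj : ∀ i j, ∃ w : solSpace (c i), (w : EuclideanSpace ℝ (Fin (n i))) j ≠ 0) :
    ∃ C : ℝ, 0 ≤ C ∧ ∀ T : ℝ, 1 ≤ T →
      |(A.coprimeTuples X c T).ncard - (∑' e : Fin s → ℕ+, (X.mobius (fun i => e i) : ℝ) *
        ∏ i, boxDensity (c i) / (e i : ℝ) ^ A.ϖ i) * A.mass T| ≤
        C * (Real.exp T * T ^ (A.rk - 1) / T) := by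
  obtain ⟨C, hC, h⟩ := A.exists_ncard_tuples_bound i₁ hn c hdim hϖ hj
  set Z := ∑' e : Fin s → ℕ+, |(X.mobius (fun i => e i) : ℝ)| *
      ∏ i, (√(e i : ℝ) / (e i : ℝ) ^ 2) with hZ
  refine ⟨C * Z, mul_nonneg hC (tsum_nonneg fun e => by positivity), fun T hT => ?_⟩
  set E := Real.exp T * T ^ (A.rk - 1) / T with hE
  have hE0 : 0 ≤ E := by positivity
  have hdiff := (A.hasSum_coprimeTuples X hn c T).sub
    ((X.summable_mobius hϖ fun i => boxDensity (c i)).hasSum.mul_right (A.mass T))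
  have hbound := (X.summable_abs_mobius.mul_right (C * E))
  rw [← hdiff.tsum_eq]
  rw [← Real.norm_eq_abs]
  refine (tsum_of_norm_bounded hbound.hasSum fun e => ?_).trans (le_of_eq ?_)
  · rw [mul_assoc, ← mul_sub, norm_mul, Real.norm_eq_abs, Real.norm_eq_abs, mul_assoc]
    refine mul_le_mul_of_nonneg_left ?_ (abs_nonneg _)
    refine (h (fun i => e i) (fun i => (e i).pos) T hT).trans (le_of_eq ?_)
    ring
  · rw [tsum_mul_right, ← hZ]
    ring

end RegionData

end Coprime

/-! ### Divisor classes and exchange of rays in a smooth complete fan -/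

namespace SmoothCompleteFan

section General

variable {d : ℕ} {ι : Type} [Fintype ι] [DecidableEq ι] (X : SmoothCompleteFan d ι)

theorem maxCones_nonempty : X.maxCones.Nonempty := by
  obtain ⟨σ, hσ, -⟩ := X.exists_mem_cone 0
  exact ⟨σ, hσ⟩

theorem card_of_mem_maxCones (σ : X.maxCones) : σ.1.card = d := by
  have h := Module.finrank_eq_card_basis (X.coneBasis σ)
  rw [Module.finrank_fin_fun, Fintype.card_coe] at h
  exact h.symm

theorem coneBasis_apply (σ : X.maxCones) (ρ : σ.1) : X.coneBasis σ ρ = X.gen ρ := by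
  simp [coneBasis]

/-- The character `u_{σ,D}` as a vector of `M = ℤ^d`. -/
noncomputable def charVec (D : ι → ℤ) (σ : X.maxCones) : Fin d → ℤ := fun k => X.coneChar D σ (Pi.single k 1)

theorem coneChar_eq_sum (D : ι → ℤ) (σ : X.maxCones) (v : Fin d → ℤ) :
    X.coneChar D σ v = ∑ k, X.charVec D σ k * v k := by
  conv_lhs => rw [pi_eq_sum_univ v, map_sum]
  refine Finset.sum_congr rfl fun k _ => ?_
  rw [map_smul, smul_eq_mul, mul_comm]
  congr 2
  ext j
  simp [Pi.single_apply, eq_comm]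

theorem atCone_eq_sub (D : ι → ℤ) (σ : X.maxCones) :
    X.atCone D σ = D - X.divChar (X.charVec D σ) := by
  ext ρ
  simp [atCone, coneChar_eq_sum, divChar]

theorem divChar_charVec (D : ι → ℤ) (σ : X.maxCones) {ρ : ι} (hρ : ρ ∈ σ.1) :
    X.divChar (X.charVec D σ) ρ = D ρ := by
  change ∑ k, X.charVec D σ k * X.gen ρ k = D ρ
  rw [← coneChar_eq_sum, coneChar, ← X.coneBasis_apply σ ⟨ρ, hρ⟩, Module.Basis.constr_basis]

theorem atCone_of_mem (D : ι → ℤ) (σ : X.maxCones) {ρ : ι} (hρ : ρ ∈ σ.1) :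
    X.atCone D σ ρ = 0 := by
  rw [atCone_eq_sub, Pi.sub_apply, X.divChar_charVec D σ hρ, sub_self]

theorem eq_zero_of_divChar_eq_zero (σ : X.maxCones) {m : Fin d → ℤ}
    (h : ∀ ρ ∈ σ.1, X.divChar m ρ = 0) : m = 0 := by
  let ψ : (Fin d → ℤ) →ₗ[ℤ] ℤ := Fintype.linearCombination ℤ m
  have hψ : ∀ v, ψ v = ∑ k, m k * v k := fun v => by
    simp [ψ, Fintype.linearCombination_apply, mul_comm]
  have h0 : ψ = 0 := (X.coneBasis σ).ext fun ρ => by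
    rw [X.coneBasis_apply, hψ]
    exact h ρ ρ.2
  funext k
  have := hψ (Pi.single k 1)
  rw [h0] at this
  simpa [Pi.single_apply] using this.symm

theorem divChar_injective : Function.Injective X.divChar := by
  obtain ⟨σ, hσ⟩ := X.maxCones_nonempty
  rw [injective_iff_map_eq_zero]
  exact fun m hm => X.eq_zero_of_divChar_eq_zero ⟨σ, hσ⟩ fun ρ _ => congrFun hm ρ

theorem cls_eq_iff {D D' : ι → ℤ} : X.cls D = X.cls D' ↔ ∃ m, D = D' + X.divChar m := by
  rw [cls, cls, Submodule.Quotient.eq, LinearMap.mem_range]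
  exact ⟨fun ⟨m, hm⟩ => ⟨m, by rw [hm]; abel⟩, fun ⟨m, hm⟩ => ⟨m, by rw [hm]; abel⟩⟩

theorem cls_atCone (D : ι → ℤ) (σ : X.maxCones) : X.cls (X.atCone D σ) = X.cls D :=
  X.cls_eq_iff.2 ⟨-X.charVec D σ, by rw [atCone_eq_sub, map_neg, sub_eq_add_neg]⟩

/-- The generators of `σ` form a basis of `N`, so a character vanishing on all of them is trivial.
In particular `atCone D σ` is the only divisor of the class of `D` supported off `σ` (`eq_atCone`).
-/
theorem eq_of_cls_eq (σ : X.maxCones) {D D' : ι → ℤ} (h : X.cls D = X.cls D')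
    (h' : ∀ ρ ∈ σ.1, D ρ = D' ρ) : D = D' := by
  obtain ⟨m, rfl⟩ := X.cls_eq_iff.1 h
  have hm : m = 0 := X.eq_zero_of_divChar_eq_zero σ fun ρ hρ => by simpa using h' ρ hρ
  rw [hm, map_zero, add_zero]

theorem eq_atCone (σ : X.maxCones) {D D' : ι → ℤ} (h : X.cls D' = X.cls D)
    (h' : ∀ ρ ∈ σ.1, D' ρ = 0) : D' = X.atCone D σ :=
  X.eq_of_cls_eq σ (h.trans (X.cls_atCone D σ).symm) fun ρ hρ => by
    rw [h' ρ hρ, X.atCone_of_mem D σ hρ]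

theorem cls_sum (D : ι → ℤ) : X.cls D = ∑ ρ, D ρ • X.primeClass ρ := by
  change (LinearMap.range X.divChar).mkQ D = ∑ ρ, D ρ • (LinearMap.range X.divChar).mkQ _
  conv_lhs => rw [pi_eq_sum_univ' D, map_sum]
  refine Finset.sum_congr rfl fun ρ _ => ?_
  rw [← map_smul]

theorem atCone_smul (k : ℤ) (D : ι → ℤ) (σ : X.maxCones) :
    X.atCone (k • D) σ = k • X.atCone D σ := by
  symm
  refine X.eq_atCone σ ?_ fun ρ hρ => by simp [X.atCone_of_mem D σ hρ]
  change (LinearMap.range X.divChar).mkQ _ = (LinearMap.range X.divChar).mkQ _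
  rw [map_smul, map_smul]
  exact congrArg (k • ·) (X.cls_atCone D σ)

/-- If `k D` is trivial, then `0` and `k • atCone D σ` both represent it off `σ`, hence agree; so
`atCone D σ = 0`, and this represents `D`. -/
instance : Module.IsTorsionFree ℤ X.PicX := by
  refine Module.IsTorsionFree.of_smul_eq_zero fun k D h => ?_
  obtain ⟨D, rfl⟩ := Submodule.Quotient.mk_surjective _ D
  by_cases hk : k = 0
  · exact Or.inl hk
  refine Or.inr ?_
  obtain ⟨σ, hσ⟩ := X.maxCones_nonempty
  have h1 : (0 : ι → ℤ) = X.atCone (k • D) ⟨σ, hσ⟩ :=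
    X.eq_atCone _ (by rw [cls, cls, Submodule.Quotient.mk_smul, h]; rfl) fun _ _ => rfl
  rw [X.atCone_smul] at h1
  have h2 : X.atCone D ⟨σ, hσ⟩ = 0 := (smul_eq_zero.1 h1.symm).resolve_left hk
  have h3 := X.cls_atCone D ⟨σ, hσ⟩
  rw [h2] at h3
  exact h3.symm

theorem finrank_picX : Module.finrank ℤ X.PicX + d = Fintype.card ι := by
  have h := (LinearMap.range X.divChar).finrank_quotient_add_finrank
  rw [LinearMap.finrank_range_of_inj X.divChar_injective] at h
  simpa using h

theorem sum_smul_gen_apply (F : Finset ι) (a : ι → ℝ) (m : Fin d → ℤ) :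
    ∑ k, (m k : ℝ) * (∑ ρ ∈ F, a ρ • fun k => (X.gen ρ k : ℝ)) k =
      ∑ ρ ∈ F, a ρ * (X.divChar m ρ : ℝ) := by
  simp only [divChar, LinearMap.coe_mk, AddHom.coe_mk, Int.cast_sum, Int.cast_mul, Finset.mul_sum,
    Finset.sum_apply, Pi.smul_apply, smul_eq_mul]
  rw [Finset.sum_comm]
  exact Finset.sum_congr rfl fun k _ => Finset.sum_congr rfl fun ρ _ => by ring

/-- Coefficients with respect to the generators of a maximal cone. -/
theorem coeff_eq (σ : X.maxCones) {a : ι → ℝ} {v : Fin d → ℝ}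
    (hv : v = ∑ ρ ∈ σ.1, a ρ • fun k => (X.gen ρ k : ℝ)) {ρ : ι} (hρ : ρ ∈ σ.1) :
    a ρ = ∑ k, (X.charVec (Pi.single ρ 1) σ k : ℝ) * v k := by
  have h := X.sum_smul_gen_apply σ.1 a (X.charVec (Pi.single ρ 1) σ)
  rw [← hv] at h
  rw [h, Finset.sum_congr rfl fun θ hθ => by rw [X.divChar_charVec _ σ hθ],
    Finset.sum_eq_single ρ (fun θ _ hθ => by simp [hθ]) fun h => absurd hρ h]
  simp

theorem sum_charVec_smul_gen (σ : X.maxCones) (v : Fin d → ℤ) :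
    v = ∑ ρ ∈ σ.1, (∑ k, X.charVec (Pi.single ρ 1) σ k * v k) • X.gen ρ := by
  have h1 : ∀ ρ : σ.1, ∑ k, X.charVec (Pi.single ρ.1 1) σ k * v k = (X.coneBasis σ).repr v ρ := by
    intro ρ
    rw [← coneChar_eq_sum]
    conv_lhs => rw [← (X.coneBasis σ).sum_repr v, map_sum]
    rw [Finset.sum_eq_single ρ]
    · rw [map_smul, coneChar, Module.Basis.constr_basis]
      simp
    · intro θ _ hθ
      rw [map_smul, coneChar, Module.Basis.constr_basis, Pi.single_eq_of_ne, smul_zero]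
      exact fun h => hθ (Subtype.ext h)
    · exact fun h => absurd (Finset.mem_univ _) h
  conv_lhs => rw [← (X.coneBasis σ).sum_repr v]
  rw [← Finset.sum_coe_sort σ.1]
  exact Finset.sum_congr rfl fun ρ _ => by rw [X.coneBasis_apply, h1]

/-- Both prime divisors are representatives of one class supported off `σ`, and there is only one.
So a maximal cone misses at most one ray of each class. -/
theorem not_mem_of_primeClass_eq (σ : X.maxCones) {ρ ρ' : ι}
    (h : X.primeClass ρ = X.primeClass ρ') (hρ : ρ ∉ σ.1) (hρ' : ρ' ∉ σ.1) : ρ = ρ' := by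
  have h1 := X.eq_of_cls_eq σ h fun θ hθ => by
    rw [Pi.single_eq_of_ne (ne_of_mem_of_not_mem hθ hρ),
      Pi.single_eq_of_ne (ne_of_mem_of_not_mem hθ hρ')]
  by_contra hne
  have := congrFun h1 ρ
  rw [Pi.single_eq_same, Pi.single_eq_of_ne hne] at this
  exact one_ne_zero this

/-- Equality of the classes gives a character `m` that is `1` on `ρ`, `-1` on `ρ'` and `0` on all
other rays. Let `w` be the sum of the generators of the facet `τ` opposite `ρ'`. Some maximal cone
`σ'` contains `k w + gen ρ` for infinitely many `k`. In the limit it contains `w`, an interior point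
of `τ`, so `τ ⊆ σ'` by `inter_subset`; evaluating `m` gives `ρ ∈ σ'`. Both sets have `d` elements,
so `σ' = τ ∪ {ρ}`. -/
theorem insert_erase_mem_maxCones (σ : X.maxCones) {ρ ρ' : ι}
    (h : X.primeClass ρ = X.primeClass ρ') (hρ : ρ ∉ σ.1) (hρ' : ρ' ∈ σ.1) :
    insert ρ (σ.1.erase ρ') ∈ X.maxCones := by
  have hne : ρ ≠ ρ' := fun e => hρ (e ▸ hρ')
  obtain ⟨m, hm⟩ := X.cls_eq_iff.1 h
  have hm' : ∀ θ, X.divChar m θ = (if θ = ρ then 1 else 0) - if θ = ρ' then 1 else 0 := fun θ => by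
    have := congrFun hm θ
    simp only [Pi.add_apply, Pi.single_apply] at this
    linarith
  set τ := σ.1.erase ρ' with hτ
  set w : Fin d → ℤ := ∑ θ ∈ τ, X.gen θ with hw
  have hcone : ∀ k : ℕ, ∃ σ' : X.maxCones,
      (fun j => ((k * w j + X.gen ρ j : ℤ) : ℝ)) ∈ coneOf X.gen σ'.1 := fun k => by
    obtain ⟨σ', h1, h2⟩ := X.exists_mem_cone fun j => ((k * w j + X.gen ρ j : ℤ) : ℝ)
    exact ⟨⟨σ', h1⟩, h2⟩
  choose f hf using hcone
  obtain ⟨σ', hσ'⟩ := Finite.exists_infinite_fiber f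
  have hinf : (f ⁻¹' {σ'}).Infinite := Set.infinite_coe_iff.1 hσ'
  have hf' : ∀ k ∈ f ⁻¹' {σ'},
      (fun j => ((k * w j + X.gen ρ j : ℤ) : ℝ)) ∈ coneOf X.gen σ'.1 := fun k hk => by
    have := hf k
    rwa [show f k = σ' from hk] at this
  -- A negative coefficient of `w` would outweigh the fixed coefficient of `gen ρ` for some large
  -- `k`.
  have hW : ∀ θ ∈ σ'.1, 0 ≤ ∑ k, X.charVec (Pi.single θ 1) σ' k * w k := by
    intro θ hθ
    by_contra hneg
    push Not at hneg
    obtain ⟨k, hk, hk'⟩ := hinf.exists_gt (∑ j, X.charVec (Pi.single θ 1) σ' j * X.gen ρ j).toNat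
    obtain ⟨a, ha, hva⟩ := hf' k hk
    have h1 := X.coeff_eq σ' hva hθ
    have h2 := ha θ
    rw [h1] at h2
    have h3 : (0 : ℤ) ≤ ∑ j, X.charVec (Pi.single θ 1) σ' j * (k * w j + X.gen ρ j) := by
      exact_mod_cast h2
    simp only [mul_add, Finset.sum_add_distrib, mul_left_comm _ (k : ℤ), ← Finset.mul_sum] at h3
    have h4 : (∑ j, X.charVec (Pi.single θ 1) σ' j * X.gen ρ j) < k := by
      have := Int.self_le_toNat (∑ j, X.charVec (Pi.single θ 1) σ' j * X.gen ρ j)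
      omega
    nlinarith
  have hcast : ∀ (F : Finset ι) (b : ι → ℤ) (v : Fin d → ℤ), v = ∑ θ ∈ F, b θ • X.gen θ →
      (fun j => (v j : ℝ)) = ∑ θ ∈ F, (b θ : ℝ) • fun k => (X.gen θ k : ℝ) := by
    rintro F b _ rfl
    funext j
    simp
  have hw1 : (fun j => (w j : ℝ)) ∈ coneOf X.gen σ'.1 := by
    refine ⟨fun θ => if θ ∈ σ'.1 then
      ((∑ k, X.charVec (Pi.single θ 1) σ' k * w k : ℤ) : ℝ) else 0, fun θ => ?_, ?_⟩
    · dsimp only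
      split_ifs with hθ
      · exact_mod_cast hW θ hθ
      · exact le_rfl
    · rw [hcast _ _ _ (X.sum_charVec_smul_gen σ' w)]
      exact Finset.sum_congr rfl fun θ hθ => by dsimp only; rw [if_pos hθ]
  have hw2 : (fun j => (w j : ℝ)) =
      ∑ θ ∈ σ.1, (if θ ∈ τ then (1 : ℝ) else 0) • fun k => (X.gen θ k : ℝ) := by
    rw [hcast τ (fun _ => 1) w (by simp [hw])]
    simp only [ite_smul, zero_smul, Int.cast_one]
    rw [← Finset.sum_filter]
    congr 1
    ext θ
    simp only [hτ, Finset.mem_filter, Finset.mem_erase]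
    tauto
  obtain ⟨a, ha, hwa⟩ := X.inter_subset _ σ.2 _ σ'.2 ⟨⟨fun θ => if θ ∈ τ then 1 else 0,
    fun θ => by positivity, hw2⟩, hw1⟩
  have hwa' : (fun j => (w j : ℝ)) =
      ∑ θ ∈ σ.1, (if θ ∈ σ'.1 then a θ else 0) • fun k => (X.gen θ k : ℝ) := by
    rw [hwa]
    simp only [ite_smul, zero_smul]
    rw [← Finset.sum_filter, Finset.filter_mem_eq_inter]
  have hτσ' : τ ⊆ σ'.1 := fun θ hθ => by
    have hθσ : θ ∈ σ.1 := Finset.mem_of_mem_erase hθ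
    have h1 := (X.coeff_eq σ hw2 hθσ).trans (X.coeff_eq σ hwa' hθσ).symm
    rw [if_pos hθ] at h1
    by_contra h2
    rw [if_neg h2] at h1
    exact one_ne_zero h1
  -- `m` has the value `1` at `k w + gen ρ`, but is at most `0` on every ray other than `ρ`.
  have hρσ' : ρ ∈ σ'.1 := by
    obtain ⟨k, hk⟩ := hinf.nonempty
    obtain ⟨a, ha, hva⟩ := hf' k hk
    have h1 := X.sum_smul_gen_apply σ'.1 a m
    rw [← hva] at h1
    have h2 : ∑ j, m j * (k * w j + X.gen ρ j) = 1 := by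
      have h3 : ∑ j, m j * w j = 0 := by
        have : ∑ j, m j * w j = ∑ θ ∈ τ, X.divChar m θ := by
          simp only [hw, Finset.sum_apply, Finset.mul_sum]
          rw [Finset.sum_comm]
          rfl
        rw [this]
        refine Finset.sum_eq_zero fun θ hθ => ?_
        rw [hm', if_neg (ne_of_mem_of_not_mem (Finset.mem_of_mem_erase hθ) hρ),
          if_neg (Finset.ne_of_mem_erase hθ), sub_zero]
      have h4 : ∑ j, m j * X.gen ρ j = 1 := by
        have := hm' ρ
        rw [if_pos rfl, if_neg hne, sub_zero] at this
        exact this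
      simp only [mul_add, Finset.sum_add_distrib, mul_left_comm _ (k : ℤ), ← Finset.mul_sum, h3, h4]
      simp
    have h3 : ∑ j, (m j : ℝ) * ((k * w j + X.gen ρ j : ℤ) : ℝ) = 1 := by exact_mod_cast h2
    rw [h3] at h1
    by_contra hcon
    have h5 : ∑ θ ∈ σ'.1, a θ * (X.divChar m θ : ℝ) ≤ 0 := by
      refine Finset.sum_nonpos fun θ hθ => mul_nonpos_of_nonneg_of_nonpos (ha θ) ?_
      rw [hm', if_neg (ne_of_mem_of_not_mem hθ hcon)]
      split_ifs <;> simp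
    linarith
  have hsub : insert ρ τ ⊆ σ'.1 := Finset.insert_subset hρσ' hτσ'
  have hcard : (insert ρ τ).card = σ'.1.card := by
    rw [Finset.card_insert_of_notMem fun e => hρ (Finset.mem_of_mem_erase e),
      Finset.card_erase_add_one hρ', X.card_of_mem_maxCones, X.card_of_mem_maxCones]
  rw [Finset.eq_of_subset_of_card_le hsub hcard.ge]
  exact σ'.2

/-- A linear relation between the generators pairs to zero with divisors of characters. The
relations are thus the real linear forms on `Pic X`, and their coefficients depend only on the class
of a ray. -/
theorem sum_mul_eq_of_cls_eq {a : ι → ℝ} (ha : ∑ ρ, a ρ • (fun k => (X.gen ρ k : ℝ)) = 0)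
    {D D' : ι → ℤ} (h : X.cls D = X.cls D') : ∑ ρ, a ρ * D ρ = ∑ ρ, a ρ * D' ρ := by
  obtain ⟨m, rfl⟩ := X.cls_eq_iff.1 h
  have h1 := X.sum_smul_gen_apply Finset.univ a m
  rw [ha] at h1
  simp only [Pi.zero_apply, mul_zero, Finset.sum_const_zero] at h1
  simp only [Pi.add_apply, Int.cast_add, mul_add, Finset.sum_add_distrib, ← h1, add_zero]

theorem eq_of_primeClass_eq {a : ι → ℝ} (ha : ∑ ρ, a ρ • (fun k => (X.gen ρ k : ℝ)) = 0)
    {ρ ρ' : ι} (h : X.primeClass ρ = X.primeClass ρ') : a ρ = a ρ' := by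
  simpa [Pi.single_apply] using X.sum_mul_eq_of_cls_eq ha h

theorem finrank_relations :
    Module.finrank ℝ (LinearMap.ker
      (Fintype.linearCombination ℝ fun (ρ : ι) (k : Fin d) => (X.gen ρ k : ℝ))) =
      Module.finrank ℤ X.PicX := by
  have h := LinearMap.finrank_range_add_finrank_ker
    (Fintype.linearCombination ℝ fun (ρ : ι) (k : Fin d) => (X.gen ρ k : ℝ))
  have hr : LinearMap.range
      (Fintype.linearCombination ℝ fun (ρ : ι) (k : Fin d) => (X.gen ρ k : ℝ)) = ⊤ := by
    rw [LinearMap.range_eq_top]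
    intro v
    obtain ⟨σ, hσ, a, -, rfl⟩ := X.exists_mem_cone v
    refine ⟨fun ρ => if ρ ∈ σ then a ρ else 0, ?_⟩
    simp [Fintype.linearCombination_apply, ite_smul]
  rw [hr, finrank_top, Module.finrank_fin_fun, Module.finrank_fintype_fun_eq_card] at h
  have := X.finrank_picX
  omega

/-- By completeness `-∑ u ρ • gen ρ` lies in some cone: any vector becomes a relation after adding
nonnegative coefficients on a single maximal cone. -/
theorem exists_neg_sum_eq (u : ι → ℝ) : ∃ (σ : X.maxCones) (a : ι → ℝ), (∀ ρ, 0 ≤ a ρ) ∧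
    (∀ ρ ∉ σ.1, a ρ = 0) ∧ ∑ ρ, (u ρ + a ρ) • (fun k => (X.gen ρ k : ℝ)) = 0 := by
  obtain ⟨σ, hσ, a, ha, h⟩ := X.exists_mem_cone (-∑ ρ, u ρ • fun k => (X.gen ρ k : ℝ))
  refine ⟨⟨σ, hσ⟩, fun ρ => if ρ ∈ σ then a ρ else 0, fun ρ => ?_, fun ρ hρ => if_neg hρ, ?_⟩
  · dsimp only
    split_ifs
    · exact ha ρ
    · exact le_rfl
  · simp only [add_smul, Finset.sum_add_distrib, ite_smul, zero_smul, Finset.sum_ite_mem,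
      Finset.univ_inter, ← h, add_neg_cancel]

end General

end SmoothCompleteFan

/-! ### Graded homomorphisms, torus-fixed points and nefness -/

section Components

variable {ι κ M : Type} [AddCommMonoid M] {w : ι → M} {w' : κ → M}

theorem isWeightedHomogeneous_map {f : MvPolynomial ι ℚ →ₐ[ℚ] MvPolynomial κ ℚ}
    (hf : ∀ ρ, MvPolynomial.IsWeightedHomogeneous w' (f (MvPolynomial.X ρ)) (w ρ))
    (e : ι →₀ ℕ) (r : ℚ) :
    MvPolynomial.IsWeightedHomogeneous w' (f (MvPolynomial.monomial e r)) (Finsupp.weight w e) := by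
  rw [MvPolynomial.monomial_eq, map_mul, Finsupp.prod, map_prod, MvPolynomial.algHom_C,
    Finsupp.weight_apply, Finsupp.sum]
  refine MvPolynomial.IsWeightedHomogeneous.C_mul ?_ r
  refine MvPolynomial.IsWeightedHomogeneous.prod _ _ _ fun ρ _ => ?_
  rw [map_pow]
  exact (hf ρ).pow _

theorem map_weightedHomogeneousComponent {f : MvPolynomial ι ℚ →ₐ[ℚ] MvPolynomial κ ℚ}
    (hf : ∀ ρ, MvPolynomial.IsWeightedHomogeneous w' (f (MvPolynomial.X ρ)) (w ρ))
    (p : MvPolynomial ι ℚ) (γ : M) :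
    f (MvPolynomial.weightedHomogeneousComponent w γ p) =
      MvPolynomial.weightedHomogeneousComponent w' γ (f p) := by
  classical
  induction p using MvPolynomial.induction_on' with
  | add p q hp hq => rw [map_add, map_add, hp, hq, map_add, map_add]
  | monomial e r =>
    have h1 := MvPolynomial.isWeightedHomogeneous_monomial w e r rfl
    have h2 := isWeightedHomogeneous_map hf e r
    by_cases h : Finsupp.weight w e = γ
    · subst h
      rw [h1.weightedHomogeneousComponent_same, h2.weightedHomogeneousComponent_same]
    · rw [h1.weightedHomogeneousComponent_ne _ (Ne.symm h),
        h2.weightedHomogeneousComponent_ne _ (Ne.symm h), map_zero]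

end Components

/-- Setting the variables of a set to zero. -/
noncomputable def zeroOn {ι : Type} [DecidableEq ι] (σ : Finset ι) :
    MvPolynomial ι ℚ →ₐ[ℚ] MvPolynomial ι ℚ :=
  MvPolynomial.aeval fun ρ => if ρ ∈ σ then 0 else MvPolynomial.X ρ

theorem exists_mem_support_of_zeroOn_ne_zero {ι : Type} [DecidableEq ι] {σ : Finset ι}
    {f : MvPolynomial ι ℚ} (hf : zeroOn σ f ≠ 0) : ∃ e ∈ f.support, ∀ ρ ∈ σ, e ρ = 0 := by
  by_contra hcon
  push Not at hcon
  refine hf ?_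
  rw [f.as_sum, map_sum]
  refine Finset.sum_eq_zero fun e he => ?_
  obtain ⟨ρ, hρ, hρe⟩ := hcon e he
  rw [zeroOn, MvPolynomial.aeval_monomial, Finsupp.prod,
    Finset.prod_eq_zero (Finsupp.mem_support_iff.2 hρe), mul_zero]
  rw [if_pos hρ, zero_pow hρe]

namespace SmoothCompleteFan

section Nef

variable {d : ℕ} {ι : Type} [Fintype ι] [DecidableEq ι] (X : SmoothCompleteFan d ι)

theorem weight_primeClass (e : ι →₀ ℕ) :
    Finsupp.weight X.primeClass e = X.cls fun ρ => (e ρ : ℤ) := by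
  rw [X.cls_sum, Finsupp.weight_apply, Finsupp.sum_fintype e (fun ρ k => k • X.primeClass ρ)
    fun _ => zero_nsmul _]
  exact Finset.sum_congr rfl fun ρ _ => (natCast_zsmul _ _).symm

/-- Some section of a positive multiple `k D` does not vanish at the torus-fixed point of `σ`, so it
contains a monomial without the variables of `σ`. Its exponents form the representative of `k D` off
`σ`, that is `k • atCone D σ`, and exponents are nonnegative. -/
theorem atCone_nonneg_of_isAmple {D : ι → ℤ} (hD : X.IsAmple (X.cls D)) (σ : X.maxCones) (ρ : ι) :
    0 ≤ X.atCone D σ ρ := by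
  have hθ : ∀ ρ, MvPolynomial.IsWeightedHomogeneous X.primeClass
      (zeroOn σ.1 (MvPolynomial.X ρ)) (X.primeClass ρ) := fun ρ => by
    rw [zeroOn, MvPolynomial.aeval_X]
    split_ifs
    · exact MvPolynomial.isWeightedHomogeneous_zero _ _ _
    · exact MvPolynomial.isWeightedHomogeneous_X _ _ _
  -- The torus-fixed point of `σ`, where exactly the variables of `σ` vanish.
  let p : X.points ⊥ := ⟨⟨RingHom.ker (zeroOn σ.1), RingHom.ker_isPrime _⟩, by
    refine ⟨fun f hf γ => ?_, bot_le, σ.1, σ.2, fun h => ?_⟩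
    · dsimp only at hf ⊢
      rw [RingHom.mem_ker] at hf ⊢
      rw [map_weightedHomogeneousComponent hθ, hf, map_zero]
    · dsimp only at h
      rw [RingHom.mem_ker, map_prod, Finset.prod_eq_zero_iff] at h
      obtain ⟨θ, h1, h2⟩ := h
      rw [zeroOn, MvPolynomial.aeval_X, if_neg (Finset.mem_compl.1 h1)] at h2
      exact MvPolynomial.X_ne_zero θ h2⟩
  obtain ⟨k, hk, f, hf, hfp, -⟩ := hD ⊤ p trivial
  obtain ⟨e, he, he'⟩ := exists_mem_support_of_zeroOn_ne_zero hfp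
  have h1 := hf (MvPolynomial.mem_support_iff.1 he)
  rw [weight_primeClass] at h1
  have h2 : (fun ρ => (e ρ : ℤ)) = X.atCone ((k : ℤ) • D) σ := by
    refine X.eq_atCone σ ?_ fun ρ hρ => by simp [he' ρ hρ]
    rw [h1, cls, cls, Submodule.Quotient.mk_smul, natCast_zsmul]
  rw [X.atCone_smul] at h2
  have h3 := congrFun h2 ρ
  simp only [Pi.smul_apply, smul_eq_mul] at h3
  have hk' : (0 : ℤ) < k := by exact_mod_cast hk
  exact nonneg_of_mul_nonneg_right (by rw [← h3]; positivity) hk'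

/-- A real linear form on the Picard group given by a linear relation between the generators. -/
theorem exists_functional {a : ι → ℝ} (ha : ∑ ρ, a ρ • (fun k => (X.gen ρ k : ℝ)) = 0) :
    ∃ Ψ : X.PicX →ₗ[ℤ] ℝ, ∀ D, Ψ (X.cls D) = ∑ ρ, a ρ * D ρ := by
  let F : (ι → ℤ) →ₗ[ℤ] ℝ :=
    { toFun := fun D => ∑ ρ, a ρ * D ρ
      map_add' := fun D D' => by simp [mul_add, Finset.sum_add_distrib]
      map_smul' := fun k D => by simp [Finset.mul_sum, mul_left_comm] }
  refine ⟨(LinearMap.range X.divChar).liftQ F ?_, fun D => rfl⟩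
  rintro _ ⟨m, rfl⟩
  have h1 := X.sum_smul_gen_apply Finset.univ a m
  rw [ha] at h1
  simp only [Pi.zero_apply, mul_zero, Finset.sum_const_zero] at h1
  exact h1.symm

end Nef

/-! ### Rays grouped by class; the polytope attached to `L` -/

section Classes

variable {d s : ℕ} {n : Fin s → ℕ} (X : SmoothCompleteFan d ((i : Fin s) × Fin (n i)))

theorem mem_coneIndex {σ : Finset ((i : Fin s) × Fin (n i))} {i : Fin s} :
    i ∈ coneIndex σ ↔ ∃ j, (⟨i, j⟩ : (i : Fin s) × Fin (n i)) ∉ σ := by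
  simp [coneIndex]

theorem sum_alpha (D : (i : Fin s) × Fin (n i) → ℤ) (σ : X.maxCones) (u : Fin s → ℝ) :
    ∑ ρ : (i : Fin s) × Fin (n i), u ρ.1 * (X.atCone D σ ρ : ℝ) =
      ∑ i, (X.alpha D σ i : ℝ) * u i := by
  rw [Fintype.sum_sigma]
  refine Finset.sum_congr rfl fun i _ => ?_
  dsimp only
  rw [← Finset.mul_sum, alpha, Int.cast_sum, mul_comm]

variable {X} {𝔇 : Fin s → X.PicX}

theorem eq_of_notMem (h𝔇 : ∀ i j, X.primeClass ⟨i, j⟩ = 𝔇 i) (σ : X.maxCones) {i : Fin s}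
    {j j' : Fin (n i)} (hj : (⟨i, j⟩ : (i : Fin s) × Fin (n i)) ∉ σ.1)
    (hj' : (⟨i, j'⟩ : (i : Fin s) × Fin (n i)) ∉ σ.1) : j = j' := by
  have := X.not_mem_of_primeClass_eq σ ((h𝔇 i j).trans (h𝔇 i j').symm) hj hj'
  simpa using this

/-- Exchanging a missing ray of a maximal cone by another ray of the same class. -/
theorem exists_exchange_one (h𝔇 : ∀ i j, X.primeClass ⟨i, j⟩ = 𝔇 i) (σ : X.maxCones) {i : Fin s}
    (hi : i ∈ coneIndex σ.1) (j : Fin (n i)) :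
    ∃ σ' : X.maxCones, (⟨i, j⟩ : (i : Fin s) × Fin (n i)) ∉ σ'.1 ∧
      (∀ ρ : (i : Fin s) × Fin (n i), ρ.1 ≠ i → (ρ ∈ σ'.1 ↔ ρ ∈ σ.1)) ∧
      (∀ D, X.alpha D σ' = X.alpha D σ) := by
  by_cases hj : (⟨i, j⟩ : (i : Fin s) × Fin (n i)) ∉ σ.1
  · exact ⟨σ, hj, fun _ _ => Iff.rfl, fun _ => rfl⟩
  push Not at hj
  obtain ⟨j', hj'⟩ := mem_coneIndex.1 hi
  have hne : (⟨i, j⟩ : (i : Fin s) × Fin (n i)) ≠ ⟨i, j'⟩ := fun e => hj' (e ▸ hj)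
  have hcls : X.primeClass ⟨i, j'⟩ = X.primeClass ⟨i, j⟩ := (h𝔇 i j').trans (h𝔇 i j).symm
  have hmem := X.insert_erase_mem_maxCones σ hcls hj' hj
  refine ⟨⟨_, hmem⟩, ?_, fun ρ hρ => ?_, fun D => ?_⟩
  · simp [hne]
  · have h1 : ρ ≠ ⟨i, j⟩ := fun e => hρ (by rw [e])
    have h2 : ρ ≠ ⟨i, j'⟩ := fun e => hρ (by rw [e])
    simp [h1, h2]
  · set a := X.atCone D σ ⟨i, j'⟩
    -- The multiple of `D_{i,j'}` is moved to the linearly equivalent `D_{i,j}`. The result is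
    -- supported off the new cone, and the sum over each class does not change.
    have key : X.atCone D σ + a • (Pi.single ⟨i, j⟩ 1 - Pi.single ⟨i, j'⟩ 1) =
        X.atCone D ⟨_, hmem⟩ := by
      refine X.eq_atCone _ ?_ fun ρ hρ => ?_
      · rw [← X.cls_atCone D σ]
        change (LinearMap.range X.divChar).mkQ _ = (LinearMap.range X.divChar).mkQ _
        rw [map_add, map_smul, map_sub]
        change _ + a • (X.primeClass ⟨i, j⟩ - X.primeClass ⟨i, j'⟩) = _
        rw [hcls, sub_self, smul_zero, add_zero]
      · rw [Finset.mem_insert, Finset.mem_erase] at hρ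
        rcases hρ with rfl | ⟨hρ1, hρ2⟩
        · simp [a, Pi.single_eq_of_ne hne.symm]
        · have : ρ ≠ ⟨i, j'⟩ := fun e => hj' (e ▸ hρ2)
          simp [Pi.single_eq_of_ne hρ1, Pi.single_eq_of_ne this, X.atCone_of_mem D σ hρ2]
    funext i'
    rw [alpha, alpha, ← key]
    simp only [Pi.add_apply, Pi.smul_apply, Pi.sub_apply, smul_eq_mul, Finset.sum_add_distrib,
      ← Finset.mul_sum, Finset.sum_sub_distrib]
    have h1 : ∀ j₀ : Fin (n i), ∑ j₁ : Fin (n i'),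
        (Pi.single ⟨i, j₀⟩ 1 : (i : Fin s) × Fin (n i) → ℤ) ⟨i', j₁⟩ = if i' = i then 1 else 0 := by
      intro j₀
      split_ifs with h
      · subst h
        simp [Pi.single_apply]
      · refine Finset.sum_eq_zero fun j₁ _ => Pi.single_eq_of_ne (fun e => h ?_) _
        exact congrArg Sigma.fst e
    rw [h1, h1, sub_self, mul_zero, add_zero]

/-- Exchanging one class after another, the missing ray of each class in `I_σ` can be prescribed
without changing `α`. Conditions over all maximal cones thereby become conditions on whole blocks of
coordinates. -/
theorem exists_exchange (h𝔇 : ∀ i j, X.primeClass ⟨i, j⟩ = 𝔇 i) (σ : X.maxCones)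
    (f : ∀ i, Fin (n i)) :
    ∃ σ' : X.maxCones, (∀ i j, (⟨i, j⟩ : (i : Fin s) × Fin (n i)) ∉ σ'.1 ↔
      i ∈ coneIndex σ.1 ∧ j = f i) ∧ ∀ D, X.alpha D σ' = X.alpha D σ := by
  have key : ∀ I : Finset (Fin s), ∃ σ' : X.maxCones, coneIndex σ'.1 = coneIndex σ.1 ∧
      (∀ i ∈ I, i ∈ coneIndex σ.1 → (⟨i, f i⟩ : (i : Fin s) × Fin (n i)) ∉ σ'.1) ∧
      ∀ D, X.alpha D σ' = X.alpha D σ := by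
    intro I
    induction I using Finset.induction_on with
    | empty => exact ⟨σ, rfl, by simp, fun _ => rfl⟩
    | insert i I hi ih =>
      obtain ⟨σ₁, h1, h2, h3⟩ := ih
      by_cases hiσ : i ∈ coneIndex σ.1
      · obtain ⟨σ₂, h4, h5, h6⟩ := exists_exchange_one h𝔇 σ₁ (h1 ▸ hiσ) (f i)
        refine ⟨σ₂, ?_, fun i' hi' hi'σ => ?_, fun D => (h6 D).trans (h3 D)⟩
        · rw [← h1]
          ext i'
          by_cases hii : i' = i
          · subst hii
            exact ⟨fun _ => h1 ▸ hiσ, fun _ => mem_coneIndex.2 ⟨_, h4⟩⟩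
          · rw [mem_coneIndex, mem_coneIndex]
            exact exists_congr fun j => not_congr (h5 ⟨i', j⟩ hii)
        · by_cases hii : i' = i
          · subst hii
            exact h4
          · rw [h5 ⟨i', _⟩ hii]
            exact h2 i' (Finset.mem_of_mem_insert_of_ne hi' hii) hi'σ
      · refine ⟨σ₁, h1, fun i' hi' hi'σ => ?_, h3⟩
        refine h2 i' (Finset.mem_of_mem_insert_of_ne hi' fun e => hiσ (e ▸ hi'σ)) hi'σ
  obtain ⟨σ', h1, h2, h3⟩ := key Finset.univ
  refine ⟨σ', fun i j => ⟨fun h => ?_, ?_⟩, h3⟩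
  · have hi : i ∈ coneIndex σ.1 := h1 ▸ mem_coneIndex.2 ⟨j, h⟩
    exact ⟨hi, eq_of_notMem h𝔇 σ' h (h2 i (Finset.mem_univ i) hi)⟩
  · rintro ⟨hi, rfl⟩
    exact h2 i (Finset.mem_univ i) hi

theorem exists_class_function (h𝔇 : ∀ i j, X.primeClass ⟨i, j⟩ = 𝔇 i) (hn : ∀ i, 0 < n i)
    {a : (i : Fin s) × Fin (n i) → ℝ}
    (ha : ∑ ρ, a ρ • (fun k => (X.gen ρ k : ℝ)) = 0) : ∃ u : Fin s → ℝ, ∀ ρ, a ρ = u ρ.1 :=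
  ⟨fun i => a ⟨i, ⟨0, hn i⟩⟩, fun ρ =>
    X.eq_of_primeClass_eq ha ((h𝔇 ρ.1 ρ.2).trans (h𝔇 ρ.1 _).symm)⟩

/-- As a linear form on `Pic X` the relation sends `𝔇 i` to `u i`; in the class of `L` the class `𝔇
i` occurs `n i` times through `-K_X`, less `t i` times through the hypersurfaces. -/
theorem sum_mul_log_anticanonical (h𝔇 : ∀ i j, X.primeClass ⟨i, j⟩ = 𝔇 i) {t : Fin s → ℕ}
    (ht : ∀ i, t i + 2 ≤ n i) {L : (i : Fin s) × Fin (n i) → ℤ}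
    (hL : X.cls L = -(X.canonicalClass + ∑ i, ∑ _l : Fin (t i), 𝔇 i)) {u : Fin s → ℝ}
    (hu : ∑ ρ : (i : Fin s) × Fin (n i), u ρ.1 • (fun k => (X.gen ρ k : ℝ)) = 0) :
    ∑ ρ : (i : Fin s) × Fin (n i), u ρ.1 * (L ρ : ℝ) = ∑ i, ((n i - t i : ℕ) : ℝ) * u i := by
  obtain ⟨Ψ, hΨ⟩ := X.exists_functional (a := fun ρ => u ρ.1) hu
  have h1 : ∀ ρ, Ψ (X.primeClass ρ) = u ρ.1 := fun ρ => by
    rw [primeClass, hΨ]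
    simp [Pi.single_apply]
  have h2 : ∀ i, Ψ (𝔇 i) = u i := fun i => by
    rw [← h𝔇 i ⟨0, by have := ht i; omega⟩, h1]
  rw [← hΨ, hL, map_neg, map_add, canonicalClass, map_neg, map_sum, map_sum]
  simp only [h1, map_nsmul, h2, Fintype.sum_sigma, Finset.sum_const, Finset.card_univ,
    Fintype.card_fin, nsmul_eq_mul]
  rw [neg_add, neg_neg, ← sub_eq_add_neg, ← Finset.sum_sub_distrib]
  refine Finset.sum_congr rfl fun i _ => ?_
  rw [Nat.cast_sub (by have := ht i; omega)]
  ring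

theorem sum_alpha_eq_of_relation (h𝔇 : ∀ i j, X.primeClass ⟨i, j⟩ = 𝔇 i) {t : Fin s → ℕ}
    (ht : ∀ i, t i + 2 ≤ n i) {L : (i : Fin s) × Fin (n i) → ℤ}
    (hL : X.cls L = -(X.canonicalClass + ∑ i, ∑ _l : Fin (t i), 𝔇 i)) {u : Fin s → ℝ}
    (hu : ∑ ρ : (i : Fin s) × Fin (n i), u ρ.1 • (fun k => (X.gen ρ k : ℝ)) = 0)
    (σ : X.maxCones) :
    ∑ i, (X.alpha L σ i : ℝ) * u i = ∑ i, ((n i - t i : ℕ) : ℝ) * u i := by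
  rw [← sum_mul_log_anticanonical h𝔇 ht hL hu, ← sum_alpha]
  exact X.sum_mul_eq_of_cls_eq hu (X.cls_atCone L σ)

/-- Complete `u` to a relation `ψ = u + a` with `a ≥ 0` supported on a maximal cone `τ`. The divisor
`L(τ)` is supported off `τ`, so `α_τ · ψ = α_τ · u ≤ ϖ · u`, while `α_τ · ψ = ϖ · ψ` for a relation.
Hence `ϖ · (ψ - u) ≤ 0` with `ψ ≥ u` and `ϖ > 0`, so `ψ = u`. -/
theorem relation_of_sum_alpha_le (h𝔇 : ∀ i j, X.primeClass ⟨i, j⟩ = 𝔇 i) {t : Fin s → ℕ}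
    (ht : ∀ i, t i + 2 ≤ n i) {L : (i : Fin s) × Fin (n i) → ℤ}
    (hL : X.cls L = -(X.canonicalClass + ∑ i, ∑ _l : Fin (t i), 𝔇 i)) {u : Fin s → ℝ}
    (hu : ∀ σ : X.maxCones,
      ∑ i, (X.alpha L σ i : ℝ) * u i ≤ ∑ i, ((n i - t i : ℕ) : ℝ) * u i) :
    ∑ ρ : (i : Fin s) × Fin (n i), u ρ.1 • (fun k => (X.gen ρ k : ℝ)) = 0 := by
  have hn : ∀ i, 0 < n i := fun i => by have := ht i; omega
  obtain ⟨τ, a, ha, haτ, hrel⟩ := X.exists_neg_sum_eq fun ρ => u ρ.1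
  obtain ⟨ψ, hψ⟩ := exists_class_function h𝔇 hn hrel
  have hψ' : ∀ ρ : (i : Fin s) × Fin (n i), a ρ = ψ ρ.1 - u ρ.1 := fun ρ => by
    rw [← hψ]; ring
  have hrel' : ∑ ρ : (i : Fin s) × Fin (n i), ψ ρ.1 • (fun k => (X.gen ρ k : ℝ)) = 0 := by
    rw [← hrel]
    exact Finset.sum_congr rfl fun ρ _ => by rw [hψ]
  have h1 := sum_alpha_eq_of_relation h𝔇 ht hL hrel' τ
  have h2 : ∑ i, (X.alpha L τ i : ℝ) * ψ i = ∑ i, (X.alpha L τ i : ℝ) * u i := by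
    rw [← sum_alpha, ← sum_alpha]
    refine Finset.sum_congr rfl fun ρ _ => ?_
    by_cases hρ : ρ ∈ τ.1
    · rw [X.atCone_of_mem L τ hρ]; simp
    · have := hψ' ρ
      rw [haτ ρ hρ] at this
      rw [show ψ ρ.1 = u ρ.1 by linarith]
  have h3 := hu τ
  rw [← h2, h1] at h3
  have h4 : ∀ i, 0 ≤ ((n i - t i : ℕ) : ℝ) * (ψ i - u i) := fun i =>
    mul_nonneg (Nat.cast_nonneg _) (by rw [← hψ' ⟨i, ⟨0, hn i⟩⟩]; exact ha _)
  have h5 : ∑ i, ((n i - t i : ℕ) : ℝ) * (ψ i - u i) = 0 := by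
    refine le_antisymm ?_ (Finset.sum_nonneg fun i _ => h4 i)
    simp only [mul_sub, Finset.sum_sub_distrib]
    linarith
  have h6 : ψ = u := funext fun i => by
    have h7 := (Finset.sum_eq_zero_iff_of_nonneg fun i _ => h4 i).1 h5 i (Finset.mem_univ i)
    have h8 : ((n i - t i : ℕ) : ℝ) ≠ 0 := by
      have := ht i
      exact_mod_cast (by omega : n i - t i ≠ 0)
    linarith [(mul_eq_zero.1 h7).resolve_left h8]
  rwa [h6] at hrel'

/-- Completing the constant vector `1` by nonnegative coefficients gives a relation with positive
coefficients, on which all `α_σ` agree with `ϖ`; it is then normalized. -/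
theorem exists_center (h𝔇 : ∀ i j, X.primeClass ⟨i, j⟩ = 𝔇 i) {t : Fin s → ℕ} (hs : 0 < s)
    (ht : ∀ i, t i + 2 ≤ n i) {L : (i : Fin s) × Fin (n i) → ℤ}
    (hL : X.cls L = -(X.canonicalClass + ∑ i, ∑ _l : Fin (t i), 𝔇 i)) :
    ∃ u : Fin s → ℝ, (∀ i, 0 < u i) ∧ (∀ σ : X.maxCones, ∑ i, (X.alpha L σ i : ℝ) * u i = 1) ∧
      ∑ i, ((n i - t i : ℕ) : ℝ) * u i = 1 := by
  have hn : ∀ i, 0 < n i := fun i => by have := ht i; omega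
  obtain ⟨τ, a, ha, haτ, hrel⟩ := X.exists_neg_sum_eq fun _ => 1
  obtain ⟨ψ, hψ⟩ := exists_class_function h𝔇 hn hrel
  have hψ0 : ∀ i, 0 < ψ i := fun i => by
    rw [← hψ ⟨i, ⟨0, hn i⟩⟩]
    have := ha ⟨i, ⟨0, hn i⟩⟩
    linarith
  set S := ∑ i, ((n i - t i : ℕ) : ℝ) * ψ i with hS
  have hS0 : 0 < S := by
    refine Finset.sum_pos (fun i _ => mul_pos ?_ (hψ0 i)) ⟨⟨0, hs⟩, Finset.mem_univ _⟩
    have := ht i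
    exact_mod_cast (by omega : 0 < n i - t i)
  have hrel' : ∑ ρ : (i : Fin s) × Fin (n i), ψ ρ.1 • (fun k => (X.gen ρ k : ℝ)) = 0 := by
    rw [← hrel]
    exact Finset.sum_congr rfl fun ρ _ => by rw [hψ]
  refine ⟨fun i => ψ i / S, fun i => div_pos (hψ0 i) hS0, fun σ => ?_, ?_⟩
  · simp only [← mul_div_assoc, ← Finset.sum_div]
    rw [sum_alpha_eq_of_relation h𝔇 ht hL hrel' σ, div_self hS0.ne']
  · simp only [← mul_div_assoc, ← Finset.sum_div]
    rw [div_self hS0.ne']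

/-- The span of the maximal face is the space of relations between the generators, read as functions
of the class, and the relations have dimension `rk Pic X` by `finrank_relations`. -/
theorem exists_regionData (h𝔇 : ∀ i j, X.primeClass ⟨i, j⟩ = 𝔇 i) {t : Fin s → ℕ} (hs : 0 < s)
    (ht : ∀ i, t i + 2 ≤ n i) {L : (i : Fin s) × Fin (n i) → ℤ}
    (hL : X.cls L = -(X.canonicalClass + ∑ i, ∑ _l : Fin (t i), 𝔇 i))
    (hL_ample : X.IsAmple (X.cls L)) :
    ∃ A : RegionData s X.maxCones, (∀ σ i, A.α σ i = X.alpha L σ i) ∧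
      (A.ϖ = fun i => n i - t i) ∧ A.rk = Module.finrank ℤ X.PicX := by
  obtain ⟨u, hu0, hu1, hu2⟩ := exists_center h𝔇 hs ht hL
  have hn : ∀ i, 0 < n i := fun i => by have := ht i; omega
  let A : RegionData s X.maxCones :=
    { α := fun σ i => X.alpha L σ i
      ϖ := fun i => n i - t i
      center := u
      α_nonneg := fun σ i => by
        have : 0 ≤ X.alpha L σ i :=
          Finset.sum_nonneg fun j _ => X.atCone_nonneg_of_isAmple hL_ample σ _
        exact_mod_cast this
      ϖ_pos := fun i => by have := ht i; omega
      rigid := fun v hv σ =>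
        sum_alpha_eq_of_relation h𝔇 ht hL (relation_of_sum_alpha_le h𝔇 ht hL hv) σ
      center_pos := hu0
      α_center := hu1
      ϖ_center := hu2 }
  refine ⟨A, fun _ _ => rfl, rfl, ?_⟩
  rw [← X.finrank_relations, RegionData.rk]
  let F := Fintype.linearCombination ℝ
    fun (ρ : (i : Fin s) × Fin (n i)) (k : Fin d) => (X.gen ρ k : ℝ)
  have hF : ∀ a, F a = ∑ ρ, a ρ • (fun k => (X.gen ρ k : ℝ)) := fun a => rfl
  let G : A.faceSpan →ₗ[ℝ] LinearMap.ker F :=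
    { toFun := fun v => ⟨fun ρ => v.1 ρ.1, by
        rw [LinearMap.mem_ker, hF]
        exact relation_of_sum_alpha_le h𝔇 ht hL fun σ => (v.2 σ).le⟩
      map_add' := fun _ _ => rfl
      map_smul' := fun _ _ => rfl }
  refine LinearEquiv.finrank_eq (LinearEquiv.ofBijective G ⟨fun v v' h => ?_, fun a => ?_⟩)
  · refine Subtype.ext (funext fun i => ?_)
    exact congrFun (congrArg Subtype.val h) (⟨i, ⟨0, hn i⟩⟩ : (i : Fin s) × Fin (n i))
  · have ha : F a.1 = 0 := a.2
    rw [hF] at ha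
    obtain ⟨v, hv⟩ := exists_class_function h𝔇 hn ha
    refine ⟨⟨v, fun σ => sum_alpha_eq_of_relation h𝔇 ht hL ?_ σ⟩,
      Subtype.ext (funext fun ρ => (hv ρ).symm)⟩
    rw [← ha]
    exact Finset.sum_congr rfl fun ρ _ => by rw [hv]

end Classes

end SmoothCompleteFan

/-! ### Integral Cox coordinates -/

theorem Rat.abs_eq_one_of_padicValRat_eq_zero {q : ℚ} (hq : q ≠ 0)
    (h : ∀ p : ℕ, p.Prime → padicValRat p q = 0) : |q| = 1 := by
  have key : ∀ p : ℕ, p.Prime → ¬ p ∣ q.num.natAbs ∧ ¬ p ∣ q.den := by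
    intro p hp
    have : Fact p.Prime := ⟨hp⟩
    have h1 := h p hp
    rw [padicValRat_def, padicValInt] at h1
    have hnum : q.num.natAbs ≠ 0 := by simpa using hq
    have hco := q.reduced
    constructor
    · intro hd
      have h2 : 1 ≤ padicValNat p q.num.natAbs := one_le_padicValNat_of_dvd hnum hd
      have h3 : ¬ p ∣ q.den := fun hd' => hp.one_lt.ne'
        (Nat.dvd_one.1 (hco ▸ Nat.dvd_gcd hd hd'))
      rw [padicValNat.eq_zero_of_not_dvd h3] at h1
      omega
    · intro hd
      have h2 : 1 ≤ padicValNat p q.den := one_le_padicValNat_of_dvd q.den_nz hd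
      have h3 : ¬ p ∣ q.num.natAbs := fun hd' => hp.one_lt.ne'
        (Nat.dvd_one.1 (hco ▸ Nat.dvd_gcd hd' hd))
      rw [padicValNat.eq_zero_of_not_dvd h3] at h1
      omega
  have h1 : q.num.natAbs = 1 := by
    by_contra hne
    obtain ⟨p, hp, hd⟩ := Nat.exists_prime_and_dvd hne
    exact (key p hp).1 hd
  have h2 : q.den = 1 := by
    by_contra hne
    obtain ⟨p, hp, hd⟩ := Nat.exists_prime_and_dvd hne
    exact (key p hp).2 hd
  rw [← Rat.num_div_den q, h2, Nat.cast_one, div_one, ← Int.cast_abs, Int.abs_eq_natAbs, h1]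
  simp

/-- The `p`-adic valuation as a homomorphism. -/
noncomputable def valHom (p : ℕ) [Fact p.Prime] : ℚˣ →* Multiplicative ℤ where
  toFun u := Multiplicative.ofAdd (padicValRat p u)
  map_one' := by simp
  map_mul' u v := by
    rw [Units.val_mul, padicValRat.mul u.ne_zero v.ne_zero, ofAdd_add]

theorem prod_zpow_eq_zpow_sum {G κ : Type} [CommGroup G] (F : Finset κ) (f : κ → ℤ) (x : G) :
    ∏ k ∈ F, x ^ f k = x ^ ∑ k ∈ F, f k := by
  classical
  induction F using Finset.induction_on with
  | empty => simp
  | insert k F hk ih => rw [Finset.prod_insert hk, Finset.sum_insert hk, ih, zpow_add]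

namespace SmoothCompleteFan

section Torsor

variable {d : ℕ} {ι : Type} [Fintype ι] [DecidableEq ι] (X : SmoothCompleteFan d ι)

/-- The quotient map from the torus of the Cox ring to the torus of `X`, with values in an arbitrary
abelian group. -/
def torusHom (G : Type) [CommGroup G] : (ι → G) →* (Fin d → G) where
  toFun x k := ∏ ρ, x ρ ^ X.gen ρ k
  map_one' := by ext; simp
  map_mul' x y := by ext; simp [mul_zpow, Finset.prod_mul_distrib]

theorem prod_zpow_divChar {G : Type} [CommGroup G] (x : ι → G) (m : Fin d → ℤ) :
    ∏ ρ, x ρ ^ X.divChar m ρ = ∏ k, X.torusHom G x k ^ m k := by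
  simp only [torusHom, MonoidHom.coe_mk, OneHom.coe_mk, divChar, LinearMap.coe_mk, AddHom.coe_mk,
    ← Finset.prod_zpow]
  rw [Finset.prod_comm]
  refine Finset.prod_congr rfl fun ρ _ => ?_
  rw [← prod_zpow_eq_zpow_sum]
  exact Finset.prod_congr rfl fun k _ => by rw [← zpow_mul, mul_comm]

/-- The kernel of `torusHom` is `Hom(Pic X, G)`: it is trivial on divisors of characters. -/
theorem prod_zpow_eq_of_cls_eq {G : Type} [CommGroup G] {z : ι → G} (hz : X.torusHom G z = 1)
    {D D' : ι → ℤ} (h : X.cls D = X.cls D') : ∏ ρ, z ρ ^ D ρ = ∏ ρ, z ρ ^ D' ρ := by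
  obtain ⟨m, rfl⟩ := X.cls_eq_iff.1 h
  simp only [Pi.add_apply, zpow_add, Finset.prod_mul_distrib]
  rw [X.prod_zpow_divChar, hz]
  simp

theorem eq_of_torusHom_eq_one {G : Type} [CommGroup G] {z : ι → G} (hz : X.torusHom G z = 1)
    {ρ ρ' : ι} (h : X.primeClass ρ = X.primeClass ρ') : z ρ = z ρ' := by
  have := X.prod_zpow_eq_of_cls_eq hz h
  rwa [Finset.prod_eq_single ρ (fun θ _ hθ => by simp [Pi.single_eq_of_ne hθ])
      (fun h => absurd (Finset.mem_univ _) h),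
    Finset.prod_eq_single ρ' (fun θ _ hθ => by simp [Pi.single_eq_of_ne hθ])
      (fun h => absurd (Finset.mem_univ _) h), Pi.single_eq_same, Pi.single_eq_same, zpow_one,
    zpow_one] at this

theorem torusHom_surjective (G : Type) [CommGroup G] : Function.Surjective (X.torusHom G) := by
  obtain ⟨σ₀, hσ₀⟩ := X.maxCones_nonempty
  let σ : X.maxCones := ⟨σ₀, hσ₀⟩
  intro y
  refine ⟨fun ρ => if ρ ∈ σ.1 then ∏ l, y l ^ X.charVec (Pi.single ρ 1) σ l else 1, ?_⟩
  funext k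
  have h1 : ∀ l, ∑ ρ ∈ σ.1, X.charVec (Pi.single ρ 1) σ l * X.gen ρ k =
      (Pi.single l 1 : Fin d → ℤ) k := fun l => by
    conv_rhs => rw [X.sum_charVec_smul_gen σ (Pi.single l 1)]
    simp [Pi.single_apply]
  simp only [torusHom, MonoidHom.coe_mk, OneHom.coe_mk, ite_pow, one_zpow]
  rw [Finset.prod_ite_mem, Finset.univ_inter]
  simp only [← Finset.prod_zpow, ← zpow_mul]
  rw [Finset.prod_comm]
  simp only [prod_zpow_eq_zpow_sum, h1]
  rw [Finset.prod_eq_single k (fun l _ hl => by simp [Pi.single_eq_of_ne hl.symm])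
    (fun h => absurd (Finset.mem_univ _) h), Pi.single_eq_same, zpow_one]

/-- `torusHom` is surjective, because the generators of one maximal cone form a basis of `N`; so the
kernel has order `2 ^ (#ι - d)`. -/
theorem card_ker_torusHom :
    Nat.card (X.torusHom ℤˣ).ker = 2 ^ Module.finrank ℤ X.PicX := by
  have h1 := Subgroup.card_mul_index (X.torusHom ℤˣ).ker
  rw [Subgroup.index_ker, MonoidHom.range_eq_top.2 (X.torusHom_surjective ℤˣ), Subgroup.card_top,
    Nat.card_eq_fintype_card (α := Fin d → ℤˣ), Nat.card_eq_fintype_card (α := ι → ℤˣ),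
    Fintype.card_fun, Fintype.card_fun, Fintype.card_units_int, Fintype.card_fin, ← X.finrank_picX,
    pow_add] at h1
  exact Nat.eq_of_mul_eq_mul_right (by positivity) h1

/-- The common value lies in both cones, hence in their common face, and expansions in the
generators of a maximal cone are unique; so both families are the expansion over that face. -/
theorem eq_of_sum_smul_gen_eq (σ σ' : X.maxCones) {a a' : ι → ℝ} (ha : ∀ ρ, 0 ≤ a ρ)
    (ha' : ∀ ρ, 0 ≤ a' ρ) (hσ : ∀ ρ ∉ σ.1, a ρ = 0) (hσ' : ∀ ρ ∉ σ'.1, a' ρ = 0)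
    (h : ∑ ρ, a ρ • (fun k => (X.gen ρ k : ℝ)) = ∑ ρ, a' ρ • (fun k => (X.gen ρ k : ℝ))) :
    a = a' := by
  have hsub : ∀ (τ : Finset ι) (b : ι → ℝ), (∀ ρ ∉ τ, b ρ = 0) →
      ∑ ρ, b ρ • (fun k => (X.gen ρ k : ℝ)) = ∑ ρ ∈ τ, b ρ • (fun k => (X.gen ρ k : ℝ)) := by
    intro τ b hb
    exact (Finset.sum_subset (Finset.subset_univ τ) fun ρ _ hρ => by rw [hb ρ hρ, zero_smul]).symm
  have hext : ∀ (τ τ' : Finset ι) (b : ι → ℝ),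
      ∑ ρ ∈ τ ∩ τ', b ρ • (fun k => (X.gen ρ k : ℝ)) =
        ∑ ρ ∈ τ, (if ρ ∈ τ' then b ρ else 0) • (fun k => (X.gen ρ k : ℝ)) := by
    intro τ τ' b
    simp only [ite_smul, zero_smul]
    rw [← Finset.sum_filter, Finset.filter_mem_eq_inter]
  obtain ⟨b, -, hb⟩ := X.inter_subset _ σ.2 _ σ'.2
    ⟨⟨a, ha, hsub _ a hσ⟩, ⟨a', ha', h.trans (hsub _ a' hσ')⟩⟩
  have h1 : ∀ ρ ∈ σ.1, a ρ = if ρ ∈ σ'.1 then b ρ else 0 := fun ρ hρ =>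
    (X.coeff_eq σ (hsub _ a hσ) hρ).trans (X.coeff_eq σ (hb.trans (hext _ _ b)) hρ).symm
  have h2 : ∀ ρ ∈ σ'.1, a' ρ = if ρ ∈ σ.1 then b ρ else 0 := fun ρ hρ =>
    (X.coeff_eq σ' (h.trans (hsub _ a' hσ')) hρ).trans
      (X.coeff_eq σ' (hb.trans (by rw [Finset.inter_comm]; exact hext _ _ b)) hρ).symm
  funext ρ
  by_cases hρ : ρ ∈ σ.1 <;> by_cases hρ' : ρ ∈ σ'.1
  · rw [h1 ρ hρ, h2 ρ hρ', if_pos hρ, if_pos hρ']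
  · rw [h1 ρ hρ, if_neg hρ', hσ' ρ hρ']
  · rw [h2 ρ hρ', if_neg hρ, hσ ρ hρ]
  · rw [hσ ρ hρ, hσ' ρ hρ']

/-- Applied to the vector of `p`-adic valuations of a torus point; smoothness makes the coefficients
integral. The last clause guarantees that only finitely many primes contribute. -/
theorem exists_nat_coeff (V : Fin d → ℤ) : ∃ (σ : X.maxCones) (w : ι → ℕ), (∀ ρ ∉ σ.1, w ρ = 0) ∧
    (∀ k, V k = ∑ ρ, (w ρ : ℤ) * X.gen ρ k) ∧ (V = 0 → w = 0) := by
  obtain ⟨σ, hσ, a, ha, hV⟩ := X.exists_mem_cone fun k => (V k : ℝ)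
  have h1 : ∀ ρ ∈ σ, 0 ≤ ∑ k, X.charVec (Pi.single ρ 1) ⟨σ, hσ⟩ k * V k := fun ρ hρ => by
    have h2 := ha ρ
    rw [X.coeff_eq ⟨σ, hσ⟩ hV hρ] at h2
    exact_mod_cast h2
  refine ⟨⟨σ, hσ⟩, fun ρ => if ρ ∈ σ then
    (∑ k, X.charVec (Pi.single ρ 1) ⟨σ, hσ⟩ k * V k).toNat else 0, fun ρ hρ => if_neg hρ,
    fun k => ?_, fun h => ?_⟩
  · conv_lhs => rw [X.sum_charVec_smul_gen ⟨σ, hσ⟩ V]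
    simp only [Finset.sum_apply, Pi.smul_apply, smul_eq_mul, Nat.cast_ite, Nat.cast_zero, ite_mul,
      zero_mul, Finset.sum_ite_mem, Finset.univ_inter]
    exact Finset.sum_congr rfl fun ρ hρ => by rw [Int.toNat_of_nonneg (h1 ρ hρ)]
  · funext ρ
    simp [h]

/-- Integral Cox coordinates are coprime if they define a point of the universal torsor over the
integers. -/
def IsCoprimeRep (a : ι → ℤ) : Prop :=
  ∀ p : ℕ, p.Prime → ∃ σ : X.maxCones, ∀ ρ ∉ σ.1, ¬ (p : ℤ) ∣ a ρ

/-- A vector of nonzero integers as a vector of rational units. -/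
noncomputable def toUnits (a : ι → ℤ) (ha : ∀ ρ, a ρ ≠ 0) : ι → ℚˣ :=
  fun ρ => Units.mk0 (a ρ : ℚ) (by exact_mod_cast ha ρ)

theorem toAdd_valHom_torusHom (p : ℕ) [Fact p.Prime] (x : ι → ℚˣ) (k : Fin d) :
    (valHom p (X.torusHom ℚˣ x k)).toAdd = ∑ ρ, padicValRat p (x ρ) * X.gen ρ k := by
  simp only [torusHom, MonoidHom.coe_mk, OneHom.coe_mk, map_prod, map_zpow, toAdd_prod, toAdd_zpow,
    smul_eq_mul]
  exact Finset.sum_congr rfl fun ρ _ => mul_comm _ _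

/-- At each prime the valuations of coprime coordinates are the nonnegative coefficients, supported
on one cone, of the valuation vector of the torus point, and these are unique. -/
theorem natAbs_eq_of_torusHom_eq {a b : ι → ℤ} (ha : ∀ ρ, a ρ ≠ 0) (hb : ∀ ρ, b ρ ≠ 0)
    (hca : X.IsCoprimeRep a) (hcb : X.IsCoprimeRep b)
    (h : X.torusHom ℚˣ (toUnits a ha) = X.torusHom ℚˣ (toUnits b hb)) (ρ : ι) :
    (a ρ).natAbs = (b ρ).natAbs := by
  rw [Nat.eq_iff_prime_padicValNat_eq _ _ (by simpa using ha ρ) (by simpa using hb ρ)]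
  intro p hp
  have : Fact p.Prime := ⟨hp⟩
  obtain ⟨σ, hσ⟩ := hca p hp
  obtain ⟨σ', hσ'⟩ := hcb p hp
  have h0 : ∀ (c : ι → ℤ) (ρ : ι), ¬ (p : ℤ) ∣ c ρ → (padicValNat p (c ρ).natAbs : ℝ) = 0 := by
    intro c ρ hc
    rw [padicValNat.eq_zero_of_not_dvd (by rwa [← Int.natCast_dvd]), Nat.cast_zero]
  have key := X.eq_of_sum_smul_gen_eq σ σ' (a := fun ρ => (padicValNat p (a ρ).natAbs : ℝ))
    (a' := fun ρ => (padicValNat p (b ρ).natAbs : ℝ)) (fun _ => Nat.cast_nonneg _)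
    (fun _ => Nat.cast_nonneg _) (fun ρ hρ => h0 a ρ (hσ ρ hρ)) (fun ρ hρ => h0 b ρ (hσ' ρ hρ)) ?_
  · exact_mod_cast congrFun key ρ
  · funext k
    have h1 := congrArg (fun u => (valHom p u).toAdd) (congrFun h k)
    simp only [toAdd_valHom_torusHom, toUnits, Units.val_mk0, padicValRat.of_int,
      padicValInt] at h1
    simp only [Finset.sum_apply, Pi.smul_apply, smul_eq_mul]
    have h2 := congrArg (Int.cast : ℤ → ℝ) h1
    simp only [Int.cast_sum, Int.cast_mul, Int.cast_natCast] at h2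
    exact h2

/-- For each prime the valuation vector of the point is expanded in a cone containing it, and the
coefficients are used as exponents of that prime. -/
theorem exists_isCoprimeRep (x : ι → ℚˣ) : ∃ (a : ι → ℤ) (ha : ∀ ρ, a ρ ≠ 0), X.IsCoprimeRep a ∧
    X.torusHom ℚˣ (toUnits a ha) = X.torusHom ℚˣ x := by
  choose σ w hσ hw hw0 using fun p : ℕ =>
    X.exists_nat_coeff fun k => ∑ ρ, padicValRat p (x ρ) * X.gen ρ k
  let S : Finset ℕ := Finset.univ.biUnion fun ρ : ι =>
    ((x ρ : ℚ).num.natAbs).primeFactors ∪ (x ρ : ℚ).den.primeFactors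
  have hS : ∀ p : ℕ, p.Prime → p ∉ S → w p = 0 := by
    intro p hp hpS
    refine hw0 p (funext fun k => Finset.sum_eq_zero fun ρ _ => ?_)
    have h1 : p ∉ ((x ρ : ℚ).num.natAbs).primeFactors ∪ (x ρ : ℚ).den.primeFactors := fun h =>
      hpS (Finset.mem_biUnion.2 ⟨ρ, Finset.mem_univ _, h⟩)
    rw [Finset.mem_union, not_or, Nat.mem_primeFactors_of_ne_zero (by simp),
      Nat.mem_primeFactors_of_ne_zero (x ρ : ℚ).den_nz] at h1
    rw [padicValRat_def, padicValInt, padicValNat.eq_zero_of_not_dvd fun h => h1.1 ⟨hp, h⟩,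
      padicValNat.eq_zero_of_not_dvd fun h => h1.2 ⟨hp, h⟩]
    simp
  let W : ι → ℕ →₀ ℕ := fun ρ => Finsupp.onFinset S (fun p => if p.Prime then w p ρ else 0) (by
    intro p hp
    by_contra hpS
    by_cases hpr : p.Prime
    · rw [if_pos hpr, hS p hpr hpS] at hp
      exact hp rfl
    · rw [if_neg hpr] at hp
      exact hp rfl)
  have hWp : ∀ ρ p, p.Prime → W ρ p = w p ρ := fun ρ p hp => by
    simp [W, hp]
  let A : ι → ℕ := fun ρ => (W ρ).prod (· ^ ·)
  have hA : ∀ ρ, (A ρ).factorization = W ρ := fun ρ => by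
    refine Nat.prod_pow_factorization_eq_self fun p hp => ?_
    by_contra hpr
    rw [Finsupp.mem_support_iff] at hp
    exact hp (by simp [W, hpr])
  have hA0 : ∀ ρ, A ρ ≠ 0 := fun ρ => by
    refine Finset.prod_ne_zero_iff.2 fun p hp => pow_ne_zero _ ?_
    rintro rfl
    rw [Finsupp.mem_support_iff] at hp
    exact hp (by simp [W, Nat.not_prime_zero])
  have hval : ∀ ρ p, p.Prime → padicValNat p (A ρ) = w p ρ := fun ρ p hp => by
    rw [← Nat.factorization_def _ hp, hA, hWp ρ p hp]
  have hsign : ∀ ρ, (SignType.sign (x ρ : ℚ) : ℤ) ≠ 0 := fun ρ => by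
    rcases lt_or_gt_of_ne (x ρ).ne_zero with h | h <;> simp [h]
  let a : ι → ℤ := fun ρ => SignType.sign (x ρ : ℚ) * A ρ
  have ha : ∀ ρ, a ρ ≠ 0 := fun ρ => mul_ne_zero (hsign ρ) (by exact_mod_cast hA0 ρ)
  have habs : ∀ ρ, (a ρ).natAbs = A ρ := fun ρ => by
    rcases lt_or_gt_of_ne (x ρ).ne_zero with h | h <;> simp [a, h]
  refine ⟨a, ha, fun p hp => ⟨σ p, fun ρ hρ hd => ?_⟩, ?_⟩
  · have : Fact p.Prime := ⟨hp⟩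
    rw [Int.natCast_dvd, habs] at hd
    have h1 := one_le_padicValNat_of_dvd (hA0 ρ) hd
    rw [hval ρ p hp, hσ p ρ hρ] at h1
    omega
  · rw [← div_eq_one, ← map_div]
    funext k
    set q := X.torusHom ℚˣ (toUnits a ha / x) k with hq
    -- The signs of `a` are those of `x`, so the quotient of the two torus points has positive
    -- coordinates; having no valuations either, it is `1`.
    have hpos : (0 : ℚ) < q := by
      simp only [hq, torusHom, MonoidHom.coe_mk, OneHom.coe_mk, Units.coe_prod, Units.val_zpow_eq_zpow_val]
      refine Finset.prod_pos fun ρ _ => zpow_pos ?_ _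
      simp only [Pi.div_apply, Units.val_div_eq_div_val, toUnits, Units.val_mk0]
      have hA0' : (0 : ℚ) < A ρ := by exact_mod_cast Nat.pos_of_ne_zero (hA0 ρ)
      rcases lt_or_gt_of_ne (x ρ).ne_zero with h | h
      · have h1 : (a ρ : ℚ) = -A ρ := by simp [a, h]
        exact div_pos_of_neg_of_neg (by linarith) h
      · have h1 : (a ρ : ℚ) = A ρ := by simp [a, h]
        exact div_pos (by linarith) h
    have habs1 := Rat.abs_eq_one_of_padicValRat_eq_zero hpos.ne' fun p hp => by
      have : Fact p.Prime := ⟨hp⟩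
      have h1 := X.toAdd_valHom_torusHom p (toUnits a ha / x) k
      rw [← hq] at h1
      change padicValRat p q = _ at h1
      rw [h1]
      have h2 : ∀ ρ, padicValRat p ((toUnits a ha / x) ρ : ℚˣ) = w p ρ - padicValRat p (x ρ) :=
        fun ρ => by
          rw [Pi.div_apply, Units.val_div_eq_div_val,
            padicValRat.div (Units.ne_zero _) (Units.ne_zero _)]
          simp only [toUnits, Units.val_mk0, padicValRat.of_int, padicValInt, habs, hval ρ p hp]
      simp only [h2, sub_mul, Finset.sum_sub_distrib]
      rw [← hw p k, sub_self]
    rw [abs_of_pos hpos] at habs1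
    exact Units.ext habs1

end Torsor

end SmoothCompleteFan

/-! ### The height in coprime coordinates -/

namespace SmoothCompleteFan

section Height

variable {d : ℕ} {ι : Type} [Fintype ι] [DecidableEq ι] (X : SmoothCompleteFan d ι)

/-- The coordinates differ by an element of `Hom(Pic X, ℚˣ)`, which multiplies all the monomials
`x^{D(σ)}`, being of one degree, by the same number; the product formula does the rest. -/
theorem height_eq_of_torusHom_eq (D : ι → ℤ) {x y : ι → ℚˣ}
    (h : X.torusHom ℚˣ x = X.torusHom ℚˣ y) : X.height D x = X.height D y := by
  have hz : X.torusHom ℚˣ (x / y) = 1 := by rw [map_div, h, div_self']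
  have h1 : (fun σ : X.maxCones => ((∏ ρ, x ρ ^ X.atCone D σ ρ : ℚˣ) : ℚ)) =
      ((∏ ρ, (x / y) ρ ^ D ρ : ℚˣ) : ℚ) •
        fun σ : X.maxCones => ((∏ ρ, y ρ ^ X.atCone D σ ρ : ℚˣ) : ℚ) := by
    funext σ
    rw [Pi.smul_apply, smul_eq_mul, ← Units.val_mul,
      ← X.prod_zpow_eq_of_cls_eq hz (X.cls_atCone D σ), ← Finset.prod_mul_distrib]
    congr 1
    refine Finset.prod_congr rfl fun ρ _ => ?_
    rw [← mul_zpow, Pi.div_apply, div_mul_cancel]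
  rw [height, height, h1, Height.mulHeight_smul_eq_mulHeight _ (Units.ne_zero _)]

/-- For each prime `p` some `σ` has all its missing coordinates prime to `p`, and then `p` does not
divide `a^{D(σ)}`. So these integers have gcd `1`, and only the real absolute value matters. -/
theorem height_le_iff {D : ι → ℤ} (hD : ∀ σ ρ, 0 ≤ X.atCone D σ ρ) {a : ι → ℤ}
    (ha : ∀ ρ, a ρ ≠ 0) (hc : X.IsCoprimeRep a) {B : ℝ} (hB : 0 < B) :
    X.height D (toUnits a ha) ≤ B ↔ ∀ σ : X.maxCones,
      ∑ ρ, (X.atCone D σ ρ : ℝ) * Real.log |(a ρ : ℝ)| ≤ Real.log B := by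
  have : Nonempty X.maxCones := X.maxCones_nonempty.to_subtype
  let b : X.maxCones → ℤ := fun σ => ∏ ρ, a ρ ^ (X.atCone D σ ρ).toNat
  have hgcd : Finset.univ.gcd b = 1 := by
    have h1 : (Finset.univ.gcd b).natAbs = 1 := by
      by_contra hne
      obtain ⟨p, hp, hd⟩ := Nat.exists_prime_and_dvd hne
      obtain ⟨σ, hσ⟩ := hc p hp
      have h2 : (p : ℤ) ∣ b σ := (Int.natCast_dvd.2 hd).trans (Finset.gcd_dvd (Finset.mem_univ σ))
      obtain ⟨ρ, -, h3⟩ := (Nat.prime_iff_prime_int.1 hp).exists_mem_finset_dvd h2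
      by_cases hρ : ρ ∈ σ.1
      · rw [X.atCone_of_mem D σ hρ, Int.toNat_zero, pow_zero] at h3
        exact (Nat.prime_iff_prime_int.1 hp).not_dvd_one h3
      · exact hσ ρ hρ ((Nat.prime_iff_prime_int.1 hp).dvd_of_dvd_pow h3)
    rw [← Finset.normalize_gcd, ← Int.abs_eq_normalize, Int.abs_eq_natAbs, h1, Nat.cast_one]
  have hb : (fun σ : X.maxCones => ((∏ ρ, toUnits a ha ρ ^ X.atCone D σ ρ : ℚˣ) : ℚ)) =
      ((↑) : ℤ → ℚ) ∘ b := by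
    funext σ
    simp only [Function.comp, b, Int.cast_prod, Int.cast_pow, Units.coe_prod,
      Units.val_zpow_eq_zpow_val, toUnits, Units.val_mk0]
    refine Finset.prod_congr rfl fun ρ _ => ?_
    rw [← zpow_natCast, Int.toNat_of_nonneg (hD σ ρ)]
  rw [height, hb, Rat.mulHeight_eq_max_abs_of_gcd_eq_one hgcd,
    Finite.map_iSup_of_monotone _ Int.cast_mono, ciSup_le_iff (Set.finite_range _).bddAbove]
  refine forall_congr' fun σ => ?_
  have hpos : ∀ ρ, 0 < |(a ρ : ℝ)| := fun ρ => abs_pos.2 (by exact_mod_cast ha ρ)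
  have h1 : ((|b σ| : ℤ) : ℝ) = ∏ ρ, |(a ρ : ℝ)| ^ (X.atCone D σ ρ).toNat := by
    simp only [b, Finset.abs_prod, abs_pow, Int.cast_prod, Int.cast_pow, Int.cast_abs]
  rw [h1, ← Real.log_le_log_iff (Finset.prod_pos fun ρ _ => pow_pos (hpos ρ) _) hB,
    Real.log_prod fun ρ _ => (pow_pos (hpos ρ) _).ne']
  refine iff_of_eq (congrArg (· ≤ Real.log B) (Finset.sum_congr rfl fun ρ _ => ?_))
  rw [Real.log_pow]
  congr 1
  have := Int.toNat_of_nonneg (hD σ ρ)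
  exact_mod_cast congrArg (Int.cast : ℤ → ℝ) this

end Height

/-! ### From rational points to tuples of integral solutions -/

section Counting

variable {d s : ℕ} {n t : Fin s → ℕ} {X : SmoothCompleteFan d ((i : Fin s) × Fin (n i))}
  {𝔇 : Fin s → X.PicX}

/-- A prime not dividing the gcd of a block is prime to some coordinate of it; by `exists_exchange`
that coordinate may be taken as the missing one. -/
theorem isCoprimeRep_iff (h𝔇 : ∀ i j, X.primeClass ⟨i, j⟩ = 𝔇 i) (hn : ∀ i, 0 < n i)
    (a : (i : Fin s) × Fin (n i) → ℤ) :
    X.IsCoprimeRep a ↔ X.coprimeInd (fun i => gcdAbs fun j => a ⟨i, j⟩) = 1 := by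
  have h1 : X.coprimeInd (fun i => gcdAbs fun j => a ⟨i, j⟩) = 1 ↔
      ∀ p : ℕ, p.Prime → ∃ σ : X.maxCones, ∀ i ∈ coneIndex σ.1, ∃ j, ¬ (p : ℤ) ∣ a ⟨i, j⟩ := by
    unfold coprimeInd
    rw [ite_eq_left_iff]
    simp only [zero_ne_one, imp_false, not_not]
    rw [Nat.eq_one_iff_not_exists_prime_dvd]
    refine forall_congr' fun p => forall_congr' fun hp => ?_
    rw [Finset.dvd_gcd_iff]
    push Not
    rw [Subtype.exists]
    simp only [exists_prop]
    refine exists_congr fun σ => and_congr_right fun _ => ?_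
    rw [(Nat.Prime.prime hp).dvd_finsetProd_iff]
    push Not
    simp only [dvd_gcdAbs_iff, not_forall]
  rw [h1]
  refine forall_congr' fun p => forall_congr' fun hp => ⟨?_, ?_⟩
  · rintro ⟨σ, hσ⟩
    refine ⟨σ, fun i hi => ?_⟩
    obtain ⟨j, hj⟩ := mem_coneIndex.1 hi
    exact ⟨j, hσ _ hj⟩
  · rintro ⟨σ, hσ⟩
    have h2 : ∀ i, ∃ j : Fin (n i), i ∈ coneIndex σ.1 → ¬ (p : ℤ) ∣ a ⟨i, j⟩ := fun i => by
      by_cases hi : i ∈ coneIndex σ.1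
      · obtain ⟨j, hj⟩ := hσ i hi
        exact ⟨j, fun _ => hj⟩
      · exact ⟨⟨0, hn i⟩, fun h => absurd h hi⟩
    choose f hf using h2
    obtain ⟨σ', h3, -⟩ := exists_exchange h𝔇 σ f
    refine ⟨σ', fun ρ hρ => ?_⟩
    obtain ⟨i, j⟩ := ρ
    obtain ⟨hi, rfl⟩ := (h3 i j).1 hρ
    exact hf i hi

theorem exists_natAbs_eq_supAbs {m : ℕ} (hm : 0 < m) (x : Fin m → ℤ) :
    ∃ j, (x j).natAbs = supAbs x := by
  have : Nonempty (Fin m) := ⟨⟨0, hm⟩⟩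
  obtain ⟨j, -, hj⟩ := Finset.exists_mem_eq_sup Finset.univ Finset.univ_nonempty
    fun j => (x j).natAbs
  exact ⟨j, hj.symm⟩

/-- Among the cones obtained from `σ` by exchanges, the strictest condition comes from the one whose
missing coordinates are the largest of their blocks. -/
theorem forall_sum_atCone_le_iff (h𝔇 : ∀ i j, X.primeClass ⟨i, j⟩ = 𝔇 i) (hn : ∀ i, 0 < n i)
    {D : (i : Fin s) × Fin (n i) → ℤ} (hD : ∀ σ ρ, 0 ≤ X.atCone D σ ρ)
    {a : (i : Fin s) × Fin (n i) → ℤ} (ha : ∀ ρ, a ρ ≠ 0) (T : ℝ) :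
    (∀ σ : X.maxCones, ∑ ρ, (X.atCone D σ ρ : ℝ) * Real.log |(a ρ : ℝ)| ≤ T) ↔
      ∀ σ : X.maxCones,
        ∑ i, (X.alpha D σ i : ℝ) * Real.log (supAbs fun j => a ⟨i, j⟩) ≤ T := by
  have habs : ∀ ρ, |(a ρ : ℝ)| = ((a ρ).natAbs : ℝ) := fun ρ => by
    rw [Nat.cast_natAbs, Int.cast_abs]
  constructor
  · intro h σ
    choose f hf using fun i => exists_natAbs_eq_supAbs (hn i) fun j => a ⟨i, j⟩
    obtain ⟨σ', h1, h2⟩ := exists_exchange h𝔇 σ f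
    refine le_trans (le_of_eq ?_) (h σ')
    rw [← h2 D, ← sum_alpha X D σ' fun i => Real.log (supAbs fun j => a ⟨i, j⟩)]
    refine Finset.sum_congr rfl fun ρ _ => ?_
    obtain ⟨i, j⟩ := ρ
    by_cases hj : (⟨i, j⟩ : (i : Fin s) × Fin (n i)) ∈ σ'.1
    · rw [X.atCone_of_mem D σ' hj]
      simp
    · obtain ⟨-, rfl⟩ := (h1 i j).1 hj
      rw [habs, hf i, mul_comm]
  · intro h σ
    refine le_trans ?_ (h σ)
    rw [← sum_alpha X D σ fun i => Real.log (supAbs fun j => a ⟨i, j⟩)]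
    refine Finset.sum_le_sum fun ρ _ => ?_
    rw [mul_comm]
    refine mul_le_mul_of_nonneg_right ?_ (by exact_mod_cast hD σ ρ)
    refine Real.log_le_log (abs_pos.2 (by exact_mod_cast ha ρ)) ?_
    rw [habs]
    exact_mod_cast Finset.le_sup (f := fun j => (a ⟨ρ.1, j⟩).natAbs) (Finset.mem_univ ρ.2)

theorem eval_linIdeal_iff (c : ∀ i, Fin (t i) → Fin (n i) → ℚ)
    (x : (i : Fin s) × Fin (n i) → ℚ) :
    (∀ f ∈ linIdeal c, MvPolynomial.eval x f = 0) ↔ ∀ i l, ∑ j, c i l j * x ⟨i, j⟩ = 0 := by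
  have h1 : (∀ f ∈ linIdeal c, MvPolynomial.eval x f = 0) ↔
      linIdeal c ≤ RingHom.ker (MvPolynomial.eval x) := Iff.rfl
  have h2 : ∀ i l, MvPolynomial.eval x (linForm i (c i l)) = ∑ j, c i l j * x ⟨i, j⟩ := fun i l => by
    simp [linForm]
  rw [h1, linIdeal, Ideal.span_le]
  constructor
  · intro h i l
    rw [← h2]
    exact h ⟨i, l, rfl⟩
  · rintro h _ ⟨i, l, rfl⟩
    exact (h2 i l).trans (h i l)

/-- The integral Cox coordinates given by a tuple of integral solutions. -/
def tupleVec {c : ∀ i, Fin (t i) → Fin (n i) → ℚ} (x : ∀ i, nzSol (c i)) :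
    (i : Fin s) × Fin (n i) → ℤ := fun ρ => (x ρ.1).1 ρ.2

theorem tupleVec_ne_zero {c : ∀ i, Fin (t i) → Fin (n i) → ℚ} (x : ∀ i, nzSol (c i)) (ρ) :
    tupleVec x ρ ≠ 0 := (x ρ.1).2.2 ρ.2

theorem mem_coprimeTuples_iff (h𝔇 : ∀ i j, X.primeClass ⟨i, j⟩ = 𝔇 i) (hn : ∀ i, 0 < n i)
    {L : (i : Fin s) × Fin (n i) → ℤ} (hL : ∀ σ ρ, 0 ≤ X.atCone L σ ρ)
    {A : RegionData s X.maxCones} (hA : ∀ σ i, A.α σ i = X.alpha L σ i)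
    (c : ∀ i, Fin (t i) → Fin (n i) → ℚ) {B : ℝ} (hB : 0 < B) (x : ∀ i, nzSol (c i)) :
    x ∈ A.coprimeTuples X c (Real.log B) ↔ X.IsCoprimeRep (tupleVec x) ∧
      X.height L (toUnits (tupleVec x) (tupleVec_ne_zero x)) ≤ B := by
  have e : (fun i => gcdAbs fun j => tupleVec x ⟨i, j⟩) = fun i => gcdAbs (x i).1 := rfl
  have h0 := isCoprimeRep_iff h𝔇 hn (tupleVec x)
  rw [e] at h0
  rw [RegionData.coprimeTuples, Set.mem_ofPred_eq, ← h0, and_comm]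
  refine and_congr_right fun hc => ?_
  rw [X.height_le_iff hL _ hc hB,
    forall_sum_atCone_le_iff h𝔇 hn hL (tupleVec_ne_zero x)]
  have h1 : x ∈ A.tuples c 1 (Real.log B) ↔
      (∀ σ, A.α σ ⬝ᵥ (fun i => Real.log (supAbs (x i).1)) ≤ Real.log B) ∧
      ∀ i, 0 ≤ Real.log (supAbs (x i).1) := by
    simp [RegionData.tuples, RegionData.region]
  rw [h1, and_iff_left]
  · refine forall_congr' fun σ => ?_
    simp only [dotProduct, hA]
    rfl
  · exact fun i => Real.log_natCast_nonneg _

/-- Changing the signs of integral Cox coordinates by an element of `Hom(Pic X, {±1})`. -/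
def signAct (h𝔇 : ∀ i j, X.primeClass ⟨i, j⟩ = 𝔇 i) {c : ∀ i, Fin (t i) → Fin (n i) → ℚ}
    (z : (X.torusHom ℤˣ).ker) (x : ∀ i, nzSol (c i)) : ∀ i, nzSol (c i) := fun i =>
  ⟨fun j => (z.1 ⟨i, j⟩ : ℤ) * (x i).1 j, fun l => by
    have hz : ∀ j j', z.1 ⟨i, j⟩ = z.1 ⟨i, j'⟩ := fun j j' =>
      X.eq_of_torusHom_eq_one z.2 ((h𝔇 i j).trans (h𝔇 i j').symm)
    rcases isEmpty_or_nonempty (Fin (n i)) with h | ⟨⟨j₀⟩⟩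
    · simp
    · simp only [fun j => hz j j₀, Int.cast_mul, mul_left_comm _ ((z.1 ⟨i, j₀⟩ : ℤ) : ℚ),
        ← Finset.mul_sum]
      rw [(x i).2.1 l, mul_zero], fun j => mul_ne_zero (Units.ne_zero _) ((x i).2.2 j)⟩

theorem tupleVec_signAct (h𝔇 : ∀ i j, X.primeClass ⟨i, j⟩ = 𝔇 i)
    {c : ∀ i, Fin (t i) → Fin (n i) → ℚ} (z : (X.torusHom ℤˣ).ker) (x : ∀ i, nzSol (c i)) (ρ) :
    tupleVec (signAct h𝔇 z x) ρ = z.1 ρ * tupleVec x ρ := rfl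

theorem torusHom_units_map (z : (i : Fin s) × Fin (n i) → ℤˣ) :
    X.torusHom ℚˣ (fun ρ => Units.map (Int.castRingHom ℚ).toMonoidHom (z ρ)) =
      fun k => Units.map (Int.castRingHom ℚ).toMonoidHom (X.torusHom ℤˣ z k) := by
  funext k
  simp only [torusHom, MonoidHom.coe_mk, OneHom.coe_mk, map_prod, map_zpow]

theorem torusHom_signAct (h𝔇 : ∀ i j, X.primeClass ⟨i, j⟩ = 𝔇 i)
    {c : ∀ i, Fin (t i) → Fin (n i) → ℚ} (z : (X.torusHom ℤˣ).ker) (x : ∀ i, nzSol (c i)) :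
    X.torusHom ℚˣ (toUnits (tupleVec (signAct h𝔇 z x)) (tupleVec_ne_zero _)) =
      X.torusHom ℚˣ (toUnits (tupleVec x) (tupleVec_ne_zero x)) := by
  have h1 : toUnits (tupleVec (signAct h𝔇 z x)) (tupleVec_ne_zero _) =
      (fun ρ => Units.map (Int.castRingHom ℚ).toMonoidHom (z.1 ρ)) *
        toUnits (tupleVec x) (tupleVec_ne_zero x) := by
    funext ρ
    refine Units.ext ?_
    simp [toUnits, tupleVec_signAct]
  rw [h1, map_mul, torusHom_units_map, show X.torusHom ℤˣ z.1 = 1 from z.2]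
  funext k
  simp

theorem signAct_mem (h𝔇 : ∀ i j, X.primeClass ⟨i, j⟩ = 𝔇 i) (hn : ∀ i, 0 < n i)
    {L : (i : Fin s) × Fin (n i) → ℤ} (hL : ∀ σ ρ, 0 ≤ X.atCone L σ ρ)
    {A : RegionData s X.maxCones} (hA : ∀ σ i, A.α σ i = X.alpha L σ i)
    (c : ∀ i, Fin (t i) → Fin (n i) → ℚ) {B : ℝ} (hB : 0 < B) (z : (X.torusHom ℤˣ).ker)
    {x : ∀ i, nzSol (c i)} (hx : x ∈ A.coprimeTuples X c (Real.log B)) :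
    signAct h𝔇 z x ∈ A.coprimeTuples X c (Real.log B) := by
  rw [mem_coprimeTuples_iff h𝔇 hn hL hA c hB] at hx ⊢
  refine ⟨fun p hp => ?_, ?_⟩
  · obtain ⟨σ, hσ⟩ := hx.1 p hp
    refine ⟨σ, fun ρ hρ => ?_⟩
    rw [tupleVec_signAct, Units.dvd_mul_left]
    exact hσ ρ hρ
  · rw [X.height_eq_of_torusHom_eq L (torusHom_signAct h𝔇 z x)]
    exact hx.2

theorem torusPoint_mem_of_mem (h𝔇 : ∀ i j, X.primeClass ⟨i, j⟩ = 𝔇 i) (hn : ∀ i, 0 < n i)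
    {L : (i : Fin s) × Fin (n i) → ℤ} (hL : ∀ σ ρ, 0 ≤ X.atCone L σ ρ)
    {A : RegionData s X.maxCones} (hA : ∀ σ i, A.α σ i = X.alpha L σ i)
    (c : ∀ i, Fin (t i) → Fin (n i) → ℚ) {B : ℝ} (hB : 0 < B)
    {x : ∀ i, nzSol (c i)} (hx : x ∈ A.coprimeTuples X c (Real.log B)) :
    X.torusHom ℚˣ (toUnits (tupleVec x) (tupleVec_ne_zero x)) ∈
      X.pointsOfHeightLE (linIdeal c) L B := by
  refine ⟨_, rfl, ?_, ((mem_coprimeTuples_iff h𝔇 hn hL hA c hB x).1 hx).2⟩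
  rw [eval_linIdeal_iff]
  exact fun i l => (x i).2.1 l

/-- Coprime coordinates differ from the given ones by a kernel element. It is constant on each
class, so the linear equations, each within one class, remain true. -/
theorem exists_tuple_of_mem (h𝔇 : ∀ i j, X.primeClass ⟨i, j⟩ = 𝔇 i) (hn : ∀ i, 0 < n i)
    {L : (i : Fin s) × Fin (n i) → ℤ} (hL : ∀ σ ρ, 0 ≤ X.atCone L σ ρ)
    {A : RegionData s X.maxCones} (hA : ∀ σ i, A.α σ i = X.alpha L σ i)
    (c : ∀ i, Fin (t i) → Fin (n i) → ℚ) {B : ℝ} (hB : 0 < B) {P : Fin d → ℚˣ}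
    (hP : P ∈ X.pointsOfHeightLE (linIdeal c) L B) :
    ∃ x ∈ A.coprimeTuples X c (Real.log B),
      X.torusHom ℚˣ (toUnits (tupleVec x) (tupleVec_ne_zero x)) = P := by
  obtain ⟨y, rfl, hy, hyB⟩ := hP
  obtain ⟨a, ha, hca, hay⟩ := X.exists_isCoprimeRep y
  rw [eval_linIdeal_iff] at hy
  have hz : X.torusHom ℚˣ (toUnits a ha / y) = 1 := by rw [map_div, hay, div_self']
  have hmem : ∀ i, (fun j => a ⟨i, j⟩) ∈ nzSol (c i) := fun i => by
    refine ⟨fun l => ?_, fun j => ha _⟩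
    have h1 : ∀ j, (a ⟨i, j⟩ : ℚ) =
        ((toUnits a ha / y) ⟨i, ⟨0, hn i⟩⟩ : ℚˣ) * (y ⟨i, j⟩ : ℚ) := fun j => by
      rw [← X.eq_of_torusHom_eq_one hz ((h𝔇 i j).trans (h𝔇 i _).symm), ← Units.val_mul,
        Pi.div_apply, div_mul_cancel]
      rfl
    simp only [h1, mul_left_comm (c i l _), ← Finset.mul_sum]
    rw [hy i l, mul_zero]
  refine ⟨fun i => ⟨_, hmem i⟩, ?_, hay⟩
  rw [mem_coprimeTuples_iff h𝔇 hn hL hA c hB]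
  refine ⟨hca, ?_⟩
  rw [← X.height_eq_of_torusHom_eq L hay] at hyB
  exact hyB

/-- Coprime coordinates of one point agree up to signs by `natAbs_eq_of_torusHom_eq`, and these
signs form an element of the kernel over `{±1}`, a group of order `2 ^ r` acting freely. -/
theorem ncard_coprimeTuples_eq (h𝔇 : ∀ i j, X.primeClass ⟨i, j⟩ = 𝔇 i) (hn : ∀ i, 0 < n i)
    {L : (i : Fin s) × Fin (n i) → ℤ} (hL : ∀ σ ρ, 0 ≤ X.atCone L σ ρ)
    {A : RegionData s X.maxCones} (hA : ∀ σ i, A.α σ i = X.alpha L σ i)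
    (c : ∀ i, Fin (t i) → Fin (n i) → ℚ) {B : ℝ} (hB : 0 < B) :
    (X.pointsOfHeightLE (linIdeal c) L B).ncard * 2 ^ Module.finrank ℤ X.PicX =
      (A.coprimeTuples X c (Real.log B)).ncard := by
  choose rep hrep hrepP using
    fun P (hP : P ∈ X.pointsOfHeightLE (linIdeal c) L B) =>
      exists_tuple_of_mem h𝔇 hn hL hA c hB hP
  rw [← X.card_ker_torusHom, ← Set.ncard_univ, ← Set.ncard_prod]
  refine Set.ncard_congr (fun p hp => signAct h𝔇 p.2 (rep p.1 hp.1)) ?_ ?_ ?_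
  · intro p hp
    exact signAct_mem h𝔇 hn hL hA c hB p.2 (hrep p.1 hp.1)
  · rintro ⟨P, z⟩ ⟨P', z'⟩ hPz hPz' h
    have hP : P ∈ X.pointsOfHeightLE (linIdeal c) L B := hPz.1
    have hP' : P' ∈ X.pointsOfHeightLE (linIdeal c) L B := hPz'.1
    change signAct h𝔇 z (rep P hP) = signAct h𝔇 z' (rep P' hP') at h
    have h1 : P = P' := by
      have e1 := (torusHom_signAct h𝔇 z (rep P hP)).trans (hrepP P hP)
      have e2 := (torusHom_signAct h𝔇 z' (rep P' hP')).trans (hrepP P' hP')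
      exact e1.symm.trans ((congrArg (fun x : ∀ i, nzSol (c i) =>
        X.torusHom ℚˣ (toUnits (tupleVec x) (tupleVec_ne_zero x))) h).trans e2)
    subst h1
    refine Prod.ext rfl (Subtype.ext (funext fun ρ => Units.ext ?_))
    have h2 : tupleVec (signAct h𝔇 z (rep P hP)) ρ = tupleVec (signAct h𝔇 z' (rep P hP)) ρ := by rw [h]
    rw [tupleVec_signAct, tupleVec_signAct] at h2
    exact mul_right_cancel₀ (tupleVec_ne_zero _ ρ) h2
  · intro x hx
    set P := X.torusHom ℚˣ (toUnits (tupleVec x) (tupleVec_ne_zero x)) with hPdef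
    have hP : P ∈ X.pointsOfHeightLE (linIdeal c) L B := torusPoint_mem_of_mem h𝔇 hn hL hA c hB hx
    have hc := ((mem_coprimeTuples_iff h𝔇 hn hL hA c hB _).1 hx).1
    have hc' := ((mem_coprimeTuples_iff h𝔇 hn hL hA c hB _).1 (hrep P hP)).1
    have habs := X.natAbs_eq_of_torusHom_eq (tupleVec_ne_zero x) (tupleVec_ne_zero (rep P hP)) hc hc'
      (hPdef.symm.trans (hrepP P hP).symm)
    have hz : ∀ ρ, ∃ z : ℤˣ, tupleVec x ρ = z * tupleVec (rep P hP) ρ := fun ρ => by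
      rcases Int.natAbs_eq_natAbs_iff.1 (habs ρ) with h | h
      · exact ⟨1, by simpa using h⟩
      · exact ⟨-1, by simpa using h⟩
    choose z hz using hz
    have hker : z ∈ (X.torusHom ℤˣ).ker := by
      have h1 : toUnits (tupleVec x) (tupleVec_ne_zero x) =
          (fun ρ => Units.map (Int.castRingHom ℚ).toMonoidHom (z ρ)) *
            toUnits (tupleVec (rep P hP)) (tupleVec_ne_zero _) := by
        funext ρ
        refine Units.ext ?_
        simp [toUnits, hz]
      have h2 := hPdef.symm.trans (hrepP P hP).symm
      rw [h1, map_mul, mul_eq_right, torusHom_units_map] at h2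
      rw [MonoidHom.mem_ker]
      funext k
      have h3 := congrFun h2 k
      refine Units.ext ?_
      have h4 := congrArg (fun u : ℚˣ => (u : ℚ)) h3
      simpa using h4
    refine ⟨(P, ⟨z, hker⟩), ⟨hP, trivial⟩, ?_⟩
    funext i
    exact Subtype.ext (funext fun j => (hz ⟨i, j⟩).symm)

theorem finite_pointsOfHeightLE (h𝔇 : ∀ i j, X.primeClass ⟨i, j⟩ = 𝔇 i) (hn : ∀ i, 0 < n i)
    {L : (i : Fin s) × Fin (n i) → ℤ} (hL : ∀ σ ρ, 0 ≤ X.atCone L σ ρ)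
    {A : RegionData s X.maxCones} (hA : ∀ σ i, A.α σ i = X.alpha L σ i)
    (c : ∀ i, Fin (t i) → Fin (n i) → ℚ) (B : ℝ) :
    (X.pointsOfHeightLE (linIdeal c) L B).Finite := by
  have : Nonempty X.maxCones := X.maxCones_nonempty.to_subtype
  by_cases hB : 0 < B
  · have hfin : (A.coprimeTuples X c (Real.log B)).Finite :=
      (A.finite_tuples hn c (d := 1) (fun _ => Nat.one_pos) (Real.log B)).subset fun x hx => hx.1
    refine (hfin.image fun x =>
      X.torusHom ℚˣ (toUnits (tupleVec x) (tupleVec_ne_zero x))).subset fun P hP => ?_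
    exact exists_tuple_of_mem h𝔇 hn hL hA c hB hP
  · refine Set.Finite.subset Set.finite_empty ?_
    rintro P ⟨x, -, -, hx⟩
    exact hB (lt_of_lt_of_le (Height.mulHeight_pos _) hx)

end Counting

end SmoothCompleteFan

/-! ### Rational and real solutions of the linear equations -/

section RatSol

variable {m t : ℕ} (c : Fin t → Fin m → ℚ)

/-- The rational solutions of a system of linear equations. -/
def ratSol : Submodule ℚ (Fin m → ℚ) := LinearMap.ker (Matrix.mulVecLin (Matrix.of c))

theorem mem_ratSol {w : Fin m → ℚ} : w ∈ ratSol c ↔ ∀ l, ∑ j, c l j * w j = 0 := by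
  rw [ratSol, LinearMap.mem_ker, funext_iff]
  rfl

theorem le_finrank_ratSol : m ≤ Module.finrank ℚ (ratSol c) + t := by
  have h1 := LinearMap.finrank_range_add_finrank_ker (Matrix.mulVecLin (Matrix.of c))
  have h2 := Submodule.finrank_le (LinearMap.range (Matrix.mulVecLin (Matrix.of c)))
  rw [Module.finrank_fin_fun] at h1 h2
  rw [ratSol]
  omega

/-- The hypothesis says that the `t` equations are independent over `ℚ`, so the matrix has a
rational right inverse, which remains one over `ℝ`. -/
theorem finrank_solSpace_of_finrank_ratSol (h : Module.finrank ℚ (ratSol c) + t = m) :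
    Module.finrank ℝ (solSpace c) + t = m := by
  have hsurj : Function.Surjective (Matrix.of c).mulVec := by
    have h1 := LinearMap.finrank_range_add_finrank_ker (Matrix.mulVecLin (Matrix.of c))
    rw [Module.finrank_fin_fun] at h1
    rw [ratSol] at h
    have h2 : LinearMap.range (Matrix.mulVecLin (Matrix.of c)) = ⊤ := by
      refine Submodule.eq_top_of_finrank_eq ?_
      rw [Module.finrank_fin_fun]
      omega
    exact LinearMap.range_eq_top.1 h2
  obtain ⟨D, hD⟩ := Matrix.mulVec_surjective_iff_exists_right_inverse.1 hsurj
  set M : Matrix (Fin t) (Fin m) ℝ := (Matrix.of c).map (algebraMap ℚ ℝ) with hM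
  have hMD : M * D.map (algebraMap ℚ ℝ) = 1 := by
    rw [hM, ← Matrix.map_mul, hD, Matrix.map_one _ (map_zero _) (map_one _)]
  have hsurj' : LinearMap.range (Matrix.mulVecLin M) = ⊤ :=
    LinearMap.range_eq_top.2 (Matrix.mulVec_surjective_iff_exists_right_inverse.2 ⟨_, hMD⟩)
  have h1 := LinearMap.finrank_range_add_finrank_ker (Matrix.mulVecLin M)
  rw [hsurj', finrank_top, Module.finrank_fin_fun, Module.finrank_fin_fun] at h1
  have h2 : Module.finrank ℝ (solSpace c) = Module.finrank ℝ (LinearMap.ker (Matrix.mulVecLin M)) := by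
    have h3 : (solSpace c).map (WithLp.linearEquiv 2 ℝ (Fin m → ℝ)).toLinearMap =
        LinearMap.ker (Matrix.mulVecLin M) := by
      ext w
      rw [Submodule.mem_map_equiv, LinearMap.mem_ker, funext_iff]
      rfl
    rw [← h3]
    exact (LinearEquiv.finrank_map_eq _ _).symm
  omega

end RatSol

/-! ### The coordinate ring of `V` as a polynomial ring -/

section Param

variable {s : ℕ} {n t : Fin s → ℕ} (c : ∀ i, Fin (t i) → Fin (n i) → ℚ)

/-- The dimensions of the spaces of rational solutions. -/
noncomputable def paramDim (i : Fin s) : ℕ := Module.finrank ℚ (ratSol (c i))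

/-- The variables of the coordinate ring of the complete intersection. -/
abbrev ParamVar : Type := (i : Fin s) × Fin (paramDim c i)

/-- A basis of the space of rational solutions. -/
noncomputable def solBasis (i : Fin s) : Module.Basis (Fin (paramDim c i)) ℚ (ratSol (c i)) :=
  Module.finBasis ℚ (ratSol (c i))

/-- The parametrization of the solutions of the linear equations. -/
noncomputable def param : MvPolynomial ((i : Fin s) × Fin (n i)) ℚ →ₐ[ℚ] MvPolynomial (ParamVar c) ℚ :=
  MvPolynomial.aeval fun ρ => linForm ρ.1 fun k => (solBasis c ρ.1 k).1 ρ.2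

theorem param_X (ρ : (i : Fin s) × Fin (n i)) :
    param c (MvPolynomial.X ρ) = linForm ρ.1 fun k => (solBasis c ρ.1 k).1 ρ.2 := by
  rw [param, MvPolynomial.aeval_X]

theorem exists_dual_coeff (i : Fin s) : ∃ D : Fin (paramDim c i) → Fin (n i) → ℚ,
    ∀ w : ratSol (c i), ∀ k, ∑ j, D k j * w.1 j = (solBasis c i).repr w k := by
  obtain ⟨g, hg⟩ := LinearMap.exists_leftInverse_of_injective (ratSol (c i)).subtype
    (LinearMap.ker_eq_bot.2 (Submodule.subtype_injective _))
  refine ⟨fun k j => (solBasis c i).repr (g (Pi.single j 1)) k, fun w k => ?_⟩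
  have h1 : g w.1 = w := congrArg (fun f : ratSol (c i) →ₗ[ℚ] ratSol (c i) => f w) hg
  conv_rhs => rw [← h1, pi_eq_sum_univ' w.1]
  simp only [map_sum, map_smul, Finsupp.coe_finsetSum, Finset.sum_apply, Finsupp.coe_smul,
    Pi.smul_apply, smul_eq_mul]
  exact Finset.sum_congr rfl fun j _ => mul_comm _ _

/-- Coefficients of linear forms dual to the basis of solutions. -/
noncomputable def dualCoeff (i : Fin s) : Fin (paramDim c i) → Fin (n i) → ℚ :=
  (exists_dual_coeff c i).choose

theorem sum_dualCoeff (i : Fin s) (w : ratSol (c i)) (k) :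
    ∑ j, dualCoeff c i k j * w.1 j = (solBasis c i).repr w k := (exists_dual_coeff c i).choose_spec w k

/-- A section of the parametrization. -/
noncomputable def paramSection :
    MvPolynomial (ParamVar c) ℚ →ₐ[ℚ] MvPolynomial ((i : Fin s) × Fin (n i)) ℚ :=
  MvPolynomial.aeval fun k => linForm k.1 (dualCoeff c k.1 k.2)

theorem linForm_sum {n : Fin s → ℕ} {κ : Type} (F : Finset κ) (i : Fin s) (a : κ → ℚ)
    (v : κ → Fin (n i) → ℚ) :
    linForm i (∑ k ∈ F, a k • v k) = ∑ k ∈ F, MvPolynomial.C (a k) * linForm i (v k) := by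
  simp only [linForm, Finset.sum_apply, Pi.smul_apply, smul_eq_mul, map_sum, map_mul,
    Finset.sum_mul, Finset.mul_sum, mul_assoc]
  exact Finset.sum_comm

theorem linForm_single {n : Fin s → ℕ} (i : Fin s) (j : Fin (n i)) :
    linForm i (Pi.single j 1) = MvPolynomial.X (⟨i, j⟩ : (i : Fin s) × Fin (n i)) := by
  rw [linForm, Finset.sum_eq_single j (fun j' _ h => by simp [Pi.single_eq_of_ne h])
    fun h => absurd (Finset.mem_univ _) h]
  simp

theorem linForm_sub {n : Fin s → ℕ} (i : Fin s) (v w : Fin (n i) → ℚ) :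
    linForm i (v - w) = linForm i v - linForm i w := by
  simp [linForm, sub_mul, Finset.sum_sub_distrib]

theorem param_linForm (i : Fin s) (v : Fin (n i) → ℚ) :
    param c (linForm i v) = linForm i fun k => ∑ j, v j * (solBasis c i k).1 j := by
  have h1 : (fun k => ∑ j, v j * (solBasis c i k).1 j) =
      ∑ j, v j • fun k => (solBasis c i k).1 j := by
    funext k
    simp
  rw [h1, linForm_sum]
  simp only [linForm, map_sum, map_mul, MvPolynomial.algHom_C, param_X]
  rfl

theorem param_paramSection (f : MvPolynomial (ParamVar c) ℚ) : param c (paramSection c f) = f := by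
  have h : (param c).comp (paramSection c) = AlgHom.id ℚ _ := by
    refine MvPolynomial.algHom_ext fun k => ?_
    rw [AlgHom.comp_apply, paramSection, MvPolynomial.aeval_X, param_linForm]
    simp only [sum_dualCoeff, Module.Basis.repr_self]
    rw [show (fun k' => (Finsupp.single k' (1 : ℚ)) k.2) = Pi.single k.2 1 from funext fun k' => by
      simp [Finsupp.single_apply, Pi.single_apply], linForm_single]
    rfl
  exact congrArg (fun g : MvPolynomial (ParamVar c) ℚ →ₐ[ℚ] MvPolynomial (ParamVar c) ℚ => g f) h

/-- A form vanishing on the common kernel of finitely many forms is a linear combination of them. -/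
theorem linForm_mem_linIdeal {i : Fin s} {v : Fin (n i) → ℚ}
    (hv : ∀ w ∈ ratSol (c i), ∑ j, v j * w j = 0) : linForm i v ∈ linIdeal c := by
  let Λ : (Fin (n i) → ℚ) → ((Fin (n i) → ℚ) →ₗ[ℚ] ℚ) := fun u => Fintype.linearCombination ℚ u
  have hΛ : ∀ u w, Λ u w = ∑ j, u j * w j := fun u w => by
    simp [Λ, Fintype.linearCombination_apply, mul_comm]
  have h1 : Λ v ∈ Submodule.span ℚ (Set.range fun l => Λ (c i l)) := by
    refine mem_span_of_iInf_ker_le_ker fun w hw => ?_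
    rw [LinearMap.mem_ker, hΛ]
    refine hv w ((mem_ratSol _).2 fun l => ?_)
    rw [← hΛ]
    exact (Submodule.mem_iInf _).1 hw l
  obtain ⟨a, ha⟩ := (Submodule.mem_span_range_iff_exists_fun ℚ).1 h1
  have h2 : v = ∑ l, a l • c i l := by
    funext j
    have h3 := congrArg (fun g : (Fin (n i) → ℚ) →ₗ[ℚ] ℚ => g (Pi.single j 1)) ha
    simpa [hΛ, Pi.single_apply] using h3.symm
  rw [h2, linForm_sum]
  exact Ideal.sum_mem _ fun l _ => Ideal.mul_mem_left _ _ (Ideal.subset_span ⟨i, l, rfl⟩)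

/-- Each variable is congruent to its image under `paramSection ∘ param` modulo `linIdeal c`, since
the difference is a linear form vanishing on all solutions. So `param` loses nothing beyond
`linIdeal c`. -/
theorem ker_param : RingHom.ker (param c) = linIdeal c := by
  refine le_antisymm (fun f hf => ?_) ?_
  · have h1 : (Ideal.Quotient.mkₐ ℚ (linIdeal c)).comp ((paramSection c).comp (param c)) =
        Ideal.Quotient.mkₐ ℚ (linIdeal c) := by
      refine MvPolynomial.algHom_ext fun ρ => ?_
      obtain ⟨i, j⟩ := ρ
      rw [AlgHom.comp_apply, AlgHom.comp_apply, param_X, ← sub_eq_zero, ← map_sub,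
        Ideal.Quotient.mkₐ_eq_mk, Ideal.Quotient.eq_zero_iff_mem, ← neg_mem_iff, neg_sub]
      have h2 : paramSection c (linForm i fun k => (solBasis c i k).1 j) =
          linForm i (∑ k, (solBasis c i k).1 j • dualCoeff c i k) := by
        rw [linForm_sum]
        simp only [linForm, map_sum, map_mul, MvPolynomial.algHom_C, paramSection,
          MvPolynomial.aeval_X]
        rfl
      rw [h2, ← linForm_single, ← linForm_sub]
      refine linForm_mem_linIdeal c fun w hw => ?_
      have h3 := congrArg (fun v : ratSol (c i) => v.1 j) ((solBasis c i).sum_repr ⟨w, hw⟩)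
      simp only [Submodule.coe_sum, Submodule.coe_smul, Finset.sum_apply, Pi.smul_apply,
        smul_eq_mul] at h3
      simp only [Pi.sub_apply, Finset.sum_apply, Pi.smul_apply, smul_eq_mul, sub_mul,
        Finset.sum_sub_distrib, Finset.sum_mul]
      rw [Finset.sum_comm]
      simp only [mul_assoc, ← Finset.mul_sum, sum_dualCoeff c i ⟨w, hw⟩]
      rw [Finset.sum_congr rfl fun k _ => mul_comm ((solBasis c i k).1 j) _, h3,
        Finset.sum_eq_single j (fun j' _ h => by simp [Pi.single_eq_of_ne h])
        fun h => absurd (Finset.mem_univ _) h]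
      simp
    have h4 := congrArg
      (fun g : MvPolynomial ((i : Fin s) × Fin (n i)) ℚ →ₐ[ℚ] _ ⧸ linIdeal c => g f) h1
    simp only [AlgHom.comp_apply] at h4
    rw [RingHom.mem_ker.1 hf, map_zero, map_zero] at h4
    exact Ideal.Quotient.eq_zero_iff_mem.1 h4.symm
  · rw [linIdeal, Ideal.span_le]
    rintro _ ⟨i, l, rfl⟩
    change param c (linForm i (c i l)) = 0
    rw [param_linForm]
    have h1 : ∀ k, ∑ j, c i l j * (solBasis c i k).1 j = 0 := fun k =>
      (mem_ratSol _).1 (solBasis c i k).2 l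
    simp [linForm, h1]

theorem linForm_ne_zero {n : Fin s → ℕ} {i : Fin s} {v : Fin (n i) → ℚ} {k : Fin (n i)} (hk : v k ≠ 0) :
    linForm i v ≠ 0 := by
  intro h
  have h1 := congrArg (MvPolynomial.coeff (Finsupp.single (⟨i, k⟩ : (i : Fin s) × Fin (n i)) 1)) h
  rw [linForm, MvPolynomial.coeff_sum, Finset.sum_eq_single k] at h1
  · simp [MvPolynomial.coeff_C_mul] at h1
    exact hk h1
  · intro k' _ hne
    rw [MvPolynomial.coeff_C_mul, MvPolynomial.coeff_X, if_neg, mul_zero]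
    intro h2
    rw [Finsupp.single_left_inj one_ne_zero] at h2
    exact hne (by simpa using h2)
  · exact fun h => absurd (Finset.mem_univ _) h

end Param

theorem isWeightedHomogeneous_linForm {s : ℕ} {n : Fin s → ℕ} {M : Type} [AddCommMonoid M]
    {w : (i : Fin s) × Fin (n i) → M} {i : Fin s} {γ : M} (hw : ∀ k, w ⟨i, k⟩ = γ)
    (v : Fin (n i) → ℚ) : MvPolynomial.IsWeightedHomogeneous w (linForm i v) γ := by
  refine MvPolynomial.IsWeightedHomogeneous.sum _ _ _ fun k _ => ?_
  refine MvPolynomial.IsWeightedHomogeneous.C_mul ?_ _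
  rw [← hw k]
  exact MvPolynomial.isWeightedHomogeneous_X _ _ _

/-! ### The dimension of `V` and independence of the linear forms -/

namespace SmoothCompleteFan

variable {d s : ℕ} {n t : Fin s → ℕ} {X : SmoothCompleteFan d ((i : Fin s) × Fin (n i))}
  {𝔇 : Fin s → X.PicX} {c : ∀ i, Fin (t i) → Fin (n i) → ℚ}

/-- Otherwise the variable `x_{i,j}` would vanish on all solutions and lie in `linIdeal c`, and `V`
would not meet `T`. -/
theorem exists_solBasis_ne_zero
    (hVT : ∃ p ∈ X.points (linIdeal c), ∀ ρ, MvPolynomial.X ρ ∉ p.asIdeal) (i : Fin s)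
    (j : Fin (n i)) : ∃ k, (solBasis c i k).1 j ≠ 0 := by
  by_contra hcon
  push Not at hcon
  obtain ⟨p, hp, hpX⟩ := hVT
  refine hpX ⟨i, j⟩ (hp.2.1 ?_)
  rw [← linForm_single]
  refine linForm_mem_linIdeal c fun w hw => ?_
  rw [Finset.sum_eq_single j (fun j' _ h => by simp [Pi.single_eq_of_ne h])
    fun h => absurd (Finset.mem_univ _) h, Pi.single_eq_same, one_mul]
  have h3 := congrArg (fun v : ratSol (c i) => v.1 j) ((solBasis c i).sum_repr ⟨w, hw⟩)
  simp only [Submodule.coe_sum, Submodule.coe_smul, Finset.sum_apply, Pi.smul_apply,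
    smul_eq_mul, hcon, mul_zero, Finset.sum_const_zero] at h3
  exact h3.symm

theorem param_X_isWeightedHomogeneous (h𝔇 : ∀ i j, X.primeClass ⟨i, j⟩ = 𝔇 i)
    (ρ : (i : Fin s) × Fin (n i)) :
    MvPolynomial.IsWeightedHomogeneous (fun k : ParamVar c => 𝔇 k.1)
      (param c (MvPolynomial.X ρ)) (X.primeClass ρ) := by
  rw [param_X]
  exact isWeightedHomogeneous_linForm (fun k => (h𝔇 ρ.1 ρ.2).symm) _

theorem zeroOn_linForm_ne_zero {m : Fin s → ℕ} {i : Fin s} {v : Fin (m i) → ℚ} {k : Fin (m i)}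
    {Z : Finset ((i : Fin s) × Fin (m i))} (hk : v k ≠ 0)
    (hkZ : (⟨i, k⟩ : (i : Fin s) × Fin (m i)) ∉ Z) : zeroOn Z (linForm i v) ≠ 0 := by
  have h1 : zeroOn Z (linForm i v) =
      linForm i fun k => if (⟨i, k⟩ : (i : Fin s) × Fin (m i)) ∈ Z then 0 else v k := by
    simp only [linForm, map_sum, map_mul, MvPolynomial.algHom_C, zeroOn, MvPolynomial.aeval_X]
    refine Finset.sum_congr rfl fun k _ => ?_
    split_ifs <;> simp
  rw [h1]
  exact linForm_ne_zero (k := k) (by simpa [hkZ] using hk)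

/-- The point of `V` given by setting some of the parameters to zero. -/
noncomputable def linearPoint (h𝔇 : ∀ i j, X.primeClass ⟨i, j⟩ = 𝔇 i) (Z : Finset (ParamVar c))
    (hZ : ∃ σ ∈ X.maxCones, ∀ ρ ∉ σ, zeroOn Z (param c (MvPolynomial.X ρ)) ≠ 0) :
    X.points (linIdeal c) :=
  ⟨⟨RingHom.ker ((zeroOn Z).comp (param c)), RingHom.ker_isPrime _⟩, by
    have hhom : ∀ k : ParamVar c, MvPolynomial.IsWeightedHomogeneous (fun k : ParamVar c => 𝔇 k.1)
        (zeroOn Z (MvPolynomial.X k)) (𝔇 k.1) := fun k => by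
      rw [zeroOn, MvPolynomial.aeval_X]
      split_ifs
      · exact MvPolynomial.isWeightedHomogeneous_zero _ _ _
      · exact MvPolynomial.isWeightedHomogeneous_X _ (fun k : ParamVar c => 𝔇 k.1) _
    refine ⟨fun f hf γ => ?_, fun f hf => ?_, ?_⟩
    · change zeroOn Z (param c f) = 0 at hf
      change zeroOn Z (param c _) = 0
      rw [map_weightedHomogeneousComponent (param_X_isWeightedHomogeneous h𝔇),
        map_weightedHomogeneousComponent hhom, hf, map_zero]
    · rw [← ker_param] at hf
      change zeroOn Z (param c f) = 0
      rw [RingHom.mem_ker.1 hf, map_zero]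
    · obtain ⟨σ, hσ, h⟩ := hZ
      refine ⟨σ, hσ, fun hmem => ?_⟩
      change zeroOn Z (param c _) = 0 at hmem
      rw [map_prod, map_prod, Finset.prod_eq_zero_iff] at hmem
      obtain ⟨ρ, hρ, h1⟩ := hmem
      exact h ρ (Finset.mem_compl.1 hρ) h1⟩

theorem specializes_points_iff {J : Ideal (MvPolynomial ((i : Fin s) × Fin (n i)) ℚ)}
    (p q : X.points J) : p ⤳ q ↔ p.1.asIdeal ≤ q.1.asIdeal := by
  rw [← Topology.IsInducing.subtypeVal.specializes_iff, ← PrimeSpectrum.le_iff_specializes]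
  rfl

/-- Setting the parameters outside a suitable set `K` to zero one by one gives a chain of
homogeneous primes. Keeping `K` ensures that no variable off a fixed maximal cone becomes zero, so
the primes stay points of `V`. -/
theorem le_topologicalKrullDim_points (h𝔇 : ∀ i j, X.primeClass ⟨i, j⟩ = 𝔇 i)
    (hVT : ∃ p ∈ X.points (linIdeal c), ∀ ρ, MvPolynomial.X ρ ∉ p.asIdeal) :
    ∃ q : ℕ, (∑ i, paramDim c i ≤ q + Module.finrank ℤ X.PicX) ∧
      (q : WithBot ℕ∞) ≤ topologicalKrullDim (X.points (linIdeal c)) := by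
  classical
  obtain ⟨σ, hσ⟩ := X.maxCones_nonempty
  choose k hk using fun ρ : (i : Fin s) × Fin (n i) => exists_solBasis_ne_zero hVT ρ.1 ρ.2
  -- One parameter for each variable off `σ`, hence at most `#ι - d = rk Pic X` of them.
  let K : Finset (ParamVar c) := σᶜ.image fun ρ => ⟨ρ.1, k ρ⟩
  have hK : K.card ≤ Module.finrank ℤ X.PicX := by
    refine Finset.card_image_le.trans ?_
    have h1 := X.finrank_picX
    rw [Finset.card_compl, X.card_of_mem_maxCones ⟨σ, hσ⟩]
    omega
  let q := Kᶜ.card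
  let e : Fin q ≃ {x // x ∈ Kᶜ} := (Finset.equivFin Kᶜ).symm
  let Z : Fin (q + 1) → Finset (ParamVar c) := fun a =>
    Finset.univ.filter fun x => ∃ b : Fin q, b.1 < a.1 ∧ (e b).1 = x
  have hZ : ∀ a, ∃ σ ∈ X.maxCones, ∀ ρ ∉ σ, zeroOn (Z a) (param c (MvPolynomial.X ρ)) ≠ 0 := by
    refine fun a => ⟨σ, hσ, fun ρ hρ => ?_⟩
    rw [param_X]
    refine zeroOn_linForm_ne_zero (k := k ρ) (hk ρ) fun hmem => ?_
    obtain ⟨b, -, hb⟩ := (Finset.mem_filter.1 hmem).2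
    have h1 := (e b).2
    rw [hb, Finset.mem_compl] at h1
    exact h1 (Finset.mem_image.2 ⟨ρ, Finset.mem_compl.2 hρ, rfl⟩)
  let P : Fin (q + 1) → X.points (linIdeal c) := fun a => linearPoint h𝔇 (Z a) (hZ a)
  have hPle : ∀ a b, a ≤ b → (P a).1.asIdeal ≤ (P b).1.asIdeal := by
    intro a b hab f hf
    change zeroOn (Z a) (param c f) = 0 at hf
    change zeroOn (Z b) (param c f) = 0
    have h1 : (zeroOn (Z b)).comp (zeroOn (Z a)) = zeroOn (Z b) := by
      refine MvPolynomial.algHom_ext fun x => ?_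
      rw [AlgHom.comp_apply, zeroOn, zeroOn, MvPolynomial.aeval_X, MvPolynomial.aeval_X]
      split_ifs with h2 h3 h3
      · rw [map_zero]
      · refine absurd ?_ h3
        obtain ⟨y, hy, hy'⟩ := (Finset.mem_filter.1 h2).2
        exact Finset.mem_filter.2 ⟨Finset.mem_univ _, y, hy.trans_le hab, hy'⟩
      · rw [MvPolynomial.aeval_X, if_pos h3]
      · rw [MvPolynomial.aeval_X, if_neg h3]
    rw [← h1, AlgHom.comp_apply, hf, map_zero]
  have hPlt : ∀ a b, a < b → ¬ (P b).1.asIdeal ≤ (P a).1.asIdeal := by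
    intro a b hab hle
    have haq : a.1 < q := by have := b.2; have : a.1 < b.1 := hab; omega
    let x : ParamVar c := (e ⟨a.1, haq⟩).1
    have hxb : x ∈ Z b := Finset.mem_filter.2 ⟨Finset.mem_univ _, ⟨a.1, haq⟩, hab, rfl⟩
    have hxa : x ∉ Z a := fun h => by
      obtain ⟨y, hy, hy'⟩ := (Finset.mem_filter.1 h).2
      have h1 : y = ⟨a.1, haq⟩ := e.injective (Subtype.ext hy')
      rw [h1] at hy
      exact lt_irrefl _ hy
    have hmem : paramSection c (MvPolynomial.X x) ∈ (P b).1.asIdeal := by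
      change zeroOn (Z b) (param c _) = 0
      rw [param_paramSection, zeroOn, MvPolynomial.aeval_X, if_pos hxb]
    have h2 := hle hmem
    change zeroOn (Z a) (param c _) = 0 at h2
    rw [param_paramSection, zeroOn, MvPolynomial.aeval_X, if_neg hxa] at h2
    exact MvPolynomial.X_ne_zero x h2
  -- Larger primes have smaller closures, whence the order dual.
  let C : Fin (q + 1) → (IrreducibleCloseds (X.points (linIdeal c)))ᵒᵈ := fun a =>
    OrderDual.toDual ⟨closure {P a}, isIrreducible_singleton.closure, isClosed_closure⟩
  have hC : StrictMono C := by
    intro a b hab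
    have h1 : closure {P b} ⊆ closure {P a} :=
      specializes_iff_closure_subset.1 ((specializes_points_iff _ _).2 (hPle a b hab.le))
    have h2 : ¬ closure {P a} ⊆ closure {P b} := fun h =>
      hPlt a b hab ((specializes_points_iff _ _).1 (specializes_iff_closure_subset.2 h))
    exact lt_of_le_not_ge (show C a ≤ C b from h1) fun h => h2 h
  refine ⟨q, ?_, ?_⟩
  · have h1 : q = ∑ i, paramDim c i - K.card := by
      simp only [q, Finset.card_compl, Fintype.card_sigma, Fintype.card_fin]
    omega
  · rw [topologicalKrullDim, ← Order.krullDim_orderDual]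
    exact Order.LTSeries.length_le_krullDim (LTSeries.mk q C hC)

/-- The dimension of `V` bounds `∑ (paramDim + t)` above by `d + rk Pic X = ∑ n`, while each summand
is at least `n i`. So equality holds for every `i`. -/
theorem paramDim_add_eq (h𝔇 : ∀ i j, X.primeClass ⟨i, j⟩ = 𝔇 i)
    (hV : topologicalKrullDim (X.points (linIdeal c)) + ((∑ i, t i : ℕ) : WithBot ℕ∞) = d)
    (hVT : ∃ p ∈ X.points (linIdeal c), ∀ ρ, MvPolynomial.X ρ ∉ p.asIdeal) (i : Fin s) :
    paramDim c i + t i = n i := by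
  obtain ⟨q, h1, h2⟩ := le_topologicalKrullDim_points h𝔇 hVT
  have h3 : ((q + ∑ i, t i : ℕ) : WithBot ℕ∞) ≤ (d : ℕ) := by
    rw [← hV, Nat.cast_add]
    gcongr
  have h4 : q + ∑ i, t i ≤ d := by exact_mod_cast h3
  have h5 := X.finrank_picX
  simp only [Fintype.card_sigma, Fintype.card_fin] at h5
  have h6 : ∀ i ∈ Finset.univ, n i ≤ paramDim c i + t i := fun i _ => le_finrank_ratSol (c i)
  have h7 : ∑ i, (paramDim c i + t i) ≤ ∑ i, n i := by
    rw [Finset.sum_add_distrib]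
    omega
  exact ((Finset.sum_eq_sum_iff_of_le h6).1 (le_antisymm (Finset.sum_le_sum h6) h7) i
    (Finset.mem_univ i)).symm

theorem exists_solSpace_ne_zero
    (hVT : ∃ p ∈ X.points (linIdeal c), ∀ ρ, MvPolynomial.X ρ ∉ p.asIdeal) (i : Fin s)
    (j : Fin (n i)) : ∃ w : solSpace (c i), (w : EuclideanSpace ℝ (Fin (n i))) j ≠ 0 := by
  obtain ⟨k, hk⟩ := exists_solBasis_ne_zero hVT i j
  refine ⟨⟨WithLp.toLp 2 fun j => ((solBasis c i k).1 j : ℝ), fun l => ?_⟩, ?_⟩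
  · have h1 := (mem_ratSol _).1 (solBasis c i k).2 l
    change ∑ j, (c i l j : ℝ) * ((solBasis c i k).1 j : ℝ) = 0
    exact_mod_cast h1
  · simpa using hk

end SmoothCompleteFan

/-! ### Factorization of homogeneous polynomials -/

section Graded

variable {κ G : Type} [AddCommGroup G] {w : κ → G}

theorem weightedHomogeneousComponent_mul {b : MvPolynomial κ ℚ} {β : G}
    (hb : MvPolynomial.IsWeightedHomogeneous w b β) (a : MvPolynomial κ ℚ) (γ : G) :
    MvPolynomial.weightedHomogeneousComponent w (γ + β) (a * b) =
      MvPolynomial.weightedHomogeneousComponent w γ a * b := by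
  induction a using MvPolynomial.induction_on' with
  | add p q hp hq => rw [add_mul, map_add, map_add, hp, hq, add_mul]
  | monomial e r =>
    have h1 := MvPolynomial.isWeightedHomogeneous_monomial w e r rfl
    by_cases h : γ = Finsupp.weight w e
    · subst h
      rw [h1.weightedHomogeneousComponent_same, (h1.mul hb).weightedHomogeneousComponent_same]
    · rw [h1.weightedHomogeneousComponent_ne _ h, zero_mul,
        (h1.mul hb).weightedHomogeneousComponent_ne _ fun h2 => h (add_right_cancel h2)]

/-- If the degrees in `a` and `b` formed more than one pair, two different pairs would have sums
attained only once. The components of `a * b` in both degrees would be nonzero, so both sums would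
equal `δ`, contradicting uniqueness. -/
theorem exists_isWeightedHomogeneous_of_mul [TwoUniqueSums G] {a b : MvPolynomial κ ℚ} {δ : G}
    (h : MvPolynomial.IsWeightedHomogeneous w (a * b) δ) (hab : a * b ≠ 0) :
    ∃ γ, MvPolynomial.IsWeightedHomogeneous w a γ := by
  classical
  have ha0 : a ≠ 0 := left_ne_zero_of_mul hab
  have hb0 : b ≠ 0 := right_ne_zero_of_mul hab
  let A := a.support.image (Finsupp.weight w)
  let B := b.support.image (Finsupp.weight w)
  have hAne : A.Nonempty := (MvPolynomial.support_nonempty.2 ha0).image _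
  have hBne : B.Nonempty := (MvPolynomial.support_nonempty.2 hb0).image _
  have hcomp : ∀ (f : MvPolynomial κ ℚ) (γ : G),
      MvPolynomial.weightedHomogeneousComponent w γ f ≠ 0 ↔
        γ ∈ f.support.image (Finsupp.weight w) := by
    intro f γ
    rw [← MvPolynomial.support_nonempty, MvPolynomial.support_weightedHomogeneousComponent]
    simp only [Finset.Nonempty, Finset.mem_filter, Finset.mem_image]
  have hbsum : b = ∑ y ∈ B, MvPolynomial.weightedHomogeneousComponent w y b := by
    ext e
    rw [MvPolynomial.coeff_sum]
    simp only [MvPolynomial.coeff_weightedHomogeneousComponent]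
    rw [Finset.sum_ite_eq]
    split_ifs with he
    · rfl
    · by_contra hne
      exact he (Finset.mem_image_of_mem _ (MvPolynomial.mem_support_iff.2 hne))
  have key : ∀ α ∈ A, ∀ β ∈ B, UniqueAdd A B α β → α + β = δ := by
    intro α hα β hβ hu
    by_contra hne
    have h1 := h.weightedHomogeneousComponent_ne _ hne
    rw [hbsum, Finset.mul_sum, map_sum, Finset.sum_eq_single β] at h1
    · rw [weightedHomogeneousComponent_mul
        (MvPolynomial.weightedHomogeneousComponent_isWeightedHomogeneous _ _)] at h1
      exact mul_ne_zero ((hcomp a α).2 hα) ((hcomp b β).2 hβ) h1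
    · intro y hy hyβ
      have h2 := weightedHomogeneousComponent_mul
        (MvPolynomial.weightedHomogeneousComponent_isWeightedHomogeneous y b (w := w)) a (α + β - y)
      rw [sub_add_cancel] at h2
      rw [h2]
      by_contra h3
      have h4 := (hcomp a (α + β - y)).1 (left_ne_zero_of_mul h3)
      exact hyβ (hu h4 hy (sub_add_cancel _ _)).2
    · exact fun h => absurd hβ h
  by_cases hcard : 1 < A.card * B.card
  · obtain ⟨p₁, hp₁, p₂, hp₂, hne, hu₁, hu₂⟩ := TwoUniqueSums.uniqueAdd_of_one_lt_card hcard
    rw [Finset.mem_product] at hp₁ hp₂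
    have h1 := key _ hp₁.1 _ hp₁.2 hu₁
    have h2 := key _ hp₂.1 _ hp₂.2 hu₂
    have h3 := hu₁ hp₂.1 hp₂.2 (h2.trans h1.symm)
    exact absurd (Prod.ext h3.1 h3.2).symm hne
  · have h1 : 1 ≤ A.card := hAne.card_pos
    have h2 : 1 ≤ B.card := hBne.card_pos
    have h3 : A.card = 1 := by nlinarith
    obtain ⟨γ, hγ⟩ := Finset.card_eq_one.1 h3
    refine ⟨γ, fun e he => ?_⟩
    have h4 : Finsupp.weight w e ∈ A :=
      Finset.mem_image_of_mem _ (MvPolynomial.mem_support_iff.2 he)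
    rw [hγ] at h4
    exact Finset.mem_singleton.1 h4

theorem exists_isWeightedHomogeneous_of_dvd [TwoUniqueSums G] {a f : MvPolynomial κ ℚ} {δ : G}
    (h : MvPolynomial.IsWeightedHomogeneous w f δ) (hf : f ≠ 0) (ha : a ∣ f) :
    ∃ γ, MvPolynomial.IsWeightedHomogeneous w a γ := by
  obtain ⟨b, rfl⟩ := ha
  exact exists_isWeightedHomogeneous_of_mul h hf

theorem dvd_weightedHomogeneousComponent {b f : MvPolynomial κ ℚ} {β : G}
    (hb : MvPolynomial.IsWeightedHomogeneous w b β) (h : b ∣ f) (γ : G) :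
    b ∣ MvPolynomial.weightedHomogeneousComponent w γ f := by
  obtain ⟨u, rfl⟩ := h
  have h1 := weightedHomogeneousComponent_mul hb u (γ - β)
  rw [sub_add_cancel] at h1
  rw [mul_comm b u, h1]
  exact dvd_mul_left _ _

end Graded

section Fractions

variable {R : Type} [CommRing R] [UniqueFactorizationMonoid R]

/-- Writing an element as a power of a prime times an element prime to it. -/
theorem exists_pow_mul_not_dvd [IsDomain R] {π a : R} (hπ : Prime π) (ha : a ≠ 0) :
    ∃ (k : ℕ) (b : R), a = π ^ k * b ∧ ¬ π ∣ b := by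
  have h := FiniteMultiplicity.of_prime_left hπ ha
  obtain ⟨b, hb, hb'⟩ := h.exists_eq_pow_mul_and_not_dvd
  exact ⟨_, b, hb, hb'⟩

theorem exists_coprime_fraction {a b : R} (hb : b ≠ 0) : ∃ a' b' e : R, a = e * a' ∧ b = e * b' ∧
    ∀ π, Prime π → π ∣ a' → ¬ π ∣ b' := by
  obtain ⟨a', b', e, hc, ha, hb'⟩ := UniqueFactorizationMonoid.exists_reduced_factors' a b hb
  refine ⟨a', b', e, ha.symm, hb'.symm, fun π hπ h1 h2 => hπ.not_isUnit (hc h1 h2)⟩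

end Fractions

section HomogeneousFractions

variable {κ G : Type} [AddCommGroup G]

/-- `f` is a quotient of homogeneous elements outside of `P`, the difference of their degrees
being `γ`. -/
def IsUnitAt (w : κ → G) (P : Ideal (MvPolynomial κ ℚ)) (γ : G)
    (f : FractionRing (MvPolynomial κ ℚ)) : Prop :=
  ∃ α β a b, MvPolynomial.IsWeightedHomogeneous w a α ∧ MvPolynomial.IsWeightedHomogeneous w b β ∧
    a ∉ P ∧ b ∉ P ∧ f * algebraMap (MvPolynomial κ ℚ) (FractionRing (MvPolynomial κ ℚ)) b =
      algebraMap (MvPolynomial κ ℚ) (FractionRing (MvPolynomial κ ℚ)) a ∧ γ = α - β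

namespace IsUnitAt

variable {w : κ → G} {P Q : Ideal (MvPolynomial κ ℚ)} {γ δ : G}
  {f g : FractionRing (MvPolynomial κ ℚ)}

theorem of_isWeightedHomogeneous (hP : P ≠ ⊤) {a : MvPolynomial κ ℚ}
    (ha : MvPolynomial.IsWeightedHomogeneous w a γ) (haP : a ∉ P) :
    IsUnitAt w P γ (algebraMap _ _ a) :=
  ⟨γ, 0, a, 1, ha, MvPolynomial.isWeightedHomogeneous_one _ _, haP, (Ideal.ne_top_iff_one _).1 hP,
    by simp, by simp⟩

theorem one (hP : P ≠ ⊤) : IsUnitAt w P 0 1 := by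
  have := of_isWeightedHomogeneous hP (MvPolynomial.isWeightedHomogeneous_one ℚ w)
    ((Ideal.ne_top_iff_one _).1 hP)
  rwa [map_one] at this

theorem mul [P.IsPrime] (hf : IsUnitAt w P γ f) (hg : IsUnitAt w P δ g) :
    IsUnitAt w P (γ + δ) (f * g) := by
  obtain ⟨α, β, a, b, ha, hb, haP, hbP, e, rfl⟩ := hf
  obtain ⟨α', β', a', b', ha', hb', haP', hbP', e', rfl⟩ := hg
  refine ⟨α + α', β + β', a * a', b * b', ha.mul ha', hb.mul hb', ?_, ?_, ?_, by abel⟩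
  · exact fun h => (‹P.IsPrime›.mem_or_mem h).elim haP haP'
  · exact fun h => (‹P.IsPrime›.mem_or_mem h).elim hbP hbP'
  · rw [map_mul, map_mul, ← e, ← e', mul_mul_mul_comm]

theorem ne_zero (hf : IsUnitAt w P γ f) : f ≠ 0 := by
  obtain ⟨α, β, a, b, ha, hb, haP, hbP, e, rfl⟩ := hf
  rintro rfl
  rw [zero_mul] at e
  have := (IsFractionRing.injective (MvPolynomial κ ℚ) (FractionRing (MvPolynomial κ ℚ)))
    (e.symm.trans (map_zero _).symm)
  exact haP (this ▸ P.zero_mem)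

theorem inv (hf : IsUnitAt w P γ f) : IsUnitAt w P (-γ) f⁻¹ := by
  have h0 := hf.ne_zero
  obtain ⟨α, β, a, b, ha, hb, haP, hbP, e, rfl⟩ := hf
  exact ⟨β, α, b, a, hb, ha, hbP, haP, by rw [← e, inv_mul_cancel_left₀ h0], by abel⟩

theorem div [P.IsPrime] (hf : IsUnitAt w P γ f) (hg : IsUnitAt w P δ g) :
    IsUnitAt w P (γ - δ) (f / g) := by
  rw [sub_eq_add_neg, div_eq_mul_inv]
  exact hf.mul hg.inv

theorem pow [P.IsPrime] (hf : IsUnitAt w P γ f) (k : ℕ) : IsUnitAt w P (k • γ) (f ^ k) := by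
  induction k with
  | zero => simpa using one ‹P.IsPrime›.ne_top
  | succ k ih => rw [pow_succ, succ_nsmul]; exact ih.mul hf

theorem zpow [P.IsPrime] (hf : IsUnitAt w P γ f) (k : ℤ) : IsUnitAt w P (k • γ) (f ^ k) := by
  obtain ⟨k, rfl | rfl⟩ := k.eq_nat_or_neg
  · rw [zpow_natCast, natCast_zsmul]; exact hf.pow k
  · rw [zpow_neg, zpow_natCast, neg_smul, natCast_zsmul]; exact (hf.pow k).inv

theorem prod [P.IsPrime] {ι : Type} (S : Finset ι) {γ : ι → G}
    {f : ι → FractionRing (MvPolynomial κ ℚ)} (hf : ∀ i ∈ S, IsUnitAt w P (γ i) (f i)) :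
    IsUnitAt w P (∑ i ∈ S, γ i) (∏ i ∈ S, f i) := by
  classical
  induction S using Finset.induction_on with
  | empty => simpa using one ‹P.IsPrime›.ne_top
  | insert i S hi ih =>
    rw [Finset.sum_insert hi, Finset.prod_insert hi]
    exact (hf i (Finset.mem_insert_self _ _)).mul
      (ih fun j hj => hf j (Finset.mem_insert_of_mem hj))

theorem degree_unique (hf : IsUnitAt w P γ f) (hf' : IsUnitAt w Q δ f) : γ = δ := by
  obtain ⟨α, β, a, b, ha, hb, haP, hbP, e, rfl⟩ := hf
  obtain ⟨α', β', a', b', ha', hb', haP', hbP', e', rfl⟩ := hf'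
  have hne : ∀ {P : Ideal (MvPolynomial κ ℚ)} {x}, x ∉ P → x ≠ 0 := fun h h0 =>
    h (h0 ▸ Ideal.zero_mem _)
  have h1 : a * b' = a' * b := by
    refine IsFractionRing.injective (MvPolynomial κ ℚ) (FractionRing (MvPolynomial κ ℚ)) ?_
    rw [map_mul, map_mul, ← e, ← e']
    ring
  have h2 := ha.mul hb'
  rw [h1] at h2
  have h3 := MvPolynomial.IsWeightedHomogeneous.inj_right (mul_ne_zero (hne haP') (hne hbP)) h2
    (ha'.mul hb)
  rw [sub_eq_sub_iff_add_eq_add, h3]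

theorem exists_coprime [TwoUniqueSums G] (hf : IsUnitAt w P γ f) :
    ∃ a b α β, MvPolynomial.IsWeightedHomogeneous w a α ∧
      MvPolynomial.IsWeightedHomogeneous w b β ∧ a ≠ 0 ∧ b ≠ 0 ∧
      f * algebraMap (MvPolynomial κ ℚ) (FractionRing (MvPolynomial κ ℚ)) b =
        algebraMap (MvPolynomial κ ℚ) (FractionRing (MvPolynomial κ ℚ)) a ∧
      ∀ π, Prime π → π ∣ a → ¬ π ∣ b := by
  obtain ⟨α, β, a, b, ha, hb, haP, hbP, e, rfl⟩ := hf
  have hne : ∀ {x}, x ∉ P → x ≠ 0 := fun h h0 => h (h0 ▸ Ideal.zero_mem _)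
  obtain ⟨a', b', u, h1, h2, h3⟩ := exists_coprime_fraction (a := a) (hne hbP)
  have ha0 := hne haP
  have hb0 := hne hbP
  obtain ⟨α', hα'⟩ := exists_isWeightedHomogeneous_of_dvd ha ha0 ⟨u, h1.trans (mul_comm _ _)⟩
  obtain ⟨β', hβ'⟩ := exists_isWeightedHomogeneous_of_dvd hb hb0 ⟨u, h2.trans (mul_comm _ _)⟩
  rw [h1] at ha0
  rw [h2] at hb0
  refine ⟨a', b', α', β', hα', hβ', right_ne_zero_of_mul ha0, right_ne_zero_of_mul hb0, ?_, h3⟩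
  have hu : algebraMap (MvPolynomial κ ℚ) (FractionRing (MvPolynomial κ ℚ)) u ≠ 0 := by
    rw [Ne, IsFractionRing.to_map_eq_zero_iff]
    exact left_ne_zero_of_mul ha0
  rw [h1, h2, map_mul, map_mul] at e
  exact mul_left_cancel₀ hu (by rw [← e]; ring)

/-- A homogeneous fraction that is a unit at all homogeneous primes of height one in `P` is a unit
at `P`. -/
theorem of_forall_prime [TwoUniqueSums G] [P.IsPrime] (hf : IsUnitAt w Q γ f)
    (h : ∀ π δ, Prime π → MvPolynomial.IsWeightedHomogeneous w π δ → π ∈ P →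
      ∃ ε, IsUnitAt w (Ideal.span {π}) ε f) : IsUnitAt w P γ f := by
  obtain ⟨a, b, α, β, ha, hb, ha0, hb0, e, hcop⟩ := hf.exists_coprime
  -- If the numerator or denominator in lowest terms is in `P`, so is a prime factor `π`, which is
  -- homogeneous. But `π` divides only one of them, so `f` is no unit at `(π)`.
  have key : ∀ x, x = a ∨ x = b → x ∉ P := by
    intro x hx hxP
    have hx0 : x ≠ 0 := by rcases hx with rfl | rfl <;> assumption
    obtain ⟨m, hm, hm'⟩ := UniqueFactorizationMonoid.exists_prime_factors x hx0
    have h1 : m.prod ∈ P := by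
      obtain ⟨u, hu⟩ := hm'
      exact (Ideal.mul_unit_mem_iff_mem P u.isUnit).1 (hu ▸ hxP)
    obtain ⟨π, hπm, hπP⟩ := (Ideal.IsPrime.multiset_prod_mem_iff_exists_mem ‹_› m).1 h1
    have hπx : π ∣ x := (Multiset.dvd_prod hπm).trans hm'.dvd
    obtain ⟨δ, hδ⟩ : ∃ δ, MvPolynomial.IsWeightedHomogeneous w π δ := by
      rcases hx with rfl | rfl
      · exact exists_isWeightedHomogeneous_of_dvd ha ha0 hπx
      · exact exists_isWeightedHomogeneous_of_dvd hb hb0 hπx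
    have hπ := hm π hπm
    obtain ⟨ε, α', β', a', b', -, -, haP', hbP', e', -⟩ := h π δ hπ hδ hπP
    rw [Ideal.mem_span_singleton] at haP' hbP'
    have h2 : a * b' = a' * b := by
      refine IsFractionRing.injective (MvPolynomial κ ℚ) (FractionRing (MvPolynomial κ ℚ)) ?_
      rw [map_mul, map_mul, ← e, ← e']
      ring
    rcases hx with rfl | rfl
    · have h3 : π ∣ a' * b := h2 ▸ hπx.mul_right b'
      exact hcop π hπ hπx ((hπ.dvd_or_dvd h3).resolve_left haP')
    · have h3 : π ∣ a * b' := h2 ▸ hπx.mul_left a'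
      exact hcop π hπ ((hπ.dvd_or_dvd h3).resolve_right hbP') hπx
  have h1 : IsUnitAt w P (α - β) f :=
    ⟨α, β, a, b, ha, hb, key a (Or.inl rfl), key b (Or.inr rfl), e, rfl⟩
  rwa [hf.degree_unique h1]

/-- By `of_forall_prime`, `f` is a unit at the ideal of polynomials without constant term. It is
thus a quotient of homogeneous polynomials with nonzero constant terms, which have degree `0`. -/
theorem degree_eq_zero [TwoUniqueSums G] (hf : IsUnitAt w Q γ f)
    (h : ∀ π δ, Prime π → MvPolynomial.IsWeightedHomogeneous w π δ →
      ∃ ε, IsUnitAt w (Ideal.span {π}) ε f) : γ = 0 := by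
  have : (RingHom.ker (MvPolynomial.constantCoeff (R := ℚ) (σ := κ))).IsPrime :=
    RingHom.ker_isPrime _
  obtain ⟨α, β, a, b, ha, hb, haP, hbP, -, rfl⟩ :=
    hf.of_forall_prime (P := RingHom.ker MvPolynomial.constantCoeff)
      fun π δ h1 h2 _ => h π δ h1 h2
  have key : ∀ {x : MvPolynomial κ ℚ} {α : G}, MvPolynomial.IsWeightedHomogeneous w x α →
      x ∉ RingHom.ker MvPolynomial.constantCoeff → α = 0 := by
    intro x α hx hxP
    have := hx (d := 0) fun h0 => hxP h0
    simpa using this.symm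
  rw [key ha haP, key hb hbP, sub_zero]

end IsUnitAt

/-- Divisors of a factorial ring are principal, in homogeneous form: along the prime factorization
of `h`, the fraction `F` is corrected at each new prime by a power of it. -/
theorem exists_fraction_of_primes {w : κ → G} [TwoUniqueSums G]
    {f : Ideal (MvPolynomial κ ℚ) → FractionRing (MvPolynomial κ ℚ)}
    (hf : ∀ P, ∃ γ, IsUnitAt w ⊥ γ (f P)) {h : MvPolynomial κ ℚ} (h0 : h ≠ 0) :
    ∃ F γ, IsUnitAt w ⊥ γ F ∧ ∀ π δ, Prime π → MvPolynomial.IsWeightedHomogeneous w π δ →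
      (π ∣ h → ∃ ε, IsUnitAt w (Ideal.span {π}) ε (f (Ideal.span {π}) / F)) ∧
      (¬ π ∣ h → ∃ ε, IsUnitAt w (Ideal.span {π}) ε F) := by
  have hspan : ∀ {π : MvPolynomial κ ℚ}, Prime π → (Ideal.span {π}).IsPrime := fun hπ =>
    (Ideal.span_singleton_prime hπ.ne_zero).2 hπ
  induction h using UniqueFactorizationMonoid.induction_on_prime with
  | h₁ => exact absurd rfl h0
  | h₂ u hu =>
    refine ⟨1, 0, IsUnitAt.one Ideal.isPrime_bot.ne_top, fun π δ hπ _ =>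
      ⟨fun hd => absurd (isUnit_of_dvd_unit hd hu) hπ.not_isUnit, fun _ => ⟨0, ?_⟩⟩⟩
    exact IsUnitAt.one (hspan hπ).ne_top
  | h₃ h τ hh0 hτ ih =>
    obtain ⟨F, γ, hF, hFπ⟩ := ih hh0
    -- Repeated prime factors and inhomogeneous ones impose no new condition.
    by_cases hcase : τ ∣ h ∨ ¬ ∃ δ, MvPolynomial.IsWeightedHomogeneous w τ δ
    · refine ⟨F, γ, hF, fun π δ hπ hδ => ⟨fun hd => (hFπ π δ hπ hδ).1 ?_,
        fun hd => (hFπ π δ hπ hδ).2 fun hd' => hd (hd'.mul_left τ)⟩⟩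
      rcases hπ.dvd_or_dvd hd with h1 | h1
      · rcases hcase with h2 | h2
        · exact h1.trans h2
        · exact absurd (exists_isWeightedHomogeneous_of_dvd hδ hπ.ne_zero
            ((hπ.associated_of_dvd hτ h1).symm.dvd)) h2
      · exact h1
    · push Not at hcase
      obtain ⟨hτh, ε, hτε⟩ := hcase
      obtain ⟨θ, hθ⟩ := hf (Ideal.span {τ})
      have hbot : (⊥ : Ideal (MvPolynomial κ ℚ)).IsPrime := Ideal.isPrime_bot
      have hF0 := hF.ne_zero
      obtain ⟨α, β, a, b, ha, hb, ha0, hb0, e, -⟩ := hθ.div hF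
      obtain ⟨k, a', rfl, ha'⟩ := exists_pow_mul_not_dvd hτ (a := a) fun h => ha0 h
      obtain ⟨l, b', rfl, hb'⟩ := exists_pow_mul_not_dvd hτ (a := b) fun h => hb0 h
      obtain ⟨α', hα'⟩ := exists_isWeightedHomogeneous_of_dvd ha (fun h => ha0 h)
        (Dvd.intro_left _ rfl)
      obtain ⟨β', hβ'⟩ := exists_isWeightedHomogeneous_of_dvd hb (fun h => hb0 h)
        (Dvd.intro_left _ rfl)
      let T := algebraMap (MvPolynomial κ ℚ) (FractionRing (MvPolynomial κ ℚ)) τ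
      have hT0 : T ≠ 0 := by
        rw [Ne, IsFractionRing.to_map_eq_zero_iff]
        exact hτ.ne_zero
      have hT : ∀ {P : Ideal (MvPolynomial κ ℚ)}, P.IsPrime → τ ∉ P →
          IsUnitAt w P (k • ε - l • ε) (T ^ k / T ^ l) := fun hP hτP =>
        ((IsUnitAt.of_isWeightedHomogeneous hP.ne_top hτε hτP).pow k).div
          ((IsUnitAt.of_isWeightedHomogeneous hP.ne_top hτε hτP).pow l)
      -- `T ^ k / T ^ l` is exactly the `τ`-part of `f (Ideal.span {τ}) / F`, and a unit at all
      -- primes not associated to `τ`.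
      refine ⟨F * (T ^ k / T ^ l), _, hF.mul (hT hbot hτ.ne_zero), fun π δ hπ hδ => ⟨?_, ?_⟩⟩
      · intro hd
        have hP := hspan hπ
        by_cases h1 : π ∣ τ
        · have h2 : Ideal.span {π} = Ideal.span {τ} :=
            Ideal.span_singleton_eq_span_singleton.2 (hπ.associated_of_dvd hτ h1)
          rw [h2]
          refine ⟨_, α', β', a', b', hα', hβ', ?_, ?_, ?_, rfl⟩
          · rwa [Ideal.mem_span_singleton]
          · rwa [Ideal.mem_span_singleton]
          · rw [map_mul, map_mul, map_pow, map_pow] at e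
            change _ * (T ^ l * _) = T ^ k * _ at e
            refine mul_left_cancel₀ (pow_ne_zero k hT0) ?_
            rw [← e]
            field_simp
        · obtain ⟨ε', h2⟩ := (hFπ π δ hπ hδ).1 ((hπ.dvd_or_dvd hd).resolve_left h1)
          rw [← div_div]
          exact ⟨_, h2.div (hT hP (by rwa [Ideal.mem_span_singleton]))⟩
      · intro hd
        have hP := hspan hπ
        obtain ⟨ε', h2⟩ := (hFπ π δ hπ hδ).2 fun h => hd (h.mul_left τ)
        exact ⟨_, h2.mul (hT hP
          (by rw [Ideal.mem_span_singleton]; exact fun h => hd (h.mul_right _)))⟩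

end HomogeneousFractions

theorem MvPolynomial.IsWeightedHomogeneous.map_algHom {ι κ M : Type} [AddCommMonoid M]
    {w : ι → M} {w' : κ → M} {f : MvPolynomial ι ℚ →ₐ[ℚ] MvPolynomial κ ℚ}
    (hf : ∀ ρ, MvPolynomial.IsWeightedHomogeneous w' (f (MvPolynomial.X ρ)) (w ρ))
    {p : MvPolynomial ι ℚ} {γ : M} (hp : MvPolynomial.IsWeightedHomogeneous w p γ) :
    MvPolynomial.IsWeightedHomogeneous w' (f p) γ := by
  rw [← hp.weightedHomogeneousComponent_same, map_weightedHomogeneousComponent hf]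
  exact MvPolynomial.weightedHomogeneousComponent_isWeightedHomogeneous _ _

/-! ### Points and stalks of `V` inside the fraction field -/

namespace SmoothCompleteFan

variable {d s : ℕ} {n t : Fin s → ℕ} {X : SmoothCompleteFan d ((i : Fin s) × Fin (n i))}
  {𝔇 : Fin s → X.PicX} {c : ∀ i, Fin (t i) → Fin (n i) → ℚ}

instance : TwoUniqueSums X.PicX := by
  have : IsAddTorsionFree X.PicX := Module.isTorsionFree_int_iff_isAddTorsionFree.1 inferInstance
  have : AddGroup.FG X.PicX := Module.Finite.iff_addGroup_fg.1 inferInstance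
  infer_instance

theorem paramSection_X_isWeightedHomogeneous (h𝔇 : ∀ i j, X.primeClass ⟨i, j⟩ = 𝔇 i)
    (k : ParamVar c) : MvPolynomial.IsWeightedHomogeneous X.primeClass
      (paramSection c (MvPolynomial.X k)) (𝔇 k.1) := by
  rw [paramSection, MvPolynomial.aeval_X]
  exact isWeightedHomogeneous_linForm (h𝔇 k.1) _

/-- The ideal of a point of `V` in the coordinate ring `ℚ[y_k]` of `V`. -/
noncomputable def redIdeal (p : X.points (linIdeal c)) : Ideal (MvPolynomial (ParamVar c) ℚ) :=
  p.1.asIdeal.comap (paramSection c)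

instance (p : X.points (linIdeal c)) : (redIdeal p).IsPrime := by
  have := p.1.2
  exact Ideal.comap_isPrime _ _

theorem param_mem_redIdeal (p : X.points (linIdeal c))
    {f : MvPolynomial ((i : Fin s) × Fin (n i)) ℚ} :
    param c f ∈ redIdeal p ↔ f ∈ p.1.asIdeal := by
  have h : f - paramSection c (param c f) ∈ p.1.asIdeal := by
    refine p.2.2.1 ?_
    rw [← ker_param, RingHom.mem_ker, map_sub, param_paramSection, sub_self]
  change paramSection c (param c f) ∈ p.1.asIdeal ↔ _
  exact ⟨fun h' => by simpa using add_mem h h', fun h' => by simpa using sub_mem h' h⟩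

/-- Open sets are stable under generization; in particular the generic point lies in every nonempty
open set. -/
theorem mem_of_redIdeal_le {p q : X.points (linIdeal c)} (h : redIdeal p ≤ redIdeal q)
    {U : Opens (X.points (linIdeal c))} (hq : q ∈ U) : p ∈ U := by
  refine Specializes.mem_open ((specializes_points_iff p q).2 fun f hf => ?_) U.2 hq
  exact (param_mem_redIdeal q).1 (h ((param_mem_redIdeal p).2 hf))

theorem isOpen_notMem (J : Ideal (MvPolynomial ((i : Fin s) × Fin (n i)) ℚ))
    (f : MvPolynomial ((i : Fin s) × Fin (n i)) ℚ) :
    IsOpen {q : X.points J | f ∉ q.1.asIdeal} :=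
  (PrimeSpectrum.basicOpen f).2.preimage continuous_subtype_val

/-- One coordinate outside `P` in each class suffices: by `exists_exchange` some maximal cone misses
only such coordinates. -/
theorem exists_redIdeal_eq (h𝔇 : ∀ i j, X.primeClass ⟨i, j⟩ = 𝔇 i)
    {P : Ideal (MvPolynomial (ParamVar c) ℚ)} (hP : P.IsPrime)
    (hhom : ∀ f ∈ P, ∀ γ, MvPolynomial.weightedHomogeneousComponent
      (fun k : ParamVar c => 𝔇 k.1) γ f ∈ P)
    (hσ : ∀ i, ∃ j, param c (MvPolynomial.X ⟨i, j⟩) ∉ P) :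
    ∃ q : X.points (linIdeal c), redIdeal q = P := by
  have hmax : ∃ σ ∈ X.maxCones, ∀ ρ ∉ σ, param c (MvPolynomial.X ρ) ∉ P := by
    obtain ⟨σ, hσm⟩ := X.maxCones_nonempty
    choose f hf using hσ
    obtain ⟨σ', h1, -⟩ := exists_exchange h𝔇 ⟨σ, hσm⟩ f
    refine ⟨σ'.1, σ'.2, fun ρ hρ => ?_⟩
    obtain ⟨i, j⟩ := ρ
    rw [((h1 i j).1 hρ).2]
    exact hf i
  obtain ⟨σ, hσm, hσ⟩ := hmax
  refine ⟨⟨⟨P.comap (param c), Ideal.comap_isPrime _ _⟩, fun f hf γ => ?_, fun f hf => ?_, σ, hσm,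
    fun h => ?_⟩, ?_⟩
  · change param c _ ∈ P
    rw [map_weightedHomogeneousComponent (param_X_isWeightedHomogeneous h𝔇)]
    exact hhom _ hf γ
  · rw [← ker_param] at hf
    change param c f ∈ P
    rw [RingHom.mem_ker.1 hf]
    exact P.zero_mem
  · change param c _ ∈ P at h
    rw [map_prod, hP.prod_mem_iff] at h
    obtain ⟨ρ, hρ, h1⟩ := h
    exact hσ ρ (Finset.mem_compl.1 hρ) h1
  · ext f
    change param c (paramSection c f) ∈ P ↔ _
    rw [param_paramSection]

theorem exists_redIdeal_eq_bot (h𝔇 : ∀ i j, X.primeClass ⟨i, j⟩ = 𝔇 i)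
    (hVT : ∃ p ∈ X.points (linIdeal c), ∀ ρ, MvPolynomial.X ρ ∉ p.asIdeal)
    (hdim : ∀ i, 2 ≤ paramDim c i) : ∃ η : X.points (linIdeal c), redIdeal η = ⊥ := by
  refine exists_redIdeal_eq h𝔇 Ideal.isPrime_bot (fun f hf γ => ?_) fun i => ?_
  · rw [Ideal.mem_bot.1 hf, map_zero]
    exact zero_mem _
  · have hn : paramDim c i ≤ n i :=
      (Submodule.finrank_le (ratSol (c i))).trans_eq (Module.finrank_fin_fun ℚ)
    have hi := hdim i
    let j : Fin (n i) := ⟨0, by omega⟩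
    refine ⟨j, fun h => ?_⟩
    obtain ⟨k, hk⟩ := exists_solBasis_ne_zero hVT i j
    rw [param_X] at h
    exact linForm_ne_zero (v := fun k => (solBasis c i k).1 j) hk h

/-- A prime element dividing all coordinates of one class would divide all parameters of that class;
there are at least two, not associated to each other. So no divisor is lost on passing from the
affine space to `V`. -/
theorem exists_redIdeal_eq_span (h𝔇 : ∀ i j, X.primeClass ⟨i, j⟩ = 𝔇 i)
    (hdim : ∀ i, 2 ≤ paramDim c i) {π : MvPolynomial (ParamVar c) ℚ} (hπ : Prime π) {δ : X.PicX}
    (hδ : MvPolynomial.IsWeightedHomogeneous (fun k : ParamVar c => 𝔇 k.1) π δ) :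
    ∃ q : X.points (linIdeal c), redIdeal q = Ideal.span {π} := by
  refine exists_redIdeal_eq h𝔇 ((Ideal.span_singleton_prime hπ.ne_zero).2 hπ) (fun f hf γ => ?_)
    fun i => ?_
  · rw [Ideal.mem_span_singleton] at hf ⊢
    exact dvd_weightedHomogeneousComponent hδ hf γ
  · by_contra hcon
    push Not at hcon
    have h1 : ∀ k, π ∣ MvPolynomial.X (⟨i, k⟩ : ParamVar c) := by
      intro k
      rw [← param_paramSection c (MvPolynomial.X _), paramSection, MvPolynomial.aeval_X, linForm,
        map_sum]
      refine Finset.dvd_sum fun j _ => ?_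
      rw [map_mul]
      exact (Ideal.mem_span_singleton.1 (hcon j)).mul_left _
    have h2 : ∀ k, Associated π (MvPolynomial.X (⟨i, k⟩ : ParamVar c)) := fun k =>
      hπ.associated_of_dvd MvPolynomial.X_prime (h1 k)
    have h3 := ((h2 ⟨0, by have := hdim i; omega⟩).symm.trans
      (h2 ⟨1, by have := hdim i; omega⟩)).dvd
    rw [MvPolynomial.X_dvd_X] at h3
    simp at h3

section Stalks

/-- The map from the coordinate ring of `V` to the field of fractions of `ℚ[y_k]`. -/
noncomputable def quotToFrac (c : ∀ i, Fin (t i) → Fin (n i) → ℚ) :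
    MvPolynomial ((i : Fin s) × Fin (n i)) ℚ ⧸ linIdeal c →+*
      FractionRing (MvPolynomial (ParamVar c) ℚ) :=
  Ideal.Quotient.lift (linIdeal c) ((algebraMap _ _).comp (param c).toRingHom) fun f hf => by
    rw [← ker_param] at hf
    change algebraMap _ _ (param c f) = 0
    rw [RingHom.mem_ker.1 hf, map_zero]

theorem quotToFrac_injective : Function.Injective (quotToFrac c) := by
  refine (injective_iff_map_eq_zero _).2 fun x hx => ?_
  obtain ⟨f, rfl⟩ := Ideal.Quotient.mk_surjective x
  change algebraMap _ _ (param c f) = 0 at hx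
  rw [IsFractionRing.to_map_eq_zero_iff] at hx
  rw [Ideal.Quotient.eq_zero_iff_mem, ← ker_param]
  exact hx

theorem isUnit_quotToFrac (q : X.points (linIdeal c))
    (y : q.1.asIdeal.primeCompl.map (Ideal.Quotient.mk (linIdeal c))) :
    IsUnit (quotToFrac c y) := by
  obtain ⟨_, f, hf, rfl⟩ := y
  change IsUnit (algebraMap _ _ (param c f))
  rw [isUnit_iff_ne_zero, Ne, IsFractionRing.to_map_eq_zero_iff]
  intro h
  refine hf (q.2.2.1 ?_)
  rw [← ker_param]
  exact h

/-- The embedding of a stalk into the field of fractions. -/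
noncomputable def evK (q : X.points (linIdeal c)) :
    X.Stalk (linIdeal c) q →+* FractionRing (MvPolynomial (ParamVar c) ℚ) :=
  IsLocalization.lift (M := q.1.asIdeal.primeCompl.map (Ideal.Quotient.mk (linIdeal c)))
    (S := Localization (q.1.asIdeal.primeCompl.map (Ideal.Quotient.mk (linIdeal c))))
    (isUnit_quotToFrac q)

theorem evK_toStalk (q : X.points (linIdeal c)) (f : MvPolynomial ((i : Fin s) × Fin (n i)) ℚ) :
    evK q (X.toStalk (linIdeal c) q f) = algebraMap _ _ (param c f) :=
  IsLocalization.lift_eq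
    (S := Localization (q.1.asIdeal.primeCompl.map (Ideal.Quotient.mk (linIdeal c))))
    (isUnit_quotToFrac q) (Ideal.Quotient.mk (linIdeal c) f)

theorem evK_injective (q : X.points (linIdeal c)) : Function.Injective (evK q) := by
  refine (IsLocalization.lift_injective_iff
    (S := Localization (q.1.asIdeal.primeCompl.map (Ideal.Quotient.mk (linIdeal c))))
    (isUnit_quotToFrac q)).2 fun x y => ⟨fun h => ?_, fun h => by rw [quotToFrac_injective h]⟩
  rw [← IsLocalization.lift_eq
    (S := Localization (q.1.asIdeal.primeCompl.map (Ideal.Quotient.mk (linIdeal c))))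
    (isUnit_quotToFrac q) x, h, IsLocalization.lift_eq]

theorem isUnit_toStalk (q : X.points (linIdeal c))
    {f : MvPolynomial ((i : Fin s) × Fin (n i)) ℚ} (hf : f ∉ q.1.asIdeal) :
    IsUnit (X.toStalk (linIdeal c) q f) :=
  IsLocalization.map_units
    (Localization (q.1.asIdeal.primeCompl.map (Ideal.Quotient.mk (linIdeal c))))
    (⟨_, f, hf, rfl⟩ : q.1.asIdeal.primeCompl.map (Ideal.Quotient.mk (linIdeal c)))

theorem exists_evK_eq {q : X.points (linIdeal c)} {γ : X.PicX}
    {f : FractionRing (MvPolynomial (ParamVar c) ℚ)}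
    (hf : IsUnitAt (fun k : ParamVar c => 𝔇 k.1) (redIdeal q) γ f) :
    ∃ u : (X.Stalk (linIdeal c) q)ˣ, evK q u = f := by
  obtain ⟨α, β, a, b, -, -, haq, hbq, e, -⟩ := hf
  obtain ⟨ua, hua⟩ := isUnit_toStalk q (f := paramSection c a) haq
  obtain ⟨ub, hub⟩ := isUnit_toStalk q (f := paramSection c b) hbq
  have hb0 : algebraMap (MvPolynomial (ParamVar c) ℚ)
      (FractionRing (MvPolynomial (ParamVar c) ℚ)) b ≠ 0 := by
    rw [Ne, IsFractionRing.to_map_eq_zero_iff]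
    rintro rfl
    exact hbq (zero_mem _)
  refine ⟨ua * ub⁻¹, mul_right_cancel₀ hb0 ?_⟩
  have h1 : evK q (ub : X.Stalk (linIdeal c) q) = algebraMap _ _ b := by
    rw [hub, evK_toStalk, param_paramSection]
  have h2 : evK q (ua : X.Stalk (linIdeal c) q) = algebraMap _ _ a := by
    rw [hua, evK_toStalk, param_paramSection]
  rw [e, ← h1, ← map_mul, ← h2, Units.val_mul, Units.inv_mul_cancel_right]

open Classical in
/-- The unit in the stalk at `q` given by an element of the field of fractions (`1` if there is
none). -/
noncomputable def unitOf (f : FractionRing (MvPolynomial (ParamVar c) ℚ))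
    (q : X.points (linIdeal c)) : (X.Stalk (linIdeal c) q)ˣ :=
  if h : ∃ u : (X.Stalk (linIdeal c) q)ˣ, evK q u = f then h.choose else 1

theorem evK_unitOf {q : X.points (linIdeal c)} {γ : X.PicX}
    {f : FractionRing (MvPolynomial (ParamVar c) ℚ)}
    (hf : IsUnitAt (fun k : ParamVar c => 𝔇 k.1) (redIdeal q) γ f) :
    evK q (unitOf f q) = f := by
  rw [unitOf, dif_pos (exists_evK_eq hf)]
  exact (exists_evK_eq hf).choose_spec

theorem exists_opens_isUnitAt {p : X.points (linIdeal c)} {γ : X.PicX}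
    {f : FractionRing (MvPolynomial (ParamVar c) ℚ)}
    (hf : IsUnitAt (fun k : ParamVar c => 𝔇 k.1) (redIdeal p) γ f) :
    ∃ W : Opens (X.points (linIdeal c)), p ∈ W ∧ ∀ q ∈ W,
      IsUnitAt (fun k : ParamVar c => 𝔇 k.1) (redIdeal q) γ f := by
  obtain ⟨α, β, a, b, ha, hb, hap, hbp, e, rfl⟩ := hf
  exact ⟨⟨_, (isOpen_notMem _ (paramSection c a)).inter (isOpen_notMem _ (paramSection c b))⟩,
    ⟨hap, hbp⟩, fun q hq => ⟨α, β, a, b, ha, hb, hq.1, hq.2, e, rfl⟩⟩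

theorem unitSections_isUnitAt (h𝔇 : ∀ i j, X.primeClass ⟨i, j⟩ = 𝔇 i)
    {U : Opens (X.points (linIdeal c))} {g : ∀ q, (X.Stalk (linIdeal c) q)ˣ}
    (hg : g ∈ X.unitSections (linIdeal c) U) {q : X.points (linIdeal c)} (hq : q ∈ U) :
    IsUnitAt (fun k : ParamVar c => 𝔇 k.1) (redIdeal q) 0 (evK q (g q)) := by
  obtain ⟨W, hqW, γ, a, b, ha, hb, h⟩ := hg q hq
  obtain ⟨h1, h2, h3⟩ := h q hqW
  refine ⟨γ, γ, param c a, param c b, ha.map_algHom (param_X_isWeightedHomogeneous h𝔇),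
    hb.map_algHom (param_X_isWeightedHomogeneous h𝔇), (param_mem_redIdeal q).not.2 h1,
    (param_mem_redIdeal q).not.2 h2, ?_, (sub_self _).symm⟩
  rw [← evK_toStalk q, ← evK_toStalk q, ← map_mul, h3]

/-- A section is a fraction near `q`, and this neighbourhood contains the generic point; so the
germs at `q` and `η` are the same rational function. -/
theorem unitSections_evK_eq {η : X.points (linIdeal c)} (hη : redIdeal η = ⊥)
    {U : Opens (X.points (linIdeal c))} {g : ∀ q, (X.Stalk (linIdeal c) q)ˣ}
    (hg : g ∈ X.unitSections (linIdeal c) U) {q : X.points (linIdeal c)} (hq : q ∈ U) :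
    evK q (g q) = evK η (g η) := by
  obtain ⟨W, hqW, γ, a, b, ha, hb, h⟩ := hg q hq
  obtain ⟨h1, h2, h3⟩ := h q hqW
  obtain ⟨-, -, h3'⟩ := h η (mem_of_redIdeal_le (hη ▸ bot_le) hqW)
  have hb0 : algebraMap (MvPolynomial (ParamVar c) ℚ)
      (FractionRing (MvPolynomial (ParamVar c) ℚ)) (param c b) ≠ 0 := by
    rw [Ne, IsFractionRing.to_map_eq_zero_iff]
    intro h0
    exact h2 ((param_mem_redIdeal q).1 (h0 ▸ zero_mem _))
  refine mul_right_cancel₀ hb0 ?_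
  rw [← evK_toStalk q, ← map_mul, h3, evK_toStalk, evK_toStalk, ← evK_toStalk η b, ← map_mul, h3',
    evK_toStalk]

theorem mem_unitSections (h𝔇 : ∀ i j, X.primeClass ⟨i, j⟩ = 𝔇 i)
    {U : Opens (X.points (linIdeal c))} {g : ∀ q, (X.Stalk (linIdeal c) q)ˣ}
    {f : FractionRing (MvPolynomial (ParamVar c) ℚ)} (hg : ∀ q ∈ U, evK q (g q) = f)
    (hf : ∀ q ∈ U, IsUnitAt (fun k : ParamVar c => 𝔇 k.1) (redIdeal q) 0 f) :
    g ∈ X.unitSections (linIdeal c) U := by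
  intro p hp
  obtain ⟨α, β, a, b, ha, hb, hap, hbp, e, hαβ⟩ := hf p hp
  have hαβ : α = β := (sub_eq_zero.1 hαβ.symm)
  subst hαβ
  refine ⟨U ⊓ ⟨_, (isOpen_notMem _ (paramSection c a)).inter (isOpen_notMem _ (paramSection c b))⟩,
    ⟨hp, hap, hbp⟩, α, paramSection c a, paramSection c b,
    ha.map_algHom (paramSection_X_isWeightedHomogeneous h𝔇),
    hb.map_algHom (paramSection_X_isWeightedHomogeneous h𝔇), fun q hq => ⟨hq.2.1, hq.2.2, ?_⟩⟩
  refine evK_injective q ?_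
  rw [map_mul, hg q hq.1, evK_toStalk, evK_toStalk, param_paramSection, param_paramSection, e]

end Stalks

end SmoothCompleteFan

/-! ### The degree of a cocycle and the Picard group of `V` -/

namespace SmoothCompleteFan

variable {d s : ℕ} {n t : Fin s → ℕ} {X : SmoothCompleteFan d ((i : Fin s) × Fin (n i))}
  {𝔇 : Fin s → X.PicX} {c : ∀ i, Fin (t i) → Fin (n i) → ℚ} {η : X.points (linIdeal c)}

/-- The rational function attached to a cochain and a point, `η` being the generic point. -/
noncomputable def cochainVal (η : X.points (linIdeal c))
    (g : ∀ _ _ q : X.points (linIdeal c), (X.Stalk (linIdeal c) q)ˣ) (p : X.points (linIdeal c)) :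
    FractionRing (MvPolynomial (ParamVar c) ℚ) := evK η (g p η η)

/-- The line bundle given by a cocycle has degree `γ`. -/
def HasDegree (𝔇 : Fin s → X.PicX) (η : X.points (linIdeal c))
    (g : ∀ _ _ q : X.points (linIdeal c), (X.Stalk (linIdeal c) q)ˣ) (γ : X.PicX) : Prop :=
  ∃ F, IsUnitAt (fun k : ParamVar c => 𝔇 k.1) ⊥ γ F ∧ ∀ p, ∃ δ,
    IsUnitAt (fun k : ParamVar c => 𝔇 k.1) (redIdeal p) δ (cochainVal η g p / F)

theorem cochainVal_ne_zero (g : ∀ _ _ q : X.points (linIdeal c), (X.Stalk (linIdeal c) q)ˣ)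
    (p : X.points (linIdeal c)) : cochainVal η g p ≠ 0 :=
  ((g p η η).isUnit.map (evK η)).ne_zero

theorem cochainVal_mul (g g' : ∀ _ _ q : X.points (linIdeal c), (X.Stalk (linIdeal c) q)ˣ)
    (p : X.points (linIdeal c)) :
    cochainVal η (g * g') p = cochainVal η g p * cochainVal η g' p := by
  simp only [cochainVal, Pi.mul_apply, Units.val_mul, map_mul]

theorem HasDegree.mul {g g' : ∀ _ _ q : X.points (linIdeal c), (X.Stalk (linIdeal c) q)ˣ}
    {γ γ' : X.PicX} (h : HasDegree 𝔇 η g γ) (h' : HasDegree 𝔇 η g' γ') :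
    HasDegree 𝔇 η (g * g') (γ + γ') := by
  obtain ⟨F, hF, hp⟩ := h
  obtain ⟨F', hF', hp'⟩ := h'
  have hbot : (⊥ : Ideal (MvPolynomial (ParamVar c) ℚ)).IsPrime := Ideal.isPrime_bot
  refine ⟨F * F', hF.mul hF', fun p => ?_⟩
  obtain ⟨δ, hδ⟩ := hp p
  obtain ⟨δ', hδ'⟩ := hp' p
  rw [cochainVal_mul, mul_div_mul_comm]
  exact ⟨_, hδ.mul hδ'⟩

/-- The quotient of two admissible fractions is a homogeneous unit at every homogeneous prime
element, as each of these is a point of `V`; then `degree_eq_zero` applies. -/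
theorem HasDegree.unique (h𝔇 : ∀ i j, X.primeClass ⟨i, j⟩ = 𝔇 i) (hdim : ∀ i, 2 ≤ paramDim c i)
    {g : ∀ _ _ q : X.points (linIdeal c), (X.Stalk (linIdeal c) q)ˣ} {γ γ' : X.PicX}
    (h : HasDegree 𝔇 η g γ) (h' : HasDegree 𝔇 η g γ') : γ = γ' := by
  obtain ⟨F, hF, hp⟩ := h
  obtain ⟨F', hF', hp'⟩ := h'
  have hbot : (⊥ : Ideal (MvPolynomial (ParamVar c) ℚ)).IsPrime := Ideal.isPrime_bot
  refine sub_eq_zero.1 ((hF.div hF').degree_eq_zero fun π δ hπ hδ => ?_)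
  obtain ⟨q, hq⟩ := exists_redIdeal_eq_span h𝔇 hdim hπ hδ
  obtain ⟨ε, hε⟩ := hp q
  obtain ⟨ε', hε'⟩ := hp' q
  have h1 : F / F' = cochainVal η g q / F' / (cochainVal η g q / F) := by
    have h2 := cochainVal_ne_zero (η := η) g q
    have h3 := hF.ne_zero
    have h4 := hF'.ne_zero
    field_simp
  rw [h1, ← hq]
  exact ⟨_, hε'.div hε⟩

section Cocycles

variable {U : X.points (linIdeal c) → Opens (X.points (linIdeal c))}
  {g : ∀ _ _ q : X.points (linIdeal c), (X.Stalk (linIdeal c) q)ˣ}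

/-- The cocycle relation with `η` as third index splits the cocycle over the field of rational
functions. -/
theorem evK_cocycle (hη : redIdeal η = ⊥) (hU : ∀ p, p ∈ U p)
    (hg : ∀ p p', g p p' ∈ X.unitSections (linIdeal c) (U p ⊓ U p'))
    (hc : ∀ p p' p'' q, q ∈ U p → q ∈ U p' → q ∈ U p'' → g p p' q * g p' p'' q = g p p'' q)
    {p p' q : X.points (linIdeal c)} (hq : q ∈ U p) (hq' : q ∈ U p') :
    evK q (g p p' q) = cochainVal η g p / cochainVal η g p' := by
  have hηU : ∀ p, η ∈ U p := fun p => mem_of_redIdeal_le (hη ▸ bot_le) (hU p)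
  rw [eq_div_iff (cochainVal_ne_zero g p'), unitSections_evK_eq hη (hg p p') ⟨hq, hq'⟩, cochainVal,
    ← map_mul, ← Units.val_mul, hc p p' η η (hηU p) (hηU p') (hηU η), cochainVal]

theorem isUnitAt_cocycle (h𝔇 : ∀ i j, X.primeClass ⟨i, j⟩ = 𝔇 i) (hη : redIdeal η = ⊥)
    (hU : ∀ p, p ∈ U p) (hg : ∀ p p', g p p' ∈ X.unitSections (linIdeal c) (U p ⊓ U p'))
    (hc : ∀ p p' p'' q, q ∈ U p → q ∈ U p' → q ∈ U p'' → g p p' q * g p' p'' q = g p p'' q)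
    {p p' q : X.points (linIdeal c)} (hq : q ∈ U p) (hq' : q ∈ U p') :
    IsUnitAt (fun k : ParamVar c => 𝔇 k.1) (redIdeal q) 0
      (cochainVal η g p / cochainVal η g p') := by
  rw [← evK_cocycle hη hU hg hc hq hq']
  exact unitSections_isUnitAt h𝔇 (hg p p') ⟨hq, hq'⟩

theorem isUnitAt_cochainVal (h𝔇 : ∀ i j, X.primeClass ⟨i, j⟩ = 𝔇 i) (hη : redIdeal η = ⊥)
    (hU : ∀ p, p ∈ U p) (hg : ∀ p p', g p p' ∈ X.unitSections (linIdeal c) (U p ⊓ U p'))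
    (hc : ∀ p p' p'' q, q ∈ U p → q ∈ U p' → q ∈ U p'' → g p p' q * g p' p'' q = g p p'' q)
    {p q : X.points (linIdeal c)} (hq : q ∈ U p) (hq' : q ∈ U η) :
    IsUnitAt (fun k : ParamVar c => 𝔇 k.1) (redIdeal q) 0 (cochainVal η g p) := by
  have h1 := isUnitAt_cocycle h𝔇 hη hU hg hc hq hq'
  have h2 : cochainVal η g η = 1 := by
    have h3 := hc η η η η (hU η) (hU η) (hU η)
    rw [mul_eq_left] at h3
    rw [cochainVal, h3, Units.val_one, map_one]
  rwa [h2, div_one] at h1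

/-- The local functions `cochainVal η g p` define a divisor, which `exists_fraction_of_primes`
writes as the divisor of a homogeneous fraction `F`. Then `cochainVal η g p / F` is a unit at all
primes of height one in `p`, hence at `p` by `of_forall_prime`. -/
theorem exists_hasDegree (h𝔇 : ∀ i j, X.primeClass ⟨i, j⟩ = 𝔇 i)
    (hdim : ∀ i, 2 ≤ paramDim c i) (hη : redIdeal η = ⊥)
    (hU : ∀ p, p ∈ U p) (hg : ∀ p p', g p p' ∈ X.unitSections (linIdeal c) (U p ⊓ U p'))
    (hc : ∀ p p' p'' q, q ∈ U p → q ∈ U p' → q ∈ U p'' → g p p' q * g p' p'' q = g p p'' q) :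
    ∃ γ, HasDegree 𝔇 η g γ := by
  classical
  have hηU : ∀ p, η ∈ U p := fun p => mem_of_redIdeal_le (hη ▸ bot_le) (hU p)
  have hbot : (⊥ : Ideal (MvPolynomial (ParamVar c) ℚ)).IsPrime := Ideal.isPrime_bot
  have hval : ∀ p, IsUnitAt (fun k : ParamVar c => 𝔇 k.1) ⊥ 0 (cochainVal η g p) := fun p => by
    rw [← hη]
    exact isUnitAt_cochainVal h𝔇 hη hU hg hc (hηU p) (hU η)
  -- Where `h` does not vanish the point lies in `U η` and the local functions are units, so only
  -- the prime divisors of `param c h` matter.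
  obtain ⟨h, hh, hhU⟩ : ∃ h, param c h ≠ 0 ∧
      ∀ q : X.points (linIdeal c), h ∉ q.1.asIdeal → q ∈ U η := by
    obtain ⟨O, hO, hOU⟩ := isOpen_induced_iff.1 (U η).2
    have h1 : η.1 ∈ O := by
      change η ∈ Subtype.val ⁻¹' O
      rw [hOU]
      exact hU η
    obtain ⟨_, ⟨h, rfl⟩, h2, h3⟩ :=
      PrimeSpectrum.isTopologicalBasis_basic_opens.exists_subset_of_mem_open h1 hO
    refine ⟨h, fun h0 => h2 ((param_mem_redIdeal η).1 (h0 ▸ zero_mem _)), fun q hq => ?_⟩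
    have h4 : q ∈ Subtype.val ⁻¹' O := h3 hq
    rw [hOU] at h4
    exact h4
  let f : Ideal (MvPolynomial (ParamVar c) ℚ) → FractionRing (MvPolynomial (ParamVar c) ℚ) :=
    fun P => if hP : ∃ q : X.points (linIdeal c), redIdeal q = P then cochainVal η g hP.choose
      else 1
  have hf : ∀ P, ∃ γ, IsUnitAt (fun k : ParamVar c => 𝔇 k.1) ⊥ γ (f P) := by
    intro P
    simp only [f]
    split_ifs with hP
    · exact ⟨0, hval _⟩
    · exact ⟨0, IsUnitAt.one hbot.ne_top⟩
  obtain ⟨F, γ, hF, hFπ⟩ := exists_fraction_of_primes hf hh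
  refine ⟨γ, F, hF, fun p => ⟨0 - γ, ((hval p).div hF).of_forall_prime
    fun π δ hπ hδ hπp => ?_⟩⟩
  have hq' := exists_redIdeal_eq_span (c := c) h𝔇 hdim hπ hδ
  obtain ⟨q, hq, hfq⟩ : ∃ q, redIdeal q = Ideal.span {π} ∧
      f (Ideal.span {π}) = cochainVal η g q := ⟨hq'.choose, hq'.choose_spec, dif_pos hq'⟩
  have hqp : q ∈ U p := mem_of_redIdeal_le (by
    rw [hq, Ideal.span_singleton_le_iff_mem]
    exact hπp) (hU p)
  have h1 := isUnitAt_cocycle h𝔇 hη hU hg hc hqp (hU q)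
  have h2 : ∃ ε, IsUnitAt (fun k : ParamVar c => 𝔇 k.1) (redIdeal q) ε
      (cochainVal η g q / F) := by
    by_cases hd : π ∣ param c h
    · obtain ⟨ε, hε⟩ := (hFπ π δ hπ hδ).1 hd
      rw [hfq, ← hq] at hε
      exact ⟨ε, hε⟩
    · obtain ⟨ε, hε⟩ := (hFπ π δ hπ hδ).2 hd
      have hqη : q ∈ U η := hhU q fun hmem => hd (by
        rw [← Ideal.mem_span_singleton, ← hq]
        exact (param_mem_redIdeal q).2 hmem)
      rw [← hq] at hε
      exact ⟨_, (isUnitAt_cochainVal h𝔇 hη hU hg hc (hU q) hqη).div hε⟩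
  obtain ⟨ε, hε⟩ := h2
  have h3 := h1.mul hε
  rw [div_mul_div_cancel₀ (cochainVal_ne_zero g q), hq] at h3
  exact ⟨_, h3⟩

end Cocycles

theorem hasDegree_zero_of_mem_cechCoboundaries (h𝔇 : ∀ i j, X.primeClass ⟨i, j⟩ = 𝔇 i)
    (hη : redIdeal η = ⊥)
    {g : ∀ _ _ q : X.points (linIdeal c), (X.Stalk (linIdeal c) q)ˣ}
    (hg : g ∈ cechCoboundaries (X.unitSections (linIdeal c))
      (X.unitSections_antitone (linIdeal c))) : HasDegree 𝔇 η g 0 := by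
  obtain ⟨U, h, hU, hh, hc⟩ := hg
  have hηU : ∀ p, η ∈ U p := fun p => mem_of_redIdeal_le (hη ▸ bot_le) (hU p)
  have h1 := (unitSections_isUnitAt h𝔇 (hh η) (hU η)).inv
  rw [hη, neg_zero] at h1
  refine ⟨_, h1, fun p => ⟨0, ?_⟩⟩
  have h2 := unitSections_isUnitAt h𝔇 (hh p) (hU p)
  rw [unitSections_evK_eq hη (hh p) (hU p)] at h2
  rwa [cochainVal, hc p η η (hηU p) (hU η), div_inv_eq_mul, ← map_mul, ← Units.val_mul,
    inv_mul_cancel_right]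

/-- For a fraction `F` of degree `0` the functions `cochainVal η g p / F` are units of degree `0`
near `p`, and their quotients give back the cocycle. -/
theorem mem_cechCoboundaries_of_hasDegree_zero (h𝔇 : ∀ i j, X.primeClass ⟨i, j⟩ = 𝔇 i)
    (hη : redIdeal η = ⊥)
    {g : ∀ _ _ q : X.points (linIdeal c), (X.Stalk (linIdeal c) q)ˣ}
    (hg : g ∈ cechCocycles (X.unitSections (linIdeal c)) (X.unitSections_antitone (linIdeal c)))
    (h : HasDegree 𝔇 η g 0) :
    g ∈ cechCoboundaries (X.unitSections (linIdeal c)) (X.unitSections_antitone (linIdeal c)) := by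
  obtain ⟨U, hU, hgU, hc⟩ := hg
  obtain ⟨F, hF, hp⟩ := h
  have hηU : ∀ p, η ∈ U p := fun p => mem_of_redIdeal_le (hη ▸ bot_le) (hU p)
  have hbot : (⊥ : Ideal (MvPolynomial (ParamVar c) ℚ)).IsPrime := Ideal.isPrime_bot
  have hp0 : ∀ p, IsUnitAt (fun k : ParamVar c => 𝔇 k.1) (redIdeal p) 0
      (cochainVal η g p / F) := by
    intro p
    obtain ⟨δ, hδ⟩ := hp p
    have h1 := isUnitAt_cochainVal h𝔇 hη hU hgU hc (hηU p) (hU η)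
    rw [hη] at h1
    have h2 := hδ.degree_unique (h1.div hF)
    rw [sub_zero] at h2
    rwa [h2] at hδ
  choose W hpW hW using fun p => exists_opens_isUnitAt (hp0 p)
  refine ⟨fun p => U p ⊓ W p, fun p => unitOf (cochainVal η g p / F), fun p => ⟨hU p, hpW p⟩,
    fun p => mem_unitSections h𝔇 (fun q hq => evK_unitOf (hW p q hq.2)) fun q hq => hW p q hq.2,
    fun p p' q hq hq' => ?_⟩
  rw [eq_mul_inv_iff_mul_eq]
  refine Units.ext (evK_injective q ?_)
  rw [Units.val_mul, map_mul, evK_unitOf (hW p q hq.2), evK_unitOf (hW p' q hq'.2),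
    evK_cocycle hη hU hgU hc hq.1 hq'.1, div_mul_div_cancel₀ (cochainVal_ne_zero g p')]

/-- Near `p` the monomial `E p = x^{D(σ)}`, with `σ` a cone whose chart contains `p`, is a unit of
degree `[D]`. The quotients `E p / E p'` form the cocycle; its value `E p / E η` leads to `F = (E
η)⁻¹`, whence the sign of the degree. -/
theorem exists_hasDegree_neg (h𝔇 : ∀ i j, X.primeClass ⟨i, j⟩ = 𝔇 i) (hη : redIdeal η = ⊥)
    (γ : X.PicX) : ∃ g ∈ cechCocycles (X.unitSections (linIdeal c))
      (X.unitSections_antitone (linIdeal c)), HasDegree 𝔇 η g (-γ) := by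
  obtain ⟨D, rfl⟩ : ∃ D, X.cls D = γ := Submodule.Quotient.mk_surjective _ γ
  have hbot : (⊥ : Ideal (MvPolynomial (ParamVar c) ℚ)).IsPrime := Ideal.isPrime_bot
  choose σ hσm hσ using fun p : X.points (linIdeal c) => p.2.2.2
  let E : X.points (linIdeal c) → FractionRing (MvPolynomial (ParamVar c) ℚ) := fun p =>
    ∏ ρ, (algebraMap _ _ (param c (MvPolynomial.X ρ))) ^ X.atCone D ⟨σ p, hσm p⟩ ρ
  let U : X.points (linIdeal c) → Opens (X.points (linIdeal c)) := fun p =>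
    ⟨_, isOpen_notMem _ (∏ ρ ∈ (σ p)ᶜ, MvPolynomial.X ρ)⟩
  have hU : ∀ p, p ∈ U p := hσ
  have hηU : ∀ p, η ∈ U p := fun p => mem_of_redIdeal_le (hη ▸ bot_le) (hU p)
  have hE : ∀ p, ∀ q ∈ U p, IsUnitAt (fun k : ParamVar c => 𝔇 k.1) (redIdeal q) (X.cls D)
      (E p) := by
    intro p q hq
    rw [← X.cls_atCone D ⟨σ p, hσm p⟩, X.cls_sum]
    refine IsUnitAt.prod _ fun ρ _ => ?_
    by_cases hρ : ρ ∈ σ p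
    · rw [X.atCone_of_mem D ⟨σ p, hσm p⟩ hρ, zero_smul, zpow_zero]
      exact IsUnitAt.one (Ideal.IsPrime.ne_top inferInstance)
    · refine IsUnitAt.zpow (IsUnitAt.of_isWeightedHomogeneous (Ideal.IsPrime.ne_top inferInstance)
        (param_X_isWeightedHomogeneous h𝔇 ρ) fun hmem => hq ?_) _
      exact Ideal.mem_of_dvd _ (Finset.dvd_prod_of_mem _ (Finset.mem_compl.2 hρ))
        ((param_mem_redIdeal q).1 hmem)
  have hE0 : ∀ p, E p ≠ 0 := fun p => (hE p p (hU p)).ne_zero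
  have hEE : ∀ p p' q, q ∈ U p → q ∈ U p' →
      IsUnitAt (fun k : ParamVar c => 𝔇 k.1) (redIdeal q) 0 (E p / E p') := fun p p' q h h' => by
    have := (hE p q h).div (hE p' q h')
    rwa [sub_self] at this
  refine ⟨fun p p' => unitOf (E p / E p'), ⟨U, hU, fun p p' => ?_, ?_⟩, (E η)⁻¹, ?_,
    fun p => ⟨X.cls D, ?_⟩⟩
  · exact mem_unitSections h𝔇 (fun q hq => evK_unitOf (hEE p p' q hq.1 hq.2))
      fun q hq => hEE p p' q hq.1 hq.2
  · intro p p' p'' q h h' h''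
    refine Units.ext (evK_injective q ?_)
    rw [Units.val_mul, map_mul, evK_unitOf (hEE p p' q h h'), evK_unitOf (hEE p' p'' q h' h''),
      evK_unitOf (hEE p p'' q h h''), div_mul_div_cancel₀ (hE0 p')]
  · have := (hE η η (hU η)).inv
    rwa [hη] at this
  · rw [cochainVal, evK_unitOf (hEE p η η (hηU p) (hU η)), div_inv_eq_mul, div_mul_cancel₀ _ (hE0 η)]
    exact hE p p (hU p)

/-- The degree is a surjective homomorphism from cocycles to `Pic X` whose kernel consists of the
coboundaries. -/
theorem rkPic_linIdeal (h𝔇 : ∀ i j, X.primeClass ⟨i, j⟩ = 𝔇 i)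
    (hVT : ∃ p ∈ X.points (linIdeal c), ∀ ρ, MvPolynomial.X ρ ∉ p.asIdeal)
    (hdim : ∀ i, 2 ≤ paramDim c i) : X.rkPic (linIdeal c) = Module.finrank ℤ X.PicX := by
  obtain ⟨η, hη⟩ := exists_redIdeal_eq_bot h𝔇 hVT hdim
  have hex : ∀ g : cechCocycles (X.unitSections (linIdeal c))
      (X.unitSections_antitone (linIdeal c)), ∃ γ, HasDegree 𝔇 η g.1 γ := by
    rintro ⟨g, U, hU, hg, hc⟩
    exact exists_hasDegree h𝔇 hdim hη hU hg hc
  choose deg hdeg using hex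
  let Φ : cechCocycles (X.unitSections (linIdeal c)) (X.unitSections_antitone (linIdeal c)) →*
      Multiplicative X.PicX := MonoidHom.mk' (fun g => Multiplicative.ofAdd (deg g)) fun g g' => by
    rw [← ofAdd_add]
    exact congrArg _ ((hdeg (g * g')).unique h𝔇 hdim ((hdeg g).mul (hdeg g')))
  have hsurj : Function.Surjective Φ := by
    intro γ
    obtain ⟨g, hg, h⟩ := exists_hasDegree_neg h𝔇 hη (-γ.toAdd)
    refine ⟨⟨g, hg⟩, ?_⟩
    change Multiplicative.ofAdd (deg ⟨g, hg⟩) = γ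
    rw [(hdeg ⟨g, hg⟩).unique h𝔇 hdim h, neg_neg, ofAdd_toAdd]
  have hker : Φ.ker = (cechCoboundaries (X.unitSections (linIdeal c))
      (X.unitSections_antitone (linIdeal c))).subgroupOf (cechCocycles (X.unitSections (linIdeal c))
      (X.unitSections_antitone (linIdeal c))) := by
    ext g
    rw [MonoidHom.mem_ker, Subgroup.mem_subgroupOf]
    change deg g = 0 ↔ _
    refine ⟨fun h => ?_, fun h => ?_⟩
    · exact mem_cechCoboundaries_of_hasDegree_zero h𝔇 hη g.2 (h ▸ hdeg g)
    · exact (hdeg g).unique h𝔇 hdim (hasDegree_zero_of_mem_cechCoboundaries h𝔇 hη h)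
  let e : X.Pic (linIdeal c) ≃* Multiplicative X.PicX :=
    (QuotientGroup.quotientMulEquivOfEq hker.symm).trans
      (QuotientGroup.quotientKerEquivOfSurjective Φ hsurj)
  exact (MulEquiv.toAdditiveLeft e).toIntLinearEquiv.finrank_eq

end SmoothCompleteFan

/-! ### The asymptotic formula -/

theorem theorem1p1 {d s : ℕ} (hd : 0 < d) {n t : Fin s → ℕ}
    -- `X` with the torus-invariant prime divisors `D_{i,j}`, of pairwise distinct classes `𝔇 i`
    (X : SmoothCompleteFan d ((i : Fin s) × Fin (n i)))
    (𝔇 : Fin s → X.PicX) (h𝔇 : ∀ i j, X.primeClass ⟨i, j⟩ = 𝔇 i)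
    (h𝔇_inj : Function.Injective 𝔇)
    -- the coefficients of the linear forms that define the hypersurfaces `H_{i,l}`
    (c : ∀ i, Fin (t i) → Fin (n i) → ℚ)
    -- `V` is a complete intersection: its codimension is the number of the hypersurfaces
    (hV : topologicalKrullDim (X.points (linIdeal c)) + ((∑ i, t i : ℕ) : WithBot ℕ∞) = d)
    -- `V ∩ T` is not empty
    (hVT : ∃ p ∈ X.points (linIdeal c), ∀ ρ, MvPolynomial.X ρ ∉ p.asIdeal)
    (ht : ∀ i, t i + 2 ≤ n i)
    -- `L` is a torus-invariant divisor of class `-(K_X + ∑ [H_{i,l}])`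
    (L : (i : Fin s) × Fin (n i) → ℤ)
    (hL : X.cls L = -(X.canonicalClass + ∑ i, ∑ _l : Fin (t i), 𝔇 i))
    (hL_ample : X.IsAmple (X.cls L)) :
    ∃ (b : ℕ) (a c_P const : ℝ),
      b = X.rkPic (linIdeal c) ∧
      -- the maximal value `a` of `∑ ϖ_i u_i` on the polytope, where `ϖ_i = n_i - t_i`
      IsGreatest ((fun u : Fin s → ℝ => ∑ i, ((n i - t i : ℕ) : ℝ) * u i) '' X.polytope L) a ∧
      -- the constant `c_P`, with `k = b - 1`
      (∀ i₀, Tendsto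
        (fun δ : ℝ => δ ^ ((b : ℤ) - s) *
          sliceMeasure (fun i => n i - t i) (X.polytope L) i₀ (a - δ))
        (𝓝[>] 0) (𝓝 c_P)) ∧
      -- the leading constant
      (Summable fun e : Fin s → ℕ+ => (X.mobius (fun i => e i) : ℝ) *
        ∏ i, boxDensity (c i) / (e i : ℝ) ^ (n i - t i)) ∧
      const = ((s - 1 - (b - 1))! : ℝ) * c_P * (2 ^ Module.finrank ℤ X.PicX)⁻¹ *
        ∑' e : Fin s → ℕ+, (X.mobius (fun i => e i) : ℝ) *
          ∏ i, boxDensity (c i) / (e i : ℝ) ^ (n i - t i) ∧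
      0 < const ∧
      (∀ B, (X.pointsOfHeightLE (linIdeal c) L B).Finite) ∧
      (fun B : ℝ => ((X.pointsOfHeightLE (linIdeal c) L B).ncard : ℝ) -
          const * B * Real.log B ^ ((b : ℤ) - 1))
        =O[atTop] fun B : ℝ =>
          B * Real.log B ^ ((b : ℤ) - 2) * Real.log (Real.log B) ^ s := by
  have hn : ∀ i, 0 < n i := fun i => by have := ht i; omega
  have hs : 0 < s := by
    by_contra h0
    have h1 := X.finrank_picX
    obtain rfl : s = 0 := by omega
    simp at h1
    omega
  have : Nonempty X.maxCones := X.maxCones_nonempty.to_subtype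
  obtain ⟨A, hA, hAϖ, hAr⟩ := SmoothCompleteFan.exists_regionData h𝔇 hs ht hL hL_ample
  have hLnef := X.atCone_nonneg_of_isAmple hL_ample
  have hpd := SmoothCompleteFan.paramDim_add_eq h𝔇 hV hVT
  have hrk : X.rkPic (linIdeal c) = Module.finrank ℤ X.PicX :=
    SmoothCompleteFan.rkPic_linIdeal h𝔇 hVT fun i => by have := hpd i; have := ht i; omega
  have hdim : ∀ i, Module.finrank ℝ (solSpace (c i)) = A.ϖ i := fun i => by
    have h1 := finrank_solSpace_of_finrank_ratSol (c i) (hpd i)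
    simp only [hAϖ]
    omega
  have hϖ : ∀ i, 2 ≤ A.ϖ i := fun i => by
    have := ht i
    simp only [hAϖ]
    omega
  have hpoly : X.polytope L = A.region 1 := by
    ext u
    simp only [SmoothCompleteFan.polytope, RegionData.region, dotProduct, hA]
  have hw : ∀ u : Fin s → ℝ, A.w ⬝ᵥ u = ∑ i, ((n i - t i : ℕ) : ℝ) * u i := fun u => by
    simp [dotProduct, RegionData.w, hAϖ]
  obtain ⟨c_P, hcP, hslice, C₁, hC₁, hmass⟩ := A.exists_slice_mass ⟨0, hs⟩
  obtain ⟨C₂, hC₂, hcount⟩ := A.exists_ncard_coprimeTuples_bound X ⟨0, hs⟩ hn c hdim hϖ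
    (SmoothCompleteFan.exists_solSpace_ne_zero hVT)
  obtain ⟨hrk1, hrks, -⟩ := A.exists_coords
  set S := ∑' e : Fin s → ℕ+, (X.mobius (fun i => e i) : ℝ) *
    ∏ i, boxDensity (c i) / (e i : ℝ) ^ (n i - t i) with hS
  have hS0 : 0 < S := by
    have h1 := X.tsum_mobius_pos X.maxCones_nonempty hϖ
    have h2 : S = (∏ i, boxDensity (c i)) * ∑' e : Fin s → ℕ+, (X.mobius (fun i => e i) : ℝ) *
        ∏ i, 1 / (e i : ℝ) ^ A.ϖ i := by
      rw [hS, ← tsum_mul_left]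
      refine tsum_congr fun e => ?_
      rw [mul_left_comm, ← Finset.prod_mul_distrib, hAϖ]
      simp only [mul_one_div]
    rw [h2]
    exact mul_pos (Finset.prod_pos fun i _ => boxDensity_pos (c i)) h1
  have hAϖ' : ∀ i, A.ϖ i = n i - t i := fun i => by rw [hAϖ]
  simp only [hAϖ', ← hS] at hcount
  -- The maximum of `ϖ · u` is `1`, attained at the center, since some `α_σ · u` is at least `ϖ ·
  -- u`.
  refine ⟨A.rk, 1, c_P, ((s - 1 - (A.rk - 1))! : ℝ) * c_P * (2 ^ Module.finrank ℤ X.PicX)⁻¹ * S,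
    ?_, ?_, ?_, ?_, rfl, ?_, ?_, ?_⟩
  · rw [hrk, hAr]
  · refine ⟨⟨A.center, ?_, ?_⟩, ?_⟩
    · rw [hpoly]
      exact ⟨fun σ => (A.α_center σ).le, fun i => (A.center_pos i).le⟩
    · dsimp only
      rw [← hw, A.w_center]
    · rintro _ ⟨u, hu, rfl⟩
      dsimp only
      rw [hpoly] at hu
      rw [← hw]
      exact A.w_le_of_mem hu
  · intro i₀
    rw [hpoly]
    have := hslice i₀
    rwa [hAϖ] at this
  · exact X.summable_mobius (fun i => by have := ht i; omega) _
  · positivity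
  · exact SmoothCompleteFan.finite_pointsOfHeightLE h𝔇 hn hLnef hA c
  · set r := A.rk with hr
    have hfact : (s - 1 - (r - 1))! = (s - r)! := by congr 1; omega
    set p : ℝ := (2 ^ Module.finrank ℤ X.PicX)⁻¹ with hp
    have hp0 : 0 < p := by positivity
    refine IsBigO.of_bound (p * (C₂ + S * C₁)) ?_
    -- For these `B` one has `log log B ≥ 1`, so the factor `(log log B)^s` only weakens the bound.
    have hev : ∀ᶠ B : ℝ in atTop, Real.exp (Real.exp 1) ≤ B := eventually_ge_atTop _
    filter_upwards [hev] with B hB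
    have hB0 : 0 < B := (Real.exp_pos _).trans_le hB
    set T := Real.log B with hT
    have hTe : Real.exp 1 ≤ T := (Real.le_log_iff_exp_le hB0).2 hB
    have hT1 : 1 ≤ T := (Real.one_le_exp zero_le_one).trans hTe
    have hT0 : 0 < T := by linarith
    have hll : 1 ≤ Real.log T := (Real.le_log_iff_exp_le hT0).2 hTe
    have hexp : Real.exp T = B := Real.exp_log hB0
    have h1 := hcount T hT1
    have h2 := hmass T hT0
    rw [hexp] at h1 h2
    have h3 := SmoothCompleteFan.ncard_coprimeTuples_eq h𝔇 hn hLnef hA c hB0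
    have h4 : ((X.pointsOfHeightLE (linIdeal c) L B).ncard : ℝ) =
        p * (A.coprimeTuples X c T).ncard := by
      rw [← h3, hp]
      push_cast
      field_simp
    have hz1 : T ^ ((r : ℤ) - 1) = T ^ (r - 1) := by
      rw [← zpow_natCast]
      congr 1
      omega
    have hz2 : T ^ ((r : ℤ) - 2) = T ^ (r - 1) / T := by
      rw [show (r : ℤ) - 2 = ((r - 1 : ℕ) : ℤ) - 1 by omega, zpow_sub_one₀ hT0.ne', zpow_natCast]
      rfl
    rw [hz1, hz2, h4, hfact]
    set G := B * T ^ (r - 1) / T with hG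
    have hG0 : 0 ≤ G := by positivity
    -- The error splits into that of the count against the mass and that of the mass against its
    -- leading term, both `O(G)`.
    have h5 : p * ((A.coprimeTuples X c T).ncard : ℝ) - (s - r)! * c_P * p * S * B * T ^ (r - 1) =
        p * (((A.coprimeTuples X c T).ncard - S * A.mass T) +
          S * (A.mass T - c_P * (s - r)! * (B * T ^ (r - 1)))) := by ring
    rw [h5, norm_mul, Real.norm_of_nonneg hp0.le, mul_assoc p]
    refine mul_le_mul_of_nonneg_left ?_ hp0.le
    have h6 : ‖B * (T ^ (r - 1) / T) * Real.log T ^ s‖ = G * Real.log T ^ s := by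
      rw [Real.norm_of_nonneg (by positivity), hG]
      ring
    rw [h6]
    calc _ ≤ |(A.coprimeTuples X c T).ncard - S * A.mass T| +
          |S * (A.mass T - c_P * (s - r)! * (B * T ^ (r - 1)))| := abs_add_le _ _
      _ ≤ C₂ * G + S * (C₁ * G) := by
          rw [abs_mul, abs_of_pos hS0]
          exact add_le_add h1 (mul_le_mul_of_nonneg_left h2 hS0.le)
      _ = (C₂ + S * C₁) * (G * 1) := by ring
      _ ≤ (C₂ + S * C₁) * (G * Real.log T ^ s) := by
          gcongr
          exact one_le_pow₀ hll
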